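/- Let $k$ be a field and let $Q$ be an infinite connected quiver which is strongly locally finite: every vertex is the starting point and the ending point of only finitely many arrows, and there are only finitely many paths between any two vertices. For $x\in Q_0$, let $P_x$ be the representation whose space at $y$ has as basis the paths from $x$ to $y$, and $I_x$ the one whose space at $y$ has as basis the paths from $y$ to $x$. Let ${\rm proj}(Q)$ consist of the representations isomorphic to finite direct sums of $P_x$'s, and let ${\rm rep}^+(Q)$ be the category of finitely presented $k$-representations $M$ of $Q$, i.e. those with an exact sequence $0\to P_1\to P_0\to M\to 0$, where $P_0,P_1\in{\rm proj}(Q)$. Let $\Gamma_{{\rm rep}^+(Q)}$ be its Auslander-Reiten quiver: the vertices are the indecomposable objects up to isomorphism; with ${\rm irr}(X,Y)={\rm rad}(X,Y)/{\rm rad}^2(X,Y)$, there are $d_{XY}=\dim_{{\rm End}(Y)/{\rm rad}(Y,Y)}{\rm irr}(X,Y)$ arrows from $X$ to $Y$; and $\tau Z=X$ if ${\rm rep}^+(Q)$ has an almost split sequence $X\to Y\to Z$. The valuation of the arrows is $(d_{XY},d'_{XY})$ with $d'_{XY}=\dim_{{\rm End}(X)/{\rm rad}(X,X)}{\rm irr}(X,Y)$.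 Let $Q^+$ be the full subquiver of $Q$ generated by the vertices which are not the ending point of a left infinite path $\cdots\to a_2\to a_1\to a_0$, and for $x\in Q^+$ let $Q_x^+$ be the connected component of $Q^+$ containing $x$. A connected component of $\Gamma_{{\rm rep}^+(Q)}$ is called preinjective if it contains $I_x$ for some $x\in Q^+$. A representation $M$ in $\Gamma_{{\rm rep}^+(Q)}$ is called pseudo-projective if ${\rm DTr}\,M$ is infinite dimensional; here ${\rm DTr}\,M$ is the kernel of $\nu(f)$, where $0\to P_1\stackrel{f}{\to}P_0\to M\to 0$ is a minimal projective resolution with $P_0,P_1\in{\rm proj}(Q)$ and $\nu=D{\rm Hom}(-,kQ)$ is the Nakayama functor. A section of a connected translation quiver $\Gamma$ is a connected convex full subquiver $\Delta$ without oriented cycles which meets each $\tau$-orbit exactly once; it is right-most (left-most) if every vertex of $\Gamma$ is of the form $\tau^n y$ (respectively $\tau^{-n}y$) with $n\ge 0$ and $y\in\Delta_0$. For a quiver $\Delta$ without oriented cycles, $\mathbb{Z}\Delta$ has vertices $(n,x)$, $n\in\mathbb{Z}$, $x\in\Delta_0$, and arrows $(n,x)\to(n,y)$ and $(n-1,y)\to(n,x)$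 for each arrow $x\to y$ of $\Delta$ and each $n$, with $\tau(n,x)=(n-1,x)$; and $\mathbb{N}^-\Delta$ is its full translation subquiver generated by the $(n,x)$ with $n\le 0$. Then $I_x$ is a vertex of $\Gamma_{{\rm rep}^+(Q)}$ for each $x\in Q^+$. If $\Gamma$ is a preinjective component of $\Gamma_{{\rm rep}^+(Q)}$ containing $I_x$ with $x\in Q^+$, then $\Gamma$ contains $I_y$ for all $y\in Q_x^+$, and these $I_y$ generate a right-most section of $\Gamma$; consequently, $\Gamma$ contains only finite dimensional representations, its arrows are symmetrically valued ($d_{XY}=d'_{XY}$), and $\Gamma$ embeds, as a full translation subquiver, in $\mathbb{N}^-(Q_x^+)^{\rm op}$. Furthermore, (1) if $Q$ has no left infinite path, then $\Gamma_{{\rm rep}^+(Q)}$ has a unique preinjective component, and it is isomorphic, as a translation quiver, to $\mathbb{N}^-Q^{\rm op}$; (2) if $Q$ has left infinite paths, then every preinjective component of $\Gamma_{{\rm rep}^+(Q)}$ has a left-most section generated by its pseudo-projective representations, and consequently it contains only finite $\tau$-orbits. -/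

import Mathlib

open CategoryTheory CategoryTheory.Limits

noncomputable section

namespace QuiverAR

/-! ### Quivers -/

section Quivers

/-- A quiver is connected if it is non-empty and any two vertices are joined by a walk. -/
def IsConnectedQuiver (V : Type*) [Quiver V] : Prop :=
  Nonempty V ∧
    ∀ x y : V, Quiver.WeaklyConnectedComponent.mk x = Quiver.WeaklyConnectedComponent.mk y

/-- Strongly locally finite quivers: every vertex is the starting point and the ending point of
only finitely many arrows, and there are only finitely many paths between two given vertices. -/
structure StronglyLocallyFinite (V : Type*) [Quiver V] : Prop where
  finite_out : ∀ x : V, Finite (Σ y : V, x ⟶ y)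
  finite_in : ∀ x : V, Finite (Σ y : V, y ⟶ x)
  finite_paths : ∀ x y : V, Finite (Quiver.Path x y)

/-- There is an infinite path `⋯ → a 2 → a 1 → a 0 = x` ending at `x`. -/
def EndsLeftInfinitePath {V : Type*} [Quiver V] (x : V) : Prop :=
  ∃ a : ℕ → V, a 0 = x ∧ ∀ n, Nonempty (a (n + 1) ⟶ a n)

/-- The quiver has a left infinite path. -/
def HasLeftInfinitePath (V : Type*) [Quiver V] : Prop :=
  ∃ x : V, EndsLeftInfinitePath x

/-- The vertices of the full subquiver generated by a set of vertices. -/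
@[ext]
structure FullSub {V : Type*} (s : Set V) where
  val : V
  property : val ∈ s

instance {V : Type*} [Quiver V] (s : Set V) : Quiver (FullSub s) where
  Hom x y := x.1 ⟶ y.1

/-- The connected component of a vertex, as a full subquiver. -/
abbrev ComponentOf {V : Type*} [Quiver V] (x : V) : Type _ :=
  FullSub {y : V | Quiver.WeaklyConnectedComponent.mk y = Quiver.WeaklyConnectedComponent.mk x}

/-- The quiver `Q⁺`: the full subquiver of the vertices at which no left infinite path ends. -/
abbrev QPlus (Q : Type*) [Quiver Q] : Type _ :=
  FullSub {x : Q | ¬ EndsLeftInfinitePath x}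

end Quivers

/-! ### Translation quivers -/

section Translation

/-- A partially defined translation `τ` on a set of vertices: `IsTau x z` means that `τ z` is
defined and equal to `x`. -/
class HasTau (V : Type*) where
  IsTau : V → V → Prop

open HasTau (IsTau)

variable {V W : Type*}

/-- A full translation subquiver: `τ z` is defined in it if it is defined in the ambient
translation quiver and belongs to the given set of vertices. -/
instance [HasTau V] (s : Set V) : HasTau (FullSub s) where
  IsTau x z := IsTau x.1 z.1

/-- `IsTauPow n x z` means that `τⁿ z` is defined and equal to `x`. -/
def IsTauPow [HasTau V] : ℕ → V → V → Prop
  | 0, x, z => x = z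
  | n + 1, x, z => ∃ y, IsTau y z ∧ IsTauPow n x y

/-- `x` and `y` lie in the same `τ`-orbit: `x = τⁿ y` or `y = τⁿ x` for some natural `n`. -/
def SameOrbit [HasTau V] (x y : V) : Prop :=
  ∃ n, IsTauPow n x y ∨ IsTauPow n y x

/-- The full subquiver generated by `Δ` is a section: it is connected, convex, contains no oriented
cycle, and meets each `τ`-orbit exactly once. -/
structure IsSection [Quiver V] [HasTau V] (Δ : Set V) : Prop where
  connected : IsConnectedQuiver (FullSub Δ)
  convex : ∀ x y z : V, x ∈ Δ → y ∈ Δ → Nonempty (Quiver.Path x z) → Nonempty (Quiver.Path z y) →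
    z ∈ Δ
  acyclic : ∀ (x : FullSub Δ) (p : Quiver.Path x x), p.length = 0
  meets_orbits : ∀ x : V, ∃! y : V, y ∈ Δ ∧ SameOrbit x y

/-- A section such that every vertex is of the form `τⁿ y` with `n ≥ 0` and `y ∈ Δ`. -/
structure IsRightMostSection [Quiver V] [HasTau V] (Δ : Set V) : Prop extends IsSection Δ where
  tau_pow : ∀ x : V, ∃ (n : ℕ) (y : V), y ∈ Δ ∧ IsTauPow n x y

/-- A section such that every vertex is of the form `τ⁻ⁿ y` with `n ≥ 0` and `y ∈ Δ`. -/
structure IsLeftMostSection [Quiver V] [HasTau V] (Δ : Set V) : Prop extends IsSection Δ where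
  tau_pow : ∀ x : V, ∃ (n : ℕ) (y : V), y ∈ Δ ∧ IsTauPow n y x

/-- An embedding of translation quivers whose image is a full translation subquiver: it is
injective on vertices, bijective on the arrows between any two vertices, and it preserves and
reflects the translation. If it is moreover surjective on vertices, it is an isomorphism. -/
structure FullEmbedding (V W : Type*) [Quiver V] [HasTau V] [Quiver W] [HasTau W] where
  toFun : V → W
  injective : Function.Injective toFun
  homEquiv : ∀ x y : V, (x ⟶ y) ≃ (toFun x ⟶ toFun y)
  isTau_iff : ∀ x z : V, IsTau x z ↔ IsTau (toFun x) (toFun z)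

/-- The vertices `(n, x)` of the translation quiver `ℤΔ`. -/
@[ext]
structure ZQuiver (D : Type*) where
  level : ℤ
  vertex : D

/-- Each arrow `x ⟶ y` of `Δ` gives arrows `(n, x) ⟶ (n, y)` and `(n - 1, y) ⟶ (n, x)` of `ℤΔ`. -/
instance {D : Type*} [Quiver D] : Quiver (ZQuiver D) where
  Hom p q := { _α : p.vertex ⟶ q.vertex // p.level = q.level } ⊕
    { _β : q.vertex ⟶ p.vertex // p.level = q.level - 1 }

/-- The translation of `ℤΔ` is `τ (n, x) = (n - 1, x)`. -/
instance {D : Type*} : HasTau (ZQuiver D) where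
  IsTau p q := p.level = q.level - 1 ∧ p.vertex = q.vertex

/-- `ℕ⁻Δ`, the full translation subquiver of `ℤΔ` generated by the `(n, x)` with `n ≤ 0`. -/
abbrev NegNQuiver (D : Type*) : Type _ := FullSub {p : ZQuiver D | p.level ≤ 0}

end Translation

/-! ### The Auslander-Reiten quiver of a preadditive category -/

section AuslanderReiten

universe v₁ u₁

variable {A : Type u₁} [Category.{v₁} A] [Preadditive A]

/-- Indecomposable objects. -/
def IsIndecomposable (X : A) : Prop :=
  ¬ IsZero X ∧ ∀ (Y Z : A) (b : BinaryBicone Y Z), Nonempty b.IsBilimit → Nonempty (b.pt ≅ X) →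
    IsZero Y ∨ IsZero Z

/-- `f` is minimal left almost split. -/
structure IsMinimalLeftAlmostSplit {X Y : A} (f : X ⟶ Y) : Prop where
  minimal : ∀ h : Y ⟶ Y, f ≫ h = f → IsIso h
  not_section : ¬ IsSplitMono f
  factors : ∀ (Z : A) (g : X ⟶ Z), ¬ IsSplitMono g → ∃ h : Y ⟶ Z, f ≫ h = g

/-- `g` is minimal right almost split. -/
structure IsMinimalRightAlmostSplit {Y Z : A} (g : Y ⟶ Z) : Prop where
  minimal : ∀ h : Y ⟶ Y, h ≫ g = g → IsIso h
  not_retraction : ¬ IsSplitEpi g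
  factors : ∀ (X : A) (f : X ⟶ Z), ¬ IsSplitEpi f → ∃ h : X ⟶ Y, h ≫ g = f

/-- `X --f--> Y --g--> Z` is an almost split sequence: `Y ≠ 0`, `f` is minimal left almost split and
a pseudo-kernel of `g`, and `g` is minimal right almost split and a pseudo-cokernel of `f`. -/
structure IsAlmostSplitSequence {X Y Z : A} (f : X ⟶ Y) (g : Y ⟶ Z) : Prop where
  ne_zero : ¬ IsZero Y
  left : IsMinimalLeftAlmostSplit f
  right : IsMinimalRightAlmostSplit g
  comp_eq_zero : f ≫ g = 0
  pseudoKernel : ∀ (T : A) (h : T ⟶ Y), h ≫ g = 0 → ∃ h' : T ⟶ X, h' ≫ f = h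
  pseudoCokernel : ∀ (T : A) (h : Y ⟶ T), f ≫ h = 0 → ∃ h' : Z ⟶ T, g ≫ h' = h

theorem isIso_one_sub_comp_swap {X Y : A} (f : X ⟶ Y) (g : Y ⟶ X) [IsIso (𝟙 X - f ≫ g)] :
    IsIso (𝟙 Y - g ≫ f) := by
  set u := 𝟙 X - f ≫ g with hu
  have h1 : f ≫ g ≫ inv u = inv u - 𝟙 X := by
    have h : u ≫ inv u = 𝟙 X := IsIso.hom_inv_id u
    have h' : u ≫ inv u = inv u - f ≫ g ≫ inv u := by
      nth_rewrite 1 [hu]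
      simp [Preadditive.sub_comp]
    rw [h'] at h
    rw [← h]; abel
  have h2 : inv u ≫ f ≫ g = inv u - 𝟙 X := by
    have h : inv u ≫ u = 𝟙 X := IsIso.inv_hom_id u
    have h' : inv u ≫ u = inv u - inv u ≫ f ≫ g := by
      nth_rewrite 2 [hu]
      simp [Preadditive.comp_sub]
    rw [h'] at h
    rw [← h]; abel
  refine ⟨𝟙 Y + g ≫ inv u ≫ f, ?_, ?_⟩
  · have e : g ≫ (f ≫ g ≫ inv u) ≫ f = g ≫ inv u ≫ f - g ≫ f := by
      rw [h1]; simp [Preadditive.sub_comp, Preadditive.comp_sub]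
    simp only [Category.assoc] at e
    simp only [Preadditive.sub_comp, Preadditive.comp_add, Category.id_comp, Category.comp_id,
      Category.assoc, e]
    abel
  · have e : g ≫ (inv u ≫ f ≫ g) ≫ f = g ≫ inv u ≫ f - g ≫ f := by
      rw [h2]; simp [Preadditive.sub_comp, Preadditive.comp_sub]
    simp only [Category.assoc] at e
    simp only [Preadditive.comp_sub, Preadditive.add_comp, Category.id_comp, Category.comp_id,
      Category.assoc, e]
    abel

/-- The radical `rad(X, Y)`, with its action of `End Y` by composition. -/
def radical (X Y : A) : Submodule (End Y) (X ⟶ Y) where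
  carrier := {f | ∀ g : Y ⟶ X, IsIso (𝟙 X - f ≫ g)}
  add_mem' := by
    intro f₁ f₂ h₁ h₂ g
    have := h₁ g
    have := h₂ (g ≫ inv (𝟙 X - f₁ ≫ g))
    have e : 𝟙 X - (f₁ + f₂) ≫ g =
        (𝟙 X - f₂ ≫ g ≫ inv (𝟙 X - f₁ ≫ g)) ≫ (𝟙 X - f₁ ≫ g) := by
      rw [Preadditive.sub_comp, Category.assoc, Category.assoc, IsIso.inv_hom_id,
        Preadditive.add_comp]
      simp only [Category.id_comp, Category.comp_id]
      abel
    rw [e]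
    infer_instance
  zero_mem' := by
    intro g
    rw [zero_comp, sub_zero]
    infer_instance
  smul_mem' := by
    intro r f hf g
    have e : (r • f : X ⟶ Y) = f ≫ r := rfl
    rw [e, Category.assoc]
    exact hf _

theorem comp_mem_radical {X Y Z : A} (h : X ⟶ Y) {f : Y ⟶ Z} (hf : f ∈ radical Y Z) :
    h ≫ f ∈ radical X Z := by
  intro g
  have : IsIso (𝟙 Y - (f ≫ g) ≫ h) := by
    rw [Category.assoc]
    exact hf _
  rw [Category.assoc]
  exact isIso_one_sub_comp_swap (f ≫ g) h

/-- The ideal `rad(X, X)` of `End X`. -/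
def endRadical (X : A) : Ideal (End X) := radical X X

instance (X : A) : (endRadical X).IsTwoSided where
  mul_mem_of_left {_} g hf := comp_mem_radical (X := X) (Y := X) (Z := X) g hf

/-- The square of the radical, generated by the composites of two radical morphisms. -/
def radicalSq (X Y : A) : Submodule (End Y) (X ⟶ Y) :=
  Submodule.span (End Y)
    {h | ∃ (Z : A) (f : X ⟶ Z) (g : Z ⟶ Y), f ∈ radical X Z ∧ g ∈ radical Z Y ∧ f ≫ g = h}

/-- `irr(X, Y) = rad(X, Y) / rad²(X, Y)`. -/
abbrev Irr (X Y : A) : Type v₁ :=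
  radical X Y ⧸ (radicalSq X Y).comap (radical X Y).subtype

theorem isTorsionBySet_irr (X Y : A) :
    Module.IsTorsionBySet (End Y) (Irr X Y) (endRadical Y : Set (End Y)) := by
  intro x r
  induction x using Submodule.Quotient.induction_on with
  | H f =>
    rw [← Submodule.Quotient.mk_smul, Submodule.Quotient.mk_eq_zero]
    exact Submodule.subset_span ⟨Y, f.1, r.1, f.2, r.2, rfl⟩

/-- The dimension `d_{XY}` of `irr(X, Y)` over `End(Y)/rad(Y, Y)`. -/
def irrDim (X Y : A) : ℕ :=
  letI : Module (End Y ⧸ endRadical Y) (Irr X Y) := (isTorsionBySet_irr X Y).module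
  Module.finrank (End Y ⧸ endRadical Y) (Irr X Y)

/-- The dimension `d'_{XY}` of `irr(X, Y)` over `End(X)/rad(X, X)`, obtained from `irrDim` by passing
to the opposite category. -/
def irrDim' (X Y : A) : ℕ := irrDim (Opposite.op Y) (Opposite.op X)

variable (A) in
/-- The vertices of the Auslander-Reiten quiver: a complete set of representatives of the
isomorphism classes of indecomposable objects. -/
def ARQuiver : Type u₁ := { X : Skeleton A // IsIndecomposable ((fromSkeleton A).obj X) }

/-- The indecomposable object representing a vertex of the Auslander-Reiten quiver. -/
def ARQuiver.obj (X : ARQuiver A) : A := (fromSkeleton A).obj X.1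

/-- There are `d_{XY}` arrows from `X` to `Y`. -/
instance : Quiver.{0} (ARQuiver A) where
  Hom X Y := Fin (irrDim X.obj Y.obj)

/-- `τ Z = X` if there is an almost split sequence from `X` to `Z`. -/
instance : HasTau (ARQuiver A) where
  IsTau X Z := ∃ (Y : A) (f : X.obj ⟶ Y) (g : Y ⟶ Z.obj), IsAlmostSplitSequence f g

/-- A connected component of the Auslander-Reiten quiver, as a full translation subquiver. -/
abbrev ARComponent (C : Quiver.WeaklyConnectedComponent (ARQuiver A)) : Type u₁ :=
  FullSub {X : ARQuiver A | Quiver.WeaklyConnectedComponent.mk X = C}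

/-- The object representing a vertex of a component. -/
def ARComponent.obj {C : Quiver.WeaklyConnectedComponent (ARQuiver A)} (X : ARComponent C) : A :=
  ARQuiver.obj X.1

end AuslanderReiten

/-! ### Representations -/

section Representations

universe u v w

variable (k : Type w) [Field k] (Q : Type u) [Quiver.{v} Q]

/-- `k`-representations of the quiver `Q`, as functors from its path category. -/
abbrev QRep : Type _ := Paths Q ⥤ ModuleCat.{max u v w} k

variable {k Q}

/-- Finite dimensional representations: finitely many of the spaces are non-zero, and they are all
finite dimensional. -/
def IsFinDim (M : QRep k Q) : Prop :=
  {x : Paths Q | Nontrivial (M.obj x)}.Finite ∧ ∀ x : Paths Q, Module.Finite k (M.obj x)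

variable (k)

/-- The representation `P_x`: the space at `y` is spanned by the paths from `x` to `y`, and paths
act by composition. -/
def projRep (x : Paths Q) : QRep k Q where
  obj y := ModuleCat.of k ((x ⟶ y) →₀ k)
  map {_ _} p := ModuleCat.ofHom (Finsupp.lmapDomain k k fun r => r ≫ p)
  map_id y := by
    ext : 1
    refine LinearMap.ext fun f => ?_
    change Finsupp.mapDomain (fun r => r ≫ 𝟙 y) f = f
    simp only [Category.comp_id]
    exact Finsupp.mapDomain_id
  map_comp p q := by
    ext : 1
    refine LinearMap.ext fun f => ?_
    simp [Finsupp.lmapDomain, ← Finsupp.mapDomain_comp, Function.comp_def]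

/-- A path from `x` to `y` induces a morphism from `P_y` to `P_x`. -/
def projRepMap {x y : Paths Q} (p : x ⟶ y) : projRep k y ⟶ projRep k x where
  app z := ModuleCat.ofHom (Finsupp.lmapDomain k k fun r => p ≫ r)
  naturality z z' q := by
    ext : 1
    refine LinearMap.ext fun (f : (y ⟶ z) →₀ k) => ?_
    change Finsupp.mapDomain (fun r => p ≫ r) (Finsupp.mapDomain (fun r => r ≫ q) f) =
      Finsupp.mapDomain (fun r => r ≫ q) (Finsupp.mapDomain (fun r => p ≫ r) f)
    simp [← Finsupp.mapDomain_comp, Function.comp_def]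

theorem projRepMap_id (x : Paths Q) : projRepMap k (𝟙 x) = 𝟙 (projRep k x) := by
  ext z : 3
  refine LinearMap.ext fun f => ?_
  change Finsupp.mapDomain (fun r => 𝟙 x ≫ r) f = f
  simp only [Category.id_comp]
  exact Finsupp.mapDomain_id

theorem projRepMap_comp {x y z : Paths Q} (p : x ⟶ y) (q : y ⟶ z) :
    projRepMap k (p ≫ q) = projRepMap k q ≫ projRepMap k p := by
  ext t : 3
  refine LinearMap.ext fun (f : (z ⟶ t) →₀ k) => ?_
  change Finsupp.mapDomain (fun r => (p ≫ q) ≫ r) f =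
    Finsupp.mapDomain (fun r => p ≫ r) (Finsupp.mapDomain (fun r => q ≫ r) f)
  simp [← Finsupp.mapDomain_comp, Function.comp_def]

theorem comp_right_injective {x y z : Paths Q} (p : y ⟶ z) :
    Function.Injective fun r : z ⟶ x => p ≫ r :=
  Quiver.Path.comp_injective_right p

/-- The representation `I_x`: the space at `y` is spanned by the paths from `y` to `x`, and a path
`p` sends `p ≫ r` to `r` and vanishes on the paths which do not start with `p`. -/
def injRep (x : Paths Q) : QRep k Q where
  obj y := ModuleCat.of k ((y ⟶ x) →₀ k)
  map {_ _} p := ModuleCat.ofHom (Finsupp.lcomapDomain (fun r => p ≫ r) (comp_right_injective p))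
  map_id y := by
    ext : 1
    refine LinearMap.ext fun f => Finsupp.ext fun r => ?_
    simp [Finsupp.lcomapDomain]
  map_comp p q := by
    ext : 1
    refine LinearMap.ext fun f => Finsupp.ext fun r => ?_
    simp [Finsupp.lcomapDomain]

variable {k}

instance : HasFiniteBiproducts (QRep k Q) := Abelian.hasFiniteBiproducts

/-- The objects of `proj(Q)`: finite direct sums of representations `P_x`. -/
def IsFinProj (P : QRep k Q) : Prop :=
  ∃ (n : ℕ) (x : Fin n → Paths Q), Nonempty (P ≅ ⨁ fun i => projRep k (x i))

variable (k Q) in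
/-- Finitely presented representations: those `M` admitting a short exact sequence
`0 ⟶ P₁ ⟶ P₀ ⟶ M ⟶ 0` with `P₁` and `P₀` in `proj(Q)`. -/
def isFinPres : ObjectProperty (QRep k Q) := fun M =>
  ∃ S : ShortComplex (QRep k Q), S.ShortExact ∧ IsFinProj S.X₁ ∧ IsFinProj S.X₂ ∧ Nonempty (S.X₃ ≅ M)

variable (k Q) in
/-- The category `rep⁺(Q)` of finitely presented representations. -/
abbrev RepPlus : Type _ := (isFinPres k Q).FullSubcategory

/-- The Nakayama functor `ν = D Hom(-, kQ)`: the space of `ν M` at `x` is the dual of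
`Hom(M, P_x)`. -/
def nakayama : QRep k Q ⥤ QRep k Q where
  obj M :=
    { obj := fun x => ModuleCat.of k (Module.Dual k (M ⟶ projRep k x))
      map := fun p => ModuleCat.ofHom (Linear.rightComp k M (projRepMap k p)).dualMap
      map_id := fun x => by
        ext : 1
        refine LinearMap.ext fun φ => LinearMap.ext fun h => ?_
        change φ (h ≫ projRepMap k (𝟙 x)) = φ h
        rw [projRepMap_id, Category.comp_id]
      map_comp := fun p q => by
        ext : 1
        refine LinearMap.ext fun φ => LinearMap.ext fun h => ?_
        change φ (h ≫ projRepMap k (p ≫ q)) = φ ((h ≫ projRepMap k q) ≫ projRepMap k p)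
        rw [projRepMap_comp, Category.assoc] }
  map {M N} f :=
    { app := fun x => ModuleCat.ofHom (Linear.leftComp k (projRep k x) f).dualMap
      naturality := fun x y p => by
        ext : 1
        refine LinearMap.ext fun φ => LinearMap.ext fun h => ?_
        change φ ((f ≫ h) ≫ projRepMap k p) = φ (f ≫ h ≫ projRepMap k p)
        rw [Category.assoc] }
  map_id M := by
    ext x : 3
    refine LinearMap.ext fun φ => LinearMap.ext fun h => ?_
    change φ (𝟙 M ≫ h) = φ h
    rw [Category.id_comp]
  map_comp f g := by
    ext x : 3
    refine LinearMap.ext fun φ => LinearMap.ext fun h => ?_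
    change φ ((f ≫ g) ≫ h) = φ (f ≫ g ≫ h)
    rw [Category.assoc]

/-- A minimal projective resolution `0 ⟶ P₁ ⟶ P₀ ⟶ M ⟶ 0` with `P₁` and `P₀` in `proj(Q)`: the
epimorphism `P₀ ⟶ M` is superfluous, that is, a projective cover. -/
structure IsMinimalProjRes (S : ShortComplex (QRep k Q)) : Prop where
  shortExact : S.ShortExact
  proj₁ : IsFinProj S.X₁
  proj₀ : IsFinProj S.X₂
  superfluous : ∀ (L : QRep k Q) (h : L ⟶ S.X₂), Epi (h ≫ S.g) → Epi h

/-- `N` is isomorphic to `DTr M`, the kernel of `ν f`, where `f` is the first morphism of a minimal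
projective resolution of `M`. -/
def IsDTr (N M : QRep k Q) : Prop :=
  ∃ S : ShortComplex (QRep k Q), IsMinimalProjRes S ∧ Nonempty (S.X₃ ≅ M) ∧
    Nonempty (N ≅ kernel (nakayama.map S.f))

/-- `M` is pseudo-projective: `DTr M` is infinite dimensional. -/
def IsPseudoProjective (M : QRep k Q) : Prop :=
  ∃ N : QRep k Q, IsDTr N M ∧ ¬ IsFinDim N

variable (k Q) in
/-- The Auslander-Reiten quiver of `rep⁺(Q)`. -/
abbrev ARRepPlus : Type _ := ARQuiver (RepPlus k Q)

/-- The vertex `X` is the representation `I_x`. -/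
def IsInjAt (x : QPlus Q) (X : ARRepPlus k Q) : Prop :=
  Nonempty (X.obj.obj ≅ injRep k (Q := Q) x.1)

/-- A connected component is preinjective if it contains `I_x` for some `x` in `Q⁺`. -/
def IsPreinjective (C : Quiver.WeaklyConnectedComponent (ARRepPlus k Q)) : Prop :=
  ∃ (x : QPlus Q) (X : ARComponent C), IsInjAt x X.1

end Representations

end QuiverAR

end

open QuiverAR

/-! A preinjective component is computed by knitting backwards from the representations `I_y` with
`y` in Q⁺. Such an `I_y` is finite dimensional, since induction along the arrows shows that `y` has
finitely many predecessors, and its endomorphism ring is `k`. A morphism from `I_y` which is not a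
split monomorphism kills the socle, so the projection of `I_y` to the quotient by its socle is
minimal left almost split; this quotient is the direct sum of the `I_u` over the arrows from `u` to
`y`. Hence the arrows among the `I_y` reproduce the opposite quiver of Q⁺, and no almost split
sequence starts at `I_y`.

The passage to τⁿ I_y (`IsAt`) stays within the class `PlusBrick`: finite dimensional, supported in
Q⁺, with endomorphism ring `k`. For a nonprojective Z in this class with minimal resolution f : P₁ →
P₀, everything depends on whether Z is nonzero at the start of an arrow leaving Q⁺
(`MeetsBoundary`). If it is not, P₀ and P₁ involve only P_x with x in Q⁺, so ker ν f is finite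
dimensional, and pulling ν f back along a suitable morphism Z → ν P₀ gives an almost split sequence
ending at Z (`exists_almostSplit`). Endomorphisms of Z and of ker ν f correspond through the
resolution (`EndRel`), so ker ν f belongs to the class again. If Z meets the boundary, extensions of
Z by P_a, with a arbitrarily far back on a left infinite path, show that no almost split sequence
ends at Z. So, among these Z, the pseudo-projective ones are those at which τ is not defined.

For an almost split sequence from X to Z and a brick Y, the spaces irr(X, Y) and irr(Y, Z) have the
same dimension over `k`, since both measure Y in the middle term. Iterating this counts the arrows
between τᵐ I_x and τⁿ I_y (`irrDimK_isAt`). Nothing else is reached (`IsAt.succ_closed`): an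
indecomposable source of an irreducible morphism to a finite dimensional representation is finite
dimensional, and a finite dimensional indecomposable which is not some `I_x` is the first term of an
almost split sequence. The component is thus a set of pairs (n, y) closed under lowering n
(`Coordinates`), and the sections and the embedding are combinatorics of these pairs.

That Q is infinite serves to exclude projectives: a translate has nonzero morphisms to finitely many
vertices only, whereas P_a has nonzero morphisms to infinitely many, because thin representations on
finite connected sets containing a exhaust Q. Without left infinite paths there is no boundary and τ
can be applied forever. With them, connectedness of Q yields an arrow leaving each component of Q⁺,
hence a pseudo-projective `I_y`; as immediate predecessors of pseudo-projectives are
pseudo-projective, an orbit next to a finite one is finite, and finiteness spreads to all orbits. -/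

noncomputable section
namespace QuiverAR

/-! ### Paths, elements and morphisms -/

section Toolkit

universe u v w
variable {k : Type w} [Field k] {Q : Type u} [Quiver.{v} Q]

/-- The arrows of the quiver, between vertices seen as objects of the path category. -/
def Arr (x y : Paths Q) : Type v := @Quiver.Hom Q _ x y

/-- An arrow, as a morphism of the path category. -/
def arr {x y : Paths Q} (a : Arr x y) : x ⟶ y := Quiver.Hom.toPath (V := Q) a

theorem path_induction {x : Paths Q} (P : ∀ {y : Paths Q}, (x ⟶ y) → Prop) (id : P (𝟙 x))
    (comp : ∀ {y z : Paths Q} (p : x ⟶ y) (a : Arr y z), P p → P (p ≫ arr a))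
    {y : Paths Q} (p : x ⟶ y) : P p :=
  Paths.induction_fixed_source P id comp p

theorem path_cases {x y : Paths Q} (p : x ⟶ y) :
    (∃ h : x = y, p = eqToHom h) ∨ ∃ (z : Paths Q) (q : x ⟶ z) (a : Arr z y), p = q ≫ arr a := by
  refine path_induction (fun {y} p => (∃ h : x = y, p = eqToHom h) ∨
    ∃ (z : Paths Q) (q : x ⟶ z) (a : Arr z y), p = q ≫ arr a) (Or.inl ⟨rfl, rfl⟩) ?_ p
  intro y z p a _
  exact Or.inr ⟨_, p, a, rfl⟩

/-- The length of a path. -/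
def len {x y : Paths Q} (p : x ⟶ y) : ℕ := Quiver.Path.length (V := Q) p

@[simp] theorem len_id (x : Paths Q) : len (𝟙 x) = 0 := rfl

@[simp] theorem len_arr {x y : Paths Q} (a : Arr x y) : len (arr a) = 1 := rfl

@[simp] theorem len_comp {x y z : Paths Q} (p : x ⟶ y) (q : y ⟶ z) :
    len (p ≫ q) = len p + len q :=
  Quiver.Path.length_comp (V := Q) p q

theorem eq_of_len_eq_zero {x y : Paths Q} (p : x ⟶ y) (h : len p = 0) : x = y :=
  Quiver.Path.eq_of_length_zero (V := Q) p h

theorem eq_id_of_len_eq_zero {x : Paths Q} (p : x ⟶ x) (h : len p = 0) : p = 𝟙 x :=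
  Quiver.Path.eq_nil_of_length_zero (V := Q) p h

/-- The action of a path on a representation. -/
def act (M : QRep k Q) {x y : Paths Q} (p : x ⟶ y) : M.obj x →ₗ[k] M.obj y := (M.map p).hom

/-- The components of a morphism of representations. -/
def ev {M N : QRep k Q} (f : M ⟶ N) (x : Paths Q) : M.obj x →ₗ[k] N.obj x := (f.app x).hom

variable {M N L : QRep k Q} {x y z : Paths Q}

@[simp] theorem act_id (m : M.obj x) : act M (𝟙 x) m = m := by simp [act]

@[simp] theorem act_comp (p : x ⟶ y) (q : y ⟶ z) (m : M.obj x) :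
    act M (p ≫ q) m = act M q (act M p m) := by simp [act]

@[simp] theorem ev_id (m : M.obj x) : ev (𝟙 M) x m = m := by simp [ev]

@[simp] theorem ev_comp (f : M ⟶ N) (g : N ⟶ L) (m : M.obj x) :
    ev (f ≫ g) x m = ev g x (ev f x m) := by simp [ev]

@[simp] theorem ev_add (f g : M ⟶ N) (m : M.obj x) : ev (f + g) x m = ev f x m + ev g x m := by
  simp [ev]

@[simp] theorem ev_sub (f g : M ⟶ N) (m : M.obj x) : ev (f - g) x m = ev f x m - ev g x m := by
  simp [ev]

@[simp] theorem ev_zero (m : M.obj x) : ev (0 : M ⟶ N) x m = 0 := by simp [ev]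

@[simp] theorem ev_smul (c : k) (f : M ⟶ N) (m : M.obj x) : ev (c • f) x m = c • ev f x m := by
  simp [ev]

@[simp] theorem ev_sum {ι : Type*} (s : Finset ι) (f : ι → (M ⟶ N)) (m : M.obj x) :
    ev (∑ i ∈ s, f i) x m = ∑ i ∈ s, ev (f i) x m := by
  classical
  induction s using Finset.induction_on with
  | empty => simp
  | insert a s h ih => simp [Finset.sum_insert h, ih]

theorem ev_act (f : M ⟶ N) (p : x ⟶ y) (m : M.obj x) :
    ev f y (act M p m) = act N p (ev f x m) := by
  simp [ev, act]

theorem hom_ext_ev {f g : M ⟶ N} (h : ∀ x m, ev f x m = ev g x m) : f = g := by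
  ext x : 3
  exact LinearMap.ext fun m => h x m

/-- A morphism of representations, given by linear maps which commute with the arrows. -/
def homOf (φ : ∀ x : Paths Q, M.obj x →ₗ[k] N.obj x)
    (h : ∀ (x y : Paths Q) (a : Arr x y) (m : M.obj x), φ y (act M (arr a) m) = act N (arr a) (φ x m)) :
    M ⟶ N where
  app x := ModuleCat.ofHom (φ x)
  naturality x y p := by
    ext m
    change φ y (act M p m) = act N p (φ x m)
    refine path_induction (fun {y} p => φ y (act M p m) = act N p (φ x m)) (by simp) ?_ p
    intro y z p a ih
    rw [act_comp, h, ih, act_comp]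

@[simp] theorem ev_homOf (φ : ∀ x : Paths Q, M.obj x →ₗ[k] N.obj x)
    (h : ∀ (x y : Paths Q) (a : Arr x y) (m : M.obj x), φ y (act M (arr a) m) = act N (arr a) (φ x m))
    (x : Paths Q) (m : M.obj x) : ev (homOf φ h) x m = φ x m := rfl

/-! ### Monomorphisms, epimorphisms and exactness, vertex by vertex; subrepresentations -/

theorem mono_iff_ev (f : M ⟶ N) : Mono f ↔ ∀ x, Function.Injective (ev f x) := by
  rw [NatTrans.mono_iff_mono_app]
  exact forall_congr' fun x => ModuleCat.mono_iff_injective _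

theorem epi_iff_ev (f : M ⟶ N) : Epi f ↔ ∀ x, Function.Surjective (ev f x) := by
  rw [NatTrans.epi_iff_epi_app]
  exact forall_congr' fun x => ModuleCat.epi_iff_surjective _

theorem isZero_iff_ev : IsZero M ↔ ∀ x (m : M.obj x), m = 0 := by
  rw [IsZero.iff_id_eq_zero]
  constructor
  · intro h x m
    have := congrArg (fun f => ev f x m) h
    simpa using this
  · intro h
    exact hom_ext_ev fun x m => by simp [h x m]

/-- Exactness of a sequence of representations at each vertex. -/
theorem exact_iff_ev {f : M ⟶ N} {g : N ⟶ L} (w : f ≫ g = 0) :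
    (ShortComplex.mk f g w).Exact ↔ ∀ x, ∀ n : N.obj x, ev g x n = 0 → ∃ m, ev f x m = n := by
  constructor
  · intro h x n hn
    have h' := h.map ((evaluation _ _).obj x)
    rw [ShortComplex.moduleCat_exact_iff] at h'
    exact h' n hn
  · intro h
    rw [ShortComplex.exact_iff_epi_kernel_lift, epi_iff_ev]
    intro x κ
    have hι := (mono_iff_ev (kernel.ι g)).1 inferInstance x
    obtain ⟨m, hm⟩ := h x (ev (kernel.ι g) x κ) (by rw [← ev_comp, kernel.condition, ev_zero])
    refine ⟨m, hι ?_⟩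
    rw [← ev_comp, ← hm]
    congr 1
    simp

/-- A short exact sequence of representations is one that is short exact at each vertex. -/
theorem shortExact_of_ev {f : M ⟶ N} {g : N ⟶ L} (w : f ≫ g = 0)
    (hf : ∀ x, Function.Injective (ev f x)) (hg : ∀ x, Function.Surjective (ev g x))
    (h : ∀ x, ∀ n : N.obj x, ev g x n = 0 → ∃ m, ev f x m = n) :
    (ShortComplex.mk f g w).ShortExact where
  exact := (exact_iff_ev w).2 h
  mono_f := (mono_iff_ev f).2 hf
  epi_g := (epi_iff_ev g).2 hg

/-- A subrepresentation, given by subspaces stable under the arrows. -/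
structure SubRep (M : QRep k Q) where
  carrier : ∀ x : Paths Q, Submodule k (M.obj x)
  stable : ∀ {x y : Paths Q} (a : Arr x y) {m : M.obj x}, m ∈ carrier x → act M (arr a) m ∈ carrier y

theorem SubRep.act_mem (S : SubRep M) (p : x ⟶ y) {m : M.obj x} (hm : m ∈ S.carrier x) :
    act M p m ∈ S.carrier y := by
  refine path_induction (fun {y} p => act M p m ∈ S.carrier y) (by simp [hm]) ?_ p
  intro y z p a ih
  rw [act_comp]
  exact S.stable a ih

/-- The quotient of a representation by a subrepresentation. -/
def SubRep.quot (S : SubRep M) : QRep k Q where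
  obj x := ModuleCat.of k (M.obj x ⧸ S.carrier x)
  map {x y} p := ModuleCat.ofHom ((S.carrier x).mapQ (S.carrier y) (act M p) fun _ h => S.act_mem p h)
  map_id x := by
    ext : 1
    refine LinearMap.ext fun m => ?_
    induction m using Submodule.Quotient.induction_on with
    | H m => exact congrArg Submodule.Quotient.mk (act_id m)
  map_comp p q := by
    ext : 1
    refine LinearMap.ext fun m => ?_
    induction m using Submodule.Quotient.induction_on with
    | H m => exact congrArg Submodule.Quotient.mk (act_comp p q m)

/-- The projection onto the quotient by a subrepresentation. -/
def SubRep.π (S : SubRep M) : M ⟶ S.quot :=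
  homOf (N := S.quot) (fun x => (S.carrier x).mkQ) fun _ _ _ _ => rfl

theorem SubRep.π_surjective (S : SubRep M) (x : Paths Q) : Function.Surjective (ev S.π x) :=
  (S.carrier x).mkQ_surjective

theorem SubRep.π_eq_zero_iff (S : SubRep M) (m : M.obj x) : ev S.π x m = 0 ↔ m ∈ S.carrier x :=
  Submodule.Quotient.mk_eq_zero _

instance (S : SubRep M) : Epi S.π := (epi_iff_ev _).2 S.π_surjective

theorem surjective_ev (f : M ⟶ N) [Epi f] (x : Paths Q) : Function.Surjective (ev f x) :=
  (epi_iff_ev f).1 inferInstance x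

theorem injective_ev (f : M ⟶ N) [Mono f] (x : Paths Q) : Function.Injective (ev f x) :=
  (mono_iff_ev f).1 inferInstance x

/-- A morphism which kills the kernel of an epimorphism factors through it. -/
theorem exists_factor_epi (f : M ⟶ N) [Epi f] (g : M ⟶ L)
    (h : ∀ x m, ev f x m = 0 → ev g x m = 0) : ∃ t : N ⟶ L, f ≫ t = g := by
  have w : kernel.ι f ≫ g = 0 := hom_ext_ev fun x m => by
    rw [ev_comp, h _ _ (by rw [← ev_comp, kernel.condition, ev_zero]), ev_zero]
  exact ⟨(Abelian.epiIsCokernelOfKernel _ (kernelIsKernel f)).desc (CokernelCofork.ofπ g w),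
    Cofork.IsColimit.π_desc (Abelian.epiIsCokernelOfKernel _ (kernelIsKernel f))⟩

/-- A morphism whose image lies in the image of a monomorphism factors through it. -/
theorem exists_factor_mono (f : N ⟶ M) [Mono f] (g : L ⟶ M)
    (h : ∀ x l, ∃ n, ev f x n = ev g x l) : ∃ t : L ⟶ N, t ≫ f = g := by
  have w : g ≫ cokernel.π f = 0 := hom_ext_ev fun x l => by
    obtain ⟨n, hn⟩ := h x l
    rw [ev_comp, ← hn, ← ev_comp, cokernel.condition, ev_zero, ev_zero]
  exact ⟨(Abelian.monoIsKernelOfCokernel _ (cokernelIsCokernel f)).lift (KernelFork.ofι g w),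
    Fork.IsLimit.lift_ι (Abelian.monoIsKernelOfCokernel _ (cokernelIsCokernel f))⟩

/-- An element of the kernel of `g`, seen in the kernel object. -/
theorem exists_kernel (g : M ⟶ N) (m : M.obj x) (h : ev g x m = 0) :
    ∃ n, ev (kernel.ι g) x n = m := by
  have w : kernel.ι g ≫ g = 0 := kernel.condition g
  exact (exact_iff_ev w).1 (ShortComplex.exact_kernel g) x m h

theorem ev_kernel_ι (g : M ⟶ N) (n : (kernel g).obj x) : ev g x (ev (kernel.ι g) x n) = 0 := by
  rw [← ev_comp, kernel.condition, ev_zero]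

/-! ### Projective representations -/

/-- The morphism `P_x ⟶ M` which corresponds to an element of `M` at `x`. -/
def yon (m : M.obj x) : projRep k x ⟶ M :=
  homOf (M := projRep k x) (fun y => Finsupp.linearCombination k fun p : x ⟶ y => act M p m) (by
    intro y z a f
    have key : ∀ f : (x ⟶ y) →₀ k, (Finsupp.linearCombination k fun p : x ⟶ z => act M p m)
        (Finsupp.mapDomain (fun r => r ≫ arr a) f) =
          act M (arr a) (Finsupp.linearCombination k (fun p : x ⟶ y => act M p m) f) := by
      intro f
      rw [Finsupp.linearCombination_mapDomain, Finsupp.linearCombination_apply,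
        Finsupp.linearCombination_apply]
      simp only [Finsupp.sum, map_sum, map_smul, Function.comp, act_comp]
    exact key f)

/-- The element of `P_x` given by a path. -/
def pathElt (p : x ⟶ y) : (projRep k x).obj y := Finsupp.single p (1 : k)

@[simp] theorem ev_yon_pathElt (m : M.obj x) (p : x ⟶ y) : ev (yon m) y (pathElt p) = act M p m := by
  change Finsupp.linearCombination k _ (Finsupp.single p (1 : k)) = _
  simp

@[simp] theorem act_projRep_pathElt (p : x ⟶ y) (q : y ⟶ z) :
    act (projRep k x) q (pathElt p) = pathElt (p ≫ q) := by
  change Finsupp.mapDomain (fun r => r ≫ q) (Finsupp.single p (1 : k)) = _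
  simp [pathElt]

@[simp] theorem ev_projRepMap_pathElt (p : x ⟶ y) (q : y ⟶ z) :
    ev (projRepMap k p) z (pathElt q) = pathElt (p ≫ q) := by
  change Finsupp.mapDomain (fun r => p ≫ r) (Finsupp.single q (1 : k)) = _
  simp [pathElt]

/-- The trivial path generates `P_x`: every path is its image under the action of that path. -/
theorem hom_ext_yon {f g : projRep k x ⟶ M}
    (h : ev f x (pathElt (𝟙 x)) = ev g x (pathElt (𝟙 x))) : f = g := by
  refine hom_ext_ev fun y m => ?_
  have : ∀ p : x ⟶ y, ev f y (pathElt p) = ev g y (pathElt p) := fun p => by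
    have e : (pathElt p : (projRep k x).obj y) = act (projRep k x) p (pathElt (𝟙 x)) := by simp
    rw [e, ev_act, ev_act, h]
  have e : ev f y = ev g y := Finsupp.lhom_ext' fun p => LinearMap.ext_ring (this p)
  rw [e]

theorem eq_yon (f : projRep k x ⟶ M) : f = yon (ev f x (pathElt (𝟙 x))) :=
  hom_ext_yon (by simp)

theorem yon_comp (m : M.obj x) (f : M ⟶ N) : yon m ≫ f = yon (ev f x m) :=
  hom_ext_yon (by simp)

theorem projRepMap_comp_yon (p : x ⟶ y) (m : M.obj x) :
    projRepMap k p ≫ yon m = yon (act M p m) :=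
  hom_ext_yon (by simp)

theorem yon_add (m n : M.obj x) : yon (m + n) = yon m + yon n := hom_ext_yon (by simp)

theorem yon_smul (c : k) (m : M.obj x) : yon (c • m) = c • yon m := hom_ext_yon (by simp)

theorem yon_pathElt (p : x ⟶ y) : yon (pathElt p : (projRep k x).obj y) = projRepMap k p :=
  hom_ext_yon (by simp)

variable (M x) in
/-- Morphisms from `P_x` to `M` are the elements of `M` at `x`. -/
def yonEquiv : M.obj x ≃ₗ[k] (projRep k x ⟶ M) where
  toFun := yon
  map_add' := yon_add
  map_smul' := yon_smul
  invFun f := ev f x (pathElt (𝟙 x))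
  left_inv m := by simp
  right_inv f := (eq_yon f).symm

/-- A decomposition of a representation as a finite direct sum of representations `P_x`. -/
structure DualBasis (P : QRep k Q) (ι : Type*) [Fintype ι] where
  pt : ι → Paths Q
  inc : ∀ i, projRep k (pt i) ⟶ P
  proj : ∀ i, P ⟶ projRep k (pt i)
  total : ∑ i, proj i ≫ inc i = 𝟙 P
  inc_proj_self : ∀ i, inc i ≫ proj i = 𝟙 _
  inc_proj_ne : ∀ i j, i ≠ j → inc i ≫ proj j = 0

theorem biproduct_total {ι : Type*} [Fintype ι] (F : ι → QRep k Q) :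
    ∑ i, biproduct.π F i ≫ biproduct.ι F i = 𝟙 (⨁ F) := by
  classical
  apply biproduct.hom_ext'
  intro j
  rw [Preadditive.comp_sum, Finset.sum_eq_single j]
  · simp
  · intro i _ h
    rw [← Category.assoc, biproduct.ι_π_ne _ h.symm, zero_comp]
  · simp

/-- The decomposition given by an isomorphism with a biproduct. -/
def DualBasis.ofIso {P : QRep k Q} {ι : Type*} [Fintype ι] (pt : ι → Paths Q)
    (e : (⨁ fun i => projRep k (pt i)) ≅ P) : DualBasis P ι where
  pt := pt
  inc i := biproduct.ι (fun i => projRep k (pt i)) i ≫ e.hom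
  proj i := e.inv ≫ biproduct.π (fun i => projRep k (pt i)) i
  total := by
    simp only [Category.assoc]
    rw [← Preadditive.comp_sum]
    simp only [← Category.assoc]
    rw [← Preadditive.sum_comp, biproduct_total]
    simp
  inc_proj_self i := by simp
  inc_proj_ne i j h := by simp [biproduct.ι_π_ne _ h]

theorem IsFinProj.exists_dualBasis {P : QRep k Q} (h : IsFinProj P) :
    ∃ n, Nonempty (DualBasis P (Fin n)) := by
  obtain ⟨n, x, ⟨e⟩⟩ := h
  exact ⟨n, ⟨DualBasis.ofIso x e.symm⟩⟩

theorem DualBasis.isFinProj {P : QRep k Q} {ι : Type*} [Fintype ι] (b : DualBasis P ι) :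
    IsFinProj P := by
  classical
  let σ := (Fintype.equivFin ι).symm
  refine ⟨Fintype.card ι, fun i => b.pt (σ i),
    ⟨⟨biproduct.lift fun i => b.proj (σ i), biproduct.desc fun i => b.inc (σ i), ?_, ?_⟩⟩⟩
  · rw [biproduct.lift_desc, ← b.total]
    exact Equiv.sum_comp σ fun i => b.proj i ≫ b.inc i
  · apply biproduct.hom_ext
    intro i
    apply biproduct.hom_ext'
    intro j
    by_cases h : j = i
    · subst h
      simp [b.inc_proj_self]
    · simp [b.inc_proj_ne _ _ (fun e => h (σ.injective e)), biproduct.ι_π_ne _ h]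

/-- Maps out of a representation with a dual basis. -/
theorem DualBasis.exists_hom {P : QRep k Q} {ι : Type*} [Fintype ι] (b : DualBasis P ι)
    (m : ∀ i, M.obj (b.pt i)) : ∃ f : P ⟶ M, ∀ i, b.inc i ≫ f = yon (m i) := by
  classical
  refine ⟨∑ i, b.proj i ≫ yon (m i), fun i => ?_⟩
  rw [Preadditive.comp_sum, Finset.sum_eq_single i]
  · rw [← Category.assoc, b.inc_proj_self, Category.id_comp]
  · intro j _ h
    rw [← Category.assoc, b.inc_proj_ne _ _ h.symm, zero_comp]
  · simp

theorem DualBasis.hom_ext {P : QRep k Q} {ι : Type*} [Fintype ι] (b : DualBasis P ι)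
    {f g : P ⟶ M} (h : ∀ i, b.inc i ≫ f = b.inc i ≫ g) : f = g := by
  rw [← Category.id_comp f, ← Category.id_comp g, ← b.total]
  simp only [Preadditive.sum_comp, Category.assoc, h]

/-- Representations in `proj(Q)` are projective. -/
theorem IsFinProj.exists_lift {P : QRep k Q} (h : IsFinProj P) (g : M ⟶ N) [Epi g] (f : P ⟶ N) :
    ∃ t : P ⟶ M, t ≫ g = f := by
  obtain ⟨n, ⟨b⟩⟩ := h.exists_dualBasis
  choose m hm using fun i => surjective_ev g _ (ev (b.inc i ≫ f) (b.pt i) (pathElt (𝟙 _)))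
  obtain ⟨t, ht⟩ := b.exists_hom m
  refine ⟨t, b.hom_ext fun i => ?_⟩
  rw [← Category.assoc, ht, yon_comp, hm, ← eq_yon]

end Toolkit
end QuiverAR
end

noncomputable section
namespace QuiverAR

/-! ### The radical of a representation -/

section Covers

universe u v w
variable {k : Type w} [Field k] {Q : Type u} [Quiver.{v} Q]
variable {M N L K P : QRep k Q} {x y z : Paths Q}

/-- The radical of a representation at a vertex, spanned by the images of the arrows. -/
def rad (M : QRep k Q) (y : Paths Q) : Submodule k (M.obj y) :=
  ⨆ a : Σ x : Paths Q, Arr x y, LinearMap.range (act M (arr a.2))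

theorem mem_rad_iff {m : M.obj y} : m ∈ rad M y ↔
    ∃ (s : Finset (Σ x : Paths Q, Arr x y)) (n : ∀ a : Σ x : Paths Q, Arr x y, M.obj a.1),
      ∑ a ∈ s, act M (arr a.2) (n a) = m := by
  classical
  constructor
  · intro h
    unfold rad at h
    rw [Submodule.mem_iSup_iff_exists_finsupp] at h
    obtain ⟨f, hf, rfl⟩ := h
    choose n hn using hf
    exact ⟨f.support, n, Finset.sum_congr rfl fun a _ => hn a⟩
  · rintro ⟨s, n, rfl⟩
    exact Submodule.sum_mem _ fun a _ => Submodule.mem_iSup_of_mem a ⟨_, rfl⟩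

theorem act_arr_mem_rad (a : Arr x y) (m : M.obj x) : act M (arr a) m ∈ rad M y :=
  Submodule.mem_iSup_of_mem (⟨x, a⟩ : Σ x : Paths Q, Arr x y) ⟨m, rfl⟩

theorem ev_mem_rad (f : M ⟶ N) {m : M.obj y} (h : m ∈ rad M y) : ev f y m ∈ rad N y := by
  obtain ⟨s, n, rfl⟩ := mem_rad_iff.1 h
  rw [map_sum]
  exact Submodule.sum_mem _ fun a _ => by rw [ev_act]; exact act_arr_mem_rad _ _

/-- Finitely generated representations: the radical is proper at finitely many vertices only. -/
def FinGen (M : QRep k Q) : Prop := {y | rad M y ≠ ⊤}.Finite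

/-- The support is contained in the set of successors of finitely many vertices. -/
def Rooted (M : QRep k Q) : Prop :=
  ∃ S : Set (Paths Q), S.Finite ∧ ∀ (y) (m : M.obj y), m ≠ 0 → ∃ s ∈ S, Nonempty (s ⟶ y)

/-- All the spaces are finite dimensional. -/
def PtFin (M : QRep k Q) : Prop := ∀ y, Module.Finite k (M.obj y)

/-- The spaces at the predecessors of a vertex form a direct sum in the space at the vertex. -/
def RadFree (M : QRep k Q) : Prop :=
  ∀ (y : Paths Q) (s : Finset (Σ x : Paths Q, Arr x y)) (n : ∀ a : Σ x : Paths Q, Arr x y, M.obj a.1),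
    ∑ a ∈ s, act M (arr a.2) (n a) = 0 → ∀ a ∈ s, n a = 0

theorem FinGen.of_epi (h : FinGen M) (f : M ⟶ N) [Epi f] : FinGen N := by
  refine h.subset fun y hy h' => hy (eq_top_iff.2 fun n _ => ?_)
  obtain ⟨m, rfl⟩ := surjective_ev f y n
  exact ev_mem_rad f (h' ▸ Submodule.mem_top)

theorem Rooted.of_epi (h : Rooted M) (f : M ⟶ N) [Epi f] : Rooted N := by
  obtain ⟨S, hS, h⟩ := h
  refine ⟨S, hS, fun y n hn => ?_⟩
  obtain ⟨m, rfl⟩ := surjective_ev f y n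
  exact h y m fun e => hn (by rw [e, map_zero])

theorem PtFin.of_epi (h : PtFin M) (f : M ⟶ N) [Epi f] : PtFin N := fun y =>
  have := h y
  Module.Finite.of_surjective _ (surjective_ev f y)

theorem Rooted.of_mono (h : Rooted M) (f : N ⟶ M) [Mono f] : Rooted N := by
  obtain ⟨S, hS, h⟩ := h
  refine ⟨S, hS, fun y n hn => h y (ev f y n) fun e => hn ?_⟩
  exact injective_ev f y (by rw [e, map_zero])

theorem PtFin.of_mono (h : PtFin M) (f : N ⟶ M) [Mono f] : PtFin N := fun y =>
  have := h y
  Module.Finite.of_injective _ (injective_ev f y)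

theorem RadFree.of_mono (h : RadFree M) (f : N ⟶ M) [Mono f] : RadFree N := by
  intro y s n hn a ha
  refine injective_ev f _ ?_
  rw [map_zero]
  refine h y s (fun a => ev f _ (n a)) ?_ a ha
  simp only [← ev_act]
  rw [← map_sum, hn, map_zero]

section Induction

variable (hQ : StronglyLocallyFinite Q)
include hQ

theorem finite_hom (x y : Paths Q) : Finite (x ⟶ y) := hQ.finite_paths x y

theorem finite_arr_in (y : Paths Q) : Finite (Σ x : Paths Q, Arr x y) := hQ.finite_in y

theorem finite_arr_out (x : Paths Q) : Finite (Σ y : Paths Q, Arr x y) := hQ.finite_out x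

/-- Induction on the vertices of the support of a rooted representation, along the arrows. -/
theorem Rooted.induction (hM : Rooted M) {C : Paths Q → Prop}
    (zero : ∀ y, (∀ m : M.obj y, m = 0) → C y)
    (step : ∀ y, (∀ x, Arr x y → C x) → C y) (y : Paths Q) : C y := by
  obtain ⟨S, hS, hM⟩ := hM
  -- Induction on a bound for the lengths of the paths to `y` which start in the support. Such a
  -- bound exists: a path from the support extends backwards to a path from one of the finitely many
  -- roots, and only finitely many paths lead from these to `y`.
  have key : ∀ (n : ℕ) (y : Paths Q),
      (∀ (x : Paths Q) (p : x ⟶ y), n ≤ len p → ∀ m : M.obj x, m = 0) →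
        C y := by
    intro n
    induction n with
    | zero => exact fun y h => zero y (h y (𝟙 y) (Nat.zero_le _))
    | succ n ih =>
      refine fun y h => step y fun x a => ih x fun x' p hp m => h x' (p ≫ arr a) ?_ m
      rw [len_comp, len_arr]
      omega
  have : ∃ n, ∀ s ∈ S, ∀ p : s ⟶ y, len p < n := by
    have hfin : (⋃ s ∈ S, Set.range fun p : s ⟶ y => len p).Finite :=
      hS.biUnion fun s _ => by
        have := finite_hom hQ s y
        exact Set.finite_range _
    obtain ⟨n, hn⟩ := hfin.bddAbove
    exact ⟨n + 1, fun s hs p => Nat.lt_succ_of_le (hn (Set.mem_biUnion hs ⟨p, rfl⟩))⟩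
  obtain ⟨n, hn⟩ := this
  refine key n y fun x p hp m => by_contra fun hm => ?_
  obtain ⟨s, hs, ⟨q⟩⟩ := hM x m hm
  have h1 := hn s hs (q ≫ p)
  have h2 := len_comp q p
  omega

/-- Nakayama's lemma. -/
theorem epi_of_rad (hN : Rooted N) (f : M ⟶ N)
    (h : ∀ y (n : N.obj y), ∃ m, n - ev f y m ∈ rad N y) : Epi f := by
  rw [epi_iff_ev]
  refine hN.induction hQ (fun y hy n => ⟨0, by rw [hy n, map_zero]⟩) fun y ih n => ?_
  obtain ⟨m, hm⟩ := h y n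
  -- The remaining radical part comes from the predecessors of `y`, where `f` is already onto.
  obtain ⟨s, t, ht⟩ := mem_rad_iff.1 hm
  choose g hg using fun a : Σ x : Paths Q, Arr x y => ih a.1 a.2 (t a)
  refine ⟨m + ∑ a ∈ s, act M (arr a.2) (g a), ?_⟩
  rw [map_add, map_sum]
  simp only [ev_act, hg, ht]
  abel

/-- There is no nontrivial oriented cycle. -/
theorem path_self_eq_id (p : x ⟶ x) : p = 𝟙 x := by
  have hfin := finite_hom hQ x x
  by_contra hp
  have hlen : 0 < len p := by
    rcases Nat.eq_zero_or_pos (len p) with h | h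
    · exact (hp (eq_id_of_len_eq_zero p h)).elim
    · exact h
  have hinf : ∀ n : ℕ, ∃ q : x ⟶ x, n ≤ len q := by
    intro n
    induction n with
    | zero => exact ⟨p, Nat.zero_le _⟩
    | succ n ih =>
      obtain ⟨q, hq⟩ := ih
      refine ⟨q ≫ p, ?_⟩
      have := len_comp q p
      omega
  obtain ⟨n, hn⟩ := (Set.finite_range fun q : x ⟶ x => len q).bddAbove
  obtain ⟨q, hq⟩ := hinf (n + 1)
  have := hn ⟨q, rfl⟩
  simp only at this
  omega

theorem eq_of_path_path (p : x ⟶ y) (q : y ⟶ x) : x = y := by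
  have h : p ≫ q = 𝟙 x := path_self_eq_id hQ _
  have h2 := len_comp p q
  rw [h, len_id] at h2
  exact eq_of_len_eq_zero p (by omega)

theorem not_arr_self (a : Arr x x) : False := by
  have h := path_self_eq_id hQ (arr a)
  have h1 := len_arr a
  rw [h, len_id] at h1
  omega

/-! ### The structure of `P_x` -/

omit hQ in
theorem pathElt_span (a : (projRep k x).obj y) (S : Submodule k ((projRep k x).obj y))
    (h : ∀ p : x ⟶ y, pathElt p ∈ S) : a ∈ S := by
  change (x ⟶ y) →₀ k at a
  induction a using Finsupp.induction_linear with
  | zero => exact S.zero_mem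
  | add f g hf hg => exact S.add_mem hf hg
  | single p c =>
    have := S.smul_mem c (h p)
    have e : c • (pathElt p : (projRep k x).obj y) = Finsupp.single p c := by
      change c • Finsupp.single p (1 : k) = _
      simp
    rwa [e] at this

omit hQ in
theorem pathElt_ne_zero (p : x ⟶ y) : (pathElt p : (projRep k x).obj y) ≠ 0 := by
  change Finsupp.single p (1 : k) ≠ 0
  simp

omit hQ in
theorem exists_path_of_ne_zero {a : (projRep k x).obj y} (ha : a ≠ 0) : Nonempty (x ⟶ y) := by
  by_contra h
  exact ha (by simpa using pathElt_span a ⊥ fun p => (h ⟨p⟩).elim)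

omit hQ in
theorem rad_projRep_of_ne (h : x ≠ y) : rad (projRep k x) y = ⊤ := by
  refine eq_top_iff.2 fun a _ => pathElt_span a _ fun p => ?_
  obtain ⟨e, -⟩ | ⟨z, q, a, rfl⟩ := path_cases p
  · exact (h e).elim
  · rw [← act_projRep_pathElt]
    exact act_arr_mem_rad _ _

theorem projRep_self (a : (projRep k x).obj x) : ∃ c : k, a = c • pathElt (𝟙 x) := by
  have : a ∈ Submodule.span k {(pathElt (𝟙 x) : (projRep k x).obj x)} :=
    pathElt_span a _ fun p => by
      rw [path_self_eq_id hQ p]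
      exact Submodule.mem_span_singleton_self _
  obtain ⟨c, hc⟩ := Submodule.mem_span_singleton.1 this
  exact ⟨c, hc.symm⟩

/-- A nonzero contribution would require an arrow to `x` from a successor of `x`, hence an oriented
cycle. -/
theorem rad_projRep_self : rad (projRep k x) x = ⊥ := by
  rw [eq_bot_iff]
  intro a ha
  obtain ⟨s, n, rfl⟩ := mem_rad_iff.1 ha
  refine Submodule.sum_mem _ fun a _ => ?_
  have : n a = 0 := by
    by_contra h
    obtain ⟨p⟩ := exists_path_of_ne_zero h
    have := eq_of_path_path hQ p (arr a.2)
    obtain ⟨y, b⟩ := a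
    subst this
    exact not_arr_self hQ b
  rw [this, map_zero]
  exact Submodule.zero_mem _

/-- The trivial path at `x`, as an element of `P_x` at `y`; it is zero if `y ≠ x`. -/
def idElt (k : Type w) [Field k] (x y : Paths Q) : (projRep k x).obj y := by
  classical exact if h : x = y then pathElt (eqToHom h) else 0

omit hQ in
@[simp] theorem idElt_self (x : Paths Q) : idElt k x x = pathElt (𝟙 x) := by simp [idElt]

omit hQ in
theorem idElt_of_ne (h : x ≠ y) : idElt k x y = 0 := by simp [idElt, h]

theorem exists_sub_idElt_mem_rad (a : (projRep k x).obj y) :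
    ∃ c : k, a - c • idElt k x y ∈ rad (projRep k x) y := by
  by_cases h : x = y
  · subst h
    obtain ⟨c, rfl⟩ := projRep_self hQ a
    exact ⟨c, by simp⟩
  · exact ⟨0, by rw [rad_projRep_of_ne h]; trivial⟩

omit hQ in
theorem arr_comp_injective {u u' : Paths Q} (q : x ⟶ u) (q' : x ⟶ u') (a : Arr u y) (a' : Arr u' y)
    (h : q ≫ arr a = q' ≫ arr a') :
    (⟨u, a⟩ : Σ x : Paths Q, Arr x y) = ⟨u', a'⟩ ∧ HEq q q' := by
  change Quiver.Path.cons (V := Q) q a = Quiver.Path.cons (V := Q) q' a' at h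
  injection h with h1 h2 h3
  subst h1
  rename_i h4
  obtain rfl := eq_of_heq h4
  exact ⟨rfl, h3⟩

/-- The coordinate of an element of `P_x` at a path. -/
def coord (p : x ⟶ y) : (projRep k x).obj y →ₗ[k] k := Finsupp.lapply p

omit hQ in
theorem elt_ext {a b : (projRep k x).obj y} (h : ∀ p : x ⟶ y, coord p a = coord p b) : a = b :=
  Finsupp.ext (M := k) h

omit hQ in
theorem coord_act_arr (q : x ⟶ y) (a : Arr y z) (f : (projRep k x).obj y) :
    coord (q ≫ arr a) (act (projRep k x) (arr a) f) = coord q f :=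
  Finsupp.mapDomain_apply (M := k) (f := fun r : x ⟶ y => r ≫ arr a)
    (fun _ _ h => eq_of_heq (arr_comp_injective _ _ _ _ h).2) f q

omit hQ in
theorem coord_act_arr_ne {y' : Paths Q} (q : x ⟶ y) (a : Arr y z) (b : Arr y' z)
    (h : (⟨y', b⟩ : Σ y : Paths Q, Arr y z) ≠ ⟨y, a⟩) (f : (projRep k x).obj y') :
    coord (q ≫ arr a) (act (projRep k x) (arr b) f) = 0 := by
  refine Finsupp.mapDomain_of_notMem_range (M := k) (f := fun r : x ⟶ y' => r ≫ arr b) f _ ?_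
  rintro ⟨r, hr⟩
  exact h (arr_comp_injective r q b a hr).1

-- The last arrow of a nontrivial path is determined by the path, so the coordinate at `q ≫ arr a`
-- sees only the summand indexed by `a`.
omit hQ in
theorem radFree_projRep : RadFree (projRep k x) := by
  intro y s n hn a ha
  refine elt_ext fun q => ?_
  have h := congrArg (coord (q ≫ arr a.2)) hn
  rw [map_sum, Finset.sum_eq_single a, coord_act_arr] at h
  · rw [h, map_zero, map_zero]
  · intro b _ hb
    exact coord_act_arr_ne _ _ _ hb _
  · exact fun h => (h ha).elim

/-! ### Representations in `proj(Q)` -/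

variable {ι : Type*} [Fintype ι]

omit hQ in
theorem DualBasis.ev_total (b : DualBasis P ι) (n : P.obj y) :
    ∑ i, ev (b.inc i) y (ev (b.proj i) y n) = n := by
  have := congrArg (fun f => ev f y n) b.total
  simpa using this

omit hQ in
theorem DualBasis.radFree (b : DualBasis P ι) : RadFree P := by
  intro y s n hn a ha
  rw [← b.ev_total (n a)]
  refine Finset.sum_eq_zero fun i _ => ?_
  rw [radFree_projRep y s (fun a => ev (b.proj i) _ (n a)) ?_ a ha, map_zero]
  simp only [← ev_act]
  rw [← map_sum, hn, map_zero]

omit hQ in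
theorem DualBasis.rad_eq_top (b : DualBasis P ι) (h : ∀ i, b.pt i ≠ y) : rad P y = ⊤ := by
  refine eq_top_iff.2 fun n _ => ?_
  rw [← b.ev_total n]
  exact Submodule.sum_mem _ fun i _ => ev_mem_rad _ (by rw [rad_projRep_of_ne (h i)]; trivial)

omit hQ in
theorem DualBasis.finGen (b : DualBasis P ι) : FinGen P := by
  refine (Set.finite_range b.pt).subset fun y hy => ?_
  by_contra h
  exact hy (b.rad_eq_top fun i hi => h ⟨i, hi⟩)

omit hQ in
theorem DualBasis.exists_path (b : DualBasis P ι) {n : P.obj y} (hn : n ≠ 0) :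
    ∃ i, Nonempty (b.pt i ⟶ y) := by
  by_contra h
  push Not at h
  refine hn ?_
  rw [← b.ev_total n]
  refine Finset.sum_eq_zero fun i _ => ?_
  have : ev (b.proj i) y n = 0 := by
    by_contra h'
    exact (h i).false (exists_path_of_ne_zero h').some
  rw [this, map_zero]

omit hQ in
theorem DualBasis.rooted (b : DualBasis P ι) : Rooted P :=
  ⟨Set.range b.pt, Set.finite_range _, fun _ _ hn =>
    let ⟨i, hi⟩ := b.exists_path hn
    ⟨_, ⟨i, rfl⟩, hi⟩⟩

theorem ptFin_projRep : PtFin (projRep k x) := fun y => by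
  have := finite_hom hQ x y
  change Module.Finite k ((x ⟶ y) →₀ k)
  infer_instance

theorem DualBasis.ptFin (b : DualBasis P ι) : PtFin P := fun y => by
  have := fun i => ptFin_projRep (k := k) hQ (x := b.pt i) y
  refine Module.Finite.of_injective (LinearMap.pi fun i => ev (b.proj i) y) fun n n' h => ?_
  rw [← b.ev_total n, ← b.ev_total n']
  exact Finset.sum_congr rfl fun i _ => congrArg _ (congrFun h i)

/-- The value at the generator is not in the radical. -/
theorem DualBasis.gen_notMem_rad (b : DualBasis P ι) (i : ι) :
    ev (b.inc i) _ (pathElt (𝟙 _)) ∉ rad P (b.pt i) := by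
  intro h
  have h1 := ev_mem_rad (b.proj i) h
  rw [← ev_comp, b.inc_proj_self, ev_id, rad_projRep_self hQ] at h1
  exact pathElt_ne_zero _ h1

theorem DualBasis.exists_sub_mem_rad (b : DualBasis P ι) (n : P.obj y) :
    ∃ c : ι → k, n - ∑ i, c i • ev (b.inc i) y (idElt k (b.pt i) y) ∈ rad P y := by
  choose c hc using fun i => exists_sub_idElt_mem_rad hQ (ev (b.proj i) y n)
  refine ⟨c, ?_⟩
  conv in n => rw [← b.ev_total n]
  rw [← Finset.sum_sub_distrib]
  refine Submodule.sum_mem _ fun i _ => ?_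
  rw [← map_smul, ← map_sub]
  exact ev_mem_rad _ (hc i)

end Induction

end Covers
end QuiverAR
end

noncomputable section
namespace QuiverAR

/-! ### Finitely presented representations -/

section Closure

universe u v w
variable {k : Type w} [Field k] {Q : Type u} [Quiver.{v} Q]
variable {M N L K P : QRep k Q} {x y z : Paths Q}
variable (hQ : StronglyLocallyFinite Q)
include hQ

omit hQ in
/-- An element transported along an equality of vertices; it is zero if the vertices differ. -/
def transport (m : M.obj x) (y : Paths Q) : M.obj y := by
  classical exact if h : x = y then act M (eqToHom h) m else 0

omit hQ in
@[simp] theorem transport_self (m : M.obj x) : transport m x = m := by simp [transport]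

omit hQ in
theorem transport_of_ne (m : M.obj x) (h : x ≠ y) : transport m y = 0 := by simp [transport, h]

omit hQ in
theorem ev_yon_idElt (m : M.obj x) (y : Paths Q) : ev (yon m) y (idElt k x y) = transport m y := by
  by_cases h : x = y
  · subst h
    simp
  · rw [idElt_of_ne h, transport_of_ne m h, map_zero]

omit hQ in
/-- A minimal set of generators of a finitely generated representation. -/
theorem exists_generators (hf : FinGen M) (hp : PtFin M) :
    ∃ (ι : Type u) (_ : Fintype ι) (pt : ι → Paths Q) (m : ∀ i, M.obj (pt i)),
      (∀ y (n : M.obj y), ∃ c : ι → k, n - ∑ i, c i • transport (m i) y ∈ rad M y) ∧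
      ∀ y (c : ι → k), ∑ i, c i • transport (m i) y ∈ rad M y → ∀ i, pt i = y → c i = 0 := by
  classical
  -- The complement `C y` plays the role of the top of `M` at `y`; the generators are bases of these
  -- complements at the finitely many vertices where they are nonzero.
  choose C hC using fun y => Submodule.exists_isCompl (rad M y)
  have hfin : ∀ y, Module.Finite k (C y) := fun y => by
    have := hp y
    infer_instance
  let B := fun y => Module.finBasis k (C y)
  let F := {y | rad M y ≠ ⊤}
  have : Fintype F := hf.fintype
  have hsum : ∀ y (hy : rad M y ≠ ⊤) (c : (Σ y : F, Fin (Module.finrank k (C y))) → k),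
      ∑ i, c i • transport (B i.1.1 i.2 : C i.1.1).1 y =
        ((∑ j, c ⟨⟨y, hy⟩, j⟩ • B y j : C y) : M.obj y) := by
    intro y hy c
    rw [Fintype.sum_sigma, Finset.sum_eq_single (⟨y, hy⟩ : F)]
    · rw [AddSubmonoidClass.coe_finsetSum]
      exact Finset.sum_congr rfl fun j _ => by simp
    · intro y' _ hy'
      refine Finset.sum_eq_zero fun j _ => ?_
      rw [transport_of_ne _ fun h => hy' (Subtype.ext h), smul_zero]
    · simp
  refine ⟨Σ y : F, Fin (Module.finrank k (C y)), inferInstance, fun i => i.1.1,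
    fun i => (B i.1.1 i.2 : C i.1.1).1, fun y n => ?_, fun y c hc i hi => ?_⟩
  · by_cases hy : rad M y = ⊤
    · exact ⟨0, by rw [hy]; trivial⟩
    · obtain ⟨r, hr, s, hs, rfl⟩ := Submodule.mem_sup.1
        ((hC y).sup_eq_top ▸ Submodule.mem_top : n ∈ rad M y ⊔ C y)
      refine ⟨fun i => if h : i.1.1 = y then
        (B y).repr ⟨s, hs⟩ (Fin.cast (by rw [h]) i.2) else 0, ?_⟩
      rw [hsum y hy]
      simp only [↓reduceDIte, Fin.cast_eq_self]
      rw [(B y).sum_repr]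
      simpa using hr
  · subst hi
    rw [hsum _ i.1.2] at hc
    have h2 := Submodule.disjoint_def.1 (hC _).disjoint _ hc (Subtype.prop _)
    exact Fintype.linearIndependent_iff.1 (B i.1.1).linearIndependent _ (Subtype.ext h2) i.2

/-- A finitely generated representation has a projective cover in `proj(Q)`. -/
theorem exists_cover (hf : FinGen M) (hr : Rooted M) (hp : PtFin M) :
    ∃ (P : QRep k Q) (f : P ⟶ M), IsFinProj P ∧ Epi f ∧
      ∀ y (n : P.obj y), ev f y n = 0 → n ∈ rad P y := by
  obtain ⟨ι, _, pt, m, hspan, hind⟩ := exists_generators hf hp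
  obtain ⟨P, b, hb⟩ : ∃ (P : QRep k Q) (b : DualBasis P ι), b.pt = pt :=
    ⟨_, DualBasis.ofIso pt (Iso.refl _), rfl⟩
  subst hb
  obtain ⟨f, hfm⟩ := b.exists_hom m
  have hv : ∀ y (c : ι → k), ev f y (∑ i, c i • ev (b.inc i) y (idElt k (b.pt i) y)) =
      ∑ i, c i • transport (m i) y := by
    intro y c
    rw [map_sum]
    exact Finset.sum_congr rfl fun i _ => by rw [map_smul, ← ev_comp, hfm, ev_yon_idElt]
  -- Surjectivity is Nakayama's lemma, since the `m i` span modulo the radical. For an element of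
  -- the kernel, independence of the `m i` modulo the radical annihilates the coefficients of its
  -- top, so that it lies in the radical.
  refine ⟨P, f, b.isFinProj, epi_of_rad hQ hr f fun y n => ?_, fun y n hn => ?_⟩
  · obtain ⟨c, hc⟩ := hspan y n
    exact ⟨_, (hv y c).symm ▸ hc⟩
  · obtain ⟨c, hc⟩ := b.exists_sub_mem_rad hQ n
    have h1 := ev_mem_rad f hc
    rw [map_sub, hn, zero_sub, Submodule.neg_mem_iff, hv] at h1
    suffices h : ∑ i, c i • ev (b.inc i) y (idElt k (b.pt i) y) = 0 by
      rwa [h, sub_zero] at hc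
    refine Finset.sum_eq_zero fun i _ => ?_
    by_cases hi : b.pt i = y
    · rw [hind y c h1 i hi, zero_smul]
    · rw [idElt_of_ne hi, map_zero, smul_zero]

/-- A finitely generated representation with free radical is in `proj(Q)`. -/
theorem isFinProj_of_radFree (hf : FinGen M) (hr : Rooted M) (hp : PtFin M) (hM : RadFree M) :
    IsFinProj M := by
  obtain ⟨P, f, hP, _, hk⟩ := exists_cover hQ hf hr hp
  obtain ⟨n, ⟨b⟩⟩ := hP.exists_dualBasis
  -- The projective cover is injective: an element of the kernel is a sum of terms `arr a` applied
  -- to `t a`; freeness of the radical of `M` kills the images of the `t a`, and induction along the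
  -- arrows then kills the `t a` themselves.
  have hinj : ∀ y (n : P.obj y), ev f y n = 0 → n = 0 := by
    refine b.rooted.induction hQ (fun y h n _ => h n) fun y ih n hn => ?_
    obtain ⟨s, t, rfl⟩ := mem_rad_iff.1 (hk y n hn)
    refine Finset.sum_eq_zero fun a ha => ?_
    rw [ih a.1 a.2 (t a), map_zero]
    refine hM y s (fun a => ev f _ (t a)) ?_ a ha
    simp only [← ev_act]
    rw [← map_sum, hn]
  have : Mono f := (mono_iff_ev f).2 fun y =>
    (injective_iff_map_eq_zero _).2 fun n hn => hinj y n hn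
  have := isIso_of_mono_of_epi f
  obtain ⟨n, x, ⟨e⟩⟩ := hP
  exact ⟨n, x, ⟨(asIso f).symm ≪≫ e⟩⟩

/-- A finitely generated subrepresentation of a representation in `proj(Q)` is in `proj(Q)`. -/
theorem IsFinProj.of_mono (hP : IsFinProj P) (i : K ⟶ P) [Mono i] (hK : FinGen K) :
    IsFinProj K := by
  obtain ⟨n, ⟨b⟩⟩ := hP.exists_dualBasis
  exact isFinProj_of_radFree hQ hK (b.rooted.of_mono i) ((b.ptFin hQ).of_mono i)
    (b.radFree.of_mono i)

/-- Heredity: a finitely generated kernel inside `P` is itself in proj(Q), so finite presentation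
reduces to finite generation of one kernel. -/
theorem isFinPres_of_finGen_kernel (hP : IsFinProj P) (f : P ⟶ M) [Epi f]
    (hK : FinGen (kernel f)) : isFinPres k Q M :=
  ⟨ShortComplex.mk (kernel.ι f) f (kernel.condition f),
    { exact := ShortComplex.exact_kernel f
      mono_f := inferInstance
      epi_g := inferInstance },
    hP.of_mono hQ (kernel.ι f) hK, hP, ⟨Iso.refl _⟩⟩

omit hQ in
/-- A presentation of an object of `rep⁺(Q)`. -/
theorem exists_presentation (hM : isFinPres k Q M) :
    ∃ (P₁ P₀ : QRep k Q) (f : P₁ ⟶ P₀) (g : P₀ ⟶ M) (w : f ≫ g = 0),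
      IsFinProj P₁ ∧ IsFinProj P₀ ∧ (ShortComplex.mk f g w).ShortExact := by
  obtain ⟨S, hS, h₁, h₂, ⟨e⟩⟩ := hM
  refine ⟨S.X₁, S.X₂, S.f, S.g ≫ e.hom, by simp, h₁, h₂, ?_⟩
  refine ShortComplex.shortExact_of_iso (S₁ := S)
    (ShortComplex.isoMk (Iso.refl _) (Iso.refl _) e ?_ ?_) hS
  · simp
  · simp

theorem finGen_rooted_ptFin (hM : isFinPres k Q M) : FinGen M ∧ Rooted M ∧ PtFin M := by
  obtain ⟨P₁, P₀, f, g, w, -, h₀, hS⟩ := exists_presentation hM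
  have : Epi g := hS.epi_g
  obtain ⟨n, ⟨b⟩⟩ := h₀.exists_dualBasis
  exact ⟨b.finGen.of_epi g, b.rooted.of_epi g, (b.ptFin hQ).of_epi g⟩

omit hQ in
theorem IsFinDim.ptFin (h : IsFinDim M) : PtFin M := h.2

omit hQ in
theorem IsFinDim.finGen (h : IsFinDim M) : FinGen M := by
  refine h.1.subset fun y hy => ?_
  by_contra hn
  have : Subsingleton (M.obj y) := not_nontrivial_iff_subsingleton.1 hn
  exact hy (Subsingleton.elim _ _)

omit hQ in
theorem IsFinDim.rooted (h : IsFinDim M) : Rooted M :=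
  ⟨_, h.1, fun y _ hm => ⟨y, ⟨_, _, hm⟩, ⟨𝟙 y⟩⟩⟩

/-- At a vertex where `P` has no generator and which is not the end of an arrow from the support of
`M`, an element of the kernel is a sum of images of elements at predecessors. These predecessors lie
outside the support of `M`, so those elements are in the kernel too. Only finitely many vertices are
excluded. -/
theorem IsFinDim.finGen_kernel (h : IsFinDim M) (hP : FinGen P) (f : P ⟶ M) :
    FinGen (kernel f) := by
  have hfin : ({y | rad P y ≠ ⊤} ∪ ⋃ x ∈ {x : Paths Q | Nontrivial (M.obj x)},
      Set.range fun a : Σ y : Paths Q, Arr x y => a.1).Finite :=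
    hP.union <| h.1.biUnion fun x _ => by
      have := finite_arr_out hQ x
      exact Set.finite_range _
  refine hfin.subset fun y hy => by_contra fun hn => hy (eq_top_iff.2 fun κ _ => ?_)
  simp only [Set.mem_union, Set.mem_iUnion, not_or, Set.mem_ofPred_eq, not_not, not_exists] at hn
  obtain ⟨s, t, ht⟩ := mem_rad_iff.1 (hn.1 ▸ Submodule.mem_top : ev (kernel.ι f) y κ ∈ rad P y)
  have h0 : ∀ a : Σ x : Paths Q, Arr x y, ev f a.1 (t a) = 0 := fun a => by
    by_contra h
    exact hn.2 a.1 ⟨_, _, h⟩ ⟨⟨y, a.2⟩, rfl⟩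
  choose κ' hκ using fun a => exists_kernel f (t a) (h0 a)
  refine mem_rad_iff.2 ⟨s, κ', injective_ev (kernel.ι f) y ?_⟩
  rw [map_sum, ← ht]
  exact Finset.sum_congr rfl fun a _ => by rw [ev_act, hκ]

/-- Finite dimensional representations have a minimal projective resolution. -/
theorem IsFinDim.exists_minimalProjRes (h : IsFinDim M) :
    ∃ S : ShortComplex (QRep k Q), IsMinimalProjRes S ∧ S.X₃ = M := by
  obtain ⟨P, f, hP, _, hk⟩ := exists_cover hQ h.finGen h.rooted h.ptFin
  obtain ⟨n, ⟨b⟩⟩ := hP.exists_dualBasis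
  refine ⟨ShortComplex.mk (kernel.ι f) f (kernel.condition f), ⟨?_, ?_, hP, ?_⟩, rfl⟩
  · exact { exact := ShortComplex.exact_kernel f, mono_f := inferInstance, epi_g := inferInstance }
  · exact hP.of_mono hQ (kernel.ι f) (h.finGen_kernel hQ b.finGen f)
  · intro L t _
    refine epi_of_rad hQ b.rooted t fun y n => ?_
    obtain ⟨l, hl⟩ := surjective_ev (t ≫ f) y (ev f y n)
    refine ⟨l, hk y _ ?_⟩
    rw [map_sub, ← hl, ev_comp, sub_self]

/-- Finite dimensional representations are finitely presented. -/
theorem IsFinDim.isFinPres (h : IsFinDim M) : isFinPres k Q M := by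
  obtain ⟨S, hS, rfl⟩ := h.exists_minimalProjRes hQ
  exact ⟨S, hS.shortExact, hS.proj₁, hS.proj₀, ⟨Iso.refl _⟩⟩

/-- Finitely presented representations are closed under direct summands. -/
theorem isFinPres_of_retract (hM : isFinPres k Q M) (i : N ⟶ M) (p : M ⟶ N) (hip : i ≫ p = 𝟙 N) :
    isFinPres k Q N := by
  obtain ⟨P₁, P₀, f, g, w, h₁, h₀, hS⟩ := exists_presentation hM
  have : Epi g := hS.epi_g
  have : Epi p := by
    have : IsSplitEpi p := ⟨⟨i, hip⟩⟩
    infer_instance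
  obtain ⟨n₀, ⟨b₀⟩⟩ := h₀.exists_dualBasis
  obtain ⟨n₁, ⟨b₁⟩⟩ := h₁.exists_dualBasis
  refine isFinPres_of_finGen_kernel hQ h₀ (g ≫ p) ((b₀.finGen.union b₁.finGen).subset fun y hy =>
    by_contra fun hn => hy (eq_top_iff.2 fun κ _ => ?_))
  simp only [Set.mem_union, Set.mem_ofPred_eq, not_or, not_not] at hn
  have hex := (exact_iff_ev w).1 hS.exact
  have hκ : ev p y (ev g y (ev (kernel.ι (g ≫ p)) y κ)) = 0 := by
    rw [← ev_comp, ← ev_comp, kernel.condition, ev_zero]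
  obtain ⟨s, t, ht⟩ := mem_rad_iff.1
    (hn.1 ▸ Submodule.mem_top : ev (kernel.ι (g ≫ p)) y κ ∈ rad P₀ y)
  -- The components `t a` of `κ` need not lie in the kernel of `g ≫ p`. They are replaced by `t' a`,
  -- whose image in `M` is the part of `g (t a)` complementary to `N`. The error κ − ∑ a (t' a) dies
  -- in `M`, so it comes from `P₁`, which has no generator at `y`.
  choose t' ht' using fun a : Σ x : Paths Q, Arr x y =>
    surjective_ev g _ (ev g a.1 (t a) - ev i _ (ev p _ (ev g _ (t a))))
  have hip' : ∀ x (n : N.obj x), ev p x (ev i x n) = n := fun x n => by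
    rw [← ev_comp, hip, ev_id]
  choose κ₁ hκ₁ using fun a : Σ x : Paths Q, Arr x y => exists_kernel (g ≫ p) (t' a) (by
    rw [ev_comp, ht', map_sub, hip', sub_self])
  obtain ⟨m, hm⟩ := hex y (ev (kernel.ι (g ≫ p)) y κ - ∑ a ∈ s, act P₀ (arr a.2) (t' a)) (by
    rw [map_sub, map_sum]
    simp only [ev_act, ht', map_sub, Finset.sum_sub_distrib]
    simp only [← ev_act]
    rw [← map_sum, ← map_sum, ← map_sum, ← map_sum, ht, hκ, map_zero]
    simp)
  have hf : ∀ x (m : P₁.obj x), ∃ κ, ev (kernel.ι (g ≫ p)) x κ = ev f x m := fun x m =>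
    exists_kernel _ _ (by rw [ev_comp, ← ev_comp f g, w, ev_zero, map_zero])
  obtain ⟨s', r, hr⟩ := mem_rad_iff.1 (hn.2 ▸ Submodule.mem_top : m ∈ rad P₁ y)
  choose κ₂ hκ₂ using fun a : Σ x : Paths Q, Arr x y => hf _ (r a)
  have hκ' : κ = ∑ a ∈ s', act _ (arr a.2) (κ₂ a) + ∑ a ∈ s, act _ (arr a.2) (κ₁ a) := by
    refine injective_ev (kernel.ι (g ≫ p)) y ?_
    rw [map_add, map_sum, map_sum]
    simp only [ev_act, hκ₁, hκ₂]
    simp only [← ev_act]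
    rw [← map_sum (ev f y), hr, hm]
    abel
  rw [hκ']
  exact Submodule.add_mem _ (Submodule.sum_mem _ fun a _ => act_arr_mem_rad _ _)
    (Submodule.sum_mem _ fun a _ => act_arr_mem_rad _ _)

omit hQ in
/-- A direct sum of two representations in `proj(Q)`. -/
theorem IsFinProj.biprod {P P' : QRep k Q} (h : IsFinProj P) (h' : IsFinProj P') :
    IsFinProj (P ⊞ P') := by
  obtain ⟨n, ⟨b⟩⟩ := h.exists_dualBasis
  obtain ⟨n', ⟨b'⟩⟩ := h'.exists_dualBasis
  let d : DualBasis (P ⊞ P') (Fin n ⊕ Fin n') :=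
    { pt := Sum.elim b.pt b'.pt
      inc := fun i => match i with
        | Sum.inl i => b.inc i ≫ biprod.inl
        | Sum.inr i => b'.inc i ≫ biprod.inr
      proj := fun i => match i with
        | Sum.inl i => biprod.fst ≫ b.proj i
        | Sum.inr i => biprod.snd ≫ b'.proj i
      total := by
        have e₁ : ∑ i, (biprod.fst ≫ b.proj i) ≫ b.inc i ≫ biprod.inl =
            (biprod.fst ≫ biprod.inl : P ⊞ P' ⟶ P ⊞ P') := by
          simp only [Category.assoc]
          rw [← Preadditive.comp_sum]
          simp only [← Category.assoc (b.proj _)]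
          rw [← Preadditive.sum_comp, b.total, Category.id_comp]
        have e₂ : ∑ i, (biprod.snd ≫ b'.proj i) ≫ b'.inc i ≫ biprod.inr =
            (biprod.snd ≫ biprod.inr : P ⊞ P' ⟶ P ⊞ P') := by
          simp only [Category.assoc]
          rw [← Preadditive.comp_sum]
          simp only [← Category.assoc (b'.proj _)]
          rw [← Preadditive.sum_comp, b'.total, Category.id_comp]
        rw [Fintype.sum_sum_type]
        exact (congrArg₂ (· + ·) e₁ e₂).trans biprod.total
      inc_proj_self := by
        rintro (i | i)
        · simp [b.inc_proj_self]
        · simp [b'.inc_proj_self]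
      inc_proj_ne := by
        rintro (i | i) (j | j) hij
        · change (b.inc i ≫ biprod.inl) ≫ biprod.fst ≫ b.proj j = 0
          simp [b.inc_proj_ne i j (fun e => hij (by rw [e]))]
        · change (b.inc i ≫ biprod.inl) ≫ biprod.snd ≫ b'.proj j = 0
          simp
        · change (b'.inc i ≫ biprod.inr) ≫ biprod.fst ≫ b.proj j = 0
          simp
        · change (b'.inc i ≫ biprod.inr) ≫ biprod.snd ≫ b'.proj j = 0
          simp [b'.inc_proj_ne i j (fun e => hij (by rw [e]))] }
  exact d.isFinProj

omit hQ in
theorem ev_biprod_ext {a b : (M ⊞ N).obj x} (h₁ : ev biprod.fst x a = ev biprod.fst x b)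
    (h₂ : ev biprod.snd x a = ev biprod.snd x b) : a = b := by
  have key : ∀ c : (M ⊞ N).obj x,
      ev (biprod.inl : M ⟶ M ⊞ N) x (ev biprod.fst x c) + ev biprod.inr x (ev biprod.snd x c) = c := by
    intro c
    have := congrArg (fun f => ev f x c) (biprod.total (X := M) (Y := N))
    simp only [ev_add, ev_comp, ev_id] at this
    exact this
  rw [← key a, ← key b, h₁, h₂]

omit hQ in
/-- Finitely presented representations are closed under extensions. -/
theorem isFinPres_of_extension (hM : isFinPres k Q M) (hN : isFinPres k Q N) {i : M ⟶ L}
    {p : L ⟶ N} {w : i ≫ p = 0} (hS : (ShortComplex.mk i p w).ShortExact) : isFinPres k Q L := by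
  obtain ⟨R₁, R₀, r, s, wr, hR₁, hR₀, hR⟩ := exists_presentation hM
  obtain ⟨P₁, P₀, f, g, wf, hP₁, hP₀, hP⟩ := exists_presentation hN
  have : Epi p := hS.epi_g
  have : Mono i := hS.mono_f
  have : Epi s := hR.epi_g
  have : Mono r := hR.mono_f
  have : Epi g := hP.epi_g
  have : Mono f := hP.mono_f
  obtain ⟨p₀, hp₀⟩ := hP₀.exists_lift p g
  have exL := (exact_iff_ev w).1 hS.exact
  have exM := (exact_iff_ev wr).1 hR.exact
  have exN := (exact_iff_ev wf).1 hP.exact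
  obtain ⟨q', hq'⟩ := exists_factor_mono i (f ≫ p₀) fun x m => exL x _ (by
    rw [← ev_comp, Category.assoc, hp₀, wf, ev_zero])
  obtain ⟨q, hq⟩ := hP₁.exists_lift s q'
  have hqi : ∀ x m, ev i x (ev s x (ev q x m)) = ev p₀ x (ev f x m) := fun x m => by
    rw [← ev_comp q s, hq, ← ev_comp, hq', ev_comp]
  -- The horseshoe construction. The lift `p₀` of `g` carries the image of `f` into `M`; the
  -- correction `q` lifts the resulting morphism to `R₀`, and its sign makes `F ≫ G` vanish.
  let F : R₁ ⊞ P₁ ⟶ R₀ ⊞ P₀ := biprod.lift (biprod.fst ≫ r - biprod.snd ≫ q) (biprod.snd ≫ f)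
  let G : R₀ ⊞ P₀ ⟶ L := biprod.fst ≫ s ≫ i + biprod.snd ≫ p₀
  have hFfst : ∀ x m, ev biprod.fst x (ev F x m) =
      ev r x (ev biprod.fst x m) - ev q x (ev biprod.snd x m) := fun x m => by
    rw [← ev_comp, biprod.lift_fst]
    simp
  have hFsnd : ∀ x m, ev biprod.snd x (ev F x m) = ev f x (ev biprod.snd x m) := fun x m => by
    rw [← ev_comp, biprod.lift_snd]
    simp
  have hG : ∀ x m, ev G x m = ev i x (ev s x (ev biprod.fst x m)) + ev p₀ x (ev biprod.snd x m) :=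
    fun x m => by simp [G]
  have hrs : ∀ x m, ev s x (ev r x m) = 0 := fun x m => by rw [← ev_comp, wr, ev_zero]
  have hfg : ∀ x m, ev g x (ev f x m) = 0 := fun x m => by rw [← ev_comp, wf, ev_zero]
  have hip : ∀ x m, ev p x (ev i x m) = 0 := fun x m => by rw [← ev_comp, w, ev_zero]
  have hgp : ∀ x m, ev p x (ev p₀ x m) = ev g x m := fun x m => by rw [← ev_comp, hp₀]
  have hin : ∀ x (a : R₁.obj x) (b : P₁.obj x), ∃ c : (R₁ ⊞ P₁).obj x,
      ev biprod.fst x c = a ∧ ev biprod.snd x c = b := fun x a b =>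
    ⟨ev biprod.inl x a + ev biprod.inr x b, by simp [← ev_comp], by simp [← ev_comp]⟩
  have hin' : ∀ x (a : R₀.obj x) (b : P₀.obj x), ∃ c : (R₀ ⊞ P₀).obj x,
      ev biprod.fst x c = a ∧ ev biprod.snd x c = b := fun x a b =>
    ⟨ev biprod.inl x a + ev biprod.inr x b, by simp [← ev_comp], by simp [← ev_comp]⟩
  have wFG : F ≫ G = 0 := hom_ext_ev fun x m => by
    rw [ev_comp, hG, hFfst, hFsnd, map_sub, map_sub, hrs, hqi, map_zero, ev_zero]
    abel
  refine ⟨ShortComplex.mk F G wFG, shortExact_of_ev wFG ?_ ?_ ?_, hR₁.biprod hP₁, hR₀.biprod hP₀,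
    ⟨Iso.refl _⟩⟩
  · refine fun x => (injective_iff_map_eq_zero _).2 fun m hm => ?_
    have h2 : ev biprod.snd x m = 0 := injective_ev f x (by rw [← hFsnd, hm, map_zero, map_zero])
    refine ev_biprod_ext (injective_ev r x ?_) (by rw [h2, map_zero])
    have h1 := hFfst x m
    rw [hm, h2, map_zero, map_zero, sub_zero] at h1
    rw [← h1, map_zero, map_zero]
  · intro x e
    obtain ⟨b, hb⟩ := surjective_ev g x (ev p x e)
    obtain ⟨m, hm⟩ := exL x (e - ev p₀ x b) (by rw [map_sub, hgp, hb, sub_self])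
    obtain ⟨a, rfl⟩ := surjective_ev s x m
    obtain ⟨c, hc₁, hc₂⟩ := hin' x a b
    exact ⟨c, by rw [hG, hc₁, hc₂, hm]; abel⟩
  · intro x n hn
    rw [hG] at hn
    obtain ⟨b, hb⟩ := exN x (ev biprod.snd x n) (by
      have h := congrArg (ev p x) hn
      rwa [map_add, hip, hgp, zero_add, map_zero] at h)
    obtain ⟨a, ha⟩ := exM x (ev biprod.fst x n + ev q x b) (injective_ev i x (by
      rw [map_add, map_add, hqi, hb, hn, map_zero]))
    obtain ⟨c, hc₁, hc₂⟩ := hin x a b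
    refine ⟨c, ev_biprod_ext ?_ ?_⟩
    · rw [hFfst, hc₁, hc₂, ha, add_sub_cancel_right]
    · rw [hFsnd, hc₂, hb]

end Closure
end QuiverAR
end

noncomputable section
namespace QuiverAR

/-! ### The Nakayama functor -/

section Nakayama

universe u v w
variable {k : Type w} [Field k] {Q : Type u} [Quiver.{v} Q]
variable {M N L K P P' P₀ P₁ Z : QRep k Q} {x y z : Paths Q}

/-- The elements of `ν P` at `x` are the linear forms on `Hom(P, P_x)`. -/
def pair (P : QRep k Q) (x : Paths Q) :
    (nakayama.obj P).obj x ≃ₗ[k] Module.Dual k (P ⟶ projRep k x) :=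
  LinearEquiv.refl _ _

@[simp] theorem pair_act (p : x ⟶ y) (θ : (nakayama.obj P).obj x) (g : P ⟶ projRep k y) :
    pair P y (act _ p θ) g = pair P x θ (g ≫ projRepMap k p) := rfl

@[simp] theorem pair_ev (f : P ⟶ P') (θ : (nakayama.obj P).obj x) (g : P' ⟶ projRep k x) :
    pair P' x (ev (nakayama.map f) x θ) g = pair P x θ (f ≫ g) := rfl

theorem pair_ext {θ θ' : (nakayama.obj P).obj x} (h : ∀ g, pair P x θ g = pair P x θ' g) : θ = θ' :=
  (pair P x).injective (LinearMap.ext h)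

/-- A linear form on `Hom(P, M)` gives a morphism from `M` to `ν P`. -/
def psi (φ : Module.Dual k (P ⟶ M)) : M ⟶ nakayama.obj P :=
  homOf (fun x => (pair P x).symm.toLinearMap ∘ₗ
    { toFun := fun m => φ ∘ₗ Linear.rightComp k P (yon m)
      map_add' := fun m n => LinearMap.ext fun g => by simp [yon_add]
      map_smul' := fun c m => LinearMap.ext fun g => by simp [yon_smul] })
    fun x y a m => pair_ext fun g => by
      rw [pair_act]
      change φ (g ≫ yon _) = φ ((g ≫ projRepMap k (arr a)) ≫ yon m)
      rw [Category.assoc, projRepMap_comp_yon]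

@[simp] theorem pair_psi (φ : Module.Dual k (P ⟶ M)) (m : M.obj x) (g : P ⟶ projRep k x) :
    pair P x (ev (psi φ) x m) g = φ (g ≫ yon m) := rfl

theorem comp_psi (h : N ⟶ M) (φ : Module.Dual k (P ⟶ M)) :
    h ≫ psi φ = psi (φ ∘ₗ Linear.rightComp k P h) :=
  hom_ext_ev fun x m => pair_ext fun g => by
    simp [yon_comp]

theorem psi_comp (f : P ⟶ P') (φ : Module.Dual k (P ⟶ M)) :
    psi φ ≫ nakayama.map f = psi (φ ∘ₗ Linear.leftComp k M f) :=
  hom_ext_ev fun x m => pair_ext fun g => by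
    simp

theorem psi_add (φ φ' : Module.Dual k (P ⟶ M)) : psi (φ + φ') = psi φ + psi φ' :=
  hom_ext_ev fun x m => pair_ext fun g => by simp

theorem yon_eq_psi (θ : (nakayama.obj P).obj x) : yon θ = psi (pair P x θ) := by
  refine hom_ext_yon (pair_ext fun g => ?_)
  rw [ev_yon_pathElt, act_id, pair_psi, yon_pathElt, projRepMap_id, Category.comp_id]

/-- For `r` a path this is naturality of `v`; both sides are linear in `r`. -/
theorem pair_ev_yon (v : M ⟶ nakayama.obj P) (m : M.obj x) (r : (projRep k x).obj y)
    (π : P ⟶ projRep k y) :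
    pair P y (ev v y (ev (yon m) y r)) π = pair P x (ev v x m) (π ≫ yon r) := by
  refine pathElt_span r (LinearMap.eqLocus
    ((pair P y).toLinearMap.flip π ∘ₗ ev v y ∘ₗ ev (yon m) y)
    (pair P x (ev v x m) ∘ₗ Linear.leftComp k (projRep k x) π ∘ₗ
      (yonEquiv (projRep k x) y).toLinearMap)) fun p => ?_
  change pair P y (ev v y (ev (yon m) y (pathElt p))) π =
    pair P x (ev v x m) (π ≫ yon (pathElt p))
  rw [ev_yon_pathElt, ev_act, pair_act, yon_pathElt]

/-- Every morphism to `ν P` comes from a unique linear form. -/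
theorem DualBasis.psi_bijective {ι : Type*} [Fintype ι] (b : DualBasis P ι) :
    Function.Bijective (psi : Module.Dual k (P ⟶ M) → (M ⟶ nakayama.obj P)) := by
  have hsum : ∀ t : P ⟶ M, t = ∑ i, b.proj i ≫ yon (ev (b.inc i ≫ t) _ (pathElt (𝟙 _))) := by
    intro t
    simp only [← eq_yon]
    simp only [← Category.assoc]
    rw [← Preadditive.sum_comp, b.total, Category.id_comp]
  constructor
  · intro φ φ' h
    refine LinearMap.ext fun t => ?_
    rw [hsum t, map_sum, map_sum]
    refine Finset.sum_congr rfl fun i _ => ?_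
    rw [← pair_psi, ← pair_psi, h]
  · intro v
    -- The form is read off from `v`: a morphism `t` is evaluated at the generators of `P`, and the
    -- values of `v` there are paired with the projections `b.proj i`.
    let φ : Module.Dual k (P ⟶ M) :=
      ∑ i, (pair P (b.pt i)).toLinearMap.flip (b.proj i) ∘ₗ ev v (b.pt i) ∘ₗ
        (yonEquiv M (b.pt i)).symm.toLinearMap ∘ₗ Linear.leftComp k M (b.inc i)
    have hφ : ∀ t, φ t = ∑ i, pair P (b.pt i) (ev v _ (ev (b.inc i ≫ t) _ (pathElt (𝟙 _))))
        (b.proj i) := by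
      intro t
      simp only [φ, LinearMap.sum_apply]
      rfl
    refine ⟨φ, hom_ext_ev fun x m => pair_ext fun g => ?_⟩
    rw [pair_psi, hφ]
    have h2 : ∀ i, pair P (b.pt i) (ev v _ (ev (b.inc i ≫ g ≫ yon m) _ (pathElt (𝟙 _)))) (b.proj i) =
        pair P x (ev v x m) (b.proj i ≫ b.inc i ≫ g) := by
      intro i
      rw [← Category.assoc, ev_comp]
      rw [eq_yon (b.inc i ≫ g)]
      generalize ev (b.inc i ≫ g) (b.pt i) (pathElt (𝟙 (b.pt i))) = r
      rw [ev_yon_pathElt, act_id]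
      exact pair_ev_yon v m r (b.proj i)
    simp only [h2]
    rw [← map_sum]
    simp only [← Category.assoc]
    rw [← Preadditive.sum_comp, b.total, Category.id_comp]


theorem IsFinProj.psi_injective (hP : IsFinProj P) {φ φ' : Module.Dual k (P ⟶ M)}
    (h : psi φ = psi φ') : φ = φ' :=
  let ⟨_, ⟨b⟩⟩ := hP.exists_dualBasis
  b.psi_bijective.1 h

theorem IsFinProj.exists_psi (hP : IsFinProj P) (v : M ⟶ nakayama.obj P) : ∃ φ, psi φ = v :=
  let ⟨_, ⟨b⟩⟩ := hP.exists_dualBasis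
  b.psi_bijective.2 v

/-- `ν P` is injective for `P` in `proj(Q)`. -/
theorem IsFinProj.exists_extend (hP : IsFinProj P) (i : N ⟶ M) [Mono i] (v : N ⟶ nakayama.obj P) :
    ∃ t : M ⟶ nakayama.obj P, i ≫ t = v := by
  obtain ⟨φ, rfl⟩ := hP.exists_psi v
  -- Under `psi`, extending a morphism to `ν P` becomes extending a linear form along the injection
  -- of Hom(P, N) into Hom(P, M).
  have hinj : Function.Injective (Linear.rightComp k P i) := fun a b h =>
    (cancel_mono i).1 h
  obtain ⟨φ', hφ'⟩ := LinearMap.dualMap_surjective_of_injective hinj φ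
  exact ⟨psi φ', by rw [comp_psi]; exact congrArg psi hφ'⟩

/-- The functor `ν` is faithful on `proj(Q)`. -/
theorem IsFinProj.nakayama_injective (hP' : IsFinProj P') {f g : P ⟶ P'}
    (h : nakayama.map f = nakayama.map g) : f = g := by
  obtain ⟨n, ⟨b⟩⟩ := hP'.exists_dualBasis
  have key : ∀ i, f ≫ b.proj i = g ≫ b.proj i := fun i => by
    rw [← sub_eq_zero]
    refine Module.forall_dual_apply_eq_zero_iff k _ |>.1 fun θ => ?_
    have := congrArg (fun t => pair P' _ (ev t _ ((pair P _).symm θ)) (b.proj i)) h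
    rw [map_sub, sub_eq_zero]
    simpa using this
  rw [← Category.comp_id f, ← Category.comp_id g, ← b.total, Preadditive.comp_sum,
    Preadditive.comp_sum]
  simp only [← Category.assoc, key]

/-- The functor `ν` is full on `proj(Q)`. -/
theorem IsFinProj.exists_nakayama_map (hQ : StronglyLocallyFinite Q) (hP : IsFinProj P)
    (hP' : IsFinProj P') (v : nakayama.obj P ⟶ nakayama.obj P') :
    ∃ t : P ⟶ P', nakayama.map t = v := by
  obtain ⟨φ, rfl⟩ := hP'.exists_psi v
  obtain ⟨n, ⟨b⟩⟩ := hP.exists_dualBasis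
  obtain ⟨n', ⟨b'⟩⟩ := hP'.exists_dualBasis
  have : Module.Finite k (P ⟶ P') := by
    have := fun i => b'.ptFin hQ (b.pt i)
    refine Module.Finite.of_injective (LinearMap.pi fun i =>
      (yonEquiv P' (b.pt i)).symm.toLinearMap ∘ₗ Linear.leftComp k P' (b.inc i)) fun f g h => ?_
    exact b.hom_ext fun i => (yonEquiv P' (b.pt i)).symm.injective (congrFun h i)
  let Ψ : Module.Dual k (P ⟶ P') →ₗ[k] (P' ⟶ nakayama.obj P) :=
    { toFun := psi
      map_add' := psi_add
      map_smul' := fun c φ => hom_ext_ev fun x m => pair_ext fun g => by simp }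
  -- Since `P ⟶ P'` is finite dimensional, the form on its dual obtained from `φ` is evaluation at
  -- some `t`.
  obtain ⟨t, ht⟩ := (Module.evalEquiv k (P ⟶ P')).surjective (φ ∘ₗ Ψ)
  refine ⟨t, hom_ext_ev fun x θ => pair_ext fun g => ?_⟩
  rw [pair_ev, pair_psi, yon_eq_psi, comp_psi]
  have := LinearMap.congr_fun ht (pair P x θ ∘ₗ Linear.rightComp k P g)
  exact this

/-- The components of `ν f` are onto if every morphism from the domain of `f` to a `P_x` which
vanishes on the image of `f` is zero. -/
theorem epi_nakayama_map {f : P₁ ⟶ P₀}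
    (h : ∀ (x : Paths Q) (t : P₀ ⟶ projRep k x), f ≫ t = 0 → t = 0) : Epi (nakayama.map f) := by
  rw [epi_iff_ev]
  intro x
  have hinj : Function.Injective (Linear.leftComp k (projRep k x) f) :=
    (injective_iff_map_eq_zero _).2 fun t ht => h x t ht
  exact LinearMap.dualMap_surjective_of_injective hinj

/-- Converse of `epi_nakayama_map`: every linear form on Hom(P₀, P_x) factors through composition
with `f`, so all forms vanish at `t`. -/
theorem eq_zero_of_epi_nakayama_map {f : P₁ ⟶ P₀} [Epi (nakayama.map f)] {t : P₀ ⟶ projRep k x}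
    (h : f ≫ t = 0) : t = 0 := by
  have hs := surjective_ev (nakayama.map f) x
  refine Module.forall_dual_apply_eq_zero_iff k t |>.1 fun θ => ?_
  obtain ⟨θ', hθ'⟩ := hs ((pair P₀ x).symm θ)
  have : pair P₀ x (ev (nakayama.map f) x θ') t = θ t := by rw [hθ']; rfl
  rw [← this, pair_ev, h, map_zero]

/-- The form of the Auslander-Reiten formula used below: a morphism to `ν P₀` factors through
`ν f` if and only if the corresponding linear form vanishes on the morphisms which factor
through the cokernel of `f`. -/
theorem exists_factor_nakayama {f : P₁ ⟶ P₀} {g : P₀ ⟶ Z} {w : f ≫ g = 0}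
    (hS : (ShortComplex.mk f g w).Exact) (hg : Epi g) (φ : Module.Dual k (P₀ ⟶ M))
    (hφ : ∀ s : Z ⟶ M, φ (g ≫ s) = 0) : ∃ v : M ⟶ nakayama.obj P₁, v ≫ nakayama.map f = psi φ := by
  -- A form lies in the range of the transpose when it vanishes on the kernel; here the kernel
  -- consists of the morphisms killed by `f`, which factor through `g`.
  have hmem : φ ∈ LinearMap.range (Linear.leftComp k M f).dualMap := by
    rw [LinearMap.range_dualMap_eq_dualAnnihilator_ker, Submodule.mem_dualAnnihilator]
    intro t ht
    have : Epi (ShortComplex.mk f g w).g := hg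
    have h2 : g ≫ hS.desc t ht = t := hS.g_desc t ht
    rw [← h2]
    exact hφ _
  obtain ⟨φ', rfl⟩ := hmem
  exact ⟨psi φ', psi_comp f φ'⟩

end Nakayama
end QuiverAR
end

noncomputable section
namespace QuiverAR

/-! ### Local objects and the radical of a category -/

section Radical

universe v₁ u₁ w

variable {A : Type u₁} [Category.{v₁} A] [Preadditive A] {W X Y Z E E' : A}

/-- Objects with a local endomorphism ring. -/
def LocalObj (X : A) : Prop := ¬ IsZero X ∧ ∀ φ : X ⟶ X, IsIso φ ∨ IsIso (𝟙 X - φ)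

/-- The composite `t ≫ φ` is idempotent, so locality makes it the identity or zero, and zero would
force `X` to be zero. -/
theorem LocalObj.isIso_of_comp_eq_id (hX : LocalObj X) {φ t : X ⟶ X} (h : φ ≫ t = 𝟙 X) :
    IsIso φ := by
  have he : (t ≫ φ) ≫ (t ≫ φ) = t ≫ φ := by
    rw [Category.assoc, ← Category.assoc φ, h, Category.id_comp]
  rcases hX.2 (t ≫ φ) with h1 | h1
  · refine ⟨t, h, ?_⟩
    rw [← cancel_epi (t ≫ φ), he, Category.comp_id]
  · have h2 : (𝟙 X - t ≫ φ) ≫ (t ≫ φ) = 0 := by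
      rw [Preadditive.sub_comp, he, Category.id_comp, sub_self]
    have h3 : t ≫ φ = 0 := by
      rw [← cancel_epi (𝟙 X - t ≫ φ), h2, comp_zero]
    refine (hX.1 ((IsZero.iff_id_eq_zero _).2 ?_)).elim
    have : φ ≫ (t ≫ φ) ≫ t = 𝟙 X := by
      rw [Category.assoc, h, Category.comp_id, h]
    rw [← this, h3, zero_comp, comp_zero]

theorem LocalObj.isIso_of_comp_eq_id' (hX : LocalObj X) {φ t : X ⟶ X} (h : φ ≫ t = 𝟙 X) :
    IsIso t := by
  have := hX.isIso_of_comp_eq_id h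
  have : t = inv φ := by rw [← cancel_epi φ, h, IsIso.hom_inv_id]
  rw [this]
  infer_instance

theorem LocalObj.left_of_comp (hX : LocalObj X) {φ ψ : X ⟶ X} (h : IsIso (φ ≫ ψ)) : IsIso φ :=
  hX.isIso_of_comp_eq_id (t := ψ ≫ inv (φ ≫ ψ)) (by rw [← Category.assoc, IsIso.hom_inv_id])

theorem LocalObj.right_of_comp (hX : LocalObj X) {φ ψ : X ⟶ X} (h : IsIso (φ ≫ ψ)) : IsIso ψ :=
  hX.isIso_of_comp_eq_id' (φ := inv (φ ≫ ψ) ≫ φ) (by rw [Category.assoc, IsIso.inv_hom_id])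

theorem mem_radical_iff {f : X ⟶ Y} : f ∈ radical X Y ↔ ∀ g : Y ⟶ X, IsIso (𝟙 X - f ≫ g) :=
  Iff.rfl

theorem mem_radical_iff' {f : X ⟶ Y} : f ∈ radical X Y ↔ ∀ g : Y ⟶ X, IsIso (𝟙 Y - g ≫ f) :=
  ⟨fun h g => have := h g; isIso_one_sub_comp_swap f g,
    fun h g => have := h g; isIso_one_sub_comp_swap g f⟩

theorem radical_comp_mem {f : X ⟶ Y} (hf : f ∈ radical X Y) (h : Y ⟶ Z) : f ≫ h ∈ radical X Z :=
  fun g => by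
    rw [Category.assoc]
    exact hf _

theorem LocalObj.mem_radical (hX : LocalObj X) {f : X ⟶ Y} (hf : ¬ IsSplitMono f) :
    f ∈ radical X Y := fun g => by
  rcases hX.2 (f ≫ g) with h | h
  · exact (hf ⟨⟨g ≫ inv (f ≫ g), by rw [← Category.assoc, IsIso.hom_inv_id]⟩⟩).elim
  · exact h

theorem LocalObj.mem_radical' (hY : LocalObj Y) {f : X ⟶ Y} (hf : ¬ IsSplitEpi f) :
    f ∈ radical X Y := mem_radical_iff'.2 fun g => by
  rcases hY.2 (g ≫ f) with h | h
  · exact (hf ⟨⟨inv (g ≫ f) ≫ g, by rw [Category.assoc, IsIso.inv_hom_id]⟩⟩).elim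
  · exact h

theorem not_isSplitMono_of_mem_radical (hX : ¬ IsZero X) {f : X ⟶ Y} (hf : f ∈ radical X Y) :
    ¬ IsSplitMono f := fun ⟨⟨s⟩⟩ => by
  have h := hf s.retraction
  rw [s.id, sub_self] at h
  exact hX ((IsZero.iff_id_eq_zero _).2 (by rw [← cancel_epi (0 : X ⟶ X)]; simp))

theorem not_isSplitEpi_of_mem_radical (hY : ¬ IsZero Y) {f : X ⟶ Y} (hf : f ∈ radical X Y) :
    ¬ IsSplitEpi f := fun ⟨⟨s⟩⟩ => by
  have h := mem_radical_iff'.1 hf s.section_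
  rw [s.id, sub_self] at h
  exact hY ((IsZero.iff_id_eq_zero _).2 (by rw [← cancel_epi (0 : Y ⟶ Y)]; simp))

theorem comp_mem_radicalSq {f : X ⟶ Y} {g : Y ⟶ Z} (hf : f ∈ radical X Y) (hg : g ∈ radical Y Z) :
    f ≫ g ∈ radicalSq X Z :=
  Submodule.subset_span ⟨Y, f, g, hf, hg, rfl⟩

/-- A product of two radical morphisms from `X` factors as `f` followed by a radical morphism,
because `f` is left almost split. Two factorizations through `f` differ by a morphism killed by `f`,
and left minimality puts such a morphism in the radical. -/
theorem mem_radicalSq_iff_of_left {f : X ⟶ E} (hX : LocalObj X) (hf : IsMinimalLeftAlmostSplit f)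
    (h : E ⟶ Y) : f ≫ h ∈ radicalSq X Y ↔ h ∈ radical E Y := by
  constructor
  · intro hh
    have key : ∀ r ∈ radicalSq X Y, ∃ h' ∈ radical E Y, f ≫ h' = r := by
      intro r hr
      induction hr using Submodule.span_induction with
      | mem x hx =>
        obtain ⟨Z, a, b, ha, hb, rfl⟩ := hx
        obtain ⟨a', rfl⟩ := hf.factors Z a (not_isSplitMono_of_mem_radical hX.1 ha)
        exact ⟨a' ≫ b, comp_mem_radical a' hb, by rw [Category.assoc]⟩
      | zero => exact ⟨0, Submodule.zero_mem _, comp_zero⟩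
      | add x y _ _ hx hy =>
        obtain ⟨a, ha, rfl⟩ := hx
        obtain ⟨b, hb, rfl⟩ := hy
        exact ⟨a + b, Submodule.add_mem _ ha hb, Preadditive.comp_add _ _ _ _ _ _⟩
      | smul r x _ hx =>
        obtain ⟨a, ha, rfl⟩ := hx
        exact ⟨a ≫ r, radical_comp_mem ha r, (Category.assoc _ _ _).symm⟩
    obtain ⟨h', hh', e⟩ := key _ hh
    have h0 : f ≫ (h - h') = 0 := by rw [Preadditive.comp_sub, e, sub_self]
    have h1 : h - h' ∈ radical E Y := fun g => hf.minimal _ (by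
      rw [Preadditive.comp_sub, ← Category.assoc, h0, zero_comp, sub_zero, Category.comp_id])
    simpa using Submodule.add_mem _ h1 hh'
  · exact comp_mem_radicalSq (hX.mem_radical hf.not_section)

theorem mem_radicalSq_iff_of_right {g : E ⟶ Z} (hZ : LocalObj Z)
    (hg : IsMinimalRightAlmostSplit g) (h : X ⟶ E) :
    h ≫ g ∈ radicalSq X Z ↔ h ∈ radical X E := by
  constructor
  · intro hh
    have key : ∀ r ∈ radicalSq X Z, ∃ h' ∈ radical X E, h' ≫ g = r := by
      intro r hr
      induction hr using Submodule.span_induction with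
      | mem x hx =>
        obtain ⟨Y, a, b, ha, hb, rfl⟩ := hx
        obtain ⟨b', rfl⟩ := hg.factors Y b (not_isSplitEpi_of_mem_radical hZ.1 hb)
        exact ⟨a ≫ b', radical_comp_mem ha b', by rw [Category.assoc]⟩
      | zero => exact ⟨0, Submodule.zero_mem _, zero_comp⟩
      | add x y _ _ hx hy =>
        obtain ⟨a, ha, rfl⟩ := hx
        obtain ⟨b, hb, rfl⟩ := hy
        exact ⟨a + b, Submodule.add_mem _ ha hb, Preadditive.add_comp _ _ _ _ _ _⟩
      | smul r x _ hx =>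
        obtain ⟨a, ha, rfl⟩ := hx
        obtain ⟨b, hb⟩ := hg.factors E (g ≫ r) (not_isSplitEpi_of_mem_radical hZ.1
          (radical_comp_mem (hZ.mem_radical' hg.not_retraction) r))
        refine ⟨a ≫ b, radical_comp_mem ha b, ?_⟩
        rw [Category.assoc, hb, ← Category.assoc]
        rfl
    obtain ⟨h', hh', e⟩ := key _ hh
    have h0 : (h - h') ≫ g = 0 := by rw [Preadditive.sub_comp, e, sub_self]
    have h1 : h - h' ∈ radical X E := mem_radical_iff'.2 fun t => hg.minimal _ (by
      rw [Preadditive.sub_comp, Category.assoc, h0, comp_zero, sub_zero, Category.id_comp])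
    simpa using Submodule.add_mem _ h1 hh'
  · exact fun h => comp_mem_radicalSq h (hZ.mem_radical' hg.not_retraction)

/-- There is an irreducible morphism: the space `irr(X, Y)` is non-zero. -/
def HasIrr (X Y : A) : Prop := ∃ r ∈ radical X Y, r ∉ radicalSq X Y

theorem hasIrr_iff_of_left {f : X ⟶ E} (hX : LocalObj X) (hf : IsMinimalLeftAlmostSplit f) :
    HasIrr X Y ↔ ∃ h : E ⟶ Y, h ∉ radical E Y := by
  constructor
  · rintro ⟨r, hr, hr'⟩
    obtain ⟨h, rfl⟩ := hf.factors Y r (not_isSplitMono_of_mem_radical hX.1 hr)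
    exact ⟨h, fun hh => hr' ((mem_radicalSq_iff_of_left hX hf h).2 hh)⟩
  · rintro ⟨h, hh⟩
    exact ⟨f ≫ h, radical_comp_mem (hX.mem_radical hf.not_section) h, fun hr =>
      hh ((mem_radicalSq_iff_of_left hX hf h).1 hr)⟩

theorem hasIrr_iff_of_right {g : E ⟶ Z} (hZ : LocalObj Z) (hg : IsMinimalRightAlmostSplit g) :
    HasIrr X Z ↔ ∃ h : X ⟶ E, h ∉ radical X E := by
  constructor
  · rintro ⟨r, hr, hr'⟩
    obtain ⟨h, rfl⟩ := hg.factors X r (not_isSplitEpi_of_mem_radical hZ.1 hr)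
    exact ⟨h, fun hh => hr' ((mem_radicalSq_iff_of_right hZ hg h).2 hh)⟩
  · rintro ⟨h, hh⟩
    exact ⟨h ≫ g, comp_mem_radical h (hZ.mem_radical' hg.not_retraction), fun hr =>
      hh ((mem_radicalSq_iff_of_right hZ hg h).1 hr)⟩

theorem exists_notMem_radical_swap (h : ∃ h : X ⟶ Y, h ∉ radical X Y) :
    ∃ h : Y ⟶ X, h ∉ radical Y X := by
  by_contra hn
  push Not at hn
  obtain ⟨h, hh⟩ := h
  exact hh fun g => mem_radical_iff'.1 (hn g) h

/-- The arrows which start at the first term of an almost split sequence correspond to those which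
end at the last term. -/
theorem hasIrr_iff_of_almostSplit {f : X ⟶ E} {g : E ⟶ Z} (hX : LocalObj X) (hZ : LocalObj Z)
    (h : IsAlmostSplitSequence f g) : HasIrr X Y ↔ HasIrr Y Z := by
  rw [hasIrr_iff_of_left hX h.left, hasIrr_iff_of_right hZ h.right]
  exact ⟨exists_notMem_radical_swap, exists_notMem_radical_swap⟩

/-! ### Bricks -/

section Linear

variable (k : Type w) [Field k] [Linear k A]

/-- Objects with trivial endomorphism ring `k`. -/
def Brick (X : A) : Prop := ¬ IsZero X ∧ ∀ φ : X ⟶ X, ∃ c : k, φ = c • 𝟙 X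

variable {k}

theorem isIso_smul_id {c : k} (hc : c ≠ 0) : IsIso (c • 𝟙 X) :=
  ⟨c⁻¹ • 𝟙 X, by simp [smul_smul, hc], by simp [smul_smul, hc]⟩

theorem Brick.local (hX : Brick k X) : LocalObj X := by
  refine ⟨hX.1, fun φ => ?_⟩
  obtain ⟨c, rfl⟩ := hX.2 φ
  by_cases hc : c = 0
  · right
    subst hc
    simp only [zero_smul, sub_zero]
    infer_instance
  · exact Or.inl (isIso_smul_id hc)

theorem Brick.smul_id_inj (hX : Brick k X) {c d : k} (h : c • 𝟙 X = d • 𝟙 X) : c = d := by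
  by_contra hcd
  have h1 := isIso_smul_id (X := X) (sub_ne_zero.2 hcd)
  rw [sub_smul, h, sub_self] at h1
  exact hX.1 ((IsZero.iff_id_eq_zero _).2 (by rw [← cancel_epi (0 : X ⟶ X)]; simp))

/-- The scalar by which an endomorphism of a brick acts. -/
def Brick.scalar (hX : Brick k X) : (X ⟶ X) →ₗ[k] k where
  toFun φ := (hX.2 φ).choose
  map_add' φ ψ := hX.smul_id_inj (by
    rw [← (hX.2 (φ + ψ)).choose_spec, add_smul, ← (hX.2 φ).choose_spec, ← (hX.2 ψ).choose_spec])
  map_smul' c φ := hX.smul_id_inj (by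
    rw [← (hX.2 (c • φ)).choose_spec, RingHom.id_apply, smul_eq_mul, mul_smul,
      ← (hX.2 φ).choose_spec])

theorem Brick.scalar_spec (hX : Brick k X) (φ : X ⟶ X) : φ = hX.scalar φ • 𝟙 X :=
  (hX.2 φ).choose_spec

theorem Brick.scalar_eq_zero_iff (hX : Brick k X) {φ : X ⟶ X} : hX.scalar φ = 0 ↔ φ = 0 := by
  constructor
  · intro h
    rw [hX.scalar_spec φ, h, zero_smul]
  · rintro rfl
    exact map_zero _

theorem Brick.isIso_one_sub_iff (hX : Brick k X) {φ : X ⟶ X} :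
    IsIso (𝟙 X - φ) ↔ hX.scalar φ ≠ 1 := by
  constructor
  · intro h h1
    rw [hX.scalar_spec φ, h1, one_smul, sub_self] at h
    exact hX.1 ((IsZero.iff_id_eq_zero _).2 (by rw [← cancel_epi (0 : X ⟶ X)]; simp))
  · intro h
    have := isIso_smul_id (X := X) (sub_ne_zero.2 h.symm)
    rwa [sub_smul, one_smul, ← hX.scalar_spec] at this

/-- The composite `g ≫ h` is a scalar; if it were nonzero, rescaling `g` would turn it into the
identity. -/
theorem Brick.mem_radical_iff (hY : Brick k Y) {h : X ⟶ Y} :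
    h ∈ radical X Y ↔ ∀ g : Y ⟶ X, g ≫ h = 0 := by
  rw [mem_radical_iff']
  constructor
  · intro H g
    by_contra hg
    have h0 : hY.scalar (g ≫ h) ≠ 0 := fun e => hg (hY.scalar_eq_zero_iff.1 e)
    have := hY.isIso_one_sub_iff.1 (H ((hY.scalar (g ≫ h))⁻¹ • g))
    rw [Linear.smul_comp, map_smul, smul_eq_mul, inv_mul_cancel₀ h0] at this
    exact this rfl
  · intro H g
    rw [H g, sub_zero]
    infer_instance

theorem Brick.mem_radical_iff' (hY : Brick k Y) {h : Y ⟶ X} :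
    h ∈ radical Y X ↔ ∀ g : X ⟶ Y, h ≫ g = 0 := by
  constructor
  · intro H g
    have h2 : h ≫ g ∈ radical Y Y := radical_comp_mem H g
    simpa using hY.mem_radical_iff.1 h2 (𝟙 Y)
  · intro H g
    rw [H g, sub_zero]
    infer_instance

variable (k) in
/-- The radical, as a subspace over the base field. -/
def radK (X Y : A) : Submodule k (X ⟶ Y) where
  carrier := radical X Y
  add_mem' := (radical X Y).add_mem
  zero_mem' := (radical X Y).zero_mem
  smul_mem' c f hf := by
    have := radical_comp_mem hf (c • 𝟙 Y)
    rwa [Linear.comp_smul, Category.comp_id] at this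

variable (k) in
/-- The square of the radical, as a subspace of the radical over the base field. -/
def radSqK (X Y : A) : Submodule k (radK k X Y) where
  carrier := {f | f.1 ∈ radicalSq X Y}
  add_mem' := (radicalSq X Y).add_mem
  zero_mem' := (radicalSq X Y).zero_mem
  smul_mem' c f hf := by
    have h : f.1 ≫ (c • 𝟙 Y) ∈ radicalSq X Y :=
      (radicalSq X Y).smul_mem (show End Y from c • 𝟙 Y) hf
    rwa [Linear.comp_smul, Category.comp_id] at h

variable (k) in
/-- The dimension of `irr(X, Y)` over the base field. -/
def irrDimK (X Y : A) : ℕ := Module.finrank k (radK k X Y ⧸ radSqK k X Y)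

-- Here `hσ` makes `k` the whole quotient of `End Y` by its radical, and `L` identifies irr(X, Y)
-- with `V` compatibly with the scalars. The map `σ` and the space `V` are left free so that the
-- same comparison serves in the opposite category.
omit [Linear k A] in
theorem irrDim_eq_finrank {V : Type*} [AddCommGroup V] [Module k V] (hY : ¬ IsZero Y)
    (σ : k →+* End Y) (hσ : ∀ r : End Y, ∃ c, r - σ c ∈ endRadical Y)
    (L : radical X Y →+ V) (hL : Function.Surjective L)
    (hker : ∀ f, L f = 0 ↔ f.1 ∈ radicalSq X Y) (hsmul : ∀ c f, L (σ c • f) = c • L f) :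
    irrDim X Y = Module.finrank k V := by
  let _ : Module (End Y ⧸ endRadical Y) (Irr X Y) := (isTorsionBySet_irr X Y).module
  have hone : (1 : End Y) ∉ endRadical Y := fun h => by
    have := h (𝟙 Y)
    rw [show (1 : End Y) = 𝟙 Y from rfl, Category.comp_id, sub_self] at this
    exact hY ((IsZero.iff_id_eq_zero _).2 (by rw [← cancel_epi (0 : Y ⟶ Y)]; simp))
  have : Nontrivial (End Y ⧸ endRadical Y) := Ideal.Quotient.nontrivial_iff.2 fun h =>
    hone (h ▸ Submodule.mem_top)
  let τ : k →+* End Y ⧸ endRadical Y := (Ideal.Quotient.mk (endRadical Y)).comp σ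
  have hτ : Function.Bijective τ := by
    refine ⟨τ.injective, fun r => ?_⟩
    obtain ⟨r, rfl⟩ := Ideal.Quotient.mk_surjective r
    obtain ⟨c, hc⟩ := hσ r
    exact ⟨c, (Ideal.Quotient.eq.2 hc).symm⟩
  let g : Irr X Y →+ V := QuotientAddGroup.lift _ L fun f hf => (hker f).2 hf
  have hg : Function.Injective g := (injective_iff_map_eq_zero g).2 fun a => by
    induction a using Submodule.Quotient.induction_on with
    | H f => exact fun h => (Submodule.Quotient.mk_eq_zero _).2 ((hker f).1 h)
  let j : Irr X Y ≃+ V := AddEquiv.ofBijective g ⟨hg, fun v => by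
    obtain ⟨f, rfl⟩ := hL v
    exact ⟨Submodule.Quotient.mk f, rfl⟩⟩
  have hj : ∀ (c : k) (m : V), j.symm (c • m) = τ c • j.symm m := by
    intro c m
    apply j.injective
    rw [AddEquiv.apply_symm_apply]
    obtain ⟨a, rfl⟩ := j.surjective m
    rw [AddEquiv.symm_apply_apply]
    induction a using Submodule.Quotient.induction_on with
    | H f => exact (hsmul c f).symm
  have := lift_rank_eq_of_equiv_equiv τ j.symm hτ hj
  have h2 := congrArg Cardinal.toNat this
  rw [Cardinal.toNat_lift, Cardinal.toNat_lift] at h2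
  exact h2.symm

theorem irrDim_eq_irrDimK (hY : Brick k Y) : irrDim X Y = irrDimK k X Y := by
  refine irrDim_eq_finrank hY.1 (algebraMap k (End Y)) (fun r => ?_)
    ⟨⟨fun f => (radSqK k X Y).mkQ ⟨f.1, f.2⟩,
      (Submodule.Quotient.mk_eq_zero _).2 (Submodule.zero_mem _)⟩, fun _ _ => rfl⟩ ?_ ?_ ?_
  · obtain ⟨c, hc⟩ := hY.2 r
    refine ⟨c, ?_⟩
    have : r - algebraMap k (End Y) c = 0 :=
      sub_eq_zero.2 (hc.trans (Algebra.algebraMap_eq_smul_one (A := End Y) c).symm)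
    rw [this]
    exact Submodule.zero_mem _
  · intro v
    obtain ⟨f, rfl⟩ := (radSqK k X Y).mkQ_surjective v
    exact ⟨⟨f.1, f.2⟩, rfl⟩
  · intro f
    exact Submodule.Quotient.mk_eq_zero _
  · intro c f
    refine congrArg (radSqK k X Y).mkQ (Subtype.ext ?_)
    change f.1 ≫ (algebraMap k (End Y) c : Y ⟶ Y) = c • f.1
    have e : (algebraMap k (End Y) c : Y ⟶ Y) = c • 𝟙 Y :=
      Algebra.algebraMap_eq_smul_one (A := End Y) c
    rw [e, Linear.comp_smul, Category.comp_id]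

/-! ### The radical in the opposite category -/

theorem op_mem_radical_iff {f : X ⟶ Y} :
    f.op ∈ radical (Opposite.op Y) (Opposite.op X) ↔ f ∈ radical X Y := by
  rw [mem_radical_iff']
  constructor
  · intro h g
    have := h g.op
    have e : (𝟙 (Opposite.op X) - g.op ≫ f.op).unop = 𝟙 X - f ≫ g := rfl
    rw [← e]
    infer_instance
  · intro h g
    have := h g.unop
    have e : 𝟙 (Opposite.op X) - g ≫ f.op = (𝟙 X - f ≫ g.unop).op := rfl
    rw [e]
    infer_instance

theorem mem_radicalSq_comp {f : X ⟶ Y} (h : Z ⟶ X) (hf : f ∈ radicalSq X Y) :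
    h ≫ f ∈ radicalSq Z Y := by
  induction hf using Submodule.span_induction with
  | mem x hx =>
    obtain ⟨W, a, b, ha, hb, rfl⟩ := hx
    rw [← Category.assoc]
    exact comp_mem_radicalSq (comp_mem_radical h ha) hb
  | zero =>
    rw [comp_zero]
    exact Submodule.zero_mem _
  | add x y _ _ hx hy =>
    rw [Preadditive.comp_add]
    exact Submodule.add_mem _ hx hy
  | smul r x _ hx =>
    have e : h ≫ (r • x : X ⟶ Y) = (r • (h ≫ x) : Z ⟶ Y) := (Category.assoc h x r).symm
    rw [e]
    exact Submodule.smul_mem _ _ hx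

theorem op_mem_radicalSq {f : X ⟶ Y} (hf : f ∈ radicalSq X Y) :
    f.op ∈ radicalSq (Opposite.op Y) (Opposite.op X) := by
  induction hf using Submodule.span_induction with
  | mem x hx =>
    obtain ⟨W, a, b, ha, hb, rfl⟩ := hx
    exact comp_mem_radicalSq (op_mem_radical_iff.2 hb) (op_mem_radical_iff.2 ha)
  | zero => exact Submodule.zero_mem _
  | add x y _ _ hx hy => exact Submodule.add_mem _ hx hy
  | smul r x _ hx => exact mem_radicalSq_comp (Quiver.Hom.op (show Y ⟶ Y from r)) hx

theorem unop_mem_radicalSq {X Y : Aᵒᵖ} {f : X ⟶ Y} (hf : f ∈ radicalSq X Y) :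
    f.unop ∈ radicalSq Y.unop X.unop := by
  induction hf using Submodule.span_induction with
  | mem x hx =>
    obtain ⟨W, a, b, ha, hb, rfl⟩ := hx
    exact comp_mem_radicalSq (op_mem_radical_iff.1 hb) (op_mem_radical_iff.1 ha)
  | zero => exact Submodule.zero_mem _
  | add x y _ _ hx hy => exact Submodule.add_mem _ hx hy
  | smul r x _ hx => exact mem_radicalSq_comp (Quiver.Hom.unop (show Y ⟶ Y from r)) hx

/-- With `irrDim_eq_irrDimK`, this is the source of symmetric valuations: both entries are the
dimension over `k` of one and the same space when the two objects are bricks. -/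
theorem irrDim'_eq_irrDimK (hX : Brick k X) : irrDim' X Y = irrDimK k X Y := by
  have hz : ¬ IsZero (Opposite.op X) := fun h => hX.1 h.unop
  let σ : k →+* End (Opposite.op X) :=
    { toFun := fun c => (c • 𝟙 X).op
      map_one' := by rw [one_smul]; rfl
      map_zero' := by rw [zero_smul]; rfl
      map_add' := fun c d => by rw [add_smul]; rfl
      map_mul' := fun c d => by
        change _ = ((c • 𝟙 X) ≫ (d • 𝟙 X)).op
        rw [Linear.smul_comp, Category.id_comp, smul_smul] }
  refine irrDim_eq_finrank hz σ (fun r => ?_)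
    ⟨⟨fun f => (radSqK k X Y).mkQ ⟨f.1.unop, op_mem_radical_iff.1 f.2⟩, ?_⟩, ?_⟩ ?_ ?_ ?_
  · obtain ⟨c, hc⟩ := hX.2 (Quiver.Hom.unop (show Opposite.op X ⟶ Opposite.op X from r))
    refine ⟨c, ?_⟩
    have : r - σ c = 0 := sub_eq_zero.2 (congrArg Quiver.Hom.op hc)
    rw [this]
    exact Submodule.zero_mem _
  · exact (Submodule.Quotient.mk_eq_zero _).2 (Submodule.zero_mem _)
  · exact fun _ _ => rfl
  · intro v
    obtain ⟨f, rfl⟩ := (radSqK k X Y).mkQ_surjective v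
    exact ⟨⟨f.1.op, op_mem_radical_iff.2 f.2⟩, rfl⟩
  · intro f
    exact (Submodule.Quotient.mk_eq_zero _).trans ⟨op_mem_radicalSq, unop_mem_radicalSq⟩
  · intro c f
    refine congrArg (radSqK k X Y).mkQ (Subtype.ext ?_)
    change (c • 𝟙 X) ≫ f.1.unop = c • f.1.unop
    rw [Linear.smul_comp, Category.id_comp]

end Linear

end Radical
end QuiverAR
end

noncomputable section
namespace QuiverAR

/-! ### Dimensions of quotients by annihilators -/

section Pairing

universe w

variable {k : Type w} [Field k] {U V : Type*} [AddCommGroup U] [Module k U] [AddCommGroup V]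
  [Module k V]

/-- The range of `B` annihilates the right kernel, and the annihilator is dual to the quotient of
`V` by that kernel. -/
theorem finrank_quot_ker_le (B : U →ₗ[k] V →ₗ[k] k) [Module.Finite k V] :
    Module.finrank k (U ⧸ LinearMap.ker B) ≤ Module.finrank k (V ⧸ LinearMap.ker B.flip) := by
  rw [LinearEquiv.finrank_eq B.quotKerEquivRange]
  have h1 : LinearMap.range B ≤ (LinearMap.ker B.flip).dualAnnihilator := by
    rintro _ ⟨u, rfl⟩
    rw [Submodule.mem_dualAnnihilator]
    intro v hv
    exact LinearMap.congr_fun (LinearMap.mem_ker.1 hv) u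
  have h2 := Submodule.finrank_mono h1
  rw [← LinearEquiv.finrank_eq (Submodule.dualQuotEquivDualAnnihilator _),
    Subspace.dual_finrank_eq] at h2
  exact h2

theorem finrank_quot_ker_eq (B : U →ₗ[k] V →ₗ[k] k) [Module.Finite k U] [Module.Finite k V] :
    Module.finrank k (U ⧸ LinearMap.ker B) = Module.finrank k (V ⧸ LinearMap.ker B.flip) :=
  le_antisymm (finrank_quot_ker_le B) (finrank_quot_ker_le B.flip)

end Pairing

/-! ### Uniqueness of almost split sequences -/

section AlmostSplit

universe v₁ u₁ w

variable {A : Type u₁} [Category.{v₁} A] [Preadditive A] {X Y Z E X' E' Z' : A}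

theorem IsAlmostSplitSequence.left_ne_zero {f : X ⟶ E} {g : E ⟶ Z}
    (h : IsAlmostSplitSequence f g) : f ≠ 0 := fun h0 => by
  have := h.left.minimal 0 (by rw [comp_zero, h0])
  exact h.ne_zero ((IsZero.iff_id_eq_zero _).2 (by rw [← cancel_epi (0 : E ⟶ E)]; simp))

theorem IsAlmostSplitSequence.right_ne_zero {f : X ⟶ E} {g : E ⟶ Z}
    (h : IsAlmostSplitSequence f g) : g ≠ 0 := fun h0 => by
  have := h.right.minimal 0 (by rw [zero_comp, h0])
  exact h.ne_zero ((IsZero.iff_id_eq_zero _).2 (by rw [← cancel_epi (0 : E ⟶ E)]; simp))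

theorem LocalObj.isIso_of_comp_right (hX : LocalObj X) {φ : X ⟶ X} {f : X ⟶ E} (hf : f ≠ 0)
    (h : φ ≫ f = f) : IsIso φ := by
  rcases hX.2 φ with h1 | h1
  · exact h1
  · refine (hf ?_).elim
    rw [← cancel_epi (𝟙 X - φ), Preadditive.sub_comp, h, Category.id_comp, sub_self, comp_zero]

theorem LocalObj.isIso_of_comp_left (hX : LocalObj X) {φ : X ⟶ X} {f : E ⟶ X} (hf : f ≠ 0)
    (h : f ≫ φ = f) : IsIso φ := by
  rcases hX.2 φ with h1 | h1
  · exact h1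
  · refine (hf ?_).elim
    rw [← cancel_mono (𝟙 X - φ), Preadditive.comp_sub, h, Category.comp_id, sub_self, zero_comp]

/-- Almost split sequences are determined by their last term. -/
theorem IsAlmostSplitSequence.exists_isIso_comp_first {f : X ⟶ E} {g : E ⟶ Z} {f' : X' ⟶ E'}
    {g' : E' ⟶ Z} (h : IsAlmostSplitSequence f g) (h' : IsAlmostSplitSequence f' g')
    (hX : LocalObj X) : ∃ (c : X ⟶ X') (d : X' ⟶ X), IsIso (c ≫ d) := by
  obtain ⟨a, ha⟩ := h'.right.factors E g h.right.not_retraction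
  obtain ⟨b, hb⟩ := h.right.factors E' g' h'.right.not_retraction
  have he := h.right.minimal (a ≫ b) (by rw [Category.assoc, hb, ha])
  have hi : inv (a ≫ b) ≫ g = g := by rw [IsIso.inv_comp_eq, Category.assoc, hb, ha]
  obtain ⟨c, hc⟩ := h'.pseudoKernel X (f ≫ a) (by rw [Category.assoc, ha, h.comp_eq_zero])
  obtain ⟨d, hd⟩ := h.pseudoKernel X' (f' ≫ b) (by rw [Category.assoc, hb, h'.comp_eq_zero])
  obtain ⟨t, ht⟩ := h.pseudoKernel X (f ≫ inv (a ≫ b))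
    (by rw [Category.assoc, hi, h.comp_eq_zero])
  -- Pseudo-kernels provide lifts without uniqueness, so `c ≫ d` is only compared with the identity
  -- after composition with `t` and `f`; locality of `X` and `f ≠ 0` then turn the equation into
  -- invertibility.
  have key : (t ≫ c ≫ d) ≫ f = f := by
    rw [Category.assoc, Category.assoc, hd, ← Category.assoc c, hc, Category.assoc,
      ← Category.assoc, ht, Category.assoc, IsIso.inv_hom_id, Category.comp_id]
  exact ⟨c, d, hX.right_of_comp (hX.isIso_of_comp_right h.left_ne_zero key)⟩

/-- Almost split sequences are determined by their first term. -/
theorem IsAlmostSplitSequence.exists_isIso_comp_last {f : X ⟶ E} {g : E ⟶ Z} {f' : X ⟶ E'}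
    {g' : E' ⟶ Z'} (h : IsAlmostSplitSequence f g) (h' : IsAlmostSplitSequence f' g')
    (hZ : LocalObj Z) : ∃ (c : Z ⟶ Z') (d : Z' ⟶ Z), IsIso (c ≫ d) := by
  obtain ⟨a, ha⟩ := h.left.factors E' f' h'.left.not_section
  obtain ⟨b, hb⟩ := h'.left.factors E f h.left.not_section
  have he := h.left.minimal (a ≫ b) (by rw [← Category.assoc, ha, hb])
  have hi : f ≫ inv (a ≫ b) = f := by rw [IsIso.comp_inv_eq, ← Category.assoc, ha, hb]
  obtain ⟨c, hc⟩ := h.pseudoCokernel Z' (a ≫ g') (by rw [← Category.assoc, ha, h'.comp_eq_zero])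
  obtain ⟨d, hd⟩ := h'.pseudoCokernel Z (b ≫ g) (by rw [← Category.assoc, hb, h.comp_eq_zero])
  obtain ⟨t, ht⟩ := h.pseudoCokernel Z (inv (a ≫ b) ≫ g)
    (by rw [← Category.assoc, hi, h.comp_eq_zero])
  have key : g ≫ (c ≫ d) ≫ t = g := by
    rw [← Category.assoc, ← Category.assoc, hc, Category.assoc a, hd, ← Category.assoc a,
      Category.assoc, ht, IsIso.hom_inv_id_assoc]
  exact ⟨c, d, hZ.left_of_comp (hZ.isIso_of_comp_left h.right_ne_zero key)⟩

/-! ### Dimensions of spaces of irreducible morphisms -/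

section Linear

variable {k : Type w} [Field k] [Linear k A]

/-- Composition with `f` maps Hom(E, Y) onto rad(X, Y), and rad(E, Y) is the preimage of rad²(X, Y).
-/
theorem irrDimK_of_left {f : X ⟶ E} (hX : LocalObj X) (hf : IsMinimalLeftAlmostSplit f) :
    irrDimK k X Y = Module.finrank k ((E ⟶ Y) ⧸ radK k E Y) := by
  let L : (E ⟶ Y) →ₗ[k] radK k X Y ⧸ radSqK k X Y :=
    (radSqK k X Y).mkQ ∘ₗ (Linear.leftComp k Y f).codRestrict (radK k X Y)
      fun h => radical_comp_mem (hX.mem_radical hf.not_section) h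
  have hL : Function.Surjective L := by
    intro r
    obtain ⟨r, rfl⟩ := (radSqK k X Y).mkQ_surjective r
    obtain ⟨h, hh⟩ := hf.factors Y r.1 (not_isSplitMono_of_mem_radical hX.1 r.2)
    exact ⟨h, congrArg (radSqK k X Y).mkQ (Subtype.ext hh)⟩
  have hk : LinearMap.ker L = radK k E Y := by
    ext h
    exact (Submodule.Quotient.mk_eq_zero _).trans (mem_radicalSq_iff_of_left hX hf h)
  rw [← hk]
  exact (LinearEquiv.finrank_eq (L.quotKerEquivOfSurjective hL)).symm

theorem irrDimK_of_right {g : E ⟶ Z} (hZ : LocalObj Z) (hg : IsMinimalRightAlmostSplit g) :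
    irrDimK k X Z = Module.finrank k ((X ⟶ E) ⧸ radK k X E) := by
  let L : (X ⟶ E) →ₗ[k] radK k X Z ⧸ radSqK k X Z :=
    (radSqK k X Z).mkQ ∘ₗ (Linear.rightComp k X g).codRestrict (radK k X Z)
      fun h => comp_mem_radical h (hZ.mem_radical' hg.not_retraction)
  have hL : Function.Surjective L := by
    intro r
    obtain ⟨r, rfl⟩ := (radSqK k X Z).mkQ_surjective r
    obtain ⟨h, hh⟩ := hg.factors X r.1 (not_isSplitEpi_of_mem_radical hZ.1 r.2)
    exact ⟨h, congrArg (radSqK k X Z).mkQ (Subtype.ext hh)⟩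
  have hk : LinearMap.ker L = radK k X E := by
    ext h
    exact (Submodule.Quotient.mk_eq_zero _).trans (mem_radicalSq_iff_of_right hZ hg h)
  rw [← hk]
  exact (LinearEquiv.finrank_eq (L.quotKerEquivOfSurjective hL)).symm

theorem irrDimK_ne_zero_iff [Module.Finite k (X ⟶ Y)] : irrDimK k X Y ≠ 0 ↔ HasIrr X Y := by
  rw [irrDimK, ne_eq, Module.finrank_zero_iff, Submodule.Quotient.subsingleton_iff]
  constructor
  · intro h
    by_contra hn
    exact h (Submodule.eq_top_iff'.2 fun r => by_contra fun hr => hn ⟨r.1, r.2, hr⟩)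
  · rintro ⟨r, hr, hr'⟩ h
    exact hr' (h ▸ Submodule.mem_top : (⟨r, hr⟩ : radK k X Y) ∈ radSqK k X Y)

/-- The two spaces are paired by the scalar of `g ≫ h`; the kernels of this pairing on either side
are the two radicals. -/
theorem finrank_hom_quot_radK (hY : Brick k Y) [Module.Finite k (E ⟶ Y)] [Module.Finite k (Y ⟶ E)] :
    Module.finrank k ((E ⟶ Y) ⧸ radK k E Y) = Module.finrank k ((Y ⟶ E) ⧸ radK k Y E) := by
  let B : (E ⟶ Y) →ₗ[k] (Y ⟶ E) →ₗ[k] k :=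
    LinearMap.mk₂ k (fun h g => hY.scalar (g ≫ h))
      (fun _ _ _ => by rw [Preadditive.comp_add, map_add])
      (fun _ _ _ => by rw [Linear.comp_smul, map_smul])
      (fun _ _ _ => by rw [Preadditive.add_comp, map_add])
      (fun _ _ _ => by rw [Linear.smul_comp, map_smul])
  have h1 : LinearMap.ker B = radK k E Y := by
    ext h
    rw [LinearMap.mem_ker, LinearMap.ext_iff]
    refine Iff.trans ?_ hY.mem_radical_iff.symm
    exact forall_congr' fun g => hY.scalar_eq_zero_iff
  have h2 : LinearMap.ker B.flip = radK k Y E := by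
    ext h
    rw [LinearMap.mem_ker, LinearMap.ext_iff]
    refine Iff.trans ?_ hY.mem_radical_iff'.symm
    exact forall_congr' fun g => hY.scalar_eq_zero_iff
  rw [← h1, ← h2]
  exact finrank_quot_ker_eq B

/-- Both sides measure the presence of `Y` in the middle term `E`. This is the knitting rule. -/
theorem irrDimK_of_almostSplit {f : X ⟶ E} {g : E ⟶ Z} (hX : LocalObj X) (hZ : LocalObj Z)
    (h : IsAlmostSplitSequence f g) (hY : Brick k Y) [Module.Finite k (E ⟶ Y)]
    [Module.Finite k (Y ⟶ E)] : irrDimK k X Y = irrDimK k Y Z := by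
  rw [irrDimK_of_left hX h.left, irrDimK_of_right hZ h.right, finrank_hom_quot_radK hY]

end Linear

end AlmostSplit
end QuiverAR
end

noncomputable section
namespace QuiverAR

/-! ### Idempotents and retracts -/

section Fitting

universe u v w
variable {k : Type w} [Field k] {Q : Type u} [Quiver.{v} Q]
variable {M N L E X Y R : QRep k Q} {x y z : Paths Q}

theorem IsFinDim.finite_hom (hM : IsFinDim M) (hN : PtFin N) : Module.Finite k (M ⟶ N) := by
  have := hM.1.to_subtype
  have := hM.2
  have : ∀ y, Module.Finite k (N.obj y) := hN
  refine Module.Finite.of_injective (LinearMap.pi fun x : {x : Paths Q | Nontrivial (M.obj x)} =>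
    ({ toFun := fun f => ev f x.1
       map_add' := fun _ _ => LinearMap.ext fun _ => by simp
       map_smul' := fun _ _ => LinearMap.ext fun _ => by simp } :
      (M ⟶ N) →ₗ[k] (M.obj x.1 →ₗ[k] N.obj x.1))) fun f g h => ?_
  refine hom_ext_ev fun x m => ?_
  by_cases hx : Nontrivial (M.obj x)
  · exact LinearMap.congr_fun (congrFun h ⟨x, hx⟩) m
  · have := not_nontrivial_iff_subsingleton.1 hx
    rw [Subsingleton.elim m 0, map_zero, map_zero]

theorem IsFinDim.of_mono (hM : IsFinDim M) (f : N ⟶ M) [Mono f] : IsFinDim N := by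
  refine ⟨hM.1.subset fun x hx => ?_, fun x => ?_⟩
  · have : Nontrivial (N.obj x) := hx
    exact (injective_ev f x).nontrivial
  · have := hM.2 x
    exact Module.Finite.of_injective (ev f x) (injective_ev f x)

theorem IsFinDim.of_epi (hM : IsFinDim M) (f : M ⟶ N) [Epi f] : IsFinDim N := by
  refine ⟨hM.1.subset fun x hx => ?_, fun x => ?_⟩
  · have : Nontrivial (N.obj x) := hx
    exact (surjective_ev f x).nontrivial
  · have := hM.2 x
    exact Module.Finite.of_surjective (ev f x) (surjective_ev f x)

theorem IsFinDim.of_iso (hM : IsFinDim M) (e : M ≅ N) : IsFinDim N := hM.of_epi e.hom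

theorem IsFinDim.of_retract (hM : IsFinDim M) {i : N ⟶ M} {p : M ⟶ N} (h : i ≫ p = 𝟙 N) :
    IsFinDim N :=
  have : IsSplitMono i := ⟨⟨⟨p, h⟩⟩⟩
  hM.of_mono i

/-- Fitting's lemma: the minimal polynomial of `a` is Xᵐ q with q prime to X, and a Bézout relation
between Xᵐ⁺¹ and q yields the idempotent of the part where `a` is invertible. The exponent m + 1
lets a factor `a` be split off from the idempotent even if m = 0. -/
theorem exists_idempotent {B : Type*} [Ring B] [Algebra k B] [Module.Finite k B] (a : B) :
    ∃ (n : ℕ) (e t : B), e * e = e ∧ e = a * t ∧ e = t * a ∧ (1 - e) * a ^ n = 0 := by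
  have hp : minpoly k a ≠ 0 := minpoly.ne_zero (Algebra.IsIntegral.isIntegral a)
  obtain ⟨q, hq, hqd⟩ := Polynomial.exists_eq_pow_rootMultiplicity_mul_and_not_dvd _ hp 0
  set m := Polynomial.rootMultiplicity 0 (minpoly k a)
  rw [map_zero, sub_zero] at hq hqd
  have hco : IsCoprime (Polynomial.X ^ (m + 1)) q :=
    ((Polynomial.irreducible_X.coprime_iff_not_dvd).2 hqd).pow_left
  obtain ⟨u, v, huv⟩ := hco
  have h0 : Polynomial.aeval a (Polynomial.X ^ m * q) = 0 := by rw [← hq, minpoly.aeval]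
  set φ := Polynomial.aeval (R := k) a
  have hX : φ Polynomial.X = a := Polynomial.aeval_X a
  have h1 : 1 - φ (u * Polynomial.X ^ (m + 1)) = φ (v * q) := by
    rw [sub_eq_iff_eq_add, ← map_add, add_comm, huv, map_one]
  have ea : ∀ r, a * φ r = φ (Polynomial.X * r) := fun r => by rw [map_mul, hX]
  have eb : ∀ r, φ r * a = φ (r * Polynomial.X) := fun r => by rw [map_mul, hX]
  refine ⟨m, φ (u * Polynomial.X ^ (m + 1)), φ (u * Polynomial.X ^ m), ?_, ?_, ?_, ?_⟩
  · have : φ (u * Polynomial.X ^ (m + 1)) * (1 - φ (u * Polynomial.X ^ (m + 1))) = 0 := by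
      rw [h1, ← map_mul, show u * Polynomial.X ^ (m + 1) * (v * q) =
        (u * Polynomial.X * v) * (Polynomial.X ^ m * q) by ring, map_mul, h0, mul_zero]
    rw [mul_sub, mul_one, sub_eq_zero] at this
    exact this.symm
  · rw [ea]
    exact congrArg φ (by ring)
  · rw [eb]
    exact congrArg φ (by ring)
  · rw [h1, ← hX, ← map_pow, ← map_mul,
      show v * q * Polynomial.X ^ m = v * (Polynomial.X ^ m * q) by ring, map_mul, h0, mul_zero]

/-- Representations without non-trivial idempotent endomorphisms. -/
def Indec (M : QRep k Q) : Prop := ¬ IsZero M ∧ ∀ e : M ⟶ M, e ≫ e = e → e = 0 ∨ e = 𝟙 M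

theorem isIso_one_sub_of_isNilpotent {a : End E} (h : IsNilpotent a) :
    IsIso (𝟙 E - (show E ⟶ E from a)) :=
  (isUnit_iff_isIso (show End E from 𝟙 E - (show E ⟶ E from a))).1 h.isUnit_one_sub

theorem IsFinDim.finite_end (hE : IsFinDim E) : Module.Finite k (End E) := hE.finite_hom hE.ptFin

theorem Indec.isIso_or_isNilpotent (hE : IsFinDim E) (h : Indec E) (a : E ⟶ E) :
    IsIso a ∨ IsNilpotent (show End E from a) := by
  have := hE.finite_end
  obtain ⟨n, e, t, he, h1, h2, h3⟩ := exists_idempotent (k := k) (show End E from a)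
  rcases h.2 e he with h0 | h0
  · right
    refine ⟨n, ?_⟩
    rw [h0] at h3
    have h4 : ((1 : End E) - 0) * (show End E from a) ^ n = 0 := h3
    rwa [sub_zero, one_mul] at h4
  · left
    rw [h0] at h1 h2
    refine (isUnit_iff_isIso (show End E from a)).1 ⟨⟨a, t, h1.symm, h2.symm⟩, rfl⟩

theorem Indec.local (hE : IsFinDim E) (h : Indec E) : LocalObj E := by
  refine ⟨h.1, fun φ => ?_⟩
  rcases h.isIso_or_isNilpotent hE φ with h1 | h1
  · exact Or.inl h1
  · exact Or.inr (isIso_one_sub_of_isNilpotent h1)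

theorem LocalObj.indec (h : LocalObj E) : Indec E := by
  refine ⟨h.1, fun e he => ?_⟩
  rcases h.2 e with h1 | h1
  · right
    rw [← cancel_epi e, he, Category.comp_id]
  · left
    rw [← cancel_epi (𝟙 E - e), Preadditive.sub_comp, he, Category.id_comp, sub_self, comp_zero]

theorem Indec.isIso_of_retract (hM : Indec M) {i : R ⟶ M} {p : M ⟶ R} (h : i ≫ p = 𝟙 R)
    (hR : ¬ IsZero R) : IsIso i ∧ IsIso p := by
  have h1 : p ≫ i = 𝟙 M := by
    refine (hM.2 (p ≫ i) ?_).resolve_left fun h0 => hR ?_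
    · rw [Category.assoc, ← Category.assoc i, h, Category.id_comp]
    · rw [IsZero.iff_id_eq_zero]
      calc 𝟙 R = (i ≫ p) ≫ (i ≫ p) := by rw [h, Category.id_comp]
        _ = i ≫ (p ≫ i) ≫ p := by simp only [Category.assoc]
        _ = 0 := by rw [h0]; simp
  exact ⟨⟨p, h, h1⟩, ⟨i, h1, h⟩⟩

theorem exists_split {e : M ⟶ M} (he : e ≫ e = e) :
    ∃ (R : QRep k Q) (i : R ⟶ M) (p : M ⟶ R), i ≫ p = 𝟙 R ∧ p ≫ i = e :=
  IsIdempotentComplete.idempotents_split M e he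

theorem not_isZero_of_comp_ne_zero {i : R ⟶ M} {f : L ⟶ R} (h : f ≫ i ≠ 0) : ¬ IsZero R := fun hR =>
  h (by rw [hR.eq_zero_of_tgt f, zero_comp])

/-- A morphism outside the radical whose domain is finite dimensional yields a common retract. -/
theorem exists_retract_of_notMem_radical (hE : IsFinDim E) {h : E ⟶ Y} (hh : h ∉ radical E Y) :
    ∃ (R : QRep k Q) (i : R ⟶ E) (p : Y ⟶ R), ¬ IsZero R ∧ IsFinDim R ∧ i ≫ h ≫ p = 𝟙 R := by
  rw [mem_radical_iff] at hh
  push Not at hh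
  obtain ⟨g, hg⟩ := hh
  have := hE.finite_end
  -- The idempotent attached to `h ≫ g` is nonzero: otherwise `h ≫ g` would be nilpotent and 1 − h ≫
  -- g invertible. It factors through both `h` and `g`, so its image is a retract of `E` and of `Y`.
  obtain ⟨n, e, t, he, h1, h2, h3⟩ := exists_idempotent (k := k) (show End E from h ≫ g)
  have he0 : e ≠ 0 := fun h0 => hg (isIso_one_sub_of_isNilpotent (a := h ≫ g) ⟨n, by
    rw [h0] at h3
    have h4 : ((1 : End E) - 0) * (show End E from h ≫ g) ^ n = 0 := h3
    rwa [sub_zero, one_mul] at h4⟩)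
  have he' : (show E ⟶ E from e) ≫ (show E ⟶ E from e) = (show E ⟶ E from e) := he
  have h1' : (show E ⟶ E from e) = (show E ⟶ E from t) ≫ h ≫ g := by
    exact h1
  obtain ⟨R, i, p, hip, hpi⟩ := exists_split he'
  have hR : ¬ IsZero R := by
    refine not_isZero_of_comp_ne_zero (f := p) (i := i) ?_
    rw [hpi]
    exact he0
  refine ⟨R, i ≫ (show E ⟶ E from t), g ≫ p, hR, hE.of_retract hip, ?_⟩
  calc (i ≫ (show E ⟶ E from t)) ≫ h ≫ g ≫ p = i ≫ ((show E ⟶ E from t) ≫ h ≫ g) ≫ p := by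
        simp only [Category.assoc]
    _ = (i ≫ p) ≫ (i ≫ p) := by rw [← h1', ← hpi]; simp only [Category.assoc]
    _ = 𝟙 R := by rw [hip, Category.id_comp]

theorem Indec.isFinDim_of_notMem_radical (hY : Indec Y) (hE : IsFinDim E) {h : E ⟶ Y}
    (hh : h ∉ radical E Y) : IsFinDim Y := by
  obtain ⟨R, i, p, hR, hRf, e⟩ := exists_retract_of_notMem_radical hE hh
  rw [← Category.assoc] at e
  have := (hY.isIso_of_retract e hR).2
  exact hRf.of_iso (asIso p).symm

/-- A non-zero morphism from a finite dimensional representation is non-zero on some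
indecomposable summand. -/
theorem exists_indec_retract (hE : IsFinDim E) {h : E ⟶ Y} (hh : h ≠ 0) :
    ∃ (R : QRep k Q) (i : R ⟶ E) (p : E ⟶ R), i ≫ p = 𝟙 R ∧ Indec R ∧ i ≫ h ≠ 0 := by
  obtain ⟨n, hn⟩ : ∃ n, Module.finrank k (E ⟶ E) = n := ⟨_, rfl⟩
  induction n using Nat.strong_induction_on generalizing E with
  | _ n ih =>
  by_cases hI : Indec E
  · exact ⟨E, 𝟙 E, 𝟙 E, Category.id_comp _, hI, by rwa [Category.id_comp]⟩
  have hz : ¬ IsZero E := fun hz => hh (hz.eq_zero_of_src h)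
  have : ∃ e : E ⟶ E, e ≫ e = e ∧ e ≠ 𝟙 E ∧ e ≫ h ≠ 0 := by
    by_contra hcon
    push Not at hcon
    refine hI ⟨hz, fun e he => ?_⟩
    by_contra hne
    push Not at hne
    have h1 := hcon e he hne.2
    have h2 := hcon (𝟙 E - e) (by simp [Preadditive.sub_comp, Preadditive.comp_sub, he])
      (by simpa using hne.1)
    rw [Preadditive.sub_comp, h1, sub_zero, Category.id_comp] at h2
    exact hh h2
  obtain ⟨e, he, he1, he2⟩ := this
  obtain ⟨R, i, p, hip, hpi⟩ := exists_split he
  have hR := hE.of_retract hip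
  have hRh : i ≫ h ≠ 0 := fun h0 => he2 (by rw [← hpi, Category.assoc, h0, comp_zero])
  -- The endomorphisms of `R` embed in those of `E` by r ↦ p r i; the identity of `E` is missed
  -- because `e` is not the identity.
  have hlt : Module.finrank k (R ⟶ R) < n := by
    have := hE.finite_hom hE.ptFin
    let F : (R ⟶ R) →ₗ[k] (E ⟶ E) := Linear.leftComp k E p ∘ₗ Linear.rightComp k R i
    have hF : ∀ r, F r = p ≫ r ≫ i := fun r => rfl
    have hinj : Function.Injective F := fun r s hrs => by
      have h1 := congrArg (fun t => i ≫ t ≫ p) hrs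
      simp only [hF, Category.assoc, hip, Category.comp_id] at h1
      rwa [← Category.assoc, hip, Category.id_comp, ← Category.assoc, hip, Category.id_comp] at h1
    have hr : LinearMap.range F ≠ ⊤ := fun htop => by
      obtain ⟨r, hr⟩ := (htop ▸ Submodule.mem_top : (𝟙 E : E ⟶ E) ∈ LinearMap.range F)
      rw [hF] at hr
      refine he1 ?_
      have h5 : e ≫ p ≫ r ≫ i = p ≫ r ≫ i := by
        rw [← hpi, Category.assoc, ← Category.assoc i, hip, Category.id_comp]
      rwa [hr, Category.comp_id] at h5
    rw [← hn, ← LinearMap.finrank_range_of_inj hinj]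
    exact Submodule.finrank_lt hr
  obtain ⟨R', i', p', h1, h2, h3⟩ := ih _ hlt hR hRh rfl
  refine ⟨R', i' ≫ i, p ≫ p', ?_, h2, by rwa [Category.assoc]⟩
  rw [Category.assoc, ← Category.assoc i, hip, Category.id_comp, h1]

end Fitting
end QuiverAR
end

noncomputable section
namespace QuiverAR

/-! ### The category `rep⁺(Q)` -/

section RepPlus

universe u v w
variable {k : Type w} [Field k] {Q : Type u} [Quiver.{v} Q]
variable {M N L R : QRep k Q}

theorem RepPlus.isIso_iff {X Y : RepPlus k Q} (f : X ⟶ Y) : IsIso f ↔ IsIso f.hom :=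
  ⟨fun _ => inferInstanceAs (IsIso ((isFinPres k Q).ι.map f)),
    fun h => have : IsIso ((isFinPres k Q).ι.map f) := h
      isIso_of_reflects_iso f (isFinPres k Q).ι⟩

theorem RepPlus.isZero_iff {X : RepPlus k Q} : IsZero X ↔ IsZero X.obj := by
  rw [IsZero.iff_id_eq_zero, IsZero.iff_id_eq_zero]
  exact ⟨fun h => congrArg InducedCategory.Hom.hom h, fun h => ObjectProperty.hom_ext _ h⟩

theorem RepPlus.isSplitMono_iff {X Y : RepPlus k Q} (f : X ⟶ Y) :
    IsSplitMono f ↔ IsSplitMono f.hom :=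
  ⟨fun ⟨⟨s⟩⟩ => ⟨⟨⟨s.retraction.hom, congrArg InducedCategory.Hom.hom s.id⟩⟩⟩,
    fun ⟨⟨s⟩⟩ => ⟨⟨⟨ObjectProperty.homMk s.retraction, ObjectProperty.hom_ext _ s.id⟩⟩⟩⟩

theorem RepPlus.isSplitEpi_iff {X Y : RepPlus k Q} (f : X ⟶ Y) :
    IsSplitEpi f ↔ IsSplitEpi f.hom :=
  ⟨fun ⟨⟨s⟩⟩ => ⟨⟨⟨s.section_.hom, congrArg InducedCategory.Hom.hom s.id⟩⟩⟩,
    fun ⟨⟨s⟩⟩ => ⟨⟨⟨ObjectProperty.homMk s.section_, ObjectProperty.hom_ext _ s.id⟩⟩⟩⟩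

theorem RepPlus.mem_radical_iff {X Y : RepPlus k Q} (f : X ⟶ Y) :
    f ∈ radical X Y ↔ f.hom ∈ radical X.obj Y.obj :=
  ⟨fun h g => (RepPlus.isIso_iff _).1 (h (ObjectProperty.homMk g)),
    fun h g => (RepPlus.isIso_iff _).2 (h g.hom)⟩

theorem RepPlus.localObj_iff {X : RepPlus k Q} : LocalObj X ↔ LocalObj X.obj := by
  refine and_congr (not_congr RepPlus.isZero_iff) ⟨fun h φ => ?_, fun h φ => ?_⟩
  · exact (h (ObjectProperty.homMk φ)).imp (RepPlus.isIso_iff _).1 (RepPlus.isIso_iff _).1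
  · exact (h φ.hom).imp (RepPlus.isIso_iff _).2 (RepPlus.isIso_iff _).2

theorem RepPlus.brick_iff {X : RepPlus k Q} : Brick k X ↔ Brick k X.obj := by
  refine and_congr (not_congr RepPlus.isZero_iff) ⟨fun h φ => ?_, fun h φ => ?_⟩
  · obtain ⟨c, hc⟩ := h (ObjectProperty.homMk φ)
    exact ⟨c, congrArg InducedCategory.Hom.hom hc⟩
  · obtain ⟨c, hc⟩ := h φ.hom
    exact ⟨c, ObjectProperty.hom_ext _ hc⟩

theorem RepPlus.finite_hom {X Y : RepPlus k Q} (h : Module.Finite k (X.obj ⟶ Y.obj)) :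
    Module.Finite k (X ⟶ Y) :=
  Module.Finite.of_injective
    ({ toFun := fun f => f.hom
       map_add' := fun _ _ => rfl
       map_smul' := fun _ _ => rfl } : (X ⟶ Y) →ₗ[k] (X.obj ⟶ Y.obj))
    fun _ _ h => ObjectProperty.hom_ext _ h

/-- Decompositions of `X` correspond to idempotents. The images of an idempotent and of its
complement, formed among all representations, stay in rep⁺(Q) because it is closed under retracts.
-/
theorem RepPlus.indec_iff (hQ : StronglyLocallyFinite Q) {X : RepPlus k Q} :
    IsIndecomposable X ↔ Indec X.obj := by
  refine and_congr (not_congr RepPlus.isZero_iff) ⟨fun h e he => ?_, fun h Y Z b _ ⟨i⟩ => ?_⟩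
  · obtain ⟨R, i, p, hip, hpi⟩ := exists_split he
    obtain ⟨R', i', p', hip', hpi'⟩ := exists_split (e := 𝟙 X.obj - e)
      (by simp [Preadditive.sub_comp, Preadditive.comp_sub, he])
    have h1 : i ≫ p' = 0 := by
      have : (p ≫ i) ≫ (p' ≫ i') = 0 := by
        rw [hpi, hpi', Preadditive.comp_sub, he, Category.comp_id, sub_self]
      calc i ≫ p' = (i ≫ p) ≫ i ≫ p' ≫ (i' ≫ p') := by rw [hip, hip']; simp
        _ = i ≫ ((p ≫ i) ≫ (p' ≫ i')) ≫ p' := by simp only [Category.assoc]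
        _ = 0 := by rw [this]; simp
    have h2 : i' ≫ p = 0 := by
      have : (p' ≫ i') ≫ (p ≫ i) = 0 := by
        rw [hpi, hpi', Preadditive.sub_comp, he, Category.id_comp, sub_self]
      calc i' ≫ p = (i' ≫ p') ≫ i' ≫ p ≫ (i ≫ p) := by rw [hip, hip']; simp
        _ = i' ≫ ((p' ≫ i') ≫ (p ≫ i)) ≫ p := by simp only [Category.assoc]
        _ = 0 := by rw [this]; simp
    let b : BinaryBicone (C := RepPlus k Q) ⟨R, isFinPres_of_retract hQ X.property i p hip⟩
        ⟨R', isFinPres_of_retract hQ X.property i' p' hip'⟩ :=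
      { pt := X
        fst := ObjectProperty.homMk p
        snd := ObjectProperty.homMk p'
        inl := ObjectProperty.homMk i
        inr := ObjectProperty.homMk i'
        inl_fst := ObjectProperty.hom_ext _ hip
        inl_snd := ObjectProperty.hom_ext _ h1
        inr_fst := ObjectProperty.hom_ext _ h2
        inr_snd := ObjectProperty.hom_ext _ hip' }
    have hb : b.IsBilimit := isBinaryBilimitOfTotal b (ObjectProperty.hom_ext _
      (show p ≫ i + p' ≫ i' = 𝟙 X.obj by rw [hpi, hpi', add_sub_cancel]))
    rcases h _ _ b ⟨hb⟩ ⟨Iso.refl _⟩ with h3 | h3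
    · left
      rw [← hpi, (RepPlus.isZero_iff.1 h3).eq_zero_of_tgt p, zero_comp]
    · right
      rw [(RepPlus.isZero_iff.1 h3).eq_zero_of_tgt p', zero_comp] at hpi'
      exact (sub_eq_zero.1 hpi'.symm).symm
  · have key := h (i.inv.hom ≫ b.fst.hom ≫ b.inl.hom ≫ i.hom.hom) (by
      have h1 : i.hom.hom ≫ i.inv.hom = 𝟙 _ := congrArg InducedCategory.Hom.hom i.hom_inv_id
      have h2 : b.inl.hom ≫ b.fst.hom = 𝟙 _ := congrArg InducedCategory.Hom.hom b.inl_fst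
      simp only [Category.assoc]
      rw [reassoc_of% h1, reassoc_of% h2])
    rw [RepPlus.isZero_iff, RepPlus.isZero_iff, IsZero.iff_id_eq_zero, IsZero.iff_id_eq_zero]
    have h1 : i.hom.hom ≫ i.inv.hom = 𝟙 _ := congrArg InducedCategory.Hom.hom i.hom_inv_id
    have h1' : i.inv.hom ≫ i.hom.hom = 𝟙 _ := congrArg InducedCategory.Hom.hom i.inv_hom_id
    have h2 : b.inl.hom ≫ b.fst.hom = 𝟙 _ := congrArg InducedCategory.Hom.hom b.inl_fst
    have h3 : b.inr.hom ≫ b.snd.hom = 𝟙 _ := congrArg InducedCategory.Hom.hom b.inr_snd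
    have h4 : b.inr.hom ≫ b.fst.hom = 0 := congrArg InducedCategory.Hom.hom b.inr_fst
    refine key.imp (fun h0 => ?_) (fun h0 => ?_)
    · calc 𝟙 _ = b.inl.hom ≫ i.hom.hom ≫
            (i.inv.hom ≫ b.fst.hom ≫ b.inl.hom ≫ i.hom.hom) ≫ i.inv.hom ≫ b.fst.hom := by
            simp only [Category.assoc]
            rw [reassoc_of% h1, reassoc_of% h1, reassoc_of% h2, h2]
        _ = 0 := by rw [h0]; simp
    · calc 𝟙 _ = b.inr.hom ≫ i.hom.hom ≫ (𝟙 _) ≫ i.inv.hom ≫ b.snd.hom := by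
            rw [Category.id_comp, reassoc_of% h1, h3]
        _ = 0 := by
            rw [← h0]
            simp only [Category.assoc]
            rw [reassoc_of% h1, reassoc_of% h4]
            simp

/-- Every indecomposable finitely presented representation is a vertex. -/
theorem exists_vertex (hQ : StronglyLocallyFinite Q) (hM : isFinPres k Q M) (h : Indec M) :
    ∃ X : ARRepPlus k Q, Nonempty (X.obj.obj ≅ M) := by
  let X₀ : RepPlus k Q := ⟨M, hM⟩
  let e : (fromSkeleton (RepPlus k Q)).obj ((toSkeleton X₀)) ≅ X₀ := fromSkeletonToSkeletonIso X₀
  have e' : ((fromSkeleton (RepPlus k Q)).obj ((toSkeleton X₀))).obj ≅ M :=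
    (isFinPres k Q).ι.mapIso e
  refine ⟨⟨toSkeleton X₀, (RepPlus.indec_iff hQ).2 ⟨fun h0 => h.1 (h0.of_iso e'.symm), fun a ha => ?_⟩⟩,
    ⟨e'⟩⟩
  have := h.2 (e'.inv ≫ a ≫ e'.hom) (by simp [reassoc_of% ha])
  refine this.imp (fun h0 => ?_) (fun h0 => ?_)
  · have h1 := congrArg (fun t => e'.hom ≫ t ≫ e'.inv) h0
    simpa using h1
  · have h1 := congrArg (fun t => e'.hom ≫ t ≫ e'.inv) h0
    simpa using h1

theorem vertex_eq {X Y : ARRepPlus k Q} (e : X.obj.obj ≅ Y.obj.obj) : X = Y := by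
  have e' : X.obj ≅ Y.obj := (isFinPres k Q).ι.preimageIso e
  have e'' : X.1 ≅ Y.1 := (fromSkeleton (RepPlus k Q)).preimageIso e'
  exact Subtype.ext (skeleton_skeletal (RepPlus k Q) ⟨e''⟩)

theorem vertex_indec (hQ : StronglyLocallyFinite Q) (X : ARRepPlus k Q) : Indec X.obj.obj :=
  (RepPlus.indec_iff hQ).1 X.2

end RepPlus

/-! ### Short exact sequences -/

section Sequences

universe u v w
variable {k : Type w} [Field k] {Q : Type u} [Quiver.{v} Q]
variable {M N L E Z T : QRep k Q}

theorem exists_lift_of_shortExact {i : N ⟶ E} {p : E ⟶ Z} {w : i ≫ p = 0}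
    (hS : (ShortComplex.mk i p w).ShortExact) (t : T ⟶ E) (ht : t ≫ p = 0) :
    ∃ s : T ⟶ N, s ≫ i = t :=
  have : Mono (ShortComplex.mk i p w).f := hS.mono_f
  ⟨hS.exact.lift t ht, hS.exact.lift_f t ht⟩

theorem exists_desc_of_shortExact {i : N ⟶ E} {p : E ⟶ Z} {w : i ≫ p = 0}
    (hS : (ShortComplex.mk i p w).ShortExact) (t : E ⟶ T) (ht : i ≫ t = 0) :
    ∃ s : Z ⟶ T, p ≫ s = t :=
  have : Epi (ShortComplex.mk i p w).g := hS.epi_g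
  ⟨hS.exact.desc t ht, hS.exact.g_desc t ht⟩

/-- The short exact sequence of a pushout. -/
theorem exists_pushout_shortExact {i : N ⟶ E} {p : E ⟶ Z} {w : i ≫ p = 0}
    (hS : (ShortComplex.mk i p w).ShortExact) (h : N ⟶ T) :
    ∃ (P : QRep k Q) (a : E ⟶ P) (j : T ⟶ P) (q : P ⟶ Z) (w' : j ≫ q = 0),
      (ShortComplex.mk j q w').ShortExact ∧ i ≫ a = h ≫ j ∧ a ≫ q = p := by
  have : Mono i := hS.mono_f
  have : Epi p := hS.epi_g
  have hw : i ≫ p = h ≫ 0 := by rw [w, comp_zero]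
  have hq : pushout.inl i h ≫ pushout.desc p 0 hw = p := pushout.inl_desc _ _ _
  have hj : pushout.inr i h ≫ pushout.desc p 0 hw = 0 := pushout.inr_desc _ _ _
  refine ⟨pushout i h, pushout.inl i h, pushout.inr i h, pushout.desc p 0 hw, hj, ?_,
    pushout.condition, hq⟩
  have : Epi (pushout.desc p (0 : T ⟶ Z) hw) := by
    have : Epi (pushout.inl i h ≫ pushout.desc p 0 hw) := by rw [hq]; infer_instance
    exact epi_of_epi (pushout.inl i h) _
  refine { exact := ?_, mono_f := ?_, epi_g := this }
  · refine ShortComplex.exact_of_g_is_cokernel _ (CokernelCofork.IsColimit.ofπ' _ _ fun {A} t ht => ?_)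
    have h1 : i ≫ pushout.inl i h ≫ t = 0 := by
      rw [← Category.assoc, pushout.condition, Category.assoc, ht, comp_zero]
    refine ⟨(exists_desc_of_shortExact hS _ h1).choose, ?_⟩
    refine pushout.hom_ext ?_ ?_
    · rw [← Category.assoc, hq, (exists_desc_of_shortExact hS _ h1).choose_spec]
    · rw [← Category.assoc, hj, zero_comp, ht]
  · change Mono (pushout.inr i h)
    infer_instance

/-- The short exact sequence of a pullback. -/
theorem exists_pullback_shortExact {J₁ J₀ : QRep k Q} (ν : J₁ ⟶ J₀) [Epi ν] (u : Z ⟶ J₀) :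
    ∃ (l : kernel ν ⟶ pullback u ν) (w : l ≫ pullback.fst u ν = 0),
      (ShortComplex.mk l (pullback.fst u ν) w).ShortExact := by
  obtain ⟨l, h1, h2⟩ : ∃ l : kernel ν ⟶ pullback u ν, l ≫ pullback.fst u ν = 0 ∧
      l ≫ pullback.snd u ν = kernel.ι ν :=
    ⟨pullback.lift 0 (kernel.ι ν) (by rw [zero_comp, kernel.condition]), pullback.lift_fst _ _ _,
      pullback.lift_snd _ _ _⟩
  have hm : Mono l := by
    have : Mono (l ≫ pullback.snd u ν) := by
      rw [h2]
      infer_instance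
    exact mono_of_mono _ (pullback.snd u ν)
  have hm' : Mono (ShortComplex.mk l (pullback.fst u ν) h1).f := hm
  have he : Epi (pullback.fst u ν) := inferInstance
  refine ⟨l, h1, { exact := ?_, mono_f := hm, epi_g := he }⟩
  refine ShortComplex.exact_of_f_is_kernel _ (KernelFork.IsLimit.ofι' _ _ fun {A} t ht => ?_)
  refine ⟨kernel.lift ν (t ≫ pullback.snd u ν) ?_, ?_⟩
  · rw [Category.assoc, ← pullback.condition, ← Category.assoc, ht, zero_comp]
  · refine pullback.hom_ext ?_ ?_
    · rw [Category.assoc, h1, comp_zero, ht]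
    · rw [Category.assoc, h2, kernel.lift_ι]

theorem exists_retraction_of_section {i : N ⟶ E} {p : E ⟶ Z} {w : i ≫ p = 0}
    (hS : (ShortComplex.mk i p w).ShortExact) (s : Z ⟶ E) (hs : s ≫ p = 𝟙 Z) :
    ∃ r : E ⟶ N, i ≫ r = 𝟙 N := by
  have : Mono i := hS.mono_f
  obtain ⟨r, hr⟩ := exists_lift_of_shortExact hS (𝟙 E - p ≫ s) (by
    rw [Preadditive.sub_comp, Category.assoc, hs, Category.comp_id, Category.id_comp, sub_self])
  refine ⟨r, ?_⟩
  rw [← cancel_mono i, Category.assoc, hr, Preadditive.comp_sub, ← Category.assoc, w, zero_comp,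
    sub_zero, Category.comp_id, Category.id_comp]

theorem exists_section_of_retraction {i : N ⟶ E} {p : E ⟶ Z} {w : i ≫ p = 0}
    (hS : (ShortComplex.mk i p w).ShortExact) (r : E ⟶ N) (hr : i ≫ r = 𝟙 N) :
    ∃ s : Z ⟶ E, s ≫ p = 𝟙 Z := by
  have : Epi p := hS.epi_g
  obtain ⟨s, hs⟩ := exists_desc_of_shortExact hS (𝟙 E - r ≫ i) (by
    rw [Preadditive.comp_sub, ← Category.assoc, hr, Category.comp_id, Category.id_comp, sub_self])
  refine ⟨s, ?_⟩
  rw [← cancel_epi p, ← Category.assoc, hs, Preadditive.sub_comp, Category.assoc, w, comp_zero,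
    sub_zero, Category.comp_id, Category.id_comp]

/-- Left almost split maps from right almost split ones. -/
theorem exists_extension_of_not_isSplitMono {i : N ⟶ E} {p : E ⟶ Z} {w : i ≫ p = 0}
    (hS : (ShortComplex.mk i p w).ShortExact) (hN : IsFinDim N) (hNI : Indec N)
    (hZ : isFinPres k Q Z) (hp : ¬ IsSplitEpi p)
    (hright : ∀ (M : QRep k Q) (t : M ⟶ Z), isFinPres k Q M → ¬ IsSplitEpi t → ∃ s, s ≫ p = t)
    (hT : isFinPres k Q T) (h : N ⟶ T) (hh : ¬ IsSplitMono h) : ∃ s, i ≫ s = h := by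
  have : Mono i := hS.mono_f
  have : Epi p := hS.epi_g
  obtain ⟨P, a, j, q, w', hP, hij, haq⟩ := exists_pushout_shortExact hS h
  by_cases hq : IsSplitEpi q
  · obtain ⟨⟨s⟩⟩ := hq
    obtain ⟨r, hr⟩ := exists_retraction_of_section hP s.section_ s.id
    exact ⟨a ≫ r, by rw [← Category.assoc, hij, Category.assoc, hr, Category.comp_id]⟩
  -- As `q` does not split, it lifts to `E`. Then `a ≫ c` is an endomorphism of `E` over the
  -- identity of `Z`, and it restricts to `h ≫ t` on `N`.
  obtain ⟨c, hc⟩ := hright P q (isFinPres_of_extension hT hZ hP) hq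
  obtain ⟨t, ht⟩ := exists_lift_of_shortExact hS (j ≫ c) (by rw [Category.assoc, hc, w'])
  have hβ : (h ≫ t) ≫ i = i ≫ a ≫ c := by
    rw [Category.assoc, ht, ← Category.assoc, ← hij, Category.assoc]
  have he : (a ≫ c) ≫ p = p := by rw [Category.assoc, hc, haq]
  rcases hNI.isIso_or_isNilpotent hN (h ≫ t) with h1 | ⟨n, hn⟩
  · refine (hh ⟨⟨t ≫ inv (h ≫ t), ?_⟩⟩).elim
    rw [← Category.assoc, IsIso.hom_inv_id]
  -- If `h ≫ t` is nilpotent, a power of `a ≫ c` kills `N` and still lies over the identity of `Z`,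
  -- which would split `p`.
  · have key : ∀ n : ℕ, ∃ e : E ⟶ E, e ≫ p = p ∧
        i ≫ e = (show N ⟶ N from (show End N from h ≫ t) ^ n) ≫ i := by
      intro n
      induction n with
      | zero => exact ⟨𝟙 E, Category.id_comp _, by
          rw [pow_zero]; exact (Category.comp_id i).trans (Category.id_comp i).symm⟩
      | succ n ih =>
        obtain ⟨e, h1, h2⟩ := ih
        refine ⟨(a ≫ c) ≫ e, by rw [Category.assoc, h1, he], ?_⟩
        rw [pow_succ, End.mul_def]
        calc i ≫ (a ≫ c) ≫ e = (i ≫ a ≫ c) ≫ e := by simp only [Category.assoc]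
          _ = (h ≫ t) ≫ i ≫ e := by rw [← hβ]; simp only [Category.assoc]
          _ = _ := by rw [h2, Category.assoc (h ≫ t)]
    obtain ⟨e, h1, h2⟩ := key n
    have h3 : i ≫ e = 0 := by
      rw [h2, hn]
      exact zero_comp
    obtain ⟨s, hs⟩ := exists_desc_of_shortExact hS e h3
    refine (hp ⟨⟨s, ?_⟩⟩).elim
    rw [← cancel_epi p, ← Category.assoc, hs, h1, Category.comp_id]

theorem isIso_of_shortExact {i : N ⟶ E} {p : E ⟶ Z} {w : i ≫ p = 0}
    (hS : (ShortComplex.mk i p w).ShortExact) {a : N ⟶ N} {b : E ⟶ E} {c : Z ⟶ Z} (ha : IsIso a)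
    (hc : IsIso c) (h1 : a ≫ i = i ≫ b) (h2 : b ≫ p = p ≫ c) : IsIso b :=
  ShortComplex.isIso₂_of_shortExact_of_isIso₁₃'
    (show ShortComplex.mk i p w ⟶ ShortComplex.mk i p w from ⟨a, b, c, h1, h2⟩) hS hS ha hc

/-- A non-split short exact sequence with local end terms is almost split if its second morphism is
right almost split. -/
theorem isAlmostSplitSequence_of_shortExact {X E Z : RepPlus k Q} {i : X ⟶ E} {p : E ⟶ Z}
    {w : i.hom ≫ p.hom = 0} (hS : (ShortComplex.mk i.hom p.hom w).ShortExact)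
    (hX : IsFinDim X.obj) (hXI : Indec X.obj) (hZ : LocalObj Z.obj) (hp : ¬ IsSplitEpi p.hom)
    (hright : ∀ (M : QRep k Q) (t : M ⟶ Z.obj), isFinPres k Q M → ¬ IsSplitEpi t →
      ∃ s, s ≫ p.hom = t) : IsAlmostSplitSequence i p := by
  have : Mono i.hom := hS.mono_f
  have : Epi p.hom := hS.epi_g
  have hi : ¬ IsSplitMono i.hom := fun ⟨⟨r⟩⟩ => hp (by
    obtain ⟨s, hs⟩ := exists_section_of_retraction hS r.retraction r.id
    exact ⟨⟨s, hs⟩⟩)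
  have hleft := fun (T : QRep k Q) (hT : isFinPres k Q T) (h : X.obj ⟶ T) (hh : ¬ IsSplitMono h) =>
    exists_extension_of_not_isSplitMono hS hX hXI Z.property hp hright hT h hh
  have hXl := hXI.local hX
  refine
    { ne_zero := fun h0 => ?_
      left := ⟨fun h hh => ?_, fun h => hi ((RepPlus.isSplitMono_iff _).1 h), fun T h hh => ?_⟩
      right := ⟨fun h hh => ?_, fun h => hp ((RepPlus.isSplitEpi_iff _).1 h), fun M t ht => ?_⟩
      comp_eq_zero := ObjectProperty.hom_ext _ w
      pseudoKernel := fun T h hh => ?_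
      pseudoCokernel := fun T h hh => ?_ }
  · have h1 : p.hom = 0 := (RepPlus.isZero_iff.1 h0).eq_zero_of_src _
    refine hZ.1 ((IsZero.iff_id_eq_zero _).2 ?_)
    rw [← cancel_epi p.hom, h1, zero_comp, zero_comp]
  · have hh' : i.hom ≫ h.hom = i.hom := congrArg InducedCategory.Hom.hom hh
    -- Left minimality is checked on the induced endomorphism `c` of `Z`: if it is a split
    -- epimorphism it is invertible and so is `h`; otherwise it lifts through `p`, and the
    -- difference of `h` and the lift gives a retraction of `i`.
    obtain ⟨c, hc⟩ := exists_desc_of_shortExact hS (h.hom ≫ p.hom)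
      (by rw [← Category.assoc, hh', w])
    rw [RepPlus.isIso_iff]
    by_cases hs : IsSplitEpi c
    · obtain ⟨⟨s⟩⟩ := hs
      have hc' : IsIso c := hZ.isIso_of_comp_eq_id' s.id
      exact isIso_of_shortExact hS (a := 𝟙 _) inferInstance hc' (by rw [hh', Category.id_comp])
        hc.symm
    · obtain ⟨s, hs⟩ := hright _ c Z.property hs
      obtain ⟨r, hr⟩ := exists_lift_of_shortExact hS (h.hom - p.hom ≫ s) (by
        rw [Preadditive.sub_comp, Category.assoc, hs, hc, sub_self])
      refine (hi ⟨⟨r, ?_⟩⟩).elim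
      rw [← cancel_mono i.hom, Category.assoc, hr, Preadditive.comp_sub, hh', ← Category.assoc, w,
        zero_comp, sub_zero, Category.id_comp]
  · obtain ⟨s, hs⟩ := hleft T.obj T.property h.hom fun h' => hh ((RepPlus.isSplitMono_iff _).2 h')
    exact ⟨ObjectProperty.homMk s, ObjectProperty.hom_ext _ hs⟩
  · have hh' : h.hom ≫ p.hom = p.hom := congrArg InducedCategory.Hom.hom hh
    obtain ⟨d, hd⟩ := exists_lift_of_shortExact hS (i.hom ≫ h.hom)
      (by rw [Category.assoc, hh', w])
    rw [RepPlus.isIso_iff]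
    by_cases hs : IsSplitMono d
    · obtain ⟨⟨s⟩⟩ := hs
      have hd' : IsIso d := hXl.isIso_of_comp_eq_id s.id
      exact isIso_of_shortExact hS (c := 𝟙 _) hd' inferInstance hd (by rw [hh', Category.comp_id])
    · obtain ⟨s, hs⟩ := hleft _ X.property d hs
      obtain ⟨r, hr⟩ := exists_desc_of_shortExact hS (h.hom - s ≫ i.hom) (by
        rw [Preadditive.comp_sub, ← Category.assoc, hs, hd, sub_self])
      refine (hp ⟨⟨r, ?_⟩⟩).elim
      rw [← cancel_epi p.hom, ← Category.assoc, hr, Preadditive.sub_comp, hh', Category.assoc, w,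
        comp_zero, sub_zero, Category.comp_id]
  · obtain ⟨s, hs⟩ := hright M.obj t.hom M.property fun h' => ht ((RepPlus.isSplitEpi_iff _).2 h')
    exact ⟨ObjectProperty.homMk s, ObjectProperty.hom_ext _ hs⟩
  · obtain ⟨s, hs⟩ := exists_lift_of_shortExact hS h.hom (congrArg InducedCategory.Hom.hom hh)
    exact ⟨ObjectProperty.homMk s, ObjectProperty.hom_ext _ hs⟩
  · obtain ⟨s, hs⟩ := exists_desc_of_shortExact hS h.hom (congrArg InducedCategory.Hom.hom hh)
    exact ⟨ObjectProperty.homMk s, ObjectProperty.hom_ext _ hs⟩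

end Sequences
end QuiverAR
end

noncomputable section
namespace QuiverAR

/-! ### Injective representations -/

section CoBasis

universe u v w
variable {k : Type w} [Field k] {Q : Type u} [Quiver.{v} Q]
variable {M N J J' P Y : QRep k Q} {x y z : Paths Q}

/-- Linear forms on a representation, at the vertices `pt i`, which identify it with the product of
the injective representations at these vertices. -/
structure CoBasis (J : QRep k Q) {ι : Type*} (pt : ι → Paths Q) where
  form : ∀ i, J.obj (pt i) →ₗ[k] k
  ext : ∀ (v : Paths Q) (m m' : J.obj v),
    (∀ i (p : v ⟶ pt i), form i (act J p m) = form i (act J p m')) → m = m'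
  exists_elt : ∀ (v : Paths Q) (c : ∀ i, (v ⟶ pt i) → k),
    ∃ m : J.obj v, ∀ i p, form i (act J p m) = c i p

variable {ι : Type*} {pt : ι → Paths Q}

theorem CoBasis.hom_ext (b : CoBasis J pt) {f g : M ⟶ J}
    (h : ∀ i m, b.form i (ev f (pt i) m) = b.form i (ev g (pt i) m)) : f = g :=
  hom_ext_ev fun x m => b.ext x _ _ fun i p => by rw [← ev_act, ← ev_act, h]

/-- The universal property of coinduction: `m` is sent to the element whose coordinate at a path `p`
is `μ i (p m)`. -/
theorem CoBasis.exists_hom (b : CoBasis J pt) (μ : ∀ i, M.obj (pt i) →ₗ[k] k) :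
    ∃ h : M ⟶ J, ∀ i m, b.form i (ev h (pt i) m) = μ i m := by
  choose φ hφ using fun (x : Paths Q) (m : M.obj x) => b.exists_elt x fun i p => μ i (act M p m)
  refine ⟨homOf (fun x => ⟨⟨φ x, fun m m' => b.ext _ _ _ fun i p => ?_⟩,
    fun c m => b.ext _ _ _ fun i p => ?_⟩) fun x y a m => b.ext _ _ _ fun i p => ?_, fun i m => ?_⟩
  · rw [hφ, map_add, map_add, map_add, map_add, hφ, hφ]
  · dsimp only
    rw [hφ, map_smul, map_smul, RingHom.id_apply, map_smul, map_smul, hφ]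
  · change b.form i (act J p (φ y _)) = b.form i (act J p (act J (arr a) (φ x m)))
    rw [hφ, ← LinearMap.comp_apply (act J p), ← LinearMap.comp_apply (act M p)]
    have h1 : ∀ m, act M p (act M (arr a) m) = act M (arr a ≫ p) m := fun m => by simp
    have h2 : ∀ m, act J p (act J (arr a) m) = act J (arr a ≫ p) m := fun m => by simp
    rw [LinearMap.comp_apply, LinearMap.comp_apply, h1, h2, hφ]
  · have := hφ (pt i) m i (𝟙 _)
    rwa [act_id, act_id] at this

theorem CoBasis.nonempty_iso (b : CoBasis J pt) (b' : CoBasis J' pt) : Nonempty (J ≅ J') := by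
  obtain ⟨f, hf⟩ := b'.exists_hom b.form
  obtain ⟨g, hg⟩ := b.exists_hom b'.form
  exact ⟨⟨f, g, b.hom_ext fun i m => by rw [ev_comp, hg, hf, ev_id],
    b'.hom_ext fun i m => by rw [ev_comp, hf, hg, ev_id]⟩⟩

/-- The linear forms on `ν P` given by the projections of `P`. -/
def DualBasis.coBasis [Fintype ι] (b : DualBasis P ι) : CoBasis (nakayama.obj P) b.pt where
  form i := (pair P (b.pt i)).toLinearMap.flip (b.proj i)
  ext v θ θ' h := pair_ext fun g => by
    rw [← Category.id_comp g, ← b.total, Preadditive.sum_comp, map_sum, map_sum]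
    refine Finset.sum_congr rfl fun i _ => ?_
    rw [Category.assoc, eq_yon (b.inc i ≫ g)]
    refine pathElt_span (ev (b.inc i ≫ g) (b.pt i) (pathElt (𝟙 _))) (LinearMap.eqLocus
      (pair P v θ ∘ₗ Linear.leftComp k (projRep k v) (b.proj i) ∘ₗ
        (yonEquiv (projRep k v) (b.pt i)).toLinearMap)
      (pair P v θ' ∘ₗ Linear.leftComp k (projRep k v) (b.proj i) ∘ₗ
        (yonEquiv (projRep k v) (b.pt i)).toLinearMap)) fun p => ?_
    change pair P v θ (b.proj i ≫ yon (pathElt p)) = pair P v θ' (b.proj i ≫ yon (pathElt p))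
    rw [yon_pathElt]
    exact h i p
  exists_elt v c := by
    let L : ∀ i, (projRep k v).obj (b.pt i) →ₗ[k] k := fun i =>
      Finsupp.linearCombination k (fun p : v ⟶ b.pt i => c i p)
    have hL : ∀ i (p : v ⟶ b.pt i), L i (pathElt p) = c i p := fun i p => by
      change Finsupp.linearCombination k (fun p : v ⟶ b.pt i => c i p) (Finsupp.single p 1) = _
      simp
    refine ⟨(pair P v).symm (∑ i, L i ∘ₗ (yonEquiv (projRep k v) (b.pt i)).symm.toLinearMap ∘ₗ
      Linear.leftComp k (projRep k v) (b.inc i)), fun i p => ?_⟩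
    change (∑ j, L j ∘ₗ (yonEquiv (projRep k v) (b.pt j)).symm.toLinearMap ∘ₗ
      Linear.leftComp k (projRep k v) (b.inc j)) (b.proj i ≫ projRepMap k p) = c i p
    rw [LinearMap.sum_apply, Finset.sum_eq_single i]
    · change L i (ev (b.inc i ≫ b.proj i ≫ projRepMap k p) _ (pathElt (𝟙 _))) = _
      rw [← Category.assoc, b.inc_proj_self, Category.id_comp, ev_projRepMap_pathElt,
        Category.comp_id, hL]
    · intro j _ hj
      change L j (ev (b.inc j ≫ b.proj i ≫ projRepMap k p) _ (pathElt (𝟙 _))) = _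
      rw [← Category.assoc, b.inc_proj_ne _ _ hj, zero_comp, ev_zero, map_zero]
    · exact fun h => (h (Finset.mem_univ _)).elim

/-- A representation with a finite co-basis is in the image of the Nakayama functor. -/
theorem CoBasis.exists_iso_nakayama [Finite ι] (b : CoBasis J pt) :
    ∃ P : QRep k Q, IsFinProj P ∧ Nonempty (J ≅ nakayama.obj P) := by
  have := Fintype.ofFinite ι
  let d := DualBasis.ofIso (k := k) pt (Iso.refl _)
  exact ⟨_, d.isFinProj, b.nonempty_iso d.coBasis⟩

/-- The path algebra form on `I_x`. -/
def injForm (x : Paths Q) : (injRep k x).obj x →ₗ[k] k := Finsupp.lapply (𝟙 x)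

theorem injForm_act (p : y ⟶ x) (m : (injRep k x).obj y) :
    injForm x (act (injRep k x) p m) = (show (y ⟶ x) →₀ k from m) p := by
  change (show (y ⟶ x) →₀ k from m) (p ≫ 𝟙 x) = _
  rw [Category.comp_id]

/-- The co-basis of `I_x`. -/
def injRepCoBasis (hQ : StronglyLocallyFinite Q) (x : Paths Q) :
    CoBasis (injRep k x) (fun _ : Unit => x) where
  form _ := injForm x
  ext v m m' h := Finsupp.ext (M := k) fun p => by
    rw [← injForm_act, h (), injForm_act]
  exists_elt v c := by
    have := finite_hom hQ v x
    exact ⟨Finsupp.equivFunOnFinite.symm (c ()), fun _ p => injForm_act p _⟩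

theorem injRep_iso_nakayama (hQ : StronglyLocallyFinite Q) (x : Paths Q) :
    Nonempty (injRep k x ≅ nakayama.obj (projRep k x)) := by
  let b : DualBasis (projRep k x) Unit :=
    { pt := fun _ => x
      inc := fun _ => 𝟙 _
      proj := fun _ => 𝟙 _
      total := by simp
      inc_proj_self := by simp
      inc_proj_ne := fun i j h => (h rfl).elim }
  exact (injRepCoBasis hQ x).nonempty_iso b.coBasis

/-- The representation coinduced from a family of vector spaces. -/
def coind (V : Paths Q → Type (max u v w)) [∀ x, AddCommGroup (V x)] [∀ x, Module k (V x)] :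
    QRep k Q where
  obj v := ModuleCat.of k (∀ x : Paths Q, (v ⟶ x) → V x)
  map q := ModuleCat.ofHom
    { toFun := fun φ x p => φ x (q ≫ p)
      map_add' := fun _ _ => rfl
      map_smul' := fun _ _ => rfl }
  map_id v := by
    ext φ x p
    exact congrArg (φ x) (Category.id_comp p)
  map_comp q r := by
    ext φ x p
    exact congrArg (φ x) (Category.assoc q r p)

/-- The co-basis of a coinduced representation. -/
def coindCoBasis (V : Paths Q → Type (max u v w)) [∀ x, AddCommGroup (V x)] [∀ x, Module k (V x)]
    [∀ x, Module.Finite k (V x)] :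
    CoBasis (coind (k := k) V) (fun i : Σ x, Fin (Module.finrank k (V x)) => i.1) where
  form i := LinearMap.proj i.2 ∘ₗ (Module.finBasis k (V i.1)).equivFun.toLinearMap ∘ₗ
    LinearMap.proj (R := k) (φ := fun _ : i.1 ⟶ i.1 => V i.1) (𝟙 i.1) ∘ₗ
      LinearMap.proj (R := k) (φ := fun x => (i.1 ⟶ x) → V x) i.1
  ext v m m' h := by
    change (∀ x : Paths Q, (v ⟶ x) → V x) at m
    change (∀ x : Paths Q, (v ⟶ x) → V x) at m'
    funext x p
    refine (Module.finBasis k (V x)).equivFun.injective (funext fun j => ?_)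
    have := h ⟨x, j⟩ p
    change (Module.finBasis k (V x)).equivFun (m x (p ≫ 𝟙 x)) j =
      (Module.finBasis k (V x)).equivFun (m' x (p ≫ 𝟙 x)) j at this
    rwa [Category.comp_id] at this
  exists_elt v c := by
    refine ⟨(fun x p => (Module.finBasis k (V x)).equivFun.symm fun j => c ⟨x, j⟩ p :
      ∀ x : Paths Q, (v ⟶ x) → V x), fun i p => ?_⟩
    change (Module.finBasis k (V i.1)).equivFun ((Module.finBasis k (V i.1)).equivFun.symm
      fun j => c ⟨i.1, j⟩ (p ≫ 𝟙 _)) i.2 = _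
    rw [LinearEquiv.apply_symm_apply, Category.comp_id]

theorem exists_coind_iso_nakayama (V : Paths Q → Type (max u v w)) [∀ x, AddCommGroup (V x)]
    [∀ x, Module k (V x)] [∀ x, Module.Finite k (V x)] (hV : {x | Nontrivial (V x)}.Finite) :
    ∃ P : QRep k Q, IsFinProj P ∧ Nonempty (coind (k := k) V ≅ nakayama.obj P) := by
  have : Finite (Σ x, Fin (Module.finrank k (V x))) := by
    have := hV.to_subtype
    refine Finite.of_surjective
      (fun i : Σ x : {x | Nontrivial (V x)}, Fin (Module.finrank k (V x.1)) =>
        (⟨i.1.1, i.2⟩ : Σ x, Fin (Module.finrank k (V x)))) ?_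
    rintro ⟨x, j⟩
    have : 0 < Module.finrank k (V x) := j.pos
    exact ⟨⟨⟨x, Module.finrank_pos_iff.1 this⟩, j⟩, rfl⟩
  exact (coindCoBasis V).exists_iso_nakayama

/-- The coefficients of a solution of the equations of the second step of the injective
resolution. -/
def solvePath (Y : QRep k Q) {v : Q}
    (ψ : ∀ x : Paths Q, (Quiver.Path v (show Q from x)) → ∀ s : (Σ y : Paths Q, Arr x y), Y.obj s.1) :
    ∀ {x : Q} (_ : Quiver.Path v x), Y.obj x
  | _, .nil => 0
  | _, .cons (b := x) p a =>
    act Y (x := x) (arr a) (solvePath Y ψ p) - ψ x p ⟨_, a⟩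

/-- The first terms of an injective resolution of a finite dimensional representation. -/
theorem exists_injective_resolution (hQ : StronglyLocallyFinite Q) (hY : IsFinDim Y) :
    ∃ (P₁ P₀ : QRep k Q) (i : Y ⟶ nakayama.obj P₁) (d : nakayama.obj P₁ ⟶ nakayama.obj P₀)
      (w : i ≫ d = 0), IsFinProj P₁ ∧ IsFinProj P₀ ∧ (ShortComplex.mk i d w).ShortExact := by
  have := hY.2
  have := fun x => (finite_arr_out hQ x)
  let V₁ : Paths Q → Type (max u v w) := fun x => Y.obj x
  let V₀ : Paths Q → Type (max u v w) := fun x => ∀ s : (Σ y : Paths Q, Arr x y), Y.obj s.1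
  have hV₀ : {x | Nontrivial (V₀ x)}.Finite := by
    have hfin : (⋃ y ∈ {y : Paths Q | Nontrivial (Y.obj y)},
        Set.range fun s : (Σ x : Paths Q, Arr x y) => s.1).Finite :=
      hY.1.biUnion fun y _ => have := finite_arr_in hQ y; Set.finite_range _
    refine hfin.subset fun x hx => ?_
    have hx' : Nontrivial (V₀ x) := hx
    obtain ⟨φ, hφ⟩ := exists_ne (0 : V₀ x)
    obtain ⟨s, hs⟩ := Function.ne_iff.1 hφ
    exact Set.mem_biUnion (x := s.1) (show Nontrivial _ from ⟨⟨_, _, hs⟩⟩) ⟨⟨x, s.2⟩, rfl⟩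
  obtain ⟨P₁, hP₁, ⟨e₁⟩⟩ := exists_coind_iso_nakayama (k := k) V₁ hY.1
  obtain ⟨P₀, hP₀, ⟨e₀⟩⟩ := exists_coind_iso_nakayama (k := k) V₀ hV₀
  let i : Y ⟶ coind (k := k) V₁ :=
    homOf (N := coind (k := k) V₁) (fun v => LinearMap.pi fun x => LinearMap.pi fun p => act Y p)
      fun x y a m => by
        funext z p
        exact (act_comp (arr a) p m).symm
  -- The map `d` measures the failure of a family of elements, indexed by the paths from `v`, to be
  -- compatible with the arrows; compatible families are those which come from an element of `Y` at
  -- `v`.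
  let d : coind (k := k) V₁ ⟶ coind (k := k) V₀ :=
    homOf (M := coind (k := k) V₁) (N := coind (k := k) V₀)
      (fun v =>
        { toFun := fun (φ : ∀ x : Paths Q, (v ⟶ x) → Y.obj x) =>
            (fun x p s => act Y (arr s.2) (φ x p) - φ s.1 (p ≫ arr s.2) :
              ∀ x : Paths Q, (v ⟶ x) → V₀ x)
          map_add' := fun φ φ' => by
            funext x p s
            change act Y (arr s.2) (φ x p + φ' x p) - (φ s.1 (p ≫ arr s.2) + φ' s.1 (p ≫ arr s.2)) =
              act Y (arr s.2) (φ x p) - φ s.1 (p ≫ arr s.2) +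
                (act Y (arr s.2) (φ' x p) - φ' s.1 (p ≫ arr s.2))
            rw [map_add]
            abel
          map_smul' := fun c φ => by
            funext x p s
            change act Y (arr s.2) (c • φ x p) - c • φ s.1 (p ≫ arr s.2) =
              c • (act Y (arr s.2) (φ x p) - φ s.1 (p ≫ arr s.2))
            rw [map_smul, smul_sub] })
      fun x y a φ => by
        funext z p s
        change act Y (arr s.2) ((show ∀ z : Paths Q, (x ⟶ z) → Y.obj z from φ) z (arr a ≫ p)) -
            (show ∀ z : Paths Q, (x ⟶ z) → Y.obj z from φ) s.1 (arr a ≫ p ≫ arr s.2) =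
          act Y (arr s.2) ((show ∀ z : Paths Q, (x ⟶ z) → Y.obj z from φ) z (arr a ≫ p)) -
            (show ∀ z : Paths Q, (x ⟶ z) → Y.obj z from φ) s.1 ((arr a ≫ p) ≫ arr s.2)
        rw [Category.assoc]
  have w : i ≫ d = 0 := hom_ext_ev fun v m => by
    funext x p s
    change act Y (arr s.2) (act Y p m) - act Y (p ≫ arr s.2) m = 0
    rw [act_comp, sub_self]
  have hS : (ShortComplex.mk i d w).ShortExact := by
    refine shortExact_of_ev w (fun v m m' h => ?_) (fun v ψ => ?_) fun v φ hφ => ?_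
    · have := congrFun (congrFun h v) (𝟙 v)
      change act Y (𝟙 v) m = act Y (𝟙 v) m' at this
      simpa using this
    · change (∀ x : Paths Q, (v ⟶ x) → V₀ x) at ψ
      -- Surjectivity of `d`: the equation at a path followed by an arrow determines the next value,
      -- so it is solved by recursion along paths, starting from zero.
      refine ⟨(fun x p => solvePath Y ψ p : ∀ x : Paths Q, (v ⟶ x) → Y.obj x), ?_⟩
      funext x p s
      change act Y (arr s.2) (solvePath Y ψ p) - (act Y (arr s.2) (solvePath Y ψ p) - ψ x p s) = _
      rw [sub_sub_cancel]
    · change (∀ x : Paths Q, (v ⟶ x) → Y.obj x) at φ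
      refine ⟨φ v (𝟙 v), funext fun x => funext fun p => ?_⟩
      change act Y p (φ v (𝟙 v)) = φ x p
      refine path_induction (fun {x} p => act Y p (φ v (𝟙 v)) = φ x p) (by simp) ?_ p
      intro y z p a ih
      have h2 : act Y (arr a) (φ y p) - φ z (p ≫ arr a) = 0 :=
        congrFun (congrFun (congrFun hφ y) p) ⟨z, a⟩
      rw [act_comp, ih]
      exact sub_eq_zero.1 h2
  refine ⟨P₁, P₀, i ≫ e₁.hom, e₁.inv ≫ d ≫ e₀.hom, by simp [reassoc_of% w], hP₁, hP₀, ?_⟩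
  refine ShortComplex.shortExact_of_iso (S₁ := ShortComplex.mk i d w)
    (ShortComplex.isoMk (Iso.refl _) e₁ e₀ ?_ ?_) hS
  · simp
  · simp

end CoBasis
end QuiverAR
end

noncomputable section
namespace QuiverAR

/-! ### Existence of almost split sequences -/

section Iso

universe v₁ u₁

variable {A : Type u₁} [Category.{v₁} A] [Preadditive A] {X Y : A}

theorem LocalObj.of_iso (hX : LocalObj X) (e : X ≅ Y) : LocalObj Y := by
  refine ⟨fun h => hX.1 (h.of_iso e), fun φ => ?_⟩
  have h1 : φ = e.inv ≫ (e.hom ≫ φ ≫ e.inv) ≫ e.hom := by simp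
  have h2 : 𝟙 Y - φ = e.inv ≫ (𝟙 X - e.hom ≫ φ ≫ e.inv) ≫ e.hom := by
    simp [Preadditive.sub_comp, Preadditive.comp_sub]
  refine (hX.2 (e.hom ≫ φ ≫ e.inv)).imp (fun h => ?_) fun h => ?_
  · rw [h1]
    exact IsIso.comp_isIso' inferInstance (IsIso.comp_isIso' h inferInstance)
  · rw [h2]
    exact IsIso.comp_isIso' inferInstance (IsIso.comp_isIso' h inferInstance)

end Iso

section Existence

universe u v w
variable {k : Type w} [Field k] {Q : Type u} [Quiver.{v} Q]
variable {M N P₁ P₀ Z Y : QRep k Q} {x y z : Paths Q}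

theorem IsFinDim.of_shortExact {E : QRep k Q} (hN : IsFinDim N) (hZ : IsFinDim Z) {i : N ⟶ E}
    {p : E ⟶ Z} {w : i ≫ p = 0} (hS : (ShortComplex.mk i p w).ShortExact) : IsFinDim E := by
  have ex := (exact_iff_ev w).1 hS.exact
  refine ⟨(hN.1.union hZ.1).subset fun x hx => ?_, fun x => ?_⟩
  · by_contra hcon
    rw [Set.mem_union, not_or] at hcon
    have h1 := not_nontrivial_iff_subsingleton.1 hcon.1
    have h2 := not_nontrivial_iff_subsingleton.1 hcon.2
    have hx' : Nontrivial (E.obj x) := hx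
    obtain ⟨m, hm⟩ := exists_ne (0 : E.obj x)
    obtain ⟨n, hn⟩ := ex x m (Subsingleton.elim _ _)
    exact hm (by rw [← hn, Subsingleton.elim n 0, map_zero])
  · have := hN.2 x
    have := hZ.2 x
    refine IsNoetherian.iff_fg.1 (isNoetherian_of_range_eq_ker (ev i x) (ev p x) ?_)
    refine le_antisymm ?_ fun m hm => ex x m hm
    rintro _ ⟨n, rfl⟩
    rw [LinearMap.mem_ker, ← ev_comp, w, ev_zero]

theorem finGen_of_isFinProj {P : QRep k Q} (hP : IsFinProj P) : FinGen P :=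
  let ⟨_, ⟨b⟩⟩ := hP.exists_dualBasis
  b.finGen

theorem not_isZero_injRep (x : Paths Q) : ¬ IsZero (injRep k x) := fun h =>
  one_ne_zero (α := k) ((Finsupp.single_eq_zero (a := 𝟙 x)).1
    (isZero_iff_ev.1 h x (Finsupp.single (𝟙 x) (1 : k))))

/-- A morphism from `P₀` to some P_x which is killed by `f` factors through `Z`. -/
theorem epi_nakayama_of_shortExact {f : P₁ ⟶ P₀} {g : P₀ ⟶ Z} {w : f ≫ g = 0}
    (hS : (ShortComplex.mk f g w).ShortExact)
    (hZ : ∀ (x : Paths Q) (t : Z ⟶ projRep k x), t = 0) : Epi (nakayama.map f) :=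
  epi_nakayama_map fun x t ht => by
    obtain ⟨s, rfl⟩ := exists_desc_of_shortExact hS t ht
    rw [hZ x s, comp_zero]

theorem nakayama_kernel_shortExact (f : P₁ ⟶ P₀) [Epi (nakayama.map f)] :
    (ShortComplex.mk (kernel.ι (nakayama.map f)) (nakayama.map f)
      (kernel.condition _)).ShortExact where
  exact := ShortComplex.exact_kernel _
  mono_f := inferInstanceAs (Mono (kernel.ι (nakayama.map f)))
  epi_g := inferInstanceAs (Epi (nakayama.map f))

/-- Existence of almost split sequences. -/
theorem exists_almostSplit {Z : RepPlus k Q} {f : P₁ ⟶ P₀} {g : P₀ ⟶ Z.obj}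
    {w : f ≫ g = 0} (hS : (ShortComplex.mk f g w).ShortExact) (hP₁ : IsFinProj P₁)
    (hP₀ : IsFinProj P₀) (hZ : LocalObj Z.obj)
    (hZP : ∀ (x : Paths Q) (t : Z.obj ⟶ projRep k x), t = 0)
    (X : RepPlus k Q) (e : X.obj ≅ kernel (nakayama.map f)) (hX : IsFinDim X.obj)
    (hXI : Indec X.obj) :
    ∃ (E : RepPlus k Q) (i : X ⟶ E) (p : E ⟶ Z), IsAlmostSplitSequence i p ∧
      (IsFinDim Z.obj → IsFinDim E.obj) := by
  have hepi := epi_nakayama_of_shortExact hS hZP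
  have : Epi g := hS.epi_g
  -- A linear form on the endomorphisms of `Z` which vanishes on the radical but not at the
  -- identity. Extended along `g` to a form `φ` on Hom(P₀, Z), it yields the morphism to ν P₀ along
  -- which `ν` is pulled back.
  obtain ⟨l, hl', hl⟩ := Submodule.exists_le_ker_of_notMem (p := radK k Z.obj Z.obj) (v := 𝟙 Z.obj)
    fun h => hZ.1 ((IsZero.iff_id_eq_zero _).2 (by
      have := h (𝟙 _)
      rw [Category.comp_id, sub_self] at this
      rw [← cancel_epi (0 : Z.obj ⟶ Z.obj)]
      simp))
  have hinj : Function.Injective (Linear.leftComp k Z.obj g) := fun a b h => (cancel_epi g).1 h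
  obtain ⟨φ, hφ⟩ := LinearMap.dualMap_surjective_of_injective hinj l
  have hφ' : ∀ s : Z.obj ⟶ Z.obj, φ (g ≫ s) = l s := fun s => LinearMap.congr_fun hφ s
  set ν := nakayama.map f with hν
  obtain ⟨a, wa, ha⟩ := exists_pullback_shortExact ν (psi φ)
  have wa' : (e.hom ≫ a) ≫ pullback.fst (psi φ) ν = 0 := by rw [Category.assoc, wa, comp_zero]
  have ha' : (ShortComplex.mk (e.hom ≫ a) (pullback.fst (psi φ) ν) wa').ShortExact := by
    refine ShortComplex.shortExact_of_iso (S₁ := ShortComplex.mk _ _ wa)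
      (ShortComplex.isoMk e.symm (Iso.refl _) (Iso.refl _) ?_ ?_) ha
    · simp
    · simp
  have hE : isFinPres k Q (pullback (psi φ) ν) :=
    isFinPres_of_extension X.property Z.property ha'
  refine ⟨⟨pullback (psi φ) ν, hE⟩, ObjectProperty.homMk (e.hom ≫ a),
    ObjectProperty.homMk (pullback.fst (psi φ) ν), ?_, fun hZf => ?_⟩
  · refine isAlmostSplitSequence_of_shortExact (w := wa') ha' hX hXI hZ ?_ ?_
    -- A section would lift `psi φ` through `ν`; then `φ` would factor through composition with `f`
    -- and vanish at `g`, whereas its value there is `l` at the identity.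
    · rintro ⟨⟨s⟩⟩
      have h1 : psi φ = (s.section_ ≫ pullback.snd (psi φ) ν) ≫ ν := by
        have h2 : s.section_ ≫ pullback.fst (psi φ) ν = 𝟙 _ := s.id
        rw [Category.assoc, ← pullback.condition, ← Category.assoc, h2, Category.id_comp]
      obtain ⟨φ', h3⟩ := hP₁.exists_psi (s.section_ ≫ pullback.snd (psi φ) ν)
      rw [← h3, hν, psi_comp] at h1
      have h4 := LinearMap.congr_fun (hP₀.psi_injective h1) g
      refine hl' ?_
      rw [← hφ' (𝟙 _), Category.comp_id, h4]
      change φ' (f ≫ g) = 0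
      rw [w, map_zero]
    · intro M t hM ht
      -- The form belonging to `t ≫ psi φ` vanishes on the morphisms `g ≫ s`: its value is `l (s ≫
      -- t)`, and `s ≫ t` is radical because `t` is not a split epimorphism. The resulting `v` and
      -- `t` together define the lift to the pullback.
      obtain ⟨v, hv⟩ := exists_factor_nakayama hS.exact this (φ ∘ₗ Linear.rightComp k P₀ t)
        fun s => by
          change φ ((g ≫ s) ≫ t) = 0
          rw [Category.assoc, hφ']
          exact hl (comp_mem_radical s (hZ.mem_radical' ht))
      rw [← comp_psi] at hv
      exact ⟨pullback.lift t v hv.symm, pullback.lift_fst _ _ _⟩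
  · exact hX.of_shortExact hZf ha'

/-- The endomorphisms of `Z` and of `ker ν f` which are induced by the same endomorphism of a
projective resolution of `Z`. -/
def EndRel (f : P₁ ⟶ P₀) (g : P₀ ⟶ Z) (a : Z ⟶ Z)
    (b : kernel (nakayama.map f) ⟶ kernel (nakayama.map f)) : Prop :=
  ∃ (a₀ : P₀ ⟶ P₀) (a₁ : P₁ ⟶ P₁), f ≫ a₀ = a₁ ≫ f ∧ g ≫ a = a₀ ≫ g ∧
    b ≫ kernel.ι (nakayama.map f) = kernel.ι (nakayama.map f) ≫ nakayama.map a₁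

theorem EndRel.smul_id (f : P₁ ⟶ P₀) (g : P₀ ⟶ Z) (c : k) : EndRel f g (c • 𝟙 Z) (c • 𝟙 _) := by
  refine ⟨c • 𝟙 _, c • 𝟙 _, by simp, by simp, ?_⟩
  refine hom_ext_ev fun x m => pair_ext fun g => ?_
  simp

theorem EndRel.sub {f : P₁ ⟶ P₀} {g : P₀ ⟶ Z} {a a' : Z ⟶ Z}
    {b b' : kernel (nakayama.map f) ⟶ kernel (nakayama.map f)} (h : EndRel f g a b)
    (h' : EndRel f g a' b') : EndRel f g (a - a') (b - b') := by
  obtain ⟨a₀, a₁, h1, h2, h3⟩ := h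
  obtain ⟨a₀', a₁', h1', h2', h3'⟩ := h'
  refine ⟨a₀ - a₀', a₁ - a₁', ?_, ?_, ?_⟩
  · rw [Preadditive.comp_sub, Preadditive.sub_comp, h1, h1']
  · rw [Preadditive.comp_sub, Preadditive.sub_comp, h2, h2']
  · have : nakayama.map (a₁ - a₁') = nakayama.map a₁ - nakayama.map a₁' :=
      hom_ext_ev fun x m => pair_ext fun g => by simp [Preadditive.sub_comp]
    rw [Preadditive.sub_comp, this, Preadditive.comp_sub, h3, h3']

theorem EndRel.comp {f : P₁ ⟶ P₀} {g : P₀ ⟶ Z} {a a' : Z ⟶ Z}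
    {b b' : kernel (nakayama.map f) ⟶ kernel (nakayama.map f)} (h : EndRel f g a b)
    (h' : EndRel f g a' b') : EndRel f g (a ≫ a') (b ≫ b') := by
  obtain ⟨a₀, a₁, h1, h2, h3⟩ := h
  obtain ⟨a₀', a₁', h1', h2', h3'⟩ := h'
  refine ⟨a₀ ≫ a₀', a₁ ≫ a₁', ?_, ?_, ?_⟩
  · rw [← Category.assoc, h1, Category.assoc, h1', Category.assoc]
  · rw [← Category.assoc, h2, Category.assoc, h2', Category.assoc]
  · rw [Category.assoc, h3', ← Category.assoc, h3, Functor.map_comp, Category.assoc]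

section

variable {f : P₁ ⟶ P₀} {g : P₀ ⟶ Z} {w : f ≫ g = 0} (hS : (ShortComplex.mk f g w).ShortExact)
  (hP₁ : IsFinProj P₁) (hP₀ : IsFinProj P₀)
include hS hP₁ hP₀

omit hP₁ in
theorem EndRel.exists_right (a : Z ⟶ Z) : ∃ b, EndRel f g a b := by
  have : Epi g := hS.epi_g
  obtain ⟨a₀, h₀⟩ := hP₀.exists_lift g (g ≫ a)
  obtain ⟨a₁, h₁⟩ := exists_lift_of_shortExact hS (f ≫ a₀) (by
    rw [Category.assoc, h₀, ← Category.assoc, w, zero_comp])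
  refine ⟨kernel.lift _ (kernel.ι (nakayama.map f) ≫ nakayama.map a₁) ?_, a₀, a₁, h₁.symm, h₀.symm,
    kernel.lift_ι _ _ _⟩
  rw [Category.assoc, ← Functor.map_comp, h₁, Functor.map_comp, ← Category.assoc, kernel.condition,
    zero_comp]

/-- Injectivity of ν P₁ extends `b` to ν P₁, and surjectivity of ν f passes it on to ν P₀. Fullness
of ν on proj(Q) brings both back to the resolution, faithfulness preserves the commuting square, and
the cokernel receives `a`. -/
theorem EndRel.exists_left (hQ : StronglyLocallyFinite Q) [Epi (nakayama.map f)]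
    (b : kernel (nakayama.map f) ⟶ kernel (nakayama.map f)) : ∃ a, EndRel f g a b := by
  obtain ⟨v, hv⟩ := hP₁.exists_extend (kernel.ι (nakayama.map f))
    (b ≫ kernel.ι (nakayama.map f))
  obtain ⟨a₁, rfl⟩ := hP₁.exists_nakayama_map hQ hP₁ v
  obtain ⟨v₀, hv₀⟩ := exists_desc_of_shortExact (nakayama_kernel_shortExact f)
    (nakayama.map a₁ ≫ nakayama.map f) (by
      rw [← Category.assoc, hv, Category.assoc, kernel.condition, comp_zero])
  obtain ⟨a₀, rfl⟩ := hP₀.exists_nakayama_map hQ hP₀ v₀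
  rw [← Functor.map_comp, ← Functor.map_comp] at hv₀
  have h₀ := hP₀.nakayama_injective hv₀
  obtain ⟨a, ha⟩ := exists_desc_of_shortExact hS (a₀ ≫ g) (by
    rw [← Category.assoc, h₀, Category.assoc, w, comp_zero])
  exact ⟨a, a₀, a₁, h₀, ha, hv.symm⟩

-- A lift of zero to the resolution is null homotopic: `a₁` factors through `f`, so ν a₁ vanishes on
-- the kernel of ν f.
omit hP₁ hP₀ in
theorem EndRel.right_eq_zero {b : kernel (nakayama.map f) ⟶ kernel (nakayama.map f)}
    (h : EndRel f g 0 b) : b = 0 := by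
  have : Mono f := hS.mono_f
  obtain ⟨a₀, a₁, h1, h2, h3⟩ := h
  obtain ⟨s, hs⟩ := exists_lift_of_shortExact hS a₀ (by rw [← h2, comp_zero])
  have h4 : a₁ = f ≫ s := by
    rw [← cancel_mono f, ← h1, Category.assoc, hs]
  rw [← cancel_mono (kernel.ι (nakayama.map f)), h3, h4, Functor.map_comp, ← Category.assoc,
    kernel.condition, zero_comp, zero_comp]

/-- Dually, ν a₁ factors through ν f, hence `a₁` is `f ≫ s`. Then `a₀ - s ≫ f` factors through `Z`
and is zero, as `Z` has no nonzero morphism to a projective. -/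
theorem EndRel.left_eq_zero (hQ : StronglyLocallyFinite Q)
    (hZ : ∀ (x : Paths Q) (t : Z ⟶ projRep k x), t = 0) [Epi (nakayama.map f)] {a : Z ⟶ Z}
    (h : EndRel f g a 0) : a = 0 := by
  have : Epi g := hS.epi_g
  obtain ⟨a₀, a₁, h1, h2, h3⟩ := h
  obtain ⟨v, hv⟩ := exists_desc_of_shortExact (nakayama_kernel_shortExact f) (nakayama.map a₁)
    (by rw [← h3, zero_comp])
  obtain ⟨s, rfl⟩ := hP₀.exists_nakayama_map hQ hP₁ v
  rw [← Functor.map_comp] at hv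
  have h4 := hP₁.nakayama_injective hv
  obtain ⟨t, ht⟩ := exists_desc_of_shortExact hS (a₀ - s ≫ f) (by
    rw [Preadditive.comp_sub, h1, ← h4, Category.assoc, sub_self])
  obtain ⟨n, ⟨b⟩⟩ := hP₀.exists_dualBasis
  have ht0 : t = 0 := by
    rw [← Category.comp_id t, ← b.total, Preadditive.comp_sum]
    refine Finset.sum_eq_zero fun i _ => ?_
    rw [← Category.assoc, hZ _ (t ≫ b.proj i), zero_comp]
  rw [ht0, comp_zero] at ht
  rw [← cancel_epi g, h2, sub_eq_zero.1 ht.symm, Category.assoc, w, comp_zero, comp_zero]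

/-- `EndRel` matches endomorphisms on the two sides and sends scalars to scalars; it is faithful by
the vanishing lemmas above. -/
theorem brick_kernel_nakayama (hQ : StronglyLocallyFinite Q) (hZb : Brick k Z)
    (hZ : ∀ (x : Paths Q) (t : Z ⟶ projRep k x), t = 0) : Brick k (kernel (nakayama.map f)) := by
  have := epi_nakayama_of_shortExact hS hZ
  refine ⟨fun h0 => hZb.1 ((IsZero.iff_id_eq_zero _).2 ?_), fun b => ?_⟩
  · have h1 := EndRel.smul_id f g (1 : k)
    rw [one_smul, h0.eq_zero_of_src ((1 : k) • 𝟙 _)] at h1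
    exact EndRel.left_eq_zero hS hP₁ hP₀ hQ hZ h1
  · obtain ⟨a, ha⟩ := EndRel.exists_left hS hP₁ hP₀ hQ b
    obtain ⟨c, rfl⟩ := hZb.2 a
    have h1 := ha.sub (EndRel.smul_id f g c)
    rw [sub_self] at h1
    exact ⟨c, sub_eq_zero.1 (EndRel.right_eq_zero hS h1)⟩

theorem localObj_of_kernel_nakayama (hQ : StronglyLocallyFinite Q)
    (hN : LocalObj (kernel (nakayama.map f)))
    (hZ : ∀ (x : Paths Q) (t : Z ⟶ projRep k x), t = 0) : LocalObj Z := by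
  have := epi_nakayama_of_shortExact hS hZ
  have hid : EndRel f g (𝟙 Z) (𝟙 _) := by
    have := EndRel.smul_id f g (1 : k)
    rwa [one_smul, one_smul] at this
  have key : ∀ a b, EndRel f g a b → IsIso b → IsIso a := by
    intro a b hab hb
    obtain ⟨a', ha'⟩ := EndRel.exists_left hS hP₁ hP₀ hQ (inv b)
    have h1 := (hab.comp ha').sub hid
    have h2 := (ha'.comp hab).sub hid
    rw [IsIso.hom_inv_id, sub_self] at h1
    rw [IsIso.inv_hom_id, sub_self] at h2
    exact ⟨a', sub_eq_zero.1 (EndRel.left_eq_zero hS hP₁ hP₀ hQ hZ h1),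
      sub_eq_zero.1 (EndRel.left_eq_zero hS hP₁ hP₀ hQ hZ h2)⟩
  refine ⟨fun h0 => hN.1 ((IsZero.iff_id_eq_zero _).2 ?_), fun a => ?_⟩
  · rw [h0.eq_zero_of_src (𝟙 Z)] at hid
    exact EndRel.right_eq_zero hS hid
  · obtain ⟨b, hb⟩ := EndRel.exists_right hS hP₀ a
    exact (hN.2 b).imp (key a b hb) (key _ _ (hid.sub hb))

end

/-- A finite dimensional indecomposable representation is the first term of an almost split
sequence unless it is one of the representations `I_x`. -/
theorem exists_almostSplit_of_first (hQ : StronglyLocallyFinite Q) (Y : RepPlus k Q)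
    (hY : IsFinDim Y.obj) (hYI : Indec Y.obj)
    (hinj : ∀ x : Paths Q, ¬ Nonempty (Y.obj ≅ injRep k x)) :
    ∃ (Z E : RepPlus k Q) (i : Y ⟶ E) (p : E ⟶ Z), LocalObj Z.obj ∧ IsAlmostSplitSequence i p ∧
      (IsFinDim Z.obj → IsFinDim E.obj) := by
  obtain ⟨P₁, P₀, i, d, w, hP₁, hP₀, hS⟩ := exists_injective_resolution hQ hY
  obtain ⟨f, rfl⟩ := hP₁.exists_nakayama_map hQ hP₀ d
  have : Mono i := hS.mono_f
  have hepi : Epi (nakayama.map f) := hS.epi_g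
  -- The image of `f` is projective, so the kernel splits off `P₁`. A summand P_x of the kernel
  -- gives a summand of ν P₁ killed by ν f, hence a retract of `Y`; this would make `Y` isomorphic
  -- to I_x.
  have hf : Mono f := by
    have hI := hP₀.of_mono hQ (image.ι f) ((finGen_of_isFinProj hP₁).of_epi (factorThruImage f))
    obtain ⟨s, hs⟩ := hI.exists_lift (factorThruImage f) (𝟙 _)
    obtain ⟨r, hr⟩ : ∃ r, r ≫ kernel.ι f = 𝟙 P₁ - factorThruImage f ≫ s := by
      refine ⟨kernel.lift f _ ?_, kernel.lift_ι _ _ _⟩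
      have h1 : s ≫ f = image.ι f := by
        have h2 : s ≫ factorThruImage f ≫ image.ι f = image.ι f := by
          rw [← Category.assoc, hs, Category.id_comp]
        rwa [image.fac] at h2
      rw [Preadditive.sub_comp, Category.assoc, h1, image.fac, Category.id_comp, sub_self]
    have hir : kernel.ι f ≫ r = 𝟙 _ := by
      have h1 : kernel.ι f ≫ factorThruImage f = 0 := by
        rw [← cancel_mono (image.ι f), Category.assoc, image.fac, kernel.condition, zero_comp]
      rw [← cancel_mono (kernel.ι f), Category.assoc, hr, Preadditive.comp_sub, ← Category.assoc, h1,
        zero_comp, sub_zero, Category.comp_id, Category.id_comp]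
    have hr' : IsSplitEpi r := ⟨⟨⟨_, hir⟩⟩⟩
    have hK := hP₁.of_mono hQ (kernel.ι f) ((finGen_of_isFinProj hP₁).of_epi r)
    obtain ⟨n, ⟨b⟩⟩ := hK.exists_dualBasis
    by_cases hn : Nonempty (Fin n)
    · obtain ⟨j⟩ := hn
      obtain ⟨t, ht⟩ := exists_lift_of_shortExact hS (nakayama.map (b.inc j ≫ kernel.ι f)) (by
        rw [← Functor.map_comp, Category.assoc, kernel.condition, comp_zero]
        exact hom_ext_ev fun x m => pair_ext fun g => by simp)
      have h1 : t ≫ i ≫ nakayama.map (r ≫ b.proj j) = 𝟙 _ := by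
        rw [← Category.assoc, ht, ← Functor.map_comp, Category.assoc, ← Category.assoc _ r, hir,
          Category.id_comp, b.inc_proj_self, CategoryTheory.Functor.map_id]
      obtain ⟨e⟩ := injRep_iso_nakayama (k := k) hQ (b.pt j)
      have h2 := (hYI.isIso_of_retract h1 fun h0 => not_isZero_injRep _ (h0.of_iso e)).1
      exact (hinj (b.pt j) ⟨(asIso t).symm ≪≫ e.symm⟩).elim
    · rw [not_nonempty_iff] at hn
      have h1 := b.total
      rw [Fintype.sum_empty] at h1
      refine Preadditive.mono_of_kernel_zero ?_
      rw [← Category.id_comp (kernel.ι f), ← h1, zero_comp]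
  let g := cokernel.π f
  have hS' : (ShortComplex.mk f g (cokernel.condition f)).ShortExact :=
    { exact := ShortComplex.exact_cokernel f
      mono_f := hf
      epi_g := inferInstanceAs (Epi (cokernel.π f)) }
  have hZP : ∀ (x : Paths Q) (t : cokernel f ⟶ projRep k x), t = 0 := fun x t => by
    rw [← cancel_epi (cokernel.π f), comp_zero]
    refine eq_zero_of_epi_nakayama_map (f := f) ?_
    rw [← Category.assoc, cokernel.condition, zero_comp]
  let e : Y.obj ≅ kernel (nakayama.map f) :=
    IsLimit.conePointUniqueUpToIso hS.fIsKernel (limit.isLimit _)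
  have hN : LocalObj (kernel (nakayama.map f)) := (hYI.local hY).of_iso e
  have hZ := localObj_of_kernel_nakayama hS' hP₁ hP₀ hQ hN hZP
  let Z : RepPlus k Q := ⟨cokernel f, _, hS', hP₁, hP₀, ⟨Iso.refl _⟩⟩
  obtain ⟨E, a, b, h1, h2⟩ := exists_almostSplit (Z := Z) hS' hP₁ hP₀ hZ hZP Y e hY hYI
  exact ⟨Z, E, a, b, hZ, h1, h2⟩

end Existence
end QuiverAR
end

noncomputable section
namespace QuiverAR

/-! ### Direct sum decompositions -/

section Decomposition

universe v₁ u₁ w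

variable {A : Type u₁} [Category.{v₁} A] [Preadditive A]

/-- A decomposition of an object as a finite direct sum. -/
structure SumDecomp (E : A) {ι : Type*} [Fintype ι] (F : ι → A) where
  inc : ∀ i, F i ⟶ E
  proj : ∀ i, E ⟶ F i
  total : ∑ i, proj i ≫ inc i = 𝟙 E
  inc_proj_self : ∀ i, inc i ≫ proj i = 𝟙 _
  inc_proj_ne : ∀ i j, i ≠ j → inc i ≫ proj j = 0

variable {E Y : A} {ι : Type*} [Fintype ι] {F : ι → A}

theorem SumDecomp.exists_notMem_radical (d : SumDecomp E F) {h : E ⟶ Y} (hh : h ∉ radical E Y) :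
    ∃ i, d.inc i ≫ h ∉ radical (F i) Y := by
  by_contra hcon
  push Not at hcon
  refine hh ?_
  rw [← Category.id_comp h, ← d.total, Preadditive.sum_comp]
  refine Submodule.sum_mem _ fun i _ => ?_
  rw [Category.assoc]
  exact comp_mem_radical _ (hcon i)

variable {k : Type w} [Field k] [Linear k A]

/-- The quotient reads off the multiplicity of `G x` in `E`: components at summands equal to `G x`
are scalars, and `hne` makes all other components radical. -/
theorem SumDecomp.finrank_hom_quot_radK {J : Type*} {G : J → A} {pt : ι → J}
    (d : SumDecomp E fun i => G (pt i)) (x : J) (hx : Brick k (G x))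
    (hne : ∀ i, pt i ≠ x → ∀ (g : G x ⟶ G (pt i)) (h : G (pt i) ⟶ G x), g ≫ h = 0) :
    Module.finrank k ((E ⟶ G x) ⧸ radK k E (G x)) = Nat.card {i // pt i = x} := by
  classical
  have hG : ∀ i : {i // pt i = x}, G x = G (pt i.1) := fun i => by rw [i.2]
  let L : (E ⟶ G x) →ₗ[k] ({i // pt i = x} → k) := LinearMap.pi fun i =>
    hx.scalar ∘ₗ Linear.leftComp k (G x) (eqToHom (hG i) ≫ d.inc i.1)
  have hL : ∀ h i, L h i = hx.scalar ((eqToHom (hG i) ≫ d.inc i.1) ≫ h) := fun _ _ => rfl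
  have hsurj : Function.Surjective L := by
    intro c
    refine ⟨∑ i, c i • d.proj i.1 ≫ eqToHom (hG i).symm, funext fun j => ?_⟩
    rw [hL, Preadditive.comp_sum, map_sum, Finset.sum_eq_single j]
    · rw [Linear.comp_smul, map_smul, Category.assoc, ← Category.assoc (d.inc _),
        d.inc_proj_self, Category.id_comp, eqToHom_trans, eqToHom_refl]
      have : hx.scalar (𝟙 (G x)) = 1 := hx.smul_id_inj (by
        rw [← hx.scalar_spec, one_smul])
      rw [this, smul_eq_mul, mul_one]
    · intro i _ hij
      rw [Linear.comp_smul, map_smul, Category.assoc, ← Category.assoc (d.inc _),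
        d.inc_proj_ne _ _ fun h => hij (Subtype.ext h.symm), zero_comp, comp_zero, map_zero,
        smul_zero]
    · exact fun h => (h (Finset.mem_univ _)).elim
  have hker : LinearMap.ker L = radK k E (G x) := by
    ext h
    rw [LinearMap.mem_ker]
    refine Iff.trans ?_ hx.mem_radical_iff.symm
    constructor
    · intro h0 g
      rw [← Category.comp_id g, ← d.total, Preadditive.comp_sum, Preadditive.sum_comp]
      refine Finset.sum_eq_zero fun i _ => ?_
      by_cases hi : pt i = x
      · have h1 : L h ⟨i, hi⟩ = 0 := by rw [h0]; rfl
        rw [hL, hx.scalar_eq_zero_iff] at h1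
        have h2 : g ≫ d.proj i = (g ≫ d.proj i ≫ eqToHom (hG ⟨i, hi⟩).symm) ≫
            eqToHom (hG ⟨i, hi⟩) := by simp
        rw [← Category.assoc g, h2, Category.assoc, Category.assoc, ← Category.assoc (eqToHom _), h1,
          comp_zero]
      · rw [Category.assoc, Category.assoc, ← Category.assoc g]
        exact hne i hi _ _
    · intro h0
      funext i
      rw [hL, h0, map_zero]
      rfl
  rw [← hker, LinearEquiv.finrank_eq (L.quotKerEquivOfSurjective hsurj),
    Module.finrank_fintype_fun_eq_card, Nat.card_eq_fintype_card]

end Decomposition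

/-! ### The representations `I_x` -/

section Injective

universe u v w
variable {k : Type w} [Field k] {Q : Type u} [Quiver.{v} Q]
variable {M N E Y : QRep k Q} {x y z : Paths Q}

/-- The vertices of `Q⁺`. -/
def IsPlus (x : Paths Q) : Prop := ¬ EndsLeftInfinitePath (V := Q) x

/-- Membership in Q⁺ becomes an induction principle along incoming arrows. -/
theorem IsPlus.acc (hx : IsPlus x) : Acc (fun u v : Paths Q => Nonempty (Arr u v)) x := by
  by_contra h
  obtain ⟨f, h0, hf⟩ := not_acc_iff_exists_descending_chain.1 h
  exact hx ⟨f, h0, hf⟩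

theorem IsPlus.of_arr (hy : IsPlus y) (a : Arr x y) : IsPlus x := by
  rintro ⟨f, h0, hf⟩
  refine hy ⟨fun n => Nat.casesOn n y f, rfl, fun n => ?_⟩
  cases n with
  | zero => exact ⟨(h0 ▸ a : Arr (f 0) y)⟩
  | succ n => exact hf n

theorem IsPlus.of_path (hy : IsPlus y) (p : x ⟶ y) : IsPlus x := by
  revert hy
  refine path_induction (fun {y} _ => IsPlus y → IsPlus x) id ?_ p
  exact fun p a ih hz => ih (hz.of_arr a)

/-- König's argument: finite branching at each vertex and no infinite backward path. -/
theorem IsPlus.finite_preds (hQ : StronglyLocallyFinite Q) (hx : IsPlus x) :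
    {v : Paths Q | Nonempty (v ⟶ x)}.Finite := by
  induction hx.acc with
  | intro y _ ih =>
  have := finite_arr_in hQ y
  refine ((Set.finite_singleton y).union (Set.finite_iUnion
    fun s : (Σ u : Paths Q, Arr u y) => ih s.1 ⟨s.2⟩ (hx.of_arr s.2))).subset ?_
  rintro v ⟨p⟩
  rcases path_cases p with ⟨rfl, -⟩ | ⟨u, q, a, -⟩
  · exact Or.inl rfl
  · exact Or.inr (Set.mem_iUnion.2 ⟨⟨u, a⟩, ⟨q⟩⟩)

theorem exists_path_of_injRep_ne_zero {m : (injRep k x).obj y} (hm : m ≠ 0) : Nonempty (y ⟶ x) := by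
  by_contra h
  rw [not_nonempty_iff] at h
  exact hm (Finsupp.ext (M := k) fun p => h.elim p)

theorem isFinDim_injRep (hQ : StronglyLocallyFinite Q) (hx : IsPlus x) :
    IsFinDim (injRep k x) := by
  refine ⟨(hx.finite_preds hQ).subset fun y hy => ?_, fun y => ?_⟩
  · have hy' : Nontrivial ((injRep k x).obj y) := hy
    obtain ⟨m, hm⟩ := exists_ne (0 : (injRep k x).obj y)
    exact exists_path_of_injRep_ne_zero hm
  · have := finite_hom hQ y x
    exact inferInstanceAs (Module.Finite k ((y ⟶ x) →₀ k))

theorem path_of_leftInfinite {a : ℕ → Paths Q} (ha : ∀ n, Nonempty (Arr (a (n + 1)) (a n))) (n : ℕ) :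
    ∀ m, ∃ p : a (n + m) ⟶ a n, len p = m
  | 0 => ⟨𝟙 _, len_id _⟩
  | m + 1 => by
    obtain ⟨p, hp⟩ := path_of_leftInfinite ha n m
    obtain ⟨α⟩ := ha (n + m)
    refine ⟨arr α ≫ p, ?_⟩
    rw [len_comp, len_arr, hp, add_comm]

theorem leftInfinite_injective (hQ : StronglyLocallyFinite Q) {a : ℕ → Paths Q}
    (ha : ∀ n, Nonempty (Arr (a (n + 1)) (a n))) : Function.Injective a := by
  have key : ∀ n m, a n = a (n + m) → m = 0 := by
    intro n m h
    obtain ⟨p, hp⟩ := path_of_leftInfinite ha n m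
    have h1 : ∀ (z : Paths Q) (q : z ⟶ a n), z = a n → len q = 0 := by
      rintro z q rfl
      rw [path_self_eq_id hQ q, len_id]
    rw [← hp, h1 _ p h.symm]
  intro n m h
  rcases le_total n m with hnm | hnm
  · obtain ⟨d, rfl⟩ := Nat.exists_eq_add_of_le hnm
    rw [key n d h, add_zero]
  · obtain ⟨d, rfl⟩ := Nat.exists_eq_add_of_le hnm
    rw [key m d h.symm, add_zero]

/-- The vertices of a left infinite path are pairwise distinct, and all of them lie in the support
of I_x if the path ends at `x`. -/
theorem isPlus_of_isFinDim_injRep (hQ : StronglyLocallyFinite Q) (h : IsFinDim (injRep k x)) :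
    IsPlus x := by
  intro hx
  obtain ⟨a, rfl, ha⟩ : ∃ a : ℕ → Paths Q, a 0 = x ∧ ∀ n, Nonempty (Arr (a (n + 1)) (a n)) := hx
  refine Set.infinite_of_injective_forall_mem (leftInfinite_injective hQ (a := a) ha) (fun n => ?_) h.1
  obtain ⟨p, -⟩ := path_of_leftInfinite (a := a) ha 0 n
  rw [zero_add] at p
  refine ⟨⟨(Finsupp.single p (1 : k) : (a n ⟶ a 0) →₀ k), 0, fun h0 => ?_⟩⟩
  exact one_ne_zero (α := k) ((Finsupp.single_eq_zero (a := p)).1 h0)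

/-- The generator of the socle of `I_x`. -/
def socElt (x : Paths Q) : (injRep k x).obj x := Finsupp.single (𝟙 x) (1 : k)

@[simp] theorem injForm_socElt (x : Paths Q) : injForm (k := k) x (socElt x) = 1 :=
  Finsupp.single_eq_same (M := k)

theorem socElt_ne_zero (x : Paths Q) : socElt (k := k) x ≠ 0 := fun h =>
  one_ne_zero (α := k) (by rw [← injForm_socElt (k := k) x, h, map_zero])

theorem eq_of_injRep_iso (hQ : StronglyLocallyFinite Q) (e : injRep k x ≅ injRep k y) : x = y := by
  have key : ∀ {x y : Paths Q}, (injRep k x ≅ injRep k y) → Nonempty (x ⟶ y) := by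
    intro x y e
    refine exists_path_of_injRep_ne_zero (k := k) (m := ev e.hom x (socElt x))
      fun h => socElt_ne_zero (k := k) x ?_
    have h1 := congrArg (ev e.inv x) h
    rwa [← ev_comp, e.hom_inv_id, ev_id, map_zero] at h1
  obtain ⟨p⟩ := key e
  obtain ⟨q⟩ := key e.symm
  exact eq_of_path_path hQ p q

theorem injForm_injective (hQ : StronglyLocallyFinite Q) (x : Paths Q) :
    Function.Injective (injForm (k := k) x) := fun m m' h =>
  (injRepCoBasis hQ x).ext x m m' fun _ p => by
    rw [path_self_eq_id hQ p, act_id, act_id]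
    exact h

theorem eq_smul_socElt (hQ : StronglyLocallyFinite Q) (m : (injRep k x).obj x) :
    m = injForm x m • socElt x :=
  injForm_injective hQ x (by rw [map_smul, injForm_socElt, smul_eq_mul, mul_one])

theorem eq_smul_id_injRep (hQ : StronglyLocallyFinite Q) (φ : injRep k x ⟶ injRep k x) :
    φ = injForm x (ev φ x (socElt x)) • 𝟙 _ := by
  refine (injRepCoBasis hQ x).hom_ext fun _ m => ?_
  change injForm x (ev φ x m) = injForm x (ev _ x m)
  rw [ev_smul, ev_id, map_smul, smul_eq_mul]
  nth_rewrite 1 [eq_smul_socElt hQ m]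
  rw [map_smul, map_smul, smul_eq_mul, mul_comm]

theorem brick_injRep (hQ : StronglyLocallyFinite Q) (x : Paths Q) : Brick k (injRep k x) :=
  ⟨not_isZero_injRep x, fun φ => ⟨_, eq_smul_id_injRep hQ φ⟩⟩

theorem nakayama_map_sum {P P' : QRep k Q} {ι : Type*} (s : Finset ι) (f : ι → (P ⟶ P')) :
    nakayama.map (∑ i ∈ s, f i) = ∑ i ∈ s, nakayama.map (f i) :=
  hom_ext_ev fun x m => pair_ext fun g => by
    rw [pair_ev, Preadditive.sum_comp, map_sum, ev_sum, map_sum, LinearMap.sum_apply]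
    rfl

/-- A representation with a finite co-basis is a direct sum of representations `I_x`. -/
theorem CoBasis.nonempty_sumDecomp (hQ : StronglyLocallyFinite Q) {ι : Type*} [Fintype ι]
    {pt : ι → Paths Q} (b : CoBasis E pt) : Nonempty (SumDecomp E fun i => injRep k (pt i)) := by
  obtain ⟨P, d, rfl⟩ : ∃ (P : QRep k Q) (d : DualBasis P ι), d.pt = pt :=
    ⟨_, DualBasis.ofIso pt (Iso.refl _), rfl⟩
  obtain ⟨e⟩ := b.nonempty_iso d.coBasis
  have e' := fun i => (injRep_iso_nakayama (k := k) hQ (d.pt i)).some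
  exact ⟨{
    inc := fun i => (e' i).hom ≫ nakayama.map (d.inc i) ≫ e.inv
    proj := fun i => e.hom ≫ nakayama.map (d.proj i) ≫ (e' i).inv
    total := by
      have : ∀ i, (e.hom ≫ nakayama.map (d.proj i) ≫ (e' i).inv) ≫
          ((e' i).hom ≫ nakayama.map (d.inc i) ≫ e.inv) =
          e.hom ≫ nakayama.map (d.proj i ≫ d.inc i) ≫ e.inv := fun i => by simp
      simp only [this]
      rw [← Preadditive.comp_sum, ← Preadditive.sum_comp, ← nakayama_map_sum, d.total]
      simp
    inc_proj_self := fun i => by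
      have : nakayama.map (d.inc i) ≫ nakayama.map (d.proj i) = 𝟙 _ := by
        rw [← Functor.map_comp, d.inc_proj_self, CategoryTheory.Functor.map_id]
      simp only [Category.assoc, Iso.inv_hom_id_assoc]
      rw [reassoc_of% this]
      exact (e' i).hom_inv_id
    inc_proj_ne := fun i j hij => by
      have : nakayama.map (d.inc i) ≫ nakayama.map (d.proj j) = 0 := by
        rw [← Functor.map_comp, d.inc_proj_ne i j hij]
        exact hom_ext_ev fun x m => pair_ext fun g => by simp
      simp only [Category.assoc, Iso.inv_hom_id_assoc]
      rw [reassoc_of% this, zero_comp, comp_zero] }⟩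

/-- The socle of `I_y`. -/
def injSocle (y : Paths Q) : SubRep (injRep k y) where
  carrier v := ⨅ s : (Σ u : Paths Q, (v ⟶ u) × Arr u y),
    LinearMap.ker (injForm y ∘ₗ act (injRep k y) (s.2.1 ≫ arr s.2.2))
  stable a m hm := by
    simp only [Submodule.mem_iInf, LinearMap.mem_ker, LinearMap.comp_apply] at hm ⊢
    intro s
    rw [← act_comp, ← Category.assoc]
    exact hm ⟨s.1, arr a ≫ s.2.1, s.2.2⟩

theorem mem_injSocle_iff {v : Paths Q} {m : (injRep k y).obj v} : m ∈ (injSocle y).carrier v ↔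
    ∀ (u : Paths Q) (q : v ⟶ u) (a : Arr u y), injForm y (act (injRep k y) (q ≫ arr a) m) = 0 := by
  simp only [injSocle, Submodule.mem_iInf, LinearMap.mem_ker, LinearMap.comp_apply]
  exact ⟨fun h u q a => h ⟨u, q, a⟩, fun h s => h s.1 s.2.1 s.2.2⟩

/-- A family of coefficients indexed by the nontrivial paths to `y`, extended by zero. -/
def extendCoeff {v y : Q} (c : ∀ s : (Σ u : Paths Q, Arr u (show Paths Q from y)),
    (Quiver.Path v (show Q from s.1)) → k) : Quiver.Path v y → k
  | .nil => 0
  | .cons q a => c ⟨_, a⟩ q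

/-- The co-basis of the quotient of `I_y` by its socle. -/
theorem nonempty_coBasis_injQuot (hQ : StronglyLocallyFinite Q) (y : Paths Q) :
    Nonempty (CoBasis (injSocle (k := k) y).quot fun s : (Σ u : Paths Q, Arr u y) => s.1) := by
  have hform : ∀ s : (Σ u : Paths Q, Arr u y), ∃ φ : (injSocle (k := k) y).quot.obj s.1 →ₗ[k] k,
      ∀ m, φ (ev (injSocle y).π s.1 m) = injForm y (act (injRep k y) (arr s.2) m) := by
    intro s
    have hle : (injSocle (k := k) y).carrier s.1 ≤
        LinearMap.ker (injForm y ∘ₗ act (injRep k y) (arr s.2)) := fun m hm => by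
      have := mem_injSocle_iff.1 hm s.1 (𝟙 _) s.2
      rwa [Category.id_comp] at this
    exact ⟨Submodule.liftQ _ _ hle, fun m => rfl⟩
  choose φ hφ using hform
  have key : ∀ (v : Paths Q) (s : Σ u : Paths Q, Arr u y) (p : v ⟶ s.1) (m : (injRep k y).obj v),
      φ s (act _ p (ev (injSocle y).π v m)) = injForm y (act (injRep k y) (p ≫ arr s.2) m) := by
    intro v s p m
    rw [← ev_act, hφ, ← act_comp]
  refine ⟨⟨φ, fun v m m' h => ?_, fun v c => ?_⟩⟩
  · obtain ⟨m, rfl⟩ := (injSocle y).π_surjective v m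
    obtain ⟨m', rfl⟩ := (injSocle y).π_surjective v m'
    rw [← sub_eq_zero, ← map_sub, SubRep.π_eq_zero_iff, mem_injSocle_iff]
    intro u q a
    have := h ⟨u, a⟩ q
    rw [key, key] at this
    rw [map_sub, map_sub, sub_eq_zero]
    exact this
  · obtain ⟨m, hm⟩ := (injRepCoBasis (k := k) hQ y).exists_elt v fun _ p => extendCoeff c p
    refine ⟨ev (injSocle y).π v m, fun s p => ?_⟩
    rw [key]
    exact hm () _

end Injective
end QuiverAR
end

noncomputable section
namespace QuiverAR

/-! ### Irreducible morphisms between injective representations -/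

section InjectiveVertex

universe u v w
variable {k : Type w} [Field k] {Q : Type u} [Quiver.{v} Q]
variable {M N E Y : QRep k Q} {x y z : Paths Q}

/-- `I_x` as an object of `rep⁺(Q)`. -/
abbrev injObj (k : Type w) [Field k] (hQ : StronglyLocallyFinite Q) (hx : IsPlus x) : RepPlus k Q :=
  ⟨injRep k x, (isFinDim_injRep hQ hx).isFinPres hQ⟩

theorem brick_injObj (hQ : StronglyLocallyFinite Q) (hx : IsPlus x) : Brick k (injObj k hQ hx) :=
  RepPlus.brick_iff.2 (brick_injRep hQ x)

/-- The quotient of `I_x` by its socle as an object of `rep⁺(Q)`. -/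
abbrev injQuot (k : Type w) [Field k] (hQ : StronglyLocallyFinite Q) (hx : IsPlus x) : RepPlus k Q :=
  ⟨(injSocle (k := k) x).quot, ((isFinDim_injRep hQ hx).of_epi (injSocle x).π).isFinPres hQ⟩

/-- The projection of `I_x` to the quotient by its socle. -/
abbrev injQuotπ (k : Type w) [Field k] (hQ : StronglyLocallyFinite Q) (hx : IsPlus x) :
    injObj k hQ hx ⟶ injQuot k hQ hx := ObjectProperty.homMk (injSocle x).π

theorem exists_path_of_hom_injRep (hQ : StronglyLocallyFinite Q) {f : injRep k x ⟶ injRep k y}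
    (hf : f ≠ 0) : Nonempty (y ⟶ x) := by
  by_contra h
  refine hf ((injRepCoBasis hQ y).hom_ext fun _ m => ?_)
  have : m = 0 := by
    by_contra hm
    exact h (exists_path_of_injRep_ne_zero hm)
  rw [this, map_zero, ev_zero]

/-- If the image of the socle were nonzero, a linear form with value one on it would define, by
coinduction, a retraction of `g`. -/
theorem ev_socElt_eq_zero (hQ : StronglyLocallyFinite Q) (g : injRep k y ⟶ M)
    (hg : ¬ IsSplitMono g) : ev g y (socElt y) = 0 := by
  by_contra h
  obtain ⟨μ, hμ⟩ := Module.Projective.exists_dual_eq_one k h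
  obtain ⟨r, hr⟩ := (injRepCoBasis hQ y).exists_hom (M := M) fun _ => μ
  refine hg ⟨⟨r, ?_⟩⟩
  rw [eq_smul_id_injRep hQ (g ≫ r), ev_comp]
  have := hr () (ev g y (socElt y))
  change injForm y _ = _ at this
  rw [this, hμ, one_smul]

/-- A morphism that is not a split monomorphism kills the socle and so factors through the quotient;
minimality is automatic for an epimorphism. -/
theorem isMinimalLeftAlmostSplit_injQuotπ (hQ : StronglyLocallyFinite Q) (hy : IsPlus y) :
    IsMinimalLeftAlmostSplit (injQuotπ k hQ hy) where
  minimal h hh := by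
    have h1 : (injSocle y).π ≫ h.hom = (injSocle (k := k) y).π :=
      congrArg InducedCategory.Hom.hom hh
    have h2 : h.hom = 𝟙 _ := by
      rw [← cancel_epi (injSocle (k := k) y).π]
      exact h1.trans (Category.comp_id _).symm
    rw [RepPlus.isIso_iff, h2]
    infer_instance
  not_section h := by
    obtain ⟨⟨r⟩⟩ := (RepPlus.isSplitMono_iff _).1 h
    have h1 : ev (injSocle (k := k) y).π y (socElt y) = 0 := by
      rw [SubRep.π_eq_zero_iff, mem_injSocle_iff]
      intro u q a
      rw [path_self_eq_id hQ (q ≫ arr a)]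
      have h2 := len_comp q (arr a)
      rw [path_self_eq_id hQ (q ≫ arr a), len_id, len_arr] at h2
      omega
    have h2 := congrArg (fun t => ev t y (socElt y)) r.id
    have h3 : ev r.retraction y (ev (injSocle (k := k) y).π y (socElt y)) = socElt y := by
      rw [← ev_comp]
      exact h2.trans (ev_id _)
    rw [h1, map_zero] at h3
    exact socElt_ne_zero y h3.symm
  factors Z g hg := by
    have h0 := ev_socElt_eq_zero hQ g.hom fun h => hg ((RepPlus.isSplitMono_iff _).2 h)
    obtain ⟨t, ht⟩ := exists_factor_epi (injSocle (k := k) y).π g.hom fun x m hm => by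
      rw [SubRep.π_eq_zero_iff] at hm
      by_cases hxy : x = y
      · subst hxy
        rw [eq_smul_socElt hQ m, map_smul]
        exact (congrArg _ h0).trans (smul_zero _)
      · have : m = 0 := by
          refine (injRepCoBasis hQ y).ext x m 0 fun _ p => ?_
          rcases path_cases p with ⟨h, -⟩ | ⟨u, q, a, rfl⟩
          · exact (hxy h).elim
          · rw [map_zero, map_zero]
            exact mem_injSocle_iff.1 hm u q a
        rw [this, map_zero]
    exact ⟨ObjectProperty.homMk t, ObjectProperty.hom_ext _ ht⟩

theorem nonempty_sumDecomp_injQuot (hQ : StronglyLocallyFinite Q) (hy : IsPlus y)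
    [Fintype (Σ u : Paths Q, Arr u y)] : Nonempty (SumDecomp (injQuot k hQ hy)
      fun s : (Σ u : Paths Q, Arr u y) => injObj k hQ (hy.of_arr s.2)) := by
  obtain ⟨b⟩ := nonempty_coBasis_injQuot (k := k) hQ y
  obtain ⟨d⟩ := b.nonempty_sumDecomp hQ
  exact ⟨{
    inc := fun i => ObjectProperty.homMk (d.inc i)
    proj := fun i => ObjectProperty.homMk (d.proj i)
    total := by
      refine ObjectProperty.hom_ext _ ?_
      have := (isFinPres k Q).ι.map_sum (fun i => (ObjectProperty.homMk (d.proj i) :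
        injQuot k hQ hy ⟶ injObj k hQ (hy.of_arr i.2)) ≫
          (ObjectProperty.homMk (d.inc i) : injObj k hQ (hy.of_arr i.2) ⟶ injQuot k hQ hy))
        Finset.univ
      exact this.trans d.total
    inc_proj_self := fun i => ObjectProperty.hom_ext _ (d.inc_proj_self i)
    inc_proj_ne := fun i j h => ObjectProperty.hom_ext _ (d.inc_proj_ne i j h) }⟩

/-- The quotient of `I_y` by its socle contains one copy of `I_x` for each arrow from `x` to `y`;
summands at other vertices contribute nothing, since a nonzero composite through them would produce
an oriented cycle. -/
theorem irrDimK_injObj (hQ : StronglyLocallyFinite Q) (hx : IsPlus x) (hy : IsPlus y) :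
    irrDimK k (injObj k hQ hy) (injObj k hQ hx) = Nat.card (Arr x y) := by
  have := finite_arr_in hQ y
  have := Fintype.ofFinite (Σ u : Paths Q, Arr u y)
  obtain ⟨d⟩ := nonempty_sumDecomp_injQuot (k := k) hQ hy
  rw [irrDimK_of_left (brick_injObj hQ hy).local (isMinimalLeftAlmostSplit_injQuotπ hQ hy)]
  let G : {u : Paths Q // IsPlus u} → RepPlus k Q := fun u => injObj k hQ u.2
  let pt : (Σ u : Paths Q, Arr u y) → {u : Paths Q // IsPlus u} := fun s => ⟨s.1, hy.of_arr s.2⟩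
  have hd : SumDecomp (injQuot k hQ hy) fun s => G (pt s) := d
  have key := hd.finrank_hom_quot_radK (⟨x, hx⟩ : {u : Paths Q // IsPlus u})
    (brick_injObj (k := k) hQ hx) fun s hs g h => by
      by_contra hne
      have h1 : g.hom ≫ h.hom ≠ 0 := fun h0 => hne (ObjectProperty.hom_ext _ h0)
      have h2 : g.hom ≠ 0 := fun h0 => h1 (by rw [h0, zero_comp])
      have h3 : h.hom ≠ 0 := fun h0 => h1 (by rw [h0, comp_zero])
      obtain ⟨p⟩ := exists_path_of_hom_injRep hQ h2
      obtain ⟨q⟩ := exists_path_of_hom_injRep hQ h3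
      exact hs (Subtype.ext (eq_of_path_path hQ p q))
  rw [key]
  refine Nat.card_congr ?_
  exact
    { toFun := fun s => Eq.rec (motive := fun u _ => Arr u y) s.1.2 (congrArg Subtype.val s.2 : s.1.1 = x)
      invFun := fun a => ⟨⟨x, a⟩, rfl⟩
      left_inv := by
        rintro ⟨⟨u, a⟩, h⟩
        obtain rfl : u = x := congrArg Subtype.val h
        rfl
      right_inv := fun a => rfl }

theorem exists_iso_injRep_of_hasIrr (hQ : StronglyLocallyFinite Q) (hy : IsPlus y)
    {Y : RepPlus k Q} (hY : Indec Y.obj) (h : HasIrr (injObj k hQ hy) Y) :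
    ∃ (u : Paths Q) (_ : Arr u y), Nonempty (Y.obj ≅ injRep k u) := by
  have := finite_arr_in hQ y
  have := Fintype.ofFinite (Σ u : Paths Q, Arr u y)
  obtain ⟨d⟩ := nonempty_sumDecomp_injQuot (k := k) hQ hy
  obtain ⟨h, hh⟩ := (hasIrr_iff_of_left (brick_injObj hQ hy).local
    (isMinimalLeftAlmostSplit_injQuotπ hQ hy)).1 h
  obtain ⟨s, hs⟩ := d.exists_notMem_radical hh
  have hsm : IsSplitMono (d.inc s ≫ h) := by
    by_contra hcon
    exact hs ((brick_injObj hQ (hy.of_arr s.2)).local.mem_radical hcon)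
  obtain ⟨⟨r⟩⟩ := (RepPlus.isSplitMono_iff _).1 hsm
  have := (hY.isIso_of_retract r.id (not_isZero_injRep s.1)).1
  exact ⟨s.1, s.2, ⟨(asIso (d.inc s ≫ h).hom).symm⟩⟩

/-- No almost split sequence starts at `I_y`. -/
theorem not_isAlmostSplitSequence_injObj (hQ : StronglyLocallyFinite Q) (hy : IsPlus y)
    {E Z : RepPlus k Q} (f : injObj k hQ hy ⟶ E) (g : E ⟶ Z) : ¬ IsAlmostSplitSequence f g := by
  intro h
  -- The left almost split morphism `f` must agree up to isomorphism with the epimorphism onto the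
  -- quotient by the socle, and then `f ≫ g = 0` forces `g = 0`.
  have hπ := isMinimalLeftAlmostSplit_injQuotπ (k := k) hQ hy
  obtain ⟨a, ha⟩ := hπ.factors E f h.left.not_section
  obtain ⟨b, hb⟩ := h.left.factors _ _ hπ.not_section
  have hi := h.left.minimal (b ≫ a) (by rw [← Category.assoc, hb, ha])
  have h1 : (injSocle y).π ≫ a.hom ≫ g.hom = 0 := by
    rw [← Category.assoc]
    have := h.comp_eq_zero
    rw [← ha] at this
    exact congrArg InducedCategory.Hom.hom this
  have h2 : a ≫ g = 0 := by
    refine ObjectProperty.hom_ext _ ?_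
    rw [← cancel_epi (injSocle (k := k) y).π]
    exact h1.trans comp_zero.symm
  refine h.right_ne_zero ?_
  rw [← cancel_epi (b ≫ a), Category.assoc, h2, comp_zero, comp_zero]

end InjectiveVertex
end QuiverAR
end

noncomputable section
namespace QuiverAR

/-! ### Infinite dimensional sources of irreducible morphisms -/

section Intervals

universe u v w
variable {k : Type w} [Field k] {Q : Type u} [Quiver.{v} Q]
variable {M N P Z : QRep k Q} {x y z b : Paths Q}

theorem finite_factorizations (hQ : StronglyLocallyFinite Q) (r : x ⟶ y) :
    {v : Paths Q | ∃ (p : x ⟶ v) (q : v ⟶ y), p ≫ q = r}.Finite := by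
  refine path_induction (fun {y} r => {v : Paths Q | ∃ (p : x ⟶ v) (q : v ⟶ y), p ≫ q = r}.Finite)
    ?_ ?_ r
  · refine (Set.finite_singleton x).subset ?_
    rintro v ⟨p, q, _⟩
    exact (eq_of_path_path hQ p q).symm
  · intro y z r a ih
    refine (ih.union (Set.finite_singleton z)).subset ?_
    rintro v ⟨p, q, h⟩
    rcases path_cases q with ⟨rfl, _⟩ | ⟨t, q', a', rfl⟩
    · exact Or.inr rfl
    · left
      rw [← Category.assoc] at h
      obtain ⟨h1, h2⟩ := arr_comp_injective _ _ _ _ h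
      cases h1
      exact ⟨p, q', eq_of_heq h2⟩

/-- There are finitely many vertices between two given vertices. -/
theorem finite_between (hQ : StronglyLocallyFinite Q) (x y : Paths Q) :
    {v : Paths Q | Nonempty (x ⟶ v) ∧ Nonempty (v ⟶ y)}.Finite := by
  have := finite_hom hQ x y
  refine (Set.finite_iUnion fun r : x ⟶ y => finite_factorizations hQ r).subset ?_
  rintro v ⟨⟨p⟩, ⟨q⟩⟩
  exact Set.mem_iUnion.2 ⟨p ≫ q, p, q, rfl⟩

/-- Only finitely many vertices of the support of a rooted representation are predecessors of
vertices of a given finite set. -/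
theorem Rooted.finite_preds (hQ : StronglyLocallyFinite Q) (hM : Rooted M) {F : Set (Paths Q)}
    (hF : F.Finite) :
    {v : Paths Q | (∃ m : M.obj v, m ≠ 0) ∧ ∃ t ∈ F, Nonempty (v ⟶ t)}.Finite := by
  obtain ⟨S, hS, h⟩ := hM
  refine (hS.biUnion fun s _ => hF.biUnion fun t _ => finite_between hQ s t).subset ?_
  rintro v ⟨⟨m, hm⟩, t, ht, ⟨q⟩⟩
  obtain ⟨s, hs, ⟨p⟩⟩ := h v m hm
  exact Set.mem_biUnion hs (Set.mem_biUnion ht ⟨⟨p⟩, ⟨q⟩⟩)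

/-- The subrepresentation of the elements supported outside a set closed under predecessors. -/
def outside (M : QRep k Q) (T : Set (Paths Q)) (hT : ∀ {x y : Paths Q}, Arr x y → y ∈ T → x ∈ T) :
    SubRep M where
  carrier v := ⨅ _ : v ∈ T, ⊥
  stable {x y} a m hm := by
    simp only [Submodule.mem_iInf, Submodule.mem_bot] at hm ⊢
    intro hy
    rw [hm (hT a hy), map_zero]

theorem mem_outside_iff {T : Set (Paths Q)} (hT : ∀ {x y : Paths Q}, Arr x y → y ∈ T → x ∈ T)
    {v : Paths Q} {m : M.obj v} : m ∈ (outside M T hT).carrier v ↔ (v ∈ T → m = 0) := by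
  simp [outside, Submodule.mem_iInf]

theorem exists_ne_zero_of_nontrivial {v : Paths Q} (h : Nontrivial (M.obj v)) :
    ∃ m : M.obj v, m ≠ 0 := exists_ne 0

theorem isFinDim_of_support (h : {v : Paths Q | ∃ m : M.obj v, m ≠ 0}.Finite) (hM : PtFin M) :
    IsFinDim M :=
  ⟨h.subset fun _ hv => exists_ne_zero_of_nontrivial hv, hM⟩

theorem IsFinDim.finite_support (h : IsFinDim M) : {v : Paths Q | ∃ m : M.obj v, m ≠ 0}.Finite :=
  h.1.subset fun _ ⟨m, hm⟩ => ⟨⟨m, 0, hm⟩⟩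

/-- There is no irreducible morphism from an infinite dimensional indecomposable representation to
a finite dimensional one. -/
theorem not_hasIrr_of_not_isFinDim (hQ : StronglyLocallyFinite Q) {Y X : RepPlus k Q}
    (hY : Indec Y.obj) (hYd : ¬ IsFinDim Y.obj) (hX : LocalObj X.obj) (hXd : IsFinDim X.obj) :
    ¬ HasIrr Y X := by
  rintro ⟨r, _, hr⟩
  apply hr
  obtain ⟨-, hroot, hpt⟩ := finGen_rooted_ptFin hQ Y.property
  set F : Set (Paths Q) := {v | ∃ m : X.obj.obj v, m ≠ 0} with hF
  have hFf : F.Finite := hXd.finite_support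
  -- Ends of arrows leaving the support of `X` are added so that, when a morphism from `X` is lifted
  -- to `Y`, its compatibility with these arrows can be tested at vertices of `T`, where `Y` and the
  -- quotient `S.quot` agree.
  set F' : Set (Paths Q) := F ∪ {v | ∃ u ∈ F, Nonempty (Arr u v)} with hF'
  have hF'f : F'.Finite := by
    refine hFf.union ?_
    refine (hFf.biUnion (t := fun u => {v | Nonempty (Arr u v)}) fun u _ => ?_).subset ?_
    · have := finite_arr_out hQ u
      refine (Set.finite_range fun s : (Σ y : Paths Q, Arr u y) => s.1).subset ?_
      rintro v ⟨a⟩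
      exact ⟨⟨v, a⟩, rfl⟩
    · rintro v ⟨u, hu, a⟩
      exact Set.mem_biUnion hu a
  set T : Set (Paths Q) := {v | ∃ t ∈ F', Nonempty (v ⟶ t)} with hTdef
  have hT : ∀ {x y : Paths Q}, Arr x y → y ∈ T → x ∈ T := by
    rintro x y a ⟨t, ht, ⟨p⟩⟩
    exact ⟨t, ht, ⟨arr a ≫ p⟩⟩
  have hF'T : F' ⊆ T := fun v hv => ⟨v, hv, ⟨𝟙 v⟩⟩
  set S := outside Y.obj T hT with hS
  have hinj : ∀ v ∈ T, ∀ m, ev S.π v m = 0 → m = 0 := fun v hv m hm =>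
    (mem_outside_iff hT).1 ((S.π_eq_zero_iff m).1 hm) hv
  have hMd : IsFinDim S.quot := by
    refine isFinDim_of_support ((hroot.finite_preds hQ hF'f).subset ?_) (hpt.of_epi S.π)
    rintro v ⟨n, hn⟩
    obtain ⟨m, rfl⟩ := S.π_surjective v n
    refine ⟨⟨m, fun h => hn (by rw [h, map_zero])⟩, ?_⟩
    by_contra hv
    exact hn ((S.π_eq_zero_iff m).2 ((mem_outside_iff hT).2 fun h => absurd h hv))
  -- The support of `X` lies in `T`, so `r` kills the part of `Y` outside `T` and factors through a
  -- finite dimensional quotient. It remains to see that both factors are radical.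
  obtain ⟨t, ht⟩ := exists_factor_epi S.π r.hom (by
    intro v m hm
    by_contra hne
    exact hne (by rw [hinj v (hF'T (Or.inl ⟨_, hne⟩)) m hm, map_zero]))
  have hπ : S.π ∈ radical Y.obj S.quot := by
    by_contra h
    obtain ⟨h', hh'⟩ := exists_notMem_radical_swap ⟨_, h⟩
    exact hYd (hY.isFinDim_of_notMem_radical hMd hh')
  -- A section of `t` would lift to `Y`, because the projection is bijective on `T`; then `X` would
  -- be a retract of `Y`, hence isomorphic to it.
  have htr : t ∈ radical S.quot X.obj := by
    refine hX.mem_radical' fun hsp => ?_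
    obtain ⟨⟨s, hs⟩⟩ := hsp
    have hbij : ∀ v : T, Function.Bijective (ev S.π v.1) := fun v =>
      ⟨(injective_iff_map_eq_zero _).2 fun m hm => hinj v.1 v.2 m hm, S.π_surjective v.1⟩
    classical
    let φ : ∀ v : Paths Q, X.obj.obj v →ₗ[k] Y.obj.obj v := fun v =>
      if h : v ∈ T then
        (LinearEquiv.ofBijective (ev S.π v) (hbij ⟨v, h⟩)).symm.toLinearMap ∘ₗ ev s v
      else 0
    have hφ : ∀ v ∈ T, ∀ m, ev S.π v (φ v m) = ev s v m := by
      intro v hv m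
      simp only [φ, dif_pos hv]
      exact (LinearEquiv.ofBijective (ev S.π v) (hbij ⟨v, hv⟩)).apply_symm_apply _
    let s' : X.obj ⟶ Y.obj := homOf φ (by
      intro v v' a m
      by_cases hm : m = 0
      · simp [hm]
      have hv : v ∈ F := ⟨m, hm⟩
      have hv' : v' ∈ T := hF'T (Or.inr ⟨v, hv, ⟨a⟩⟩)
      apply (hbij ⟨v', hv'⟩).1
      rw [hφ v' hv', ev_act, ev_act, hφ v (hF'T (Or.inl hv))])
    have hs' : s' ≫ r.hom = 𝟙 X.obj := by
      rw [← ht, ← hs]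
      refine hom_ext_ev fun v m => ?_
      by_cases hm : m = 0
      · simp [hm]
      rw [ev_comp, ev_comp, ev_homOf, hφ v (hF'T (Or.inl ⟨m, hm⟩)), ev_comp]
    have := (hY.isIso_of_retract hs' hX.indec.1).1
    exact hYd (hXd.of_iso (asIso s'))
  let M' : RepPlus k Q := ⟨S.quot, hMd.isFinPres hQ⟩
  have e : r = (ObjectProperty.homMk S.π : Y ⟶ M') ≫ (ObjectProperty.homMk t : M' ⟶ X) :=
    ObjectProperty.hom_ext _ ht.symm
  rw [e]
  exact comp_mem_radicalSq ((RepPlus.mem_radical_iff _).2 hπ) ((RepPlus.mem_radical_iff _).2 htr)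

end Intervals

/-! ### Extensions along an arrow -/

section Extensions

universe u v w
variable {k : Type w} [Field k] {Q : Type u} [Quiver.{v} Q]
variable {Z P : QRep k Q}

/-- The extension of `Z` by `P` given by a family of linear maps along the arrows. -/
def extRep (Z P : QRep k Q) (c : ∀ u v : Paths Q, Arr u v → (Z.obj u →ₗ[k] P.obj v)) : QRep k Q :=
  Paths.lift
    { obj := fun v : Q => ModuleCat.of k (Z.obj v × P.obj v)
      map := fun {u v} a => ModuleCat.ofHom
        (LinearMap.prod (act Z (arr a) ∘ₗ LinearMap.fst k _ _)
          (act P (arr a) ∘ₗ LinearMap.snd k _ _ + c u v a ∘ₗ LinearMap.fst k _ _)) }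

variable {c : ∀ u v : Paths Q, Arr u v → (Z.obj u →ₗ[k] P.obj v)} {x y : Paths Q}

theorem act_extRep (a : Arr x y) (m : Z.obj x × P.obj x) :
    act (extRep Z P c) (arr a) m =
      ((act Z (arr a) m.1, act P (arr a) m.2 + c x y a m.1) : Z.obj y × P.obj y) := by
  have := Paths.lift_toPath (V := Q)
    { obj := fun v : Q => ModuleCat.of k (Z.obj v × P.obj v)
      map := fun {u v} a => ModuleCat.ofHom
        (LinearMap.prod (act Z (arr a) ∘ₗ LinearMap.fst k _ _)
          (act P (arr a) ∘ₗ LinearMap.snd k _ _ + c u v a ∘ₗ LinearMap.fst k _ _)) } a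
  exact congrArg (fun f => f.hom m) this

variable (c) in
/-- The inclusion of `P` in the extension of `Z` by `P`. -/
def extInc : P ⟶ extRep Z P c :=
  homOf (N := extRep Z P c) (fun _ => LinearMap.inr k _ _) fun x y a m => by
    refine Eq.trans ?_ (act_extRep (c := c) a ((0, m) : Z.obj x × P.obj x)).symm
    refine Prod.ext (map_zero (act Z (arr a))).symm ?_
    change act P (arr a) m = act P (arr a) m + c x y a 0
    rw [map_zero, add_zero]

variable (c) in
/-- The projection to `Z` of the extension of `Z` by `P`. -/
def extProj : extRep Z P c ⟶ Z :=
  homOf (M := extRep Z P c) (fun _ => LinearMap.fst k _ _) fun _ _ a m =>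
    congrArg Prod.fst (act_extRep (c := c) a m)

variable (c) in
theorem extInc_extProj : extInc c ≫ extProj c = 0 := hom_ext_ev fun _ _ => rfl

variable (c) in
theorem extRep_shortExact : (ShortComplex.mk _ _ (extInc_extProj c)).ShortExact :=
  shortExact_of_ev _ (fun _ => LinearMap.inr_injective) (fun _ => LinearMap.fst_surjective)
    fun x n hn => ⟨n.2, Prod.ext (show (0 : Z.obj x) = n.1 from hn.symm) rfl⟩

/-- A morphism killed by the family of linear maps lifts to the extension. -/
theorem exists_lift_extProj {Y : QRep k Q} (h : Y ⟶ Z)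
    (hc : ∀ (u v : Paths Q) (a : Arr u v) (m : Y.obj u), c u v a (ev h u m) = 0) :
    ∃ s : Y ⟶ extRep Z P c, s ≫ extProj c = h := by
  refine ⟨homOf (N := extRep Z P c) (fun v => LinearMap.prod (ev h v) 0) ?_, hom_ext_ev fun _ _ => rfl⟩
  intro x y a m
  refine Eq.trans ?_ (act_extRep (c := c) a ((ev h x m, 0) : Z.obj x × P.obj x)).symm
  refine Prod.ext ?_ ?_
  · exact ev_act h (arr a) m
  · change 0 = act P (arr a) 0 + c x y a (ev h x m)
    rw [hc, map_zero, add_zero]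

/-- The family of linear maps concentrated on one arrow. -/
def single {b z : Paths Q} (β : Arr b z) (φ : Z.obj b →ₗ[k] P.obj z) :
    ∀ u v : Paths Q, Arr u v → (Z.obj u →ₗ[k] P.obj v) := fun u v a => by
  classical
  exact if h : (⟨u, ⟨v, a⟩⟩ : Σ u : Paths Q, Σ v : Paths Q, Arr u v) = ⟨b, ⟨z, β⟩⟩ then
    (by cases h; exact φ) else 0

theorem single_self {b z : Paths Q} (β : Arr b z) (φ : Z.obj b →ₗ[k] P.obj z) :
    single β φ b z β = φ := by
  simp [single]

theorem single_of_forall {b z : Paths Q} (β : Arr b z) (φ : Z.obj b →ₗ[k] P.obj z) {u v : Paths Q}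
    (a : Arr u v) {m : Z.obj u} (hm : u = b → m = 0) : single β φ u v a m = 0 := by
  classical
  unfold single
  split_ifs with h
  · rw [hm (congrArg Sigma.fst h), map_zero]
  · rfl

/-- As `P` vanishes at `b` and `Z` at `z`, a section sends `m` to `(m, 0)` at `b`, and its
compatibility with the arrow `β` reads `φ m = 0`. -/
theorem not_isSplitEpi_extProj {b z : Paths Q} (β : Arr b z) (φ : Z.obj b →ₗ[k] P.obj z)
    (hZ : ∀ m : Z.obj z, m = 0) (hP : ∀ m : P.obj b, m = 0) (hφ : φ ≠ 0) :
    ¬ IsSplitEpi (extProj (single β φ)) := by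
  rintro ⟨⟨s, hs⟩⟩
  apply hφ
  refine LinearMap.ext fun m => ?_
  have h1 := ev_act s (arr β) m
  have h2 : ev s b m = ((m, 0) : Z.obj b × P.obj b) := by
    refine Prod.ext ?_ (hP _)
    exact (ev_comp s (extProj (single β φ)) m).symm.trans (by rw [hs, ev_id])
  rw [hZ (act Z (arr β) m), map_zero, h2] at h1
  have h3 := congrArg Prod.snd (h1.trans (act_extRep (c := single β φ) β ((m, 0) : Z.obj b × P.obj b)))
  simp only [map_zero, zero_add, single_self] at h3
  exact h3.symm

end Extensions

end QuiverAR
end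

noncomputable section
namespace QuiverAR

/-! ### The boundary of `Q⁺` -/

section Boundary

universe u v w
variable {k : Type w} [Field k] {Q : Type u} [Quiver.{v} Q]
variable {M N P Z : QRep k Q} {x y z b : Paths Q}

/-- The support is contained in `Q⁺`. -/
def SuppPlus (M : QRep k Q) : Prop := ∀ (v : Paths Q) (m : M.obj v), m ≠ 0 → IsPlus v

/-- The support contains the starting point of an arrow which ends outside `Q⁺`. -/
def MeetsBoundary (M : QRep k Q) : Prop :=
  ∃ (b z : Paths Q) (_ : Arr b z) (m : M.obj b), ¬ IsPlus z ∧ m ≠ 0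

theorem SuppPlus.of_mono (h : SuppPlus M) (f : N ⟶ M) [Mono f] : SuppPlus N := fun v n hn =>
  h v (ev f v n) fun h0 => hn (injective_ev f v (by rw [h0, map_zero]))

theorem SuppPlus.eq_zero (h : SuppPlus M) {v : Paths Q} (hv : ¬ IsPlus v) (m : M.obj v) : m = 0 := by
  by_contra hm
  exact hv (h v m hm)

theorem suppPlus_injRep (hx : IsPlus x) : SuppPlus (injRep k x) := fun v _ hm => by
  obtain ⟨p⟩ := exists_path_of_injRep_ne_zero hm
  exact hx.of_path p

theorem SumDecomp.ev_total {ι : Type*} [Fintype ι] {F : ι → QRep k Q} (d : SumDecomp M F)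
    {v : Paths Q} (m : M.obj v) : ∑ i, ev (d.inc i) v (ev (d.proj i) v m) = m := by
  have := congrArg (fun f => ev f v m) d.total
  simpa using this

theorem isFinDim_of_sumDecomp {ι : Type*} [Fintype ι] {F : ι → QRep k Q} (d : SumDecomp M F)
    (h : ∀ i, IsFinDim (F i)) : IsFinDim M := by
  refine isFinDim_of_support ((Set.finite_iUnion fun i => (h i).finite_support).subset ?_) ?_
  · rintro v ⟨m, hm⟩
    by_contra hv
    simp only [Set.mem_iUnion, Set.mem_ofPred_eq, not_exists, not_not] at hv
    exact hm (by rw [← d.ev_total m]; simp [hv])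
  · intro v
    have := fun i => (h i).2 v
    refine Module.Finite.of_injective (LinearMap.pi fun i => ev (d.proj i) v) ?_
    intro m m' hmm
    rw [← d.ev_total m, ← d.ev_total m']
    exact Finset.sum_congr rfl fun i _ => congrArg _ (congrFun hmm i)

theorem suppPlus_of_sumDecomp {ι : Type*} [Fintype ι] {F : ι → QRep k Q} (d : SumDecomp M F)
    (h : ∀ i, SuppPlus (F i)) : SuppPlus M := by
  intro v m hm
  by_contra hv
  exact hm (by rw [← d.ev_total m]; simp [fun i => (h i).eq_zero hv])

theorem DualBasis.isFinDim_nakayama (hQ : StronglyLocallyFinite Q) {ι : Type*} [Fintype ι]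
    (b : DualBasis P ι) (h : ∀ i, IsPlus (b.pt i)) :
    IsFinDim (nakayama.obj P) ∧ SuppPlus (nakayama.obj P) := by
  obtain ⟨d⟩ := b.coBasis.nonempty_sumDecomp hQ
  exact ⟨isFinDim_of_sumDecomp d fun i => isFinDim_injRep hQ (h i),
    suppPlus_of_sumDecomp d fun i => suppPlus_injRep (h i)⟩

theorem isFinPres_of_isFinProj (hQ : StronglyLocallyFinite Q) (hP : IsFinProj P) : isFinPres k Q P := by
  refine isFinPres_of_finGen_kernel hQ hP (𝟙 P) ?_
  refine Set.finite_empty.subset fun y hy => hy ?_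
  refine Submodule.eq_top_iff'.2 fun m => ?_
  have h := ev_kernel_ι (𝟙 P) m
  rw [ev_id] at h
  have : m = 0 := injective_ev (kernel.ι (𝟙 P)) y (by rw [h, map_zero])
  rw [this]
  exact Submodule.zero_mem _

theorem isFinProj_projRep (x : Paths Q) : IsFinProj (projRep k x) :=
  ⟨1, fun _ => x, ⟨(biproductUniqueIso (fun _ : Fin 1 => projRep k x)).symm⟩⟩

theorem projRep_eq_zero_of_isPlus (hb : IsPlus b) (hz : ¬ IsPlus z)
    (m : (projRep k z).obj b) : m = 0 := by
  by_contra hm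
  obtain ⟨p⟩ := exists_path_of_ne_zero hm
  exact hz (hb.of_path p)

/-- No almost split sequence ends at a representation which meets the boundary. -/
theorem MeetsBoundary.not_isAlmostSplitSequence (hQ : StronglyLocallyFinite Q) {X E Z : RepPlus k Q}
    (hZ : SuppPlus Z.obj) (hB : MeetsBoundary Z.obj) (f : X ⟶ E) (g : E ⟶ Z) :
    ¬ IsAlmostSplitSequence f g := by
  intro h
  obtain ⟨b, z, β, m, hz, hm⟩ := hB
  have hb := hZ b m hm
  obtain ⟨l, hl⟩ := Module.Projective.exists_dual_eq_one k hm
  obtain ⟨a, rfl, ha⟩ : ∃ a : ℕ → Paths Q, a 0 = z ∧ ∀ n, Nonempty (Arr (a (n + 1)) (a n)) :=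
    not_not.1 hz
  have hnp : ∀ n, ¬ IsPlus (a n) := fun n =>
    not_not.2 ⟨fun i => a (n + i), rfl, fun i => ha (n + i)⟩
  have hpath : ∀ n, ∃ p : (a n) ⟶ (a 0), len p = n := fun n => by
    have := path_of_leftInfinite (a := a) ha 0 n
    rwa [zero_add] at this
  -- The nonsplit extension of `Z` by P_{a n} along `β` lifts through `g`, which induces a morphism
  -- from P_{a n} to `X`. If it vanished, the lift would descend to a section of `g`; so `X` is
  -- nonzero at every vertex of the left infinite path.
  have key : ∀ n, ∃ t : X.obj.obj (a n), t ≠ 0 := by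
    intro n
    obtain ⟨p, -⟩ := hpath n
    let φ : Z.obj.obj b →ₗ[k] (projRep k (a n)).obj (a 0) :=
      l.smulRight (pathElt p)
    have hφ : φ ≠ 0 := fun h0 => pathElt_ne_zero (k := k) p (by
      have := congrArg (fun φ => φ m) h0
      simpa [φ, hl] using this)
    have hns := not_isSplitEpi_extProj β φ (hZ.eq_zero hz)
      (projRep_eq_zero_of_isPlus hb (hnp n)) hφ
    have hS := extRep_shortExact (single β φ)
    let V : RepPlus k Q := ⟨extRep Z.obj (projRep k (a n)) (single β φ),
      isFinPres_of_extension (isFinPres_of_isFinProj hQ (isFinProj_projRep _)) Z.property hS⟩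
    let P' : RepPlus k Q := ⟨projRep k (a n),
      isFinPres_of_isFinProj hQ (isFinProj_projRep _)⟩
    obtain ⟨s, hs⟩ := h.right.factors V (ObjectProperty.homMk (extProj (single β φ)))
      (fun h0 => hns ((RepPlus.isSplitEpi_iff _).1 h0))
    have hs' : s.hom ≫ g.hom = extProj (single β φ) := congrArg InducedCategory.Hom.hom hs
    let i : P' ⟶ V := ObjectProperty.homMk (extInc (single β φ))
    obtain ⟨t, ht⟩ := h.pseudoKernel P' (i ≫ s) (ObjectProperty.hom_ext _ (by
      change (extInc (single β φ) ≫ s.hom) ≫ g.hom = 0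
      rw [Category.assoc, hs', extInc_extProj]))
    refine ⟨ev t.hom _ (pathElt (𝟙 _)), fun h0 => ?_⟩
    have ht0 : t.hom = 0 := hom_ext_yon (by rw [h0, ev_zero])
    have h1 : extInc (single β φ) ≫ s.hom = 0 := by
      have := congrArg InducedCategory.Hom.hom ht
      change t.hom ≫ f.hom = extInc (single β φ) ≫ s.hom at this
      rw [← this, ht0, zero_comp]
    obtain ⟨s', hs''⟩ := exists_desc_of_shortExact hS s.hom h1
    refine h.right.not_retraction ((RepPlus.isSplitEpi_iff _).2 ⟨⟨s', ?_⟩⟩)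
    have := hS.epi_g
    refine (cancel_epi (extProj (single β φ))).1 ?_
    rw [← Category.assoc, hs'', hs', Category.comp_id]
  -- This contradicts rootedness: paths from the finitely many roots of `X` to `a 0` through `a n`
  -- have length at least `n`.
  obtain ⟨-, ⟨S, hSf, hS⟩, -⟩ := finGen_rooted_ptFin hQ X.property
  have hfin : (⋃ s ∈ S, Set.range fun p : s ⟶ (a 0) => len p).Finite :=
    hSf.biUnion fun s _ => by
      have := finite_hom hQ s (a 0)
      exact Set.finite_range _
  obtain ⟨B, hBd⟩ := hfin.bddAbove
  obtain ⟨t, ht⟩ := key (B + 1)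
  obtain ⟨s, hs, ⟨p⟩⟩ := hS _ t ht
  obtain ⟨q, hq⟩ := hpath (B + 1)
  have := hBd (Set.mem_biUnion hs ⟨p ≫ q, rfl⟩)
  simp only [len_comp, hq] at this
  omega

/-- `DTr Z` is finite dimensional and supported in `Q⁺` if `Z` is supported in `Q⁺` and does not meet
the boundary. -/
theorem IsMinimalProjRes.isFinDim_kernel (hQ : StronglyLocallyFinite Q) {S : ShortComplex (QRep k Q)}
    (hS : IsMinimalProjRes S) (hZ : SuppPlus S.X₃) (hB : ¬ MeetsBoundary S.X₃) :
    IsFinDim (kernel (nakayama.map S.f)) ∧ SuppPlus (kernel (nakayama.map S.f)) := by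
  obtain ⟨n₀, ⟨b₀⟩⟩ := hS.proj₀.exists_dualBasis
  obtain ⟨n₁, ⟨b₁⟩⟩ := hS.proj₁.exists_dualBasis
  have := hS.shortExact.mono_f
  have := hS.shortExact.epi_g
  -- A summand of P₀ at a vertex outside Q⁺ maps to zero in Z. By minimality the complementary
  -- idempotent is still an epimorphism, which forces the projection to that summand to vanish.
  have h₀ : ∀ i, IsPlus (b₀.pt i) := by
    intro i
    by_contra hi
    have h1 : b₀.inc i ≫ S.g = 0 := by
      rw [eq_yon (b₀.inc i ≫ S.g), hZ.eq_zero hi (ev (b₀.inc i ≫ S.g) _ _)]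
      exact hom_ext_yon (by simp)
    have h2 : (𝟙 _ - b₀.proj i ≫ b₀.inc i) ≫ S.g = S.g := by
      rw [Preadditive.sub_comp, Category.assoc, h1, comp_zero, sub_zero, Category.id_comp]
    have h3 := hS.superfluous _ (𝟙 _ - b₀.proj i ≫ b₀.inc i) (by rw [h2]; infer_instance)
    have h4 : b₀.proj i = 0 := by
      refine (cancel_epi (𝟙 _ - b₀.proj i ≫ b₀.inc i)).1 ?_
      rw [Preadditive.sub_comp, Category.assoc, b₀.inc_proj_self, Category.id_comp,
        Category.comp_id, sub_self, comp_zero]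
    have h5 := b₀.inc_proj_self i
    rw [h4, comp_zero] at h5
    have h6 := congrArg (fun f => ev f _ (pathElt (𝟙 (b₀.pt i)))) h5
    simp only [ev_zero, ev_id] at h6
    exact pathElt_ne_zero (k := k) (𝟙 (b₀.pt i)) h6.symm
  -- At a vertex outside Q⁺ the term P₀ has no generators, so the image of a generator of P₁ comes
  -- from the predecessors. Z vanishes there because it does not meet the boundary, so the
  -- components lie in P₁ and the generator would be in its radical.
  have h₁ : ∀ i, IsPlus (b₁.pt i) := by
    intro i
    by_contra hi
    apply b₁.gen_notMem_rad hQ i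
    set e := ev (b₁.inc i) _ (pathElt (𝟙 (b₁.pt i))) with he
    have hrad : ev S.f _ e ∈ rad S.X₂ (b₁.pt i) := by
      have htop : rad S.X₂ (b₁.pt i) = ⊤ := b₀.rad_eq_top fun j hj => hi (hj ▸ h₀ j)
      rw [htop]
      trivial
    obtain ⟨s, n, hn⟩ := mem_rad_iff.1 hrad
    have hlift : ∀ a ∈ s, ∃ m, ev S.f a.1 m = n a := by
      intro a _
      refine (exact_iff_ev S.zero).1 hS.shortExact.exact a.1 (n a) ?_
      by_contra hne
      exact hB ⟨a.1, _, a.2, _, hi, hne⟩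
    choose! m hm using hlift
    refine mem_rad_iff.2 ⟨s, m, injective_ev S.f _ ?_⟩
    rw [map_sum, ← hn]
    exact Finset.sum_congr rfl fun a ha => by rw [ev_act, hm a ha]
  obtain ⟨h5, h6⟩ := b₁.isFinDim_nakayama hQ h₁
  exact ⟨h5.of_mono (kernel.ι _), h6.of_mono (kernel.ι _)⟩

/-- If the target of an irreducible morphism does not vanish at the starting point of an arrow which
ends outside `Q⁺`, neither does its source. -/
theorem exists_ne_zero_of_hasIrr (hQ : StronglyLocallyFinite Q) {Y X : RepPlus k Q}
    (hY : LocalObj Y.obj) (hX : LocalObj X.obj) (hYp : SuppPlus Y.obj) (hXp : SuppPlus X.obj)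
    (h : HasIrr Y X) (β : Arr b z) (hz : ¬ IsPlus z) {m : X.obj.obj b} (hm : m ≠ 0) :
    ∃ m : Y.obj.obj b, m ≠ 0 := by
  by_contra! hYb
  obtain ⟨r, hr, hr'⟩ := h
  apply hr'
  have hb := hXp b m hm
  obtain ⟨l, hl⟩ := Module.Projective.exists_dual_eq_one k hm
  let φ : X.obj.obj b →ₗ[k] (projRep k z).obj z := l.smulRight (pathElt (𝟙 z))
  have hφ : φ ≠ 0 := fun h0 => pathElt_ne_zero (k := k) (𝟙 z) (by
    have := congrArg (fun φ => φ m) h0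
    simpa [φ, hl] using this)
  have hns := not_isSplitEpi_extProj β φ (hXp.eq_zero hz) (projRep_eq_zero_of_isPlus hb hz) hφ
  have hS := extRep_shortExact (single β φ)
  let V : RepPlus k Q := ⟨extRep X.obj (projRep k z) (single β φ),
    isFinPres_of_extension (isFinPres_of_isFinProj hQ (isFinProj_projRep _)) X.property hS⟩
  -- If `Y` vanishes at `b`, then `r` lifts to the nonsplit extension of `X` by P_z along `β`, which
  -- writes `r` as a product of two radical morphisms.
  obtain ⟨s, hs⟩ := exists_lift_extProj (P := projRep k z) (c := single β φ) r.hom (by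
    intro u v a n
    refine single_of_forall β φ a ?_
    rintro rfl
    rw [hYb n, map_zero])
  have e : r = (ObjectProperty.homMk s : Y ⟶ V) ≫
      (ObjectProperty.homMk (extProj (single β φ)) : V ⟶ X) := ObjectProperty.hom_ext _ hs.symm
  rw [e]
  refine comp_mem_radicalSq ((RepPlus.mem_radical_iff _).2 (hY.mem_radical ?_))
    ((RepPlus.mem_radical_iff _).2 (hX.mem_radical' hns))
  -- A retraction `q` of the lift kills P_z, because `Y` vanishes at `z`; it would descend to a
  -- retraction of `r`.
  rintro ⟨⟨q, hq⟩⟩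
  have hq0 : extInc (single β φ) ≫ q = 0 := hom_ext_yon (by
    rw [ev_zero]
    exact hYp.eq_zero hz _)
  obtain ⟨q', hq'⟩ := exists_desc_of_shortExact hS q hq0
  refine not_isSplitMono_of_mem_radical hY.indec.1 ((RepPlus.mem_radical_iff _).1 hr) ⟨⟨q', ?_⟩⟩
  rw [← hs, Category.assoc, hq']
  exact hq

end Boundary

end QuiverAR
end

noncomputable section
namespace QuiverAR

/-! ### Thin representations -/

section Thin

universe u v w
variable {k : Type w} [Field k] {Q : Type u} [Quiver.{v} Q]
variable {M N P Z : QRep k Q} {x y z a : Paths Q}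

variable (k) in
/-- The thin representation supported on a set of vertices. -/
def thinRep (F : Set (Paths Q)) : QRep k Q := by
  classical
  exact Paths.lift
    { obj := fun v : Q => ModuleCat.of k (PLift ((v : Paths Q) ∈ F) → ULift.{max u v} k)
      map := fun {u v} _ => ModuleCat.ofHom (LinearMap.pi fun _ =>
        if h : (u : Paths Q) ∈ F then LinearMap.proj (R := k) (φ := fun _ => ULift.{max u v} k) ⟨h⟩
        else 0) }

variable {F : Set (Paths Q)}

/-- The generator of the thin representation at a vertex. -/
def thinOne (F : Set (Paths Q)) (x : Paths Q) : (thinRep k F).obj x :=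
  show PLift (x ∈ F) → ULift.{max u v} k from fun _ => ⟨1⟩

/-- The coordinate on the thin representation at a vertex. -/
def thinCoord (hx : x ∈ F) : (thinRep k F).obj x →ₗ[k] k :=
  ULift.moduleEquiv.toLinearMap ∘ₗ
    LinearMap.proj (R := k) (φ := fun _ : PLift (x ∈ F) => ULift.{max u v} k) ⟨hx⟩

theorem thinCoord_thinOne (hx : x ∈ F) : thinCoord (k := k) hx (thinOne F x) = 1 := rfl

theorem eq_thinCoord_smul (hx : x ∈ F) (m : (thinRep k F).obj x) :
    m = thinCoord hx m • thinOne F x := by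
  change (m : PLift (x ∈ F) → ULift.{max u v} k) = fun h => _
  funext h
  exact ULift.ext _ _ (mul_one _).symm

theorem thinRep_eq_zero (hx : x ∉ F) (m : (thinRep k F).obj x) : m = 0 := by
  change (m : PLift (x ∈ F) → ULift.{max u v} k) = fun h => _
  funext h
  exact absurd h.down hx

theorem act_thinRep (hx : x ∈ F) (hy : y ∈ F) (a : Arr x y) (m : (thinRep k F).obj x) :
    thinCoord hy (act (thinRep k F) (arr a) m) = thinCoord hx m := by
  classical
  have := Paths.lift_toPath (V := Q)
    { obj := fun v : Q => ModuleCat.of k (PLift ((v : Paths Q) ∈ F) → ULift.{max u v} k)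
      map := fun {u v} _ => ModuleCat.ofHom (LinearMap.pi fun _ =>
        if h : (u : Paths Q) ∈ F then LinearMap.proj (R := k) (φ := fun _ => ULift.{max u v} k) ⟨h⟩
        else 0) } a
  have h2 := congrArg (fun f => f.hom m ⟨hy⟩) this
  refine (congrArg ULift.down h2).trans ?_
  change ULift.down ((if h : (x : Paths Q) ∈ F then
    LinearMap.proj (R := k) (φ := fun _ => ULift.{max u v} k) ⟨h⟩ else 0 :
      (PLift (x ∈ F) → ULift.{max u v} k) →ₗ[k] ULift.{max u v} k) m) = _
  rw [dif_pos hx]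
  rfl

theorem isFinDim_thinRep (hF : F.Finite) : IsFinDim (thinRep k F) := by
  refine ⟨hF.subset ?_, fun x => ?_⟩
  · intro x hx
    by_contra h
    obtain ⟨m, hm⟩ := exists_ne_zero_of_nontrivial hx
    exact hm (thinRep_eq_zero h m)
  · change Module.Finite k (PLift (x ∈ F) → ULift.{max u v} k)
    infer_instance

/-- An endomorphism is a scalar at each vertex of `F`, constant along the arrows inside `F`; by `hF`
it is constant on `F`. -/
theorem brick_thinRep (ha : a ∈ F) (hF : ∀ c : Paths Q → k,
    (∀ x y : Paths Q, x ∈ F → y ∈ F → Arr x y → c x = c y) → ∀ x ∈ F, c x = c a) :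
    Brick k (thinRep k F) := by
  classical
  refine ⟨fun h => ?_, fun φ => ?_⟩
  · have := isZero_iff_ev.1 h a (thinOne F a)
    have := congrArg (thinCoord ha) this
    rw [thinCoord_thinOne, map_zero] at this
    exact one_ne_zero this
  · let c : Paths Q → k := fun x => if h : x ∈ F then thinCoord h (ev φ x (thinOne F x)) else 0
    have hc : ∀ x (h : x ∈ F), c x = thinCoord h (ev φ x (thinOne F x)) := fun x h => dif_pos h
    have key := hF c (by
      intro x y hx hy a
      have h1 : act (thinRep k F) (arr a) (thinOne F x) = thinOne F y := by
        rw [eq_thinCoord_smul hy (act (thinRep k F) (arr a) (thinOne F x)), act_thinRep hx hy,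
          thinCoord_thinOne, one_smul]
      rw [hc x hx, hc y hy, ← h1, ev_act, act_thinRep hx hy])
    refine ⟨c a, hom_ext_ev fun x m => ?_⟩
    by_cases hx : x ∈ F
    · rw [eq_thinCoord_smul hx m, map_smul, eq_thinCoord_smul hx (ev φ x (thinOne F x)), ← hc x hx,
        key x hx, ev_smul, ev_id, smul_comm]
    · rw [thinRep_eq_zero hx m, map_zero, map_zero]

omit [Field k] in
/-- A finite set of vertices which contains two given vertices and is connected in the sense that
functions which are constant along its arrows are constant. -/
theorem exists_finite_connected (hconn : IsConnectedQuiver Q) (a x : Paths Q) :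
    ∃ F : Set (Paths Q), F.Finite ∧ a ∈ F ∧ x ∈ F ∧ ∀ c : Paths Q → k,
      (∀ x y : Paths Q, x ∈ F → y ∈ F → Arr x y → c x = c y) → ∀ x ∈ F, c x = c a := by
  obtain ⟨p⟩ := (@Quiver.WeaklyConnectedComponent.eq Q _ a x).1 (hconn.2 _ _)
  induction p with
  | nil => exact ⟨{a}, Set.finite_singleton a, rfl, rfl, by rintro c - x rfl; rfl⟩
  | cons p e ih =>
    rename_i b d
    obtain ⟨F, hF, ha, hb, h⟩ := ih
    refine ⟨insert (d : Paths Q) F, hF.insert _, Or.inr ha, Or.inl rfl, fun c hc => ?_⟩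
    have h' := h c fun x y hx hy => hc x y (Or.inr hx) (Or.inr hy)
    rintro y (rfl | hy)
    · rcases e with e | e
      · exact (hc b y (Or.inr hb) (Or.inl rfl) e).symm.trans (h' b hb)
      · exact (hc y b (Or.inl rfl) (Or.inr hb) e).trans (h' b hb)
    · exact h' y hy

/-- There are infinitely many vertices whose representation does not vanish at a given vertex. -/
theorem infinite_vertices_at (hQ : StronglyLocallyFinite Q) (hconn : IsConnectedQuiver Q)
    (hinf : Infinite Q) (a : Paths Q) :
    {X : ARRepPlus k Q | ∃ m : X.obj.obj.obj a, m ≠ 0}.Infinite := by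
  intro hfin
  -- For each `x`, the thin representation on a finite connected set containing `a` and `x` is a
  -- vertex nonzero at `a`. Were there finitely many such vertices, the finite supports of the
  -- finite dimensional ones would cover the infinite quiver.
  have hall : (Set.univ : Set (Paths Q)) ⊆ ⋃ X ∈ {X : ARRepPlus k Q | (∃ m : X.obj.obj.obj a, m ≠ 0) ∧
      IsFinDim X.obj.obj}, {v | ∃ m : X.obj.obj.obj v, m ≠ 0} := by
    intro x _
    obtain ⟨F, hF, ha, hx, h⟩ := exists_finite_connected (k := k) hconn a x
    have hb := brick_thinRep ha h
    obtain ⟨X, ⟨e⟩⟩ := exists_vertex hQ ((isFinDim_thinRep (k := k) hF).isFinPres hQ) hb.local.indec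
    have hne : ∀ y ∈ F, ∃ m : X.obj.obj.obj y, m ≠ 0 := by
      intro y hy
      refine ⟨ev e.inv y (thinOne F y), fun h0 => ?_⟩
      have h1 : (thinOne F y : (thinRep k F).obj y) = 0 :=
        injective_ev e.inv y (by rw [h0, map_zero])
      have := congrArg (thinCoord hy) h1
      rw [thinCoord_thinOne, map_zero] at this
      exact one_ne_zero this
    exact Set.mem_biUnion (show X ∈ _ from ⟨hne a ha, (isFinDim_thinRep hF).of_iso e.symm⟩)
      (hne x hx)
  refine Set.infinite_univ (α := Q) (Set.Finite.subset ?_ hall)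
  exact (hfin.subset fun X hX => hX.1).biUnion fun X hX => hX.2.finite_support

/-- A non-zero morphism to `P_x` from a finitely generated representation `Z` makes some `P_a` a
direct summand of `Z`. -/
theorem exists_retract_projRep (hQ : StronglyLocallyFinite Q) (hZ : FinGen Z)
    {t : Z ⟶ projRep k x} (ht : t ≠ 0) :
    ∃ (a : Paths Q) (i : projRep k a ⟶ Z) (p : Z ⟶ projRep k a), i ≫ p = 𝟙 _ := by
  have hI := (isFinProj_projRep (k := k) x).of_mono hQ (image.ι t) (hZ.of_epi (factorThruImage t))
  obtain ⟨n, ⟨b⟩⟩ := hI.exists_dualBasis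
  have hn : Nonempty (Fin n) := by
    by_contra hn
    rw [not_nonempty_iff] at hn
    have h1 : 𝟙 (image t) = 0 := by rw [← b.total, Finset.univ_eq_empty, Finset.sum_empty]
    exact ht (by rw [← image.fac t, ← Category.id_comp (image.ι t), h1, zero_comp, comp_zero])
  obtain ⟨i⟩ := hn
  obtain ⟨m, hm⟩ := surjective_ev (factorThruImage t) _ (ev (b.inc i) _ (pathElt (𝟙 _)))
  refine ⟨b.pt i, yon m, factorThruImage t ≫ b.proj i, ?_⟩
  rw [← Category.assoc, yon_comp, hm, ← eq_yon, b.inc_proj_self]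

theorem not_isZero_projRep (a : Paths Q) : ¬ IsZero (projRep k a) := fun h =>
  pathElt_ne_zero (k := k) (𝟙 a) (isZero_iff_ev.1 h a _)

/-- Morphisms to projective representations vanish on indecomposable representations which are not
projective. -/
theorem Indec.hom_projRep_eq_zero (hQ : StronglyLocallyFinite Q) (hZI : Indec Z) (hZ : FinGen Z)
    (h : ∀ a : Paths Q, ¬ Nonempty (Z ≅ projRep k a)) (x : Paths Q) (t : Z ⟶ projRep k x) : t = 0 := by
  by_contra ht
  obtain ⟨a, i, p, hip⟩ := exists_retract_projRep hQ hZ ht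
  have := (hZI.isIso_of_retract hip (not_isZero_projRep a)).2
  exact h a ⟨asIso p⟩

end Thin

end QuiverAR
end

noncomputable section
namespace QuiverAR

/-! ### Invariance under isomorphism -/

section Transport

universe v₁ u₁ w
variable {A : Type u₁} [Category.{v₁} A] [Preadditive A] {X X' Y Y' Z E : A}

omit [Preadditive A] in
theorem IsMinimalLeftAlmostSplit.of_iso {f : X ⟶ E} (h : IsMinimalLeftAlmostSplit f) (e : X' ≅ X) :
    IsMinimalLeftAlmostSplit (e.hom ≫ f) where
  minimal t ht := h.minimal t (by rwa [Category.assoc, cancel_epi] at ht)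
  not_section hs := h.not_section (by
    have : IsSplitMono (e.inv ≫ e.hom ≫ f) := inferInstance
    rwa [Iso.inv_hom_id_assoc] at this)
  factors T t ht := by
    obtain ⟨s, hs⟩ := h.factors T (e.inv ≫ t) fun hs => ht (by
      have : IsSplitMono (e.hom ≫ e.inv ≫ t) := inferInstance
      rwa [Iso.hom_inv_id_assoc] at this)
    exact ⟨s, by rw [Category.assoc, hs, Iso.hom_inv_id_assoc]⟩

theorem IsAlmostSplitSequence.of_iso_left {f : X ⟶ E} {g : E ⟶ Z} (h : IsAlmostSplitSequence f g)
    (e : X' ≅ X) : IsAlmostSplitSequence (e.hom ≫ f) g where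
  ne_zero := h.ne_zero
  left := h.left.of_iso e
  right := h.right
  comp_eq_zero := by rw [Category.assoc, h.comp_eq_zero, comp_zero]
  pseudoKernel T t ht := by
    obtain ⟨s, hs⟩ := h.pseudoKernel T t ht
    exact ⟨s ≫ e.inv, by simp [hs]⟩
  pseudoCokernel T t ht := h.pseudoCokernel T t (by
    rwa [Category.assoc, Preadditive.IsIso.comp_left_eq_zero] at ht)

theorem IsAlmostSplitSequence.of_iso_right {f : X ⟶ E} {g : E ⟶ Y} (h : IsAlmostSplitSequence f g)
    (e : Y ≅ Y') : IsAlmostSplitSequence f (g ≫ e.hom) where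
  ne_zero := h.ne_zero
  left := h.left
  right :=
    { minimal := fun t ht => h.right.minimal t (by
        rwa [← Category.assoc, cancel_mono] at ht)
      not_retraction := fun hs => h.right.not_retraction (by
        have : IsSplitEpi ((g ≫ e.hom) ≫ e.inv) := inferInstance
        rwa [Category.assoc, Iso.hom_inv_id, Category.comp_id] at this)
      factors := fun T t ht => by
        obtain ⟨s, hs⟩ := h.right.factors T (t ≫ e.inv) fun hs => ht (by
          have : IsSplitEpi ((t ≫ e.inv) ≫ e.hom) := inferInstance
          rwa [Category.assoc, Iso.inv_hom_id, Category.comp_id] at this)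
        exact ⟨s, by rw [← Category.assoc, hs, Category.assoc, Iso.inv_hom_id, Category.comp_id]⟩ }
  comp_eq_zero := by rw [← Category.assoc, h.comp_eq_zero, zero_comp]
  pseudoKernel T t ht := h.pseudoKernel T t (by
    rwa [← Category.assoc, Preadditive.IsIso.comp_right_eq_zero] at ht)
  pseudoCokernel T t ht := by
    obtain ⟨s, hs⟩ := h.pseudoCokernel T t ht
    exact ⟨e.inv ≫ s, by simp [hs]⟩

theorem mem_radicalSq_comp_right {f : X ⟶ Y} (hf : f ∈ radicalSq X Y) (h : Y ⟶ Z) :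
    f ≫ h ∈ radicalSq X Z := by
  have := mem_radicalSq_comp h.op (op_mem_radicalSq hf)
  exact unop_mem_radicalSq this

theorem HasIrr.of_iso (h : HasIrr X Y) (e : X ≅ X') : HasIrr X' Y := by
  obtain ⟨r, hr, hr'⟩ := h
  refine ⟨e.inv ≫ r, comp_mem_radical _ hr, fun h => hr' ?_⟩
  have := mem_radicalSq_comp e.hom h
  rwa [Iso.hom_inv_id_assoc] at this

variable {k : Type w} [Field k] [Linear k A]

theorem irrDimK_congr (e : X ≅ X') (e' : Y ≅ Y') : irrDimK k X Y = irrDimK k X' Y' := by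
  let L : radK k X Y ≃ₗ[k] radK k X' Y' :=
    { toFun := fun f => ⟨e.inv ≫ f.1 ≫ e'.hom, comp_mem_radical _ (radical_comp_mem f.2 _)⟩
      map_add' := fun f g => Subtype.ext (by simp)
      map_smul' := fun c f => Subtype.ext (by simp)
      invFun := fun f => ⟨e.hom ≫ f.1 ≫ e'.inv, comp_mem_radical _ (radical_comp_mem f.2 _)⟩
      left_inv := fun f => Subtype.ext (by simp)
      right_inv := fun f => Subtype.ext (by simp) }
  refine LinearEquiv.finrank_eq (Submodule.Quotient.equiv _ _ L ?_)
  ext f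
  constructor
  · rintro ⟨g, hg, rfl⟩
    exact mem_radicalSq_comp _ (mem_radicalSq_comp_right hg _)
  · intro hf
    exact ⟨L.symm f, mem_radicalSq_comp _ (mem_radicalSq_comp_right hf _), L.apply_symm_apply f⟩

end Transport

/-! ### Translates of injective representations -/

section Translates

universe u v w
variable {k : Type w} [Field k] {Q : Type u} [Quiver.{v} Q]
variable {X Y Z X' Z' : ARRepPlus k Q} {x y z : Paths Q}

/-- Finite dimensional bricks supported in `Q⁺`. -/
structure PlusBrick (X : ARRepPlus k Q) : Prop where
  isFinDim : IsFinDim X.obj.obj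
  suppPlus : SuppPlus X.obj.obj
  brick : Brick k X.obj.obj

theorem PlusBrick.localObj (h : PlusBrick X) : LocalObj X.obj := RepPlus.localObj_iff.2 h.brick.local

/-- No almost split sequence ends at a projective representation. -/
theorem not_nonempty_iso_projRep_of_almostSplit (hQ : StronglyLocallyFinite Q) {X E Z : RepPlus k Q}
    {f : X ⟶ E} {g : E ⟶ Z} (h : IsAlmostSplitSequence f g) (a : Paths Q) :
    ¬ Nonempty (Z.obj ≅ projRep k a) := by
  rintro ⟨e⟩
  set t := g.hom ≫ e.hom with ht
  have hE := (finGen_rooted_ptFin hQ E.property).1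
  have hI := (isFinProj_projRep (k := k) a).of_mono hQ (image.ι t) (hE.of_epi (factorThruImage t))
  -- The image of E in P_a is projective, so E can be projected onto a copy of it without changing
  -- `g`. Right minimality makes this projection invertible; thus `g` is mono and `f ≫ g = 0` forces
  -- `f = 0`.
  obtain ⟨s, hs⟩ := hI.exists_lift (factorThruImage t) (𝟙 _)
  have h1 : (factorThruImage t ≫ s) ≫ g.hom = g.hom := by
    rw [← cancel_mono e.hom, Category.assoc, Category.assoc, ← ht]
    have h2 : s ≫ t = image.ι t :=
      (congrArg (s ≫ ·) (image.fac t).symm).trans (by rw [reassoc_of% hs])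
    rw [h2, image.fac]
  let φ : E ⟶ E := ObjectProperty.homMk (factorThruImage t ≫ s)
  have h2 := (RepPlus.isIso_iff φ).1 (h.right.minimal φ (ObjectProperty.hom_ext _ h1))
  have h3 : Mono (factorThruImage t) := by
    have : Mono (factorThruImage t ≫ s) := (inferInstance : Mono φ.hom)
    exact mono_of_mono _ s
  have h4 : Mono g.hom := by
    have : Mono (g.hom ≫ e.hom) := by
      rw [← ht]
      exact (image.fac t) ▸ mono_comp (factorThruImage t) (image.ι t)
    exact mono_of_mono _ e.hom
  refine h.left_ne_zero (ObjectProperty.hom_ext _ ((cancel_mono g.hom).1 ?_))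
  exact (congrArg InducedCategory.Hom.hom h.comp_eq_zero).trans zero_comp.symm

theorem isTau_left_unique (hQ : StronglyLocallyFinite Q) (h : HasTau.IsTau X Z) (h' : HasTau.IsTau X' Z)
    (hX : LocalObj X.obj) : X = X' := by
  obtain ⟨E, f, g, h⟩ := h
  obtain ⟨E', f', g', h'⟩ := h'
  obtain ⟨c, d, hcd⟩ := h.exists_isIso_comp_first h' hX
  have hcd' : IsIso (c.hom ≫ d.hom) := (RepPlus.isIso_iff _).1 hcd
  have h1 : c.hom ≫ d.hom ≫ inv (c.hom ≫ d.hom) = 𝟙 _ := by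
    rw [← Category.assoc]
    exact IsIso.hom_inv_id _
  have := ((vertex_indec hQ X').isIso_of_retract h1 (vertex_indec hQ X).1).1
  exact vertex_eq (asIso c.hom)

theorem isTau_right_unique (hQ : StronglyLocallyFinite Q) (h : HasTau.IsTau X Z) (h' : HasTau.IsTau X Z')
    (hZ : LocalObj Z.obj) : Z = Z' := by
  obtain ⟨E, f, g, h⟩ := h
  obtain ⟨E', f', g', h'⟩ := h'
  obtain ⟨c, d, hcd⟩ := h.exists_isIso_comp_last h' hZ
  have hcd' : IsIso (c.hom ≫ d.hom) := (RepPlus.isIso_iff _).1 hcd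
  have h1 : c.hom ≫ d.hom ≫ inv (c.hom ≫ d.hom) = 𝟙 _ := by
    rw [← Category.assoc]
    exact IsIso.hom_inv_id _
  have := ((vertex_indec hQ Z').isIso_of_retract h1 (vertex_indec hQ Z).1).1
  exact vertex_eq (asIso c.hom)

/-- There is an almost split sequence from `X` to `Z` with a finite dimensional middle term. -/
def FinTau (X Z : ARRepPlus k Q) : Prop :=
  ∃ (E : RepPlus k Q) (f : X.obj ⟶ E) (g : E ⟶ Z.obj), IsAlmostSplitSequence f g ∧ IsFinDim E.obj

theorem FinTau.isTau (h : FinTau X Z) : HasTau.IsTau X Z := by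
  obtain ⟨E, f, g, h, -⟩ := h
  exact ⟨E, f, g, h⟩

/-- If `DTr Z` is finite dimensional, where `Z` is a non-projective brick, then it is `τ Z`. -/
theorem PlusBrick.exists_isTau (hQ : StronglyLocallyFinite Q) (hZ : PlusBrick Z)
    (hp : ∀ a : Paths Q, ¬ Nonempty (Z.obj.obj ≅ projRep k a)) {S : ShortComplex (QRep k Q)}
    (hS : IsMinimalProjRes S) (e : S.X₃ ≅ Z.obj.obj) (hN : IsFinDim (kernel (nakayama.map S.f))) :
    ∃ X : ARRepPlus k Q, FinTau X Z ∧ Nonempty (X.obj.obj ≅ kernel (nakayama.map S.f)) ∧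
      Brick k X.obj.obj := by
  have hZP := (vertex_indec hQ Z).hom_projRep_eq_zero hQ hZ.isFinDim.finGen hp
  have w : S.f ≫ S.g ≫ e.hom = 0 := by rw [← Category.assoc, S.zero, zero_comp]
  have hS' : (ShortComplex.mk S.f (S.g ≫ e.hom) w).ShortExact := by
    refine ShortComplex.shortExact_of_iso (S₁ := S) (ShortComplex.isoMk (Iso.refl _) (Iso.refl _) e
      ?_ ?_) hS.shortExact
    · simp
    · simp
  have hb := brick_kernel_nakayama hS' hS.proj₁ hS.proj₀ hQ hZ.brick hZP
  obtain ⟨X, ⟨e'⟩⟩ := exists_vertex hQ (hN.isFinPres hQ) hb.local.indec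
  obtain ⟨E, i, p, h, hE⟩ := exists_almostSplit hS' hS.proj₁ hS.proj₀ hZ.brick.local hZP X.obj e'
    (hN.of_iso e'.symm) (vertex_indec hQ X)
  have hb' := brick_kernel_nakayama hS' hS.proj₁ hS.proj₀ hQ hZ.brick hZP
  refine ⟨X, ⟨E, i, p, h, hE hZ.isFinDim⟩, ⟨e'⟩, fun h0 => hb.1 (h0.of_iso e'.symm), fun φ => ?_⟩
  obtain ⟨c, hc⟩ := hb.2 (e'.inv ≫ φ ≫ e'.hom)
  refine ⟨c, ?_⟩
  have := congrArg (fun t => e'.hom ≫ t ≫ e'.inv) hc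
  simpa using this

theorem PlusBrick.isTau_of_not_meetsBoundary (hQ : StronglyLocallyFinite Q) (hZ : PlusBrick Z)
    (hp : ∀ a : Paths Q, ¬ Nonempty (Z.obj.obj ≅ projRep k a)) (hB : ¬ MeetsBoundary Z.obj.obj) :
    ∃ X : ARRepPlus k Q, FinTau X Z ∧ PlusBrick X := by
  obtain ⟨S, hS, hS3⟩ := hZ.isFinDim.exists_minimalProjRes hQ
  have h1 := hS.isFinDim_kernel hQ (hS3 ▸ hZ.suppPlus) (hS3 ▸ hB)
  obtain ⟨X, hX, ⟨e⟩, hb⟩ := hZ.exists_isTau hQ hp hS (eqToIso hS3) h1.1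
  exact ⟨X, hX, h1.1.of_iso e.symm, h1.2.of_mono e.hom, hb⟩

theorem PlusBrick.not_meetsBoundary_of_isTau (hQ : StronglyLocallyFinite Q) (hZ : PlusBrick Z)
    (h : HasTau.IsTau X Z) : ¬ MeetsBoundary Z.obj.obj := fun hB => by
  obtain ⟨E, f, g, h⟩ := h
  exact hB.not_isAlmostSplitSequence hQ hZ.suppPlus f g h

/-- The given sequence shows that `Z` is neither projective nor meets the boundary, so the
constructed almost split sequence exists; uniqueness of the first term transfers its properties to
`X`. -/
theorem PlusBrick.of_isTau_and_finTau (hQ : StronglyLocallyFinite Q) (hZ : PlusBrick Z)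
    (h : HasTau.IsTau X Z) : PlusBrick X ∧ FinTau X Z := by
  have hB := hZ.not_meetsBoundary_of_isTau hQ h
  have hp : ∀ a : Paths Q, ¬ Nonempty (Z.obj.obj ≅ projRep k a) := by
    obtain ⟨E, f, g, h⟩ := h
    exact not_nonempty_iso_projRep_of_almostSplit hQ h
  obtain ⟨X', h', hX'⟩ := hZ.isTau_of_not_meetsBoundary hQ hp hB
  rw [← isTau_left_unique hQ h'.isTau h hX'.localObj]
  exact ⟨hX', h'⟩

theorem PlusBrick.of_isTau (hQ : StronglyLocallyFinite Q) (hZ : PlusBrick Z) (h : HasTau.IsTau X Z) :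
    PlusBrick X := (hZ.of_isTau_and_finTau hQ h).1

/-- A non-projective brick is pseudo-projective if and only if it meets the boundary. -/
theorem PlusBrick.isPseudoProjective_iff (hQ : StronglyLocallyFinite Q) (hZ : PlusBrick Z)
    (hp : ∀ a : Paths Q, ¬ Nonempty (Z.obj.obj ≅ projRep k a)) :
    IsPseudoProjective Z.obj.obj ↔ MeetsBoundary Z.obj.obj := by
  constructor
  · rintro ⟨N, ⟨S, hS, ⟨e⟩, ⟨e'⟩⟩, hN⟩
    by_contra hB
    refine hN (IsFinDim.of_iso (hS.isFinDim_kernel hQ (hZ.suppPlus.of_mono e.hom) ?_).1 e'.symm)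
    rintro ⟨b, z, β, m, hz, hm⟩
    refine hB ⟨b, z, β, ev e.hom b m, hz, fun h0 => hm (injective_ev e.hom b ?_)⟩
    rw [h0, map_zero]
  · intro hB
    -- Were DTr Z finite dimensional, it would be the first term of an almost split sequence ending
    -- at `Z`, which the boundary excludes.
    obtain ⟨S, hS, hS3⟩ := hZ.isFinDim.exists_minimalProjRes hQ
    refine ⟨_, ⟨S, hS, ⟨eqToIso hS3⟩, ⟨Iso.refl _⟩⟩, fun hN => ?_⟩
    obtain ⟨X, hX, -⟩ := hZ.exists_isTau hQ hp hS (eqToIso hS3) hN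
    exact hZ.not_meetsBoundary_of_isTau hQ hX.isTau hB

/-- `X` is `τⁿ I_y` for a vertex `y` of `Q⁺`. -/
def IsAt : ℕ → Paths Q → ARRepPlus k Q → Prop
  | 0, y, X => IsPlus y ∧ Nonempty (X.obj.obj ≅ injRep k y)
  | n + 1, y, X => ∃ Z, HasTau.IsTau X Z ∧ IsAt n y Z

theorem IsAt.isPlus : ∀ {n : ℕ} {X : ARRepPlus k Q}, IsAt n y X → IsPlus y
  | 0, _, h => h.1
  | _ + 1, _, ⟨_, _, h⟩ => h.isPlus

theorem IsAt.plusBrick (hQ : StronglyLocallyFinite Q) :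
    ∀ {n : ℕ} {X : ARRepPlus k Q}, IsAt n y X → PlusBrick X
  | 0, X, ⟨hy, ⟨e⟩⟩ => ⟨(isFinDim_injRep hQ hy).of_iso e.symm, (suppPlus_injRep hy).of_mono e.hom, by
      have hb := brick_injRep (k := k) hQ y
      refine ⟨fun h0 => hb.1 (h0.of_iso e.symm), fun φ => ?_⟩
      obtain ⟨c, hc⟩ := hb.2 (e.inv ≫ φ ≫ e.hom)
      refine ⟨c, ?_⟩
      have := congrArg (fun t => e.hom ≫ t ≫ e.inv) hc
      simpa using this⟩
  | _ + 1, _, ⟨_, h, hZ⟩ => (hZ.plusBrick hQ).of_isTau hQ h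

/-- The isomorphism with `I_y` in `rep⁺(Q)`. -/
theorem IsAt.nonempty_iso_injObj (hQ : StronglyLocallyFinite Q) (h : IsAt 0 y X) :
    Nonempty (injObj k hQ h.1 ≅ X.obj) := by
  obtain ⟨hy, ⟨e⟩⟩ := h
  exact ⟨(isFinPres k Q).ι.preimageIso e.symm⟩

theorem IsAt.not_isTau (hQ : StronglyLocallyFinite Q) (h : IsAt 0 y X) : ¬ HasTau.IsTau X Z := by
  rintro ⟨E, f, g, h'⟩
  obtain ⟨e⟩ := h.nonempty_iso_injObj hQ
  exact not_isAlmostSplitSequence_injObj hQ h.1 _ _ (h'.of_iso_left e)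

/-- The inverse translate is unique and is undefined at the I_y, so the number of steps needed to
arrive at some I_y is determined. -/
theorem IsAt.coord_unique (hQ : StronglyLocallyFinite Q) : ∀ {m n : ℕ} {X : ARRepPlus k Q},
    IsAt m x X → IsAt n y X → m = n ∧ x = y
  | 0, 0, _, ⟨_, ⟨e⟩⟩, ⟨_, ⟨e'⟩⟩ => ⟨rfl, eq_of_injRep_iso hQ (e.symm ≪≫ e')⟩
  | 0, _ + 1, _, h, ⟨_, h', _⟩ => (h.not_isTau hQ h').elim
  | _ + 1, 0, _, ⟨_, h', _⟩, h => (h.not_isTau hQ h').elim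
  | m + 1, n + 1, _, ⟨_, h, hZ⟩, ⟨_, h', hZ'⟩ => by
    obtain rfl := isTau_right_unique hQ h h' (hZ.plusBrick hQ).localObj
    obtain ⟨rfl, rfl⟩ := hZ.coord_unique hQ hZ'
    exact ⟨rfl, rfl⟩

theorem IsAt.unique (hQ : StronglyLocallyFinite Q) : ∀ {n : ℕ} {X X' : ARRepPlus k Q},
    IsAt n y X → IsAt n y X' → X = X'
  | 0, _, _, ⟨_, ⟨e⟩⟩, ⟨_, ⟨e'⟩⟩ => vertex_eq (e ≪≫ e'.symm)
  | n + 1, _, _, ⟨_, h, hZ⟩, ⟨_, h', hZ'⟩ => by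
    obtain rfl := hZ.unique hQ hZ'
    exact isTau_left_unique hQ h h' ((hZ.plusBrick hQ).of_isTau hQ h).localObj

theorem PlusBrick.finite_hom (hX : PlusBrick X) (hY : PlusBrick Y) :
    Module.Finite k (X.obj ⟶ Y.obj) :=
  RepPlus.finite_hom (hX.isFinDim.finite_hom hY.isFinDim.ptFin)

end Translates

end QuiverAR
end

noncomputable section
namespace QuiverAR

/-! ### Irreducible morphisms between translates -/

section Closure

universe u v w
variable {k : Type w} [Field k] {Q : Type u} [Quiver.{v} Q]
variable {R X Y Z X' Z' : ARRepPlus k Q} {x y z : Paths Q} {m n : ℕ}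

/-- A vertex is of the form `τⁿ I_y`. -/
def IsTranslate (X : ARRepPlus k Q) : Prop := ∃ n y, IsAt n y X

theorem IsTranslate.plusBrick (hQ : StronglyLocallyFinite Q) (h : IsTranslate X) : PlusBrick X := by
  obtain ⟨n, y, h⟩ := h
  exact h.plusBrick hQ

theorem IsAt.isTranslate (h : IsAt n y X) : IsTranslate X := ⟨n, y, h⟩

/-- An indecomposable finite dimensional representation which is not an `I_x` is of the form `τ W`. -/
theorem exists_isTau_of_first (hQ : StronglyLocallyFinite Q) (hR : IsFinDim R.obj.obj)
    (hinj : ∀ x : Paths Q, ¬ Nonempty (R.obj.obj ≅ injRep k x)) :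
    ∃ W : ARRepPlus k Q, HasTau.IsTau R W ∧ LocalObj W.obj := by
  obtain ⟨Z, E, i, p, hZ, h, -⟩ := exists_almostSplit_of_first hQ R.obj hR (vertex_indec hQ R) hinj
  obtain ⟨W, ⟨e⟩⟩ := exists_vertex hQ Z.property hZ.indec
  have e' : Z ≅ W.obj := ((isFinPres k Q).ι.preimageIso e).symm
  have hW : LocalObj W.obj := RepPlus.localObj_iff.2 (hZ.of_iso e.symm)
  exact ⟨W, ⟨E, i, p ≫ e'.hom, h.of_iso_right e'⟩, hW⟩

/-- The translates are closed under irreducible morphisms in both directions. -/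
theorem IsAt.succ_closed (hQ : StronglyLocallyFinite Q) : ∀ {n : ℕ} {X : ARRepPlus k Q},
    IsAt n y X → (∀ R : ARRepPlus k Q, HasIrr X.obj R.obj → IsTranslate R) ∧
      ∀ R : ARRepPlus k Q, HasIrr R.obj X.obj → IsTranslate R := by
  -- Predecessors reduce to successors of the same `X`: a predecessor `R` is finite dimensional, and
  -- it is either some I_x or τ W with `W` a successor of `X`.
  have pred : ∀ {X : ARRepPlus k Q}, IsTranslate X →
      (∀ R : ARRepPlus k Q, HasIrr X.obj R.obj → IsTranslate R) →
      ∀ R : ARRepPlus k Q, HasIrr R.obj X.obj → IsTranslate R := by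
    intro X hX hs R hR
    have hXb := hX.plusBrick hQ
    have hRd : IsFinDim R.obj.obj := by
      by_contra hRd
      exact not_hasIrr_of_not_isFinDim hQ (vertex_indec hQ R) hRd hXb.brick.local hXb.isFinDim hR
    by_cases hinj : ∃ x : Paths Q, Nonempty (R.obj.obj ≅ injRep k x)
    · obtain ⟨x, ⟨e⟩⟩ := hinj
      exact ⟨0, x, isPlus_of_isFinDim_injRep hQ (hRd.of_iso e), ⟨e⟩⟩
    · obtain ⟨W, hW, hWl⟩ := exists_isTau_of_first hQ hRd (not_exists.1 hinj)
      obtain ⟨E, f, g, h⟩ := id hW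
      have hRl : LocalObj R.obj := RepPlus.localObj_iff.2 ((vertex_indec hQ R).local hRd)
      obtain ⟨n, y, hn⟩ := hs W ((hasIrr_iff_of_almostSplit hRl hWl h).1 hR)
      exact ⟨n + 1, y, W, hW, hn⟩
  intro n
  induction n with
  | zero =>
    intro X hX
    have hs : ∀ R : ARRepPlus k Q, HasIrr X.obj R.obj → IsTranslate R := by
      intro R hR
      obtain ⟨e⟩ := hX.nonempty_iso_injObj hQ
      obtain ⟨u, a, ⟨e'⟩⟩ := exists_iso_injRep_of_hasIrr hQ hX.1 (vertex_indec hQ R) (hR.of_iso e.symm)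
      exact ⟨0, u, hX.1.of_arr a, ⟨e'⟩⟩
    exact ⟨hs, pred hX.isTranslate hs⟩
  | succ n ih =>
    intro X hX
    obtain ⟨Z, hZ, hn⟩ := id hX
    -- Successors of τ Z are predecessors of `Z`, which are covered by the induction hypothesis.
    have hs : ∀ R : ARRepPlus k Q, HasIrr X.obj R.obj → IsTranslate R := by
      intro R hR
      obtain ⟨E, f, g, h⟩ := hZ
      exact (ih hn).2 R ((hasIrr_iff_of_almostSplit (hX.plusBrick hQ).localObj
        (hn.plusBrick hQ).localObj h).1 hR)
    exact ⟨hs, pred hX.isTranslate hs⟩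

theorem IsTranslate.of_hasIrr (hQ : StronglyLocallyFinite Q) (hX : IsTranslate X)
    (h : HasIrr X.obj R.obj) : IsTranslate R := by
  obtain ⟨n, y, hX⟩ := hX
  exact (hX.succ_closed hQ).1 R h

theorem IsTranslate.of_hasIrr' (hQ : StronglyLocallyFinite Q) (hX : IsTranslate X)
    (h : HasIrr R.obj X.obj) : IsTranslate R := by
  obtain ⟨n, y, hX⟩ := hX
  exact (hX.succ_closed hQ).2 R h

/-- The number of arrows between `τᵐ I_x` and `τⁿ I_y`. -/
theorem irrDimK_isAt (hQ : StronglyLocallyFinite Q) : ∀ (N m n : ℕ) (x y : Paths Q)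
    (X Y : ARRepPlus k Q), m + n ≤ N → IsAt m x X → IsAt n y Y →
    (m = n → irrDimK k X.obj Y.obj = Nat.card (Arr y x)) ∧
    (m = n + 1 → irrDimK k X.obj Y.obj = Nat.card (Arr x y)) ∧
    (m ≠ n → m ≠ n + 1 → irrDimK k X.obj Y.obj = 0) := by
  intro N
  induction N with
  | zero =>
    intro m n x y X Y hN hX hY
    obtain ⟨rfl, rfl⟩ : m = 0 ∧ n = 0 := by omega
    refine ⟨fun _ => ?_, fun h => by omega, fun h => by omega⟩
    obtain ⟨e⟩ := hX.nonempty_iso_injObj hQ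
    obtain ⟨e'⟩ := hY.nonempty_iso_injObj hQ
    rw [← irrDimK_congr e e', irrDimK_injObj hQ hY.1 hX.1]
  | succ N ih =>
    intro m n x y X Y hN hX hY
    have hYb := hY.plusBrick hQ
    have hXb := hX.plusBrick hQ
    have := hXb.finite_hom hYb
    cases m with
    | zero =>
      cases n with
      | zero => exact ih 0 0 x y X Y (by omega) hX hY
      | succ n =>
        refine ⟨fun h => by omega, fun h => by omega, fun _ _ => ?_⟩
        by_contra h
        rw [← ne_eq, irrDimK_ne_zero_iff] at h
        obtain ⟨e⟩ := hX.nonempty_iso_injObj hQ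
        obtain ⟨u, a, e'⟩ := exists_iso_injRep_of_hasIrr hQ hX.1 (vertex_indec hQ Y) (h.of_iso e.symm)
        have hY0 : IsAt 0 u Y := ⟨hX.1.of_arr a, e'⟩
        have := (hY0.coord_unique hQ hY).1
        omega
    -- The knitting rule replaces irr(τ Z, Y) by irr(Y, Z): the roles are exchanged and the sum of
    -- the levels drops by one.
    | succ m =>
      obtain ⟨Z, hXZ, hZ⟩ := hX
      obtain ⟨E, f, g, h, hE⟩ := ((hZ.plusBrick hQ).of_isTau_and_finTau hQ hXZ).2
      have : Module.Finite k (E ⟶ Y.obj) := RepPlus.finite_hom (hE.finite_hom hYb.isFinDim.ptFin)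
      have : Module.Finite k (Y.obj ⟶ E) := RepPlus.finite_hom (hYb.isFinDim.finite_hom hE.ptFin)
      rw [irrDimK_of_almostSplit hXb.localObj (hZ.plusBrick hQ).localObj h
        (RepPlus.brick_iff.2 hYb.brick)]
      obtain ⟨h1, h2, h3⟩ := ih n m y x Y Z (by omega) hY hZ
      refine ⟨fun h => h2 (by omega), fun h => h1 (by omega), fun h h' => h3 (by omega) (by omega)⟩

/-- A translate has a minimal left almost split morphism to a finite dimensional representation. -/
theorem IsTranslate.exists_left (hQ : StronglyLocallyFinite Q) (h : IsTranslate X) :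
    ∃ (E : RepPlus k Q) (f : X.obj ⟶ E), IsMinimalLeftAlmostSplit f ∧ IsFinDim E.obj := by
  obtain ⟨n, y, h⟩ := h
  cases n with
  | zero =>
    obtain ⟨e⟩ := h.nonempty_iso_injObj hQ
    exact ⟨injQuot k hQ h.1, _, (isMinimalLeftAlmostSplit_injQuotπ hQ h.1).of_iso e.symm,
      (isFinDim_injRep hQ h.1).of_epi (injSocle y).π⟩
  | succ n =>
    obtain ⟨Z, hXZ, hZ⟩ := h
    obtain ⟨E, f, g, h, hE⟩ := ((hZ.plusBrick hQ).of_isTau_and_finTau hQ hXZ).2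
    exact ⟨E, f, h.left, hE⟩

theorem hasIrr_iff_nonempty_arr (hQ : StronglyLocallyFinite Q) (hX : IsAt m x X) (hY : IsAt n y Y) :
    HasIrr X.obj Y.obj ↔ (m = n ∧ Nonempty (Arr y x)) ∨ (m = n + 1 ∧ Nonempty (Arr x y)) := by
  have := (hX.plusBrick hQ).finite_hom (hY.plusBrick hQ)
  obtain ⟨h1, h2, h3⟩ := irrDimK_isAt hQ (m + n) m n x y X Y le_rfl hX hY
  have hfin : ∀ x y : Paths Q, Finite (Arr x y) := fun x y => by
    have := finite_arr_out hQ x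
    exact Finite.of_injective (fun a : Arr x y => (⟨y, a⟩ : Σ y : Paths Q, Arr x y))
      sigma_mk_injective
  have hc : ∀ x y : Paths Q, Nat.card (Arr x y) ≠ 0 ↔ Nonempty (Arr x y) := fun x y => by
    have := hfin x y
    rw [← Nat.pos_iff_ne_zero, Nat.card_pos_iff]
    exact and_iff_left inferInstance
  rw [← irrDimK_ne_zero_iff (k := k)]
  by_cases hmn : m = n
  · rw [h1 hmn, hc]
    simp [hmn]
  · by_cases hmn' : m = n + 1
    · rw [h2 hmn', hc]
      simp [hmn']
    · rw [h3 hmn hmn']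
      simp [hmn, hmn']

theorem IsAt.finite_succ (hQ : StronglyLocallyFinite Q) (h : IsAt n y X) :
    {R : ARRepPlus k Q | HasIrr X.obj R.obj}.Finite := by
  have := finite_arr_in hQ y
  have := finite_arr_out hQ y
  have hsub : ∀ m u, {R : ARRepPlus k Q | IsAt m u R}.Finite := fun m u =>
    Set.Subsingleton.finite fun R hR R' hR' => IsAt.unique hQ hR hR'
  refine ((Set.finite_iUnion fun s : (Σ u : Paths Q, Arr u y) => hsub n s.1).union
    (Set.finite_iUnion fun s : (Σ v : Paths Q, Arr y v) => hsub (n - 1) s.1)).subset ?_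
  intro R hR
  obtain ⟨m, u, hm⟩ := h.isTranslate.of_hasIrr hQ hR
  rcases (hasIrr_iff_nonempty_arr hQ h hm).1 hR with ⟨rfl, ⟨a⟩⟩ | ⟨rfl, ⟨a⟩⟩
  · exact Or.inl (Set.mem_iUnion.2 ⟨⟨u, a⟩, hm⟩)
  · exact Or.inr (Set.mem_iUnion.2 ⟨⟨u, a⟩, hm⟩)

/-- A non-zero morphism which starts at a translate and is not an isomorphism gives a non-zero
morphism which starts at an immediate successor. -/
theorem IsTranslate.exists_hasIrr (hQ : StronglyLocallyFinite Q) (h : IsTranslate X)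
    {t : X.obj.obj ⟶ Y.obj.obj} (ht : t ≠ 0) (hXY : X ≠ Y) :
    ∃ (R : ARRepPlus k Q) (s : R.obj.obj ⟶ Y.obj.obj), HasIrr X.obj R.obj ∧ s ≠ 0 := by
  obtain ⟨E, f, hf, hE⟩ := h.exists_left hQ
  have hX := h.plusBrick hQ
  obtain ⟨g, hg⟩ := hf.factors Y.obj (ObjectProperty.homMk t) (by
    rw [RepPlus.isSplitMono_iff]
    rintro ⟨⟨r, hr⟩⟩
    have hr' : t ≫ r = 𝟙 _ := hr
    have := ((vertex_indec hQ Y).isIso_of_retract hr' hX.brick.1).1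
    exact hXY (vertex_eq (asIso t)))
  have hg0 : g.hom ≠ 0 := fun h0 => ht (by
    have h1 : f.hom ≫ g.hom = t := congrArg InducedCategory.Hom.hom hg
    rw [← h1, h0, comp_zero])
  obtain ⟨R, i, p, hip, hR, hne⟩ := exists_indec_retract hE hg0
  obtain ⟨W, ⟨e⟩⟩ := exists_vertex hQ ((hE.of_retract hip).isFinPres hQ) hR
  refine ⟨W, e.hom ≫ i ≫ g.hom, (hasIrr_iff_of_left hX.localObj hf).2
    ⟨ObjectProperty.homMk (p ≫ e.inv), fun hrad => ?_⟩, fun h0 => hne ?_⟩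
  · refine not_isSplitEpi_of_mem_radical (vertex_indec hQ W).1
      ((RepPlus.mem_radical_iff _).1 hrad) ⟨⟨e.hom ≫ i, ?_⟩⟩
    change (e.hom ≫ i) ≫ p ≫ e.inv = 𝟙 _
    rw [Category.assoc, reassoc_of% hip, Iso.hom_inv_id]
  · rwa [Preadditive.IsIso.comp_left_eq_zero] at h0

/-- Only finitely many vertices receive a non-zero morphism from a translate. -/
theorem IsAt.finite_targets (hQ : StronglyLocallyFinite Q) (h : IsAt n y X) :
    {M : ARRepPlus k Q | ∃ t : X.obj.obj ⟶ M.obj.obj, t ≠ 0}.Finite := by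
  -- Each irreducible morphism either lowers the level or keeps it and moves backwards along an
  -- arrow of Q⁺, which is well founded. A nonzero morphism to another vertex continues from one of
  -- the finitely many immediate successors.
  induction n using Nat.strong_induction_on generalizing y X with
  | _ n ihn =>
  have hacc := h.isPlus.acc
  induction hacc generalizing X with
  | intro y _ ihy =>
  refine ((Set.finite_singleton X).union ((h.finite_succ hQ).biUnion
    (t := fun R => {M : ARRepPlus k Q | ∃ t : R.obj.obj ⟶ M.obj.obj, t ≠ 0}) fun R hR => ?_)).subset ?_
  · obtain ⟨m, u, hm⟩ := h.isTranslate.of_hasIrr hQ hR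
    rcases (hasIrr_iff_nonempty_arr hQ h hm).1 hR with ⟨rfl, a⟩ | ⟨rfl, -⟩
    · exact ihy u a hm
    · exact ihn m (Nat.lt_succ_self m) hm
  · rintro M ⟨t, ht⟩
    by_cases hXM : X = M
    · exact Or.inl hXM.symm
    · obtain ⟨R, s, hR, hs⟩ := h.isTranslate.exists_hasIrr hQ ht hXM
      exact Or.inr (Set.mem_biUnion hR ⟨s, hs⟩)

/-- No translate is projective. -/
theorem IsTranslate.not_projective (hQ : StronglyLocallyFinite Q) (hconn : IsConnectedQuiver Q)
    (hinf : Infinite Q) (h : IsTranslate X) (a : Paths Q) : ¬ Nonempty (X.obj.obj ≅ projRep k a) := by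
  rintro ⟨e⟩
  obtain ⟨n, y, h⟩ := h
  -- P_a has a nonzero morphism to every representation that is nonzero at `a`, and there are
  -- infinitely many such vertices.
  refine infinite_vertices_at (k := k) hQ hconn hinf a ((h.finite_targets hQ).subset ?_)
  rintro M ⟨m, hm⟩
  refine ⟨e.hom ≫ yon m, fun h0 => hm ?_⟩
  rw [Preadditive.IsIso.comp_left_eq_zero] at h0
  have := congrArg (fun f => ev f a (pathElt (𝟙 a))) h0
  simpa using this

end Closure

end QuiverAR
end

noncomputable section
namespace QuiverAR

/-! ### Translation quivers with coordinates -/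

section Combinatorics

/-- Invariance along arrows suffices for invariance on connected components. Propositions are
allowed as values, and this is how membership is propagated below. -/
theorem eq_of_mk_eq {V : Type*} [Quiver V] {β : Type*} (f : V → β)
    (h : ∀ a b : V, Nonempty (a ⟶ b) → f a = f b) {x y : V}
    (hxy : Quiver.WeaklyConnectedComponent.mk x = Quiver.WeaklyConnectedComponent.mk y) :
    f x = f y := by
  obtain ⟨p⟩ := (Quiver.WeaklyConnectedComponent.eq x y).1 hxy
  induction p with
  | nil => rfl
  | cons p e ih =>
    rcases e with e | e
    · exact (ih ((Quiver.WeaklyConnectedComponent.eq _ _).2 ⟨p⟩)).trans (h _ _ ⟨e⟩)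
    · exact (ih ((Quiver.WeaklyConnectedComponent.eq _ _).2 ⟨p⟩)).trans (h _ _ ⟨e⟩).symm

theorem mk_eq_of_hom {V : Type*} [Quiver V] {a b : V} (h : Nonempty (a ⟶ b)) :
    Quiver.WeaklyConnectedComponent.mk a = Quiver.WeaklyConnectedComponent.mk b := by
  obtain ⟨e⟩ := h
  exact (Quiver.WeaklyConnectedComponent.eq _ _).2 ⟨Quiver.Hom.toPath (V := Quiver.Symmetrify V)
    (show (_ : Quiver.Symmetrify V) ⟶ _ from Sum.inl e)⟩

theorem isConnectedQuiver_componentOf {V : Type*} [Quiver V] (x : V) :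
    IsConnectedQuiver (ComponentOf x) := by
  refine ⟨⟨⟨x, rfl⟩⟩, ?_⟩
  have key : ∀ y : ComponentOf x, Quiver.WeaklyConnectedComponent.mk y =
      Quiver.WeaklyConnectedComponent.mk (⟨x, rfl⟩ : ComponentOf x) := by
    intro y
    have := eq_of_mk_eq (fun v : V => ∀ hv : Quiver.WeaklyConnectedComponent.mk v =
      Quiver.WeaklyConnectedComponent.mk x, Quiver.WeaklyConnectedComponent.mk
        (⟨v, hv⟩ : ComponentOf x) = Quiver.WeaklyConnectedComponent.mk (⟨x, rfl⟩ : ComponentOf x))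
      (by
        intro a b hab
        refine propext ⟨fun h hb => ?_, fun h ha => ?_⟩
        · have ha := (mk_eq_of_hom hab).trans hb
          rw [← h ha]
          exact (mk_eq_of_hom (V := ComponentOf x) (a := ⟨a, ha⟩) (b := ⟨b, hb⟩) hab).symm
        · have hb := (mk_eq_of_hom hab).symm.trans ha
          rw [← h hb]
          exact mk_eq_of_hom (V := ComponentOf x) (a := ⟨a, ha⟩) (b := ⟨b, hb⟩) hab) y.2
    exact this.mpr (fun _ => rfl) y.2
  exact fun y z => (key y).trans (key z).symm

variable {V D : Type*} [Quiver V] [HasTau V] [Quiver D]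

variable (V D) in
/-- Coordinates on a translation quiver: it is identified with a set of pairs `(n, y)` with `n` a
natural number, closed under decreasing `n`, where `τ (n, y) = (n + 1, y)`. -/
structure Coordinates where
  lev : V → ℕ
  vtx : V → D
  ext : ∀ {X Y : V}, lev X = lev Y → vtx X = vtx Y → X = Y
  exists_of_le : ∀ (X : V) (n : ℕ), n ≤ lev X → ∃ Z, lev Z = n ∧ vtx Z = vtx X
  exists_zero : ∀ y : D, ∃ X, lev X = 0 ∧ vtx X = y
  isTau_iff : ∀ X Z : V, HasTau.IsTau X Z ↔ lev X = lev Z + 1 ∧ vtx X = vtx Z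
  homEquiv : ∀ X Y : V, Nonempty ((X ⟶ Y) ≃ { _α : vtx Y ⟶ vtx X // lev X = lev Y } ⊕
    { _β : vtx X ⟶ vtx Y // lev X = lev Y + 1 })

namespace Coordinates

variable (c : Coordinates V D) {X Y Z : V} {n : ℕ}

theorem nonempty_hom_iff : Nonempty (X ⟶ Y) ↔ (c.lev X = c.lev Y ∧ Nonempty (c.vtx Y ⟶ c.vtx X)) ∨
    (c.lev X = c.lev Y + 1 ∧ Nonempty (c.vtx X ⟶ c.vtx Y)) := by
  obtain ⟨e⟩ := c.homEquiv X Y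
  rw [e.nonempty_congr, nonempty_sum]
  simp only [nonempty_subtype, exists_const_iff]
  tauto

theorem isTauPow_iff : IsTauPow n X Y ↔ c.lev X = c.lev Y + n ∧ c.vtx X = c.vtx Y := by
  induction n generalizing Y with
  | zero => exact ⟨by rintro rfl; exact ⟨rfl, rfl⟩, fun h => c.ext h.1 h.2⟩
  | succ n ih =>
    constructor
    · rintro ⟨Z, hZ, h⟩
      rw [c.isTau_iff] at hZ
      rw [ih] at h
      exact ⟨by omega, h.2.trans hZ.2⟩
    · rintro ⟨h, h'⟩
      obtain ⟨Z, hZ, hZ'⟩ := c.exists_of_le X (c.lev Y + 1) (by omega)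
      exact ⟨Z, (c.isTau_iff _ _).2 ⟨hZ, hZ'.trans h'⟩, ih.2 ⟨by omega, hZ'.symm⟩⟩

theorem sameOrbit_iff : SameOrbit X Y ↔ c.vtx X = c.vtx Y := by
  constructor
  · rintro ⟨n, h | h⟩
    · exact (c.isTauPow_iff.1 h).2
    · exact (c.isTauPow_iff.1 h).2.symm
  · intro h
    rcases le_total (c.lev X) (c.lev Y) with hl | hl
    · exact ⟨c.lev Y - c.lev X, Or.inr (c.isTauPow_iff.2 ⟨by omega, h.symm⟩)⟩
    · exact ⟨c.lev X - c.lev Y, Or.inl (c.isTauPow_iff.2 ⟨by omega, h⟩)⟩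

/-- Levels never rise along an arrow, and the arrows within one level are the reversed arrows of
`D`. -/
theorem path_lev (p : Quiver.Path X Y) : c.lev Y ≤ c.lev X ∧
    (c.lev X = c.lev Y → ∃ q : Quiver.Path (c.vtx Y) (c.vtx X), q.length = p.length) := by
  induction p with
  | nil => exact ⟨le_rfl, fun _ => ⟨.nil, rfl⟩⟩
  | cons p e ih =>
    rcases c.nonempty_hom_iff.1 ⟨e⟩ with ⟨h, ⟨a⟩⟩ | ⟨h, -⟩
    · refine ⟨by omega, fun h' => ?_⟩
      obtain ⟨q, hq⟩ := ih.2 (by omega)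
      refine ⟨a.toPath.comp q, ?_⟩
      rw [Quiver.Path.length_comp, hq, Quiver.Path.length_toPath, Quiver.Path.length_cons, add_comm]
    · exact ⟨by omega, fun h' => by omega⟩

omit [HasTau V] in
theorem exists_path_of_fullSub {Δ : Set V} {X Y : FullSub Δ} (p : Quiver.Path X Y) :
    ∃ q : Quiver.Path X.1 Y.1, q.length = p.length := by
  induction p with
  | nil => exact ⟨.nil, rfl⟩
  | cons p e ih =>
    obtain ⟨q, hq⟩ := ih
    exact ⟨q.cons e, congrArg Nat.succ hq⟩

/-- A convex set of representatives of the orbits, in which neighbours are adjacent, is a section. -/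
theorem isSection {Δ : Set V} (hD : IsConnectedQuiver D)
    (hacyc : ∀ (y : D) (p : Quiver.Path y y), p.length = 0)
    (hex : ∀ y : D, ∃ X ∈ Δ, c.vtx X = y) (huniq : ∀ X ∈ Δ, ∀ Y ∈ Δ, c.vtx X = c.vtx Y → X = Y)
    (hadj : ∀ X ∈ Δ, ∀ Y ∈ Δ, Nonempty (c.vtx X ⟶ c.vtx Y) → Nonempty (X ⟶ Y) ∨ Nonempty (Y ⟶ X))
    (hconv : ∀ x y z : V, x ∈ Δ → y ∈ Δ → Nonempty (Quiver.Path x z) → Nonempty (Quiver.Path z y) →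
      z ∈ Δ) : IsSection Δ where
  connected := by
    obtain ⟨⟨y₀⟩, hmk⟩ := hD
    choose s hs hs' using hex
    let f : D → Quiver.WeaklyConnectedComponent (FullSub Δ) := fun y =>
      Quiver.WeaklyConnectedComponent.mk ⟨s y, hs y⟩
    have hf : ∀ a b : D, Nonempty (a ⟶ b) → f a = f b := by
      intro a b hab
      rcases hadj _ (hs a) _ (hs b) (by rwa [hs', hs']) with h | h
      · exact mk_eq_of_hom (V := FullSub Δ) (a := ⟨s a, hs a⟩) (b := ⟨s b, hs b⟩) h
      · exact (mk_eq_of_hom (V := FullSub Δ) (a := ⟨s b, hs b⟩) (b := ⟨s a, hs a⟩) h).symm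
    have hsX : ∀ X : FullSub Δ, X = ⟨s (c.vtx X.1), hs _⟩ := fun X =>
      FullSub.ext (huniq _ X.2 _ (hs _) (hs' _).symm)
    refine ⟨⟨⟨s y₀, hs y₀⟩⟩, fun X Y => ?_⟩
    rw [hsX X, hsX Y]
    exact eq_of_mk_eq f hf (hmk _ _)
  convex := hconv
  acyclic X p := by
    obtain ⟨q, hq⟩ := exists_path_of_fullSub p
    obtain ⟨r, hr⟩ := (c.path_lev q).2 rfl
    rw [← hq, ← hr]
    exact hacyc _ r
  meets_orbits X := by
    obtain ⟨Y, hY, hY'⟩ := hex (c.vtx X)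
    refine ⟨Y, ⟨hY, c.sameOrbit_iff.2 hY'.symm⟩, ?_⟩
    rintro Z ⟨hZ, hXZ⟩
    exact huniq _ hZ _ hY ((c.sameOrbit_iff.1 hXZ).symm.trans hY'.symm)

/-- Level zero is closed under successors because levels never rise, which gives convexity. -/
theorem isRightMostSection (hD : IsConnectedQuiver D)
    (hacyc : ∀ (y : D) (p : Quiver.Path y y), p.length = 0) :
    IsRightMostSection {X : V | c.lev X = 0} where
  toIsSection := by
    refine c.isSection hD hacyc c.exists_zero (fun X hX Y hY h => c.ext (hX.trans hY.symm) h) ?_ ?_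
    · intro X hX Y hY h
      exact Or.inr (c.nonempty_hom_iff.2 (Or.inl ⟨hY.trans hX.symm, h⟩))
    · rintro X Y Z hX - ⟨p⟩ -
      have h1 := (c.path_lev p).1
      have h2 : c.lev X = 0 := hX
      exact (by omega : c.lev Z = 0)
  tau_pow X := by
    obtain ⟨Y, hY, hY'⟩ := c.exists_zero (c.vtx X)
    exact ⟨c.lev X, Y, hY, c.isTauPow_iff.2 ⟨by omega, hY'.symm⟩⟩

/-- The vertices at which the translation is not defined form a left-most section, if they are
closed under predecessors and exist. -/
theorem isLeftMostSection (hD : IsConnectedQuiver D)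
    (hacyc : ∀ (y : D) (p : Quiver.Path y y), p.length = 0) (B : V → Prop)
    (hB : ∀ X, B X ↔ ∀ Y, c.vtx Y = c.vtx X → c.lev Y ≤ c.lev X)
    (hpred : ∀ X Y : V, Nonempty (X ⟶ Y) → B Y → B X) (hne : ∃ X, B X) :
    IsLeftMostSection {X : V | B X} ∧ ∀ X : V, {Y : V | SameOrbit X Y}.Finite := by
  have hof : ∀ (Y : V) (y : D) (n : ℕ), c.vtx Y = y → c.lev Y = n → ¬ (∃ X, B X ∧ c.vtx X = y) →
      ∃ Y', c.vtx Y' = y ∧ c.lev Y' = n + 1 := by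
    rintro Y y n rfl rfl h
    have : ¬ B Y := fun hY => h ⟨Y, hY, rfl⟩
    rw [hB] at this
    push Not at this
    obtain ⟨Z, hZ, hlt⟩ := this
    obtain ⟨Z', h1, h2⟩ := c.exists_of_le Z (c.lev Y + 1) hlt
    exact ⟨Z', h2.trans hZ, h1⟩
  -- An orbit without a member of `B` has no last element, so it contains every level.
  have hunb : ∀ y : D, ¬ (∃ X, B X ∧ c.vtx X = y) → ∀ n, ∃ Y, c.vtx Y = y ∧ c.lev Y = n := by
    intro y hy n
    induction n with
    | zero =>
      obtain ⟨Y, h, h'⟩ := c.exists_zero y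
      exact ⟨Y, h', h⟩
    | succ n ih =>
      obtain ⟨Y, h, h'⟩ := ih
      exact hof Y y n h h' hy
  have hcomp : ∀ X Y : V, B X → B Y → c.vtx X = c.vtx Y → X = Y := fun X Y hX hY h =>
    c.ext (le_antisymm ((hB Y).1 hY X h) ((hB X).1 hX Y h.symm)) h
  -- An orbit adjacent to one that meets `B`, but missing `B` itself, would contain every level and
  -- in particular a predecessor of a member of `B`, which lies in `B`. Connectedness of `D` then
  -- spreads existence to all orbits.
  have hex : ∀ y : D, ∃ X ∈ {X : V | B X}, c.vtx X = y := by
    obtain ⟨X₀, hX₀⟩ := hne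
    have h0 : ∃ X, B X ∧ c.vtx X = c.vtx X₀ := ⟨X₀, hX₀, rfl⟩
    intro y
    have := eq_of_mk_eq (fun y : D => ∃ X, B X ∧ c.vtx X = y) (by
      intro a b hab
      refine propext ⟨?_, ?_⟩
      · rintro ⟨X, hX, rfl⟩
        by_contra h
        obtain ⟨Y, hY, hY'⟩ := hunb b h (c.lev X)
        exact h ⟨Y, hpred Y X (c.nonempty_hom_iff.2 (Or.inl ⟨hY', by rwa [hY]⟩)) hX, hY⟩
      · rintro ⟨X, hX, rfl⟩
        by_contra h
        obtain ⟨Y, hY, hY'⟩ := hunb a h (c.lev X + 1)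
        exact h ⟨Y, hpred Y X (c.nonempty_hom_iff.2 (Or.inr ⟨hY', by rwa [hY]⟩)) hX, hY⟩)
      (hD.2 (c.vtx X₀) y)
    exact this.mp h0
  refine ⟨{ toIsSection := ?_, tau_pow := fun X => ?_ }, fun X => ?_⟩
  · refine c.isSection hD hacyc hex (fun X hX Y hY h => hcomp X Y hX hY h) ?_ ?_
    -- Of the two orbits, the one reaching far enough contains a predecessor of the `B`-member of
    -- the other. That predecessor is in `B`, so it is the member sought, and the two are joined by
    -- an arrow.
    · intro X hX Y hY hXY
      rcases le_or_gt (c.lev X) (c.lev Y) with hle | hlt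
      · obtain ⟨Z, hZ, hZ'⟩ := c.exists_of_le Y (c.lev X) hle
        have hZX : Nonempty (Z ⟶ X) := c.nonempty_hom_iff.2 (Or.inl ⟨hZ, by rwa [hZ']⟩)
        rw [hcomp Y Z hY (hpred _ _ hZX hX) hZ'.symm]
        exact Or.inr hZX
      · obtain ⟨Z, hZ, hZ'⟩ := c.exists_of_le X (c.lev Y + 1) hlt
        have hZY : Nonempty (Z ⟶ Y) := c.nonempty_hom_iff.2 (Or.inr ⟨hZ, by rwa [hZ']⟩)
        rw [hcomp X Z hX (hpred _ _ hZY hY) hZ'.symm]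
        exact Or.inl hZY
    · rintro X Y Z - hY - ⟨p⟩
      have hp : ∀ {Z Y : V}, Quiver.Path Z Y → B Y → B Z := by
        intro Z Y p
        induction p with
        | nil => exact id
        | cons p e ih => exact fun h => ih (hpred _ _ ⟨e⟩ h)
      exact hp p hY
  · obtain ⟨Y, hY, hY'⟩ := hex (c.vtx X)
    have := (hB Y).1 hY X hY'.symm
    exact ⟨c.lev Y - c.lev X, Y, hY, c.isTauPow_iff.2 ⟨by omega, hY'⟩⟩
  · obtain ⟨Y, hY, hY'⟩ := hex (c.vtx X)
    refine Set.Finite.of_finite_image (f := c.lev) ((Set.finite_Iic (c.lev Y)).subset ?_) ?_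
    · rintro _ ⟨Z, hZ, rfl⟩
      exact (hB Y).1 hY Z ((c.sameOrbit_iff.1 hZ).symm.trans hY'.symm)
    · intro Z hZ Z' hZ' h
      exact c.ext h ((c.sameOrbit_iff.1 hZ).symm.trans (c.sameOrbit_iff.1 hZ'))

/-- The embedding in `ℕ⁻Dᵒᵖ` given by coordinates. -/
def fullEmbedding : FullEmbedding V (NegNQuiver Dᵒᵖ) where
  toFun X := ⟨⟨-(c.lev X : ℤ), Opposite.op (c.vtx X)⟩, by
    change -(c.lev X : ℤ) ≤ 0
    omega⟩
  injective X Y h := by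
    have h' := congrArg FullSub.val h
    refine c.ext ?_ (congrArg (fun t => Opposite.unop (ZQuiver.vertex t)) h')
    have : -(c.lev X : ℤ) = -(c.lev Y : ℤ) := congrArg ZQuiver.level h'
    omega
  homEquiv X Y := (c.homEquiv X Y).some.trans (Equiv.sumCongr
    { toFun := fun a => ⟨Opposite.op a.1, by have := a.2; change -(c.lev X : ℤ) = -(c.lev Y : ℤ); omega⟩
      invFun := fun a => ⟨Opposite.unop a.1, by
        have : -(c.lev X : ℤ) = -(c.lev Y : ℤ) := a.2
        omega⟩
      left_inv := fun _ => rfl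
      right_inv := fun _ => rfl }
    { toFun := fun a => ⟨Opposite.op a.1, by
        have := a.2; change -(c.lev X : ℤ) = -(c.lev Y : ℤ) - 1; omega⟩
      invFun := fun a => ⟨Opposite.unop a.1, by
        have : -(c.lev X : ℤ) = -(c.lev Y : ℤ) - 1 := a.2
        omega⟩
      left_inv := fun _ => rfl
      right_inv := fun _ => rfl })
  isTau_iff X Z := by
    rw [c.isTau_iff]
    change _ ↔ -(c.lev X : ℤ) = -(c.lev Z : ℤ) - 1 ∧ Opposite.op (c.vtx X) = Opposite.op (c.vtx Z)
    rw [Opposite.op_inj_iff]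
    exact and_congr_left' (by omega)

theorem surjective_fullEmbedding (h : ∀ (n : ℕ) (y : D), ∃ X, c.lev X = n ∧ c.vtx X = y) :
    Function.Surjective c.fullEmbedding.toFun := by
  rintro ⟨⟨n, y⟩, hn⟩
  obtain ⟨X, hX, hX'⟩ := h n.natAbs y.unop
  refine ⟨X, FullSub.ext (ZQuiver.ext ?_ (congrArg Opposite.op hX'))⟩
  change -(c.lev X : ℤ) = n
  have : n ≤ 0 := hn
  omega

end Coordinates

end Combinatorics

end QuiverAR
end

noncomputable section
namespace QuiverAR

/-! ### Preinjective components -/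

section Components

universe u v w
variable {k : Type w} [Field k] {Q : Type u} [Quiver.{v} Q]
variable {R X Y Z : ARRepPlus k Q} {x y z : Paths Q} {m n : ℕ}

theorem hasIrr_of_hom (h : Nonempty (X ⟶ Y)) : HasIrr X.obj Y.obj := by
  obtain ⟨⟨i, hi⟩⟩ := h
  by_contra hirr
  have hsub : Subsingleton (Irr X.obj Y.obj) := by
    refine ⟨fun a b => ?_⟩
    have h0 : ∀ a : Irr X.obj Y.obj, a = 0 := by
      intro a
      induction a using Submodule.Quotient.induction_on with
      | H f =>
        rw [Submodule.Quotient.mk_eq_zero]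
        by_contra hf
        exact hirr ⟨f.1, f.2, hf⟩
    rw [h0 a, h0 b]
  have hne : endRadical Y.obj ≠ ⊤ := fun h => by
    have h1 : (1 : End Y.obj) ∈ endRadical Y.obj := h ▸ Submodule.mem_top
    exact not_isSplitMono_of_mem_radical Y.2.1 h1 (inferInstanceAs (IsSplitMono (𝟙 Y.obj)))
  have h0 : irrDim X.obj Y.obj = 0 := by
    have : Nontrivial (End Y.obj ⧸ endRadical Y.obj) := Ideal.Quotient.nontrivial_iff.2 hne
    let _ : Module (End Y.obj ⧸ endRadical Y.obj) (Irr X.obj Y.obj) :=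
      (isTorsionBySet_irr X.obj Y.obj).module
    exact Module.finrank_zero_of_subsingleton
  omega

theorem hom_of_hasIrr (hX : PlusBrick X) (hY : PlusBrick Y)
    (h : HasIrr X.obj Y.obj) : Nonempty (X ⟶ Y) := by
  have := hX.finite_hom hY
  have h1 := irrDimK_ne_zero_iff (k := k).2 h
  rw [← irrDim_eq_irrDimK (RepPlus.brick_iff.2 hY.brick)] at h1
  exact ⟨⟨0, Nat.pos_of_ne_zero h1⟩⟩

theorem exists_isAt_zero (hQ : StronglyLocallyFinite Q) (hy : IsPlus y) :
    ∃ X : ARRepPlus k Q, IsAt 0 y X := by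
  obtain ⟨X, hX⟩ := exists_vertex hQ ((isFinDim_injRep (k := k) hQ hy).isFinPres hQ)
    (brick_injRep hQ y).local.indec
  exact ⟨X, hy, hX⟩

theorem IsAt.exists_of_le (h : IsAt n y X) (hm : m ≤ n) : ∃ Z : ARRepPlus k Q, IsAt m y Z := by
  induction n generalizing X with
  | zero => exact ⟨X, by rwa [Nat.le_zero.1 hm]⟩
  | succ n ih =>
    rcases Nat.of_le_succ hm with h' | rfl
    · obtain ⟨Z, -, hZ⟩ := h
      exact ih hZ h'
    · exact ⟨X, h⟩

/-- A vertex and its translate lie in the same component. -/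
theorem IsAt.mk_eq_of_isTau (hQ : StronglyLocallyFinite Q) (hZ : IsAt n y Z) (h : HasTau.IsTau X Z) :
    Quiver.WeaklyConnectedComponent.mk X = Quiver.WeaklyConnectedComponent.mk Z := by
  have hXt : IsTranslate X := ⟨n + 1, y, Z, h, hZ⟩
  have hZb := hZ.plusBrick hQ
  obtain ⟨hX, E, f, g, h, hE⟩ := hZb.of_isTau_and_finTau hQ h
  have h1 : 𝟙 E.obj ≠ 0 := fun h0 => h.ne_zero (RepPlus.isZero_iff.2 ((IsZero.iff_id_eq_zero _).2 h0))
  -- An indecomposable summand of the middle term joins `X` to `Z` by two arrows.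
  obtain ⟨R, i, p, hip, hR, -⟩ := exists_indec_retract hE h1
  obtain ⟨W, ⟨e⟩⟩ := exists_vertex hQ ((hE.of_retract hip).isFinPres hQ) hR
  have hXW : HasIrr X.obj W.obj := (hasIrr_iff_of_left hX.localObj h.left).2
    ⟨ObjectProperty.homMk (p ≫ e.inv), fun hrad => by
      refine not_isSplitEpi_of_mem_radical (vertex_indec hQ W).1
        ((RepPlus.mem_radical_iff _).1 hrad) ⟨⟨e.hom ≫ i, ?_⟩⟩
      change (e.hom ≫ i) ≫ p ≫ e.inv = 𝟙 _
      rw [Category.assoc, reassoc_of% hip, Iso.hom_inv_id]⟩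
  have hWb := (hXt.of_hasIrr hQ hXW).plusBrick hQ
  have hWZ := (hasIrr_iff_of_almostSplit hX.localObj hZb.localObj h).1 hXW
  exact (mk_eq_of_hom (hom_of_hasIrr hX hWb hXW)).trans (mk_eq_of_hom (hom_of_hasIrr hWb hZb hWZ))

/-- The component of a translate `τᵐ I_x` consists of translates of representations `I_y`, with `y` in
the component of `x` in `Q⁺`. -/
theorem IsAt.exists_of_mk_eq (hQ : StronglyLocallyFinite Q) (hX : IsAt m x X)
    (h : Quiver.WeaklyConnectedComponent.mk X = Quiver.WeaklyConnectedComponent.mk Y) :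
    ∃ (n : ℕ) (y : QPlus Q), IsAt n y.1 Y ∧ Quiver.WeaklyConnectedComponent.mk y =
      Quiver.WeaklyConnectedComponent.mk (⟨x, hX.isPlus⟩ : QPlus Q) := by
  have := eq_of_mk_eq (fun Y : ARRepPlus k Q => ∃ (n : ℕ) (y : QPlus Q), IsAt n y.1 Y ∧
    Quiver.WeaklyConnectedComponent.mk y =
      Quiver.WeaklyConnectedComponent.mk (⟨x, hX.isPlus⟩ : QPlus Q)) (by
    intro X Y hXY
    have hirr := hasIrr_of_hom hXY
    refine propext ⟨?_, ?_⟩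
    · rintro ⟨m, a, hXa, ha⟩
      obtain ⟨n, b, hYb⟩ := IsTranslate.of_hasIrr hQ hXa.isTranslate hirr
      refine ⟨n, ⟨b, hYb.isPlus⟩, hYb, Eq.trans ?_ ha⟩
      rcases (hasIrr_iff_nonempty_arr hQ hXa hYb).1 hirr with ⟨-, h⟩ | ⟨-, h⟩
      · exact mk_eq_of_hom (V := QPlus Q) h
      · exact (mk_eq_of_hom (V := QPlus Q) (a := a) (b := ⟨b, hYb.isPlus⟩) h).symm
    · rintro ⟨n, b, hYb, hb⟩
      obtain ⟨m, a, hXa⟩ := IsTranslate.of_hasIrr' hQ hYb.isTranslate hirr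
      refine ⟨m, ⟨a, hXa.isPlus⟩, hXa, Eq.trans ?_ hb⟩
      rcases (hasIrr_iff_nonempty_arr hQ hXa hYb).1 hirr with ⟨-, h⟩ | ⟨-, h⟩
      · exact (mk_eq_of_hom (V := QPlus Q) (a := b) (b := ⟨a, hXa.isPlus⟩) h).symm
      · exact mk_eq_of_hom (V := QPlus Q) h) h
  exact this.mp ⟨m, ⟨x, hX.isPlus⟩, hX, rfl⟩

theorem IsAt.mk_eq_zero (hQ : StronglyLocallyFinite Q) (hX : IsAt n y X) (hY : IsAt 0 y Y) :
    Quiver.WeaklyConnectedComponent.mk X = Quiver.WeaklyConnectedComponent.mk Y := by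
  induction n generalizing X with
  | zero => rw [hX.unique hQ hY]
  | succ n ih =>
    obtain ⟨Z, hXZ, hZ⟩ := hX
    exact (hZ.mk_eq_of_isTau hQ hXZ).trans (ih hZ)

/-- Each translate is joined to the level zero vertex of its orbit, and an arrow of Q⁺ gives an
arrow between the corresponding injectives. -/
theorem IsAt.mk_eq (hQ : StronglyLocallyFinite Q) (hX : IsAt m x X) (hY : IsAt n y Y)
    (h : Quiver.WeaklyConnectedComponent.mk (⟨x, hX.isPlus⟩ : QPlus Q) =
      Quiver.WeaklyConnectedComponent.mk (⟨y, hY.isPlus⟩ : QPlus Q)) :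
    Quiver.WeaklyConnectedComponent.mk X = Quiver.WeaklyConnectedComponent.mk Y := by
  choose s hs using fun y : QPlus Q => exists_isAt_zero (k := k) hQ (y := y.1) y.2
  have := eq_of_mk_eq (fun y : QPlus Q => Quiver.WeaklyConnectedComponent.mk (s y)) (by
    intro a b hab
    refine (mk_eq_of_hom (hom_of_hasIrr ((hs b).plusBrick hQ) ((hs a).plusBrick hQ) ?_)).symm
    exact (hasIrr_iff_nonempty_arr hQ (hs b) (hs a)).2 (Or.inl ⟨rfl, hab⟩)) h
  exact (hX.mk_eq_zero hQ (hs ⟨x, _⟩)).trans (this.trans (hY.mk_eq_zero hQ (hs ⟨y, _⟩)).symm)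

theorem card_subtype_prop {T : Type*} {p : Prop} [Decidable p] :
    Nat.card {_t : T // p} = if p then Nat.card T else 0 := by
  split_ifs with hp
  · exact Nat.card_congr (Equiv.subtypeUnivEquiv fun _ => hp)
  · have : IsEmpty {_t : T // p} := ⟨fun t => hp t.2⟩
    exact Nat.card_of_isEmpty

/-- Coordinates on a preinjective component. -/
theorem exists_coordinates (hQ : StronglyLocallyFinite Q) {D : Type*} [Quiver D] (f : D → Paths Q)
    (hf : Function.Injective f) (e : ∀ a b : D, (a ⟶ b) ≃ Arr (f a) (f b))
    (hplus : ∀ d, IsPlus (f d)) {C : Quiver.WeaklyConnectedComponent (ARRepPlus k Q)}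
    (hC : ∀ X : ARRepPlus k Q, Quiver.WeaklyConnectedComponent.mk X = C → ∃ n d, IsAt n (f d) X)
    (hC' : ∀ (n : ℕ) (d : D) (X : ARRepPlus k Q), IsAt n (f d) X →
      Quiver.WeaklyConnectedComponent.mk X = C) :
    ∃ c : Coordinates (ARComponent C) D, ∀ X, IsAt (c.lev X) (f (c.vtx X)) X.1 := by
  classical
  choose lev vtx h using fun X : ARComponent C => hC X.1 X.2
  have hbrick : ∀ X : ARComponent C, PlusBrick X.1 := fun X => (h X).plusBrick hQ
  have huniq : ∀ (X : ARComponent C) (n : ℕ) (d : D), IsAt n (f d) X.1 → lev X = n ∧ vtx X = d :=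
    fun X n d hX => ((h X).coord_unique hQ hX).imp_right fun h => hf h
  refine ⟨⟨lev, vtx, ?_, ?_, ?_, ?_, ?_⟩, h⟩
  · intro X Y h1 h2
    refine FullSub.ext ((h X).unique hQ ?_)
    rw [h1, h2]
    exact h Y
  · intro X n hn
    obtain ⟨Z, hZ⟩ := (h X).exists_of_le hn
    exact ⟨⟨Z, hC' _ _ _ hZ⟩, huniq _ _ _ hZ⟩
  · intro d
    obtain ⟨X, hX⟩ := exists_isAt_zero (k := k) hQ (hplus d)
    exact ⟨⟨X, hC' _ _ _ hX⟩, huniq _ _ _ hX⟩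
  · intro X Z
    constructor
    · intro hXZ
      exact huniq X _ _ ⟨Z.1, hXZ, h Z⟩
    · rintro ⟨h1, h2⟩
      have hX := h X
      rw [h1, h2] at hX
      obtain ⟨Z', hXZ', hZ'⟩ := hX
      have := hZ'.unique hQ (h Z)
      subst this
      exact hXZ'
  · intro X Y
    have hfin : ∀ a b : D, Finite (a ⟶ b) := fun a b => by
      have := finite_arr_out hQ (f a)
      exact Finite.of_injective (fun t => (⟨f b, e a b t⟩ : Σ y : Paths Q, Arr (f a) y))
        (sigma_mk_injective.comp (e a b).injective)
    -- The arrow sets are finite, so only cardinalities have to be compared.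
    refine ⟨(Finite.equivFinOfCardEq ?_).symm⟩
    rw [Nat.card_sum, card_subtype_prop, card_subtype_prop, Nat.card_congr (e _ _),
      Nat.card_congr (e _ _)]
    obtain ⟨h1, h2, h3⟩ := irrDimK_isAt hQ _ _ _ _ _ _ _ le_rfl (h X) (h Y)
    rw [irrDim_eq_irrDimK (RepPlus.brick_iff.2 (hbrick Y).brick)]
    by_cases hmn : lev X = lev Y
    · rw [h1 hmn, if_pos hmn, if_neg (by omega), add_zero]
    · rw [if_neg hmn, zero_add]
      by_cases hmn' : lev X = lev Y + 1
      · rw [h2 hmn', if_pos hmn']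
      · rw [h3 hmn hmn', if_neg hmn']

end Components

end QuiverAR
end

noncomputable section
namespace QuiverAR

/-! ### Pseudo-projective representations in preinjective components -/

section Preinjective

universe u v w
variable {k : Type w} [Field k] {Q : Type u} [Quiver.{v} Q]
variable {X Y Z : ARRepPlus k Q}

theorem IsInjAt.isAt {x : QPlus Q} (h : IsInjAt x X) : IsAt 0 x.1 X := ⟨x.2, h⟩

theorem exists_coordinates_componentOf (hQ : StronglyLocallyFinite Q)
    {C : Quiver.WeaklyConnectedComponent (ARRepPlus k Q)} {x : QPlus Q} {X₀ : ARComponent C}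
    (hX₀ : IsInjAt x X₀.1) :
    ∃ c : Coordinates (ARComponent C) (ComponentOf x), ∀ X, IsAt (c.lev X) (c.vtx X).1.1 X.1 := by
  refine exists_coordinates hQ (fun d : ComponentOf x => d.1.1)
    (fun a b h => FullSub.ext (FullSub.ext h)) (fun a b => Equiv.refl _) (fun d => d.1.2) ?_ ?_
  · intro X hX
    obtain ⟨n, y, hy, hyx⟩ := hX₀.isAt.exists_of_mk_eq hQ (X₀.2.trans hX.symm)
    exact ⟨n, ⟨y, hyx⟩, hy⟩
  · intro n d X hX
    exact (hX.mk_eq hQ hX₀.isAt d.2).trans X₀.2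

theorem isInjAt_iff (hQ : StronglyLocallyFinite Q)
    {C : Quiver.WeaklyConnectedComponent (ARRepPlus k Q)} {x : QPlus Q}
    {c : Coordinates (ARComponent C) (ComponentOf x)}
    (hc : ∀ X, IsAt (c.lev X) (c.vtx X).1.1 X.1) (Y : ARComponent C) :
    (∃ y : ComponentOf x, IsInjAt y.1 Y.1) ↔ c.lev Y = 0 := by
  constructor
  · rintro ⟨y, hy⟩
    exact ((hc Y).coord_unique hQ hy.isAt).1
  · intro h
    have := hc Y
    rw [h] at this
    exact ⟨c.vtx Y, this.2⟩

theorem length_eq_zero_of_closed (hQ : StronglyLocallyFinite Q) {x : QPlus Q} (y : ComponentOf x)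
    (p : Quiver.Path y y) : p.length = 0 := by
  have key : ∀ {a b : ComponentOf x} (p : Quiver.Path a b),
      ∃ q : Quiver.Path a.1.1 b.1.1, q.length = p.length := by
    intro a b p
    induction p with
    | nil => exact ⟨.nil, rfl⟩
    | cons p e ih =>
      obtain ⟨q, hq⟩ := ih
      exact ⟨q.cons e, congrArg Nat.succ hq⟩
  obtain ⟨q, hq⟩ := key p
  have := path_self_eq_id hQ (x := (y.1.1 : Paths Q)) q
  rw [← hq, this]
  rfl

/-- The pseudo-projective vertices of a preinjective component are those without a translate. -/
theorem isPseudoProjective_iff_lev (hQ : StronglyLocallyFinite Q) (hconn : IsConnectedQuiver Q)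
    (hinf : Infinite Q) {C : Quiver.WeaklyConnectedComponent (ARRepPlus k Q)} {x : QPlus Q}
    {c : Coordinates (ARComponent C) (ComponentOf x)}
    (hc : ∀ X, IsAt (c.lev X) (c.vtx X).1.1 X.1) (X : ARComponent C) :
    IsPseudoProjective X.obj.obj ↔ ∀ Y, c.vtx Y = c.vtx X → c.lev Y ≤ c.lev X := by
  have hX := (hc X).plusBrick hQ
  have hnp := (hc X).isTranslate.not_projective hQ hconn hinf
  rw [ARComponent.obj, hX.isPseudoProjective_iff hQ hnp]
  constructor
  · intro hB Y hY
    by_contra! hlt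
    obtain ⟨Z, hZ, hZ'⟩ := c.exists_of_le Y _ hlt
    exact hX.not_meetsBoundary_of_isTau hQ ((c.isTau_iff Z X).2 ⟨hZ, hZ'.trans hY⟩) hB
  · intro h
    by_contra hB
    obtain ⟨Z, hZX, -⟩ := hX.isTau_of_not_meetsBoundary hQ hnp hB
    let Z' : ARComponent C := ⟨Z, ((hc X).mk_eq_of_isTau hQ hZX.isTau).trans X.2⟩
    obtain ⟨h1, h2⟩ := (c.isTau_iff Z' X).1 hZX.isTau
    have := h Z' h2
    omega

/-- The pseudo-projective vertices of a preinjective component are closed under predecessors. -/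
theorem IsPseudoProjective.of_hom (hQ : StronglyLocallyFinite Q) (hconn : IsConnectedQuiver Q)
    (hinf : Infinite Q) {X Y : ARRepPlus k Q} (hX : IsTranslate X) (hY : IsTranslate Y)
    (h : Nonempty (X ⟶ Y)) (hB : IsPseudoProjective Y.obj.obj) : IsPseudoProjective X.obj.obj := by
  have hXb := hX.plusBrick hQ
  have hYb := hY.plusBrick hQ
  rw [hYb.isPseudoProjective_iff hQ (hY.not_projective hQ hconn hinf)] at hB
  rw [hXb.isPseudoProjective_iff hQ (hX.not_projective hQ hconn hinf)]
  obtain ⟨b, z, β, m, hz, hm⟩ := hB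
  obtain ⟨m', hm'⟩ := exists_ne_zero_of_hasIrr hQ hXb.brick.local hYb.brick.local hXb.suppPlus
    hYb.suppPlus (hasIrr_of_hom h) β hz hm
  exact ⟨b, z, β, m', hz, hm'⟩

/-- A component of `Q⁺` contains the starting point of an arrow which ends outside `Q⁺`. -/
theorem exists_boundary (hconn : IsConnectedQuiver Q) (h : HasLeftInfinitePath Q) (x : QPlus Q) :
    ∃ (y : ComponentOf x) (z : Q), Nonempty (y.1.1 ⟶ z) ∧ EndsLeftInfinitePath z := by
  by_contra! hno
  obtain ⟨z, hz⟩ := h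
  -- If no arrow leaves the component of `x` in Q⁺, membership in that component is invariant along
  -- all arrows of Q, so by connectedness it holds at `z` as well. In the backward direction, Q⁺ is
  -- closed under predecessors.
  have := eq_of_mk_eq (fun v : Q => ∃ hv : ¬ EndsLeftInfinitePath v,
    Quiver.WeaklyConnectedComponent.mk (⟨v, hv⟩ : QPlus Q) =
      Quiver.WeaklyConnectedComponent.mk x) (by
    intro a b hab
    refine propext ⟨?_, ?_⟩
    · rintro ⟨ha, hax⟩
      have hb := hno ⟨⟨a, ha⟩, hax⟩ b hab
      exact ⟨hb, (mk_eq_of_hom (V := QPlus Q) (a := ⟨a, ha⟩) (b := ⟨b, hb⟩) hab).symm.trans hax⟩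
    · rintro ⟨hb, hbx⟩
      have ha : ¬ EndsLeftInfinitePath a := by
        obtain ⟨e⟩ := hab
        exact IsPlus.of_arr (y := (b : Paths Q)) hb e
      exact ⟨ha, (mk_eq_of_hom (V := QPlus Q) (a := ⟨a, ha⟩) (b := ⟨b, hb⟩) hab).trans hbx⟩)
    (hconn.2 x.1 z)
  exact (this.mp ⟨x.2, rfl⟩).1 hz

/-- At the start `y` of an arrow leaving Q⁺, the socle of I_y makes it nonzero at `y`, so it meets
the boundary. -/
theorem exists_isPseudoProjective (hQ : StronglyLocallyFinite Q) (hconn : IsConnectedQuiver Q)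
    (hinf : Infinite Q) (h : HasLeftInfinitePath Q)
    {C : Quiver.WeaklyConnectedComponent (ARRepPlus k Q)} {x : QPlus Q}
    {c : Coordinates (ARComponent C) (ComponentOf x)}
    (hc : ∀ X, IsAt (c.lev X) (c.vtx X).1.1 X.1) :
    ∃ X : ARComponent C, IsPseudoProjective X.obj.obj := by
  obtain ⟨y, z, ⟨β⟩, hz⟩ := exists_boundary hconn h x
  obtain ⟨X, hX, rfl⟩ := c.exists_zero y
  refine ⟨X, ?_⟩
  have hX' := hc X
  rw [ARComponent.obj, (hX'.plusBrick hQ).isPseudoProjective_iff hQ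
    (hX'.isTranslate.not_projective hQ hconn hinf)]
  rw [hX] at hX'
  obtain ⟨e⟩ := hX'.2
  refine ⟨(c.vtx X).1.1, z, β, ev e.inv _ (socElt _), not_not.2 hz, fun h0 => ?_⟩
  exact socElt_ne_zero (k := k) ((c.vtx X).1.1 : Paths Q)
    (injective_ev e.inv _ (by rw [h0, map_zero]))

/-- Without left infinite paths Q⁺ is all of Q and the boundary is empty; since no translate is
projective, τ can be applied indefinitely. -/
theorem exists_isAt_of_not_hasLeftInfinitePath (hQ : StronglyLocallyFinite Q)
    (hconn : IsConnectedQuiver Q) (hinf : Infinite Q) (h : ¬ HasLeftInfinitePath Q) (n : ℕ)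
    (y : Paths Q) : ∃ X : ARRepPlus k Q, IsAt n y X := by
  have hplus : ∀ y : Paths Q, IsPlus y := fun y hy => h ⟨y, hy⟩
  induction n with
  | zero => exact exists_isAt_zero hQ (hplus y)
  | succ n ih =>
    obtain ⟨X, hX⟩ := ih
    obtain ⟨Z, hZ, -⟩ := (hX.plusBrick hQ).isTau_of_not_meetsBoundary hQ
      (hX.isTranslate.not_projective hQ hconn hinf) (by
        rintro ⟨b, z, β, m, hz, hm⟩
        exact hz (hplus z))
    exact ⟨Z, X, hZ.isTau, hX⟩

end Preinjective

end QuiverAR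
end

/-! ### The structure of preinjective components -/

theorem mainTheorem6 (k : Type*) [Field k] (Q : Type*) [Quiver Q]
    (hQ : StronglyLocallyFinite Q) (hconn : IsConnectedQuiver Q) (hinf : Infinite Q) :
    -- each `I_x` with `x` in `Q⁺` is a vertex of the Auslander-Reiten quiver
    (∀ x : QPlus Q, ∃ X : ARRepPlus k Q, IsInjAt x X) ∧
    -- a component containing `I_x`
    (∀ (C : Quiver.WeaklyConnectedComponent (ARRepPlus k Q)) (x : QPlus Q),
      (∃ X : ARComponent C, IsInjAt x X.1) →
        (∀ y : ComponentOf x, ∃ Y : ARComponent C, IsInjAt y.1 Y.1) ∧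
        IsRightMostSection {Y : ARComponent C | ∃ y : ComponentOf x, IsInjAt y.1 Y.1} ∧
        (∀ X : ARComponent C, IsFinDim X.obj.obj) ∧
        (∀ X Y : ARComponent C, irrDim X.obj Y.obj = irrDim' X.obj Y.obj) ∧
        Nonempty (FullEmbedding (ARComponent C) (NegNQuiver (ComponentOf x)ᵒᵖ))) ∧
    -- no left infinite path
    (¬ HasLeftInfinitePath Q →
      ∃ C : Quiver.WeaklyConnectedComponent (ARRepPlus k Q),
        IsPreinjective C ∧
        (∀ C' : Quiver.WeaklyConnectedComponent (ARRepPlus k Q), IsPreinjective C' → C' = C) ∧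
        ∃ e : FullEmbedding (ARComponent C) (NegNQuiver Qᵒᵖ), Function.Surjective e.toFun) ∧
    -- some left infinite path
    (HasLeftInfinitePath Q →
      ∀ C : Quiver.WeaklyConnectedComponent (ARRepPlus k Q), IsPreinjective C →
        IsLeftMostSection {X : ARComponent C | IsPseudoProjective X.obj.obj} ∧
        ∀ X : ARComponent C, {Y : ARComponent C | SameOrbit X Y}.Finite) := by
  have hvertex : ∀ x : QPlus Q, ∃ X : ARRepPlus k Q, IsInjAt x X := fun x => by
    obtain ⟨X, hX⟩ := exists_isAt_zero (k := k) hQ (y := x.1) x.2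
    exact ⟨X, hX.2⟩
  refine ⟨hvertex, ?_, ?_, ?_⟩
  · rintro C x ⟨X₀, hX₀⟩
    obtain ⟨c, hc⟩ := exists_coordinates_componentOf hQ hX₀
    refine ⟨fun y => ?_, ?_, fun X => ((hc X).plusBrick hQ).isFinDim, fun X Y => ?_,
      ⟨c.fullEmbedding⟩⟩
    · obtain ⟨Y, hY, hY'⟩ := c.exists_zero y
      have := hc Y
      rw [hY, hY'] at this
      exact ⟨Y, this.2⟩
    · have := c.isRightMostSection (isConnectedQuiver_componentOf x) (length_eq_zero_of_closed hQ)
      have e : {Y : ARComponent C | ∃ y : ComponentOf x, IsInjAt y.1 Y.1} = {Y | c.lev Y = 0} :=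
        Set.ext fun Y => isInjAt_iff hQ hc Y
      rwa [e]
    · have hX := RepPlus.brick_iff.2 ((hc X).plusBrick hQ).brick
      have hY := RepPlus.brick_iff.2 ((hc Y).plusBrick hQ).brick
      exact (irrDim_eq_irrDimK hY).trans (irrDim'_eq_irrDimK hX).symm
  · intro h
    have hplus : ∀ y : Q, ¬ EndsLeftInfinitePath y := fun y hy => h ⟨y, hy⟩
    have hconn' : ∀ x y : QPlus Q, Quiver.WeaklyConnectedComponent.mk x =
        Quiver.WeaklyConnectedComponent.mk y := fun x y =>
      eq_of_mk_eq (fun v : Q => Quiver.WeaklyConnectedComponent.mk (⟨v, hplus v⟩ : QPlus Q))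
        (fun a b hab => mk_eq_of_hom (V := QPlus Q) (a := ⟨a, hplus a⟩) (b := ⟨b, hplus b⟩) hab)
        (hconn.2 x.1 y.1)
    obtain ⟨x₀⟩ := hconn.1
    obtain ⟨X₀, hX₀⟩ := hvertex ⟨x₀, hplus x₀⟩
    have hmk : ∀ (n : ℕ) (y : Q) (X : ARRepPlus k Q), IsAt n y X →
        Quiver.WeaklyConnectedComponent.mk X = Quiver.WeaklyConnectedComponent.mk X₀ :=
      fun n y X hX => hX.mk_eq hQ hX₀.isAt (hconn' _ _)
    refine ⟨Quiver.WeaklyConnectedComponent.mk X₀, ⟨_, ⟨X₀, rfl⟩, hX₀⟩, ?_, ?_⟩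
    · rintro C' ⟨x, X, hX⟩
      exact X.2.symm.trans (hmk 0 x.1 X.1 hX.isAt)
    -- The coordinates take values in Q itself instead of a component of Q⁺, to match the target
    -- ℕ⁻Qᵒᵖ.
    · obtain ⟨c, hc⟩ := exists_coordinates hQ (D := Q) (fun d : Q => (d : Paths Q))
        Function.injective_id (fun a b => Equiv.refl _) hplus
        (C := Quiver.WeaklyConnectedComponent.mk X₀) (fun X hX => by
          obtain ⟨n, y, hy, -⟩ := hX₀.isAt.exists_of_mk_eq hQ hX.symm
          exact ⟨n, y.1, hy⟩) hmk
      refine ⟨c.fullEmbedding, c.surjective_fullEmbedding fun n y => ?_⟩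
      obtain ⟨X, hX⟩ := exists_isAt_of_not_hasLeftInfinitePath (k := k) hQ hconn hinf h n y
      obtain ⟨h1, h2⟩ := (hc ⟨X, hmk n y X hX⟩).coord_unique hQ hX
      exact ⟨⟨X, hmk n y X hX⟩, h1, h2⟩
  · rintro h C ⟨x, X₀, hX₀⟩
    obtain ⟨c, hc⟩ := exists_coordinates_componentOf hQ hX₀
    exact c.isLeftMostSection (isConnectedQuiver_componentOf x) (length_eq_zero_of_closed hQ)
      (fun X => IsPseudoProjective X.obj.obj) (isPseudoProjective_iff_lev hQ hconn hinf hc)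
      (fun X Y hXY => IsPseudoProjective.of_hom hQ hconn hinf (hc X).isTranslate (hc Y).isTranslate
        hXY) (exists_isPseudoProjective hQ hconn hinf h hc)
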